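/- Let $G$ be a finite, simple, connected graph with vertex set $V$ and degrees $\deg_G(x)$. Consider the continuous-time random walk on $G$ that jumps at rate $1$ to a uniformly chosen neighbour, i.e. the Markov chain $(\mathbb P_x)_{x\in V}$ with rates $q(x,y)=1/\deg_G(x)$ if $x\sim y$ and $q(x,y)=0$ for other $y\neq x$, and let $\pi$ be its stationary distribution. Let $$T_{\rm mix}^G=\min\Big\{t\ge 0:\ \tfrac12\sum_{y\in V}|\mathbb P_x(X_t=y)-\pi(y)|\le \tfrac14\ \text{ for all } x\in V\Big\}$$ be its mixing time, and let $m_G=\mathbb E[\inf\{t\ge 0: X_t=X'_t\}]$ be the expected meeting time of two independent walks $X,X'$, both started from $\pi$. Start independent walks $X(1),\dots,X(|V|)$, one from each vertex, and let them coalesce: $\overline X(1)=X(1)$, and $\overline X(j)$ follows $X(j)$ until the first time that $X(j)$ is at the same vertex as some $\overline X(i)$ with $i<j$, and follows that $\overline X(i)$ from then on. Let $\mathsf C=\inf\{t\ge 0: |\{\overline X_t(j): 1\le j\le |V|\}|\le 1\}$ be the full coalescence time. Let $Z_2,Z_3,\dots$ be independent with $\mathbb P(Z_i\ge t)=e^{-t\binom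 i2}$ for all $t\ge 0$, and let $d_W(\lambda_1,\lambda_2)=\int_{\mathbb R}|\lambda_1(x,\infty)-\lambda_2(x,\infty)|\,dx$ be the $L_1$ Wasserstein distance of probability measures on $\mathbb R$. There are universal constants $K,\xi>0$ such that for every such $G$ and every $\varepsilon\in(|V|^{-1},1)$ with $$\left(\frac{\max_{x\in V}\deg_G(x)}{|V|^{-1}\sum_{x\in V}\deg_G(x)}\right)T_{\rm mix}^G\le\frac{\varepsilon|V|}{\ln^4|V|\,\ln\ln|V|}$$ one has $0<m_G<\infty$ and $\mathsf C<\infty$ almost surely, and, writing $a=\left[\varepsilon\left(1+\frac{\ln(1/\varepsilon)}{\ln\ln|V|}\right)\right]^{1/6}$, $$a\le\xi\quad\Longrightarrow\quad d_W\left(\mathrm{Law}\Big(\frac{\mathsf C}{m_G}\Big),\ \mathrm{Law}\Big(\sum_{i\ge2}Z_i\Big)\right)\le K\,a .$$ -/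

import Mathlib

open MeasureTheory Filter Topology
open scoped NNReal ENNReal

noncomputable section

/-! ### Trajectories -/

/-- `ω : [0,∞) → V` is constant on each `[τ n, τ (n+1))` for some `0 = τ 0 < τ 1 < ⋯` increasing
to infinity. -/
def IsStepPath {V : Type*} (ω : ℝ≥0 → V) : Prop :=
  ∃ τ : ℕ → ℝ≥0, τ 0 = 0 ∧ StrictMono τ ∧ Tendsto τ atTop atTop ∧
    ∀ n s, τ n ≤ s → s < τ (n + 1) → ω s = ω (τ n)

/-- The space of càdlàg trajectories in the (finite, discrete) state space `V`. -/
def PathSpace (V : Type*) : Type _ := {ω : ℝ≥0 → V // IsStepPath ω}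

namespace PathSpace

variable {V : Type*}

/-- The position `X_t(ω) = ω_t`. -/
def eval (t : ℝ≥0) (ω : PathSpace V) : V := ω.1 t

/-- The σ-field generated by the projections `X_t`, `t ≥ 0`. -/
instance : MeasurableSpace (PathSpace V) := ⨆ t : ℝ≥0, MeasurableSpace.comap (eval t) ⊤

/-- The σ-field `F_T = σ(X_s : s ≤ T)`. -/
@[reducible] def past (T : ℝ≥0) : MeasurableSpace (PathSpace V) :=
  ⨆ s : Set.Iic T, MeasurableSpace.comap (eval s.1) ⊤

end PathSpace

theorem IsStepPath.shift {V : Type*} {ω : ℝ≥0 → V} (h : IsStepPath ω) (T : ℝ≥0) :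
    IsStepPath (fun t => ω (t + T)) := by
  classical
  obtain ⟨τ, h0, hmono, htop, hconst⟩ := h
  have hex : ∃ n, T < τ n := ((htop.eventually_gt_atTop T)).exists
  set N := Nat.find hex with hN
  have hNspec : T < τ N := Nat.find_spec hex
  have hNpos : 0 < N := by
    rcases Nat.eq_zero_or_pos N with h' | h'
    · rw [h', h0] at hNspec; exact absurd hNspec (by simp)
    · exact h'
  have hprev : τ (N - 1) ≤ T := by
    have := Nat.find_min hex (m := N - 1) (by omega)
    exact not_lt.mp this
  have hlt : ∀ n, T < τ (N + n) := fun n =>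
    lt_of_lt_of_le hNspec (hmono.monotone (Nat.le_add_right N n))
  refine ⟨fun n => Nat.casesOn n 0 (fun m => τ (N + m) - T), rfl, ?_, ?_, ?_⟩
  · refine strictMono_nat_of_lt_succ ?_
    rintro (_ | m)
    · exact tsub_pos_of_lt (hlt 0)
    · have : τ (N + m) < τ (N + (m + 1)) := hmono (by omega)
      exact tsub_lt_tsub_right_of_le (hlt m).le this
  · rw [← tendsto_add_atTop_iff_nat 1]
    refine tendsto_atTop.2 fun b => ?_
    have h1 : Tendsto (fun m => τ (N + m)) atTop atTop := by
      have := (tendsto_add_atTop_iff_nat N).2 htop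
      simpa [add_comm] using this
    filter_upwards [h1.eventually_ge_atTop (b + T)] with m hm
    exact le_tsub_of_add_le_right hm
  · rintro (_ | m) s hs1 hs2
    · have hs2' : s < τ N - T := hs2
      have e : N - 1 + 1 = N := by omega
      have a1 : ω (s + T) = ω (τ (N - 1)) :=
        hconst (N - 1) (s + T) (hprev.trans le_add_self) (by rw [e]; exact lt_tsub_iff_right.1 hs2')
      have a2 : ω (0 + T) = ω (τ (N - 1)) :=
        hconst (N - 1) (0 + T) (by simpa using hprev) (by rw [e]; simpa using hNspec)
      exact a1.trans a2.symm
    · have hs1' : τ (N + m) - T ≤ s := hs1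
      have hs2' : s < τ (N + (m + 1)) - T := hs2
      have a1 : ω (s + T) = ω (τ (N + m)) :=
        hconst (N + m) (s + T) (tsub_le_iff_right.1 hs1') (lt_tsub_iff_right.1 hs2')
      have a2 : (τ (N + m) - T) + T = τ (N + m) := tsub_add_cancel_of_le (hlt m).le
      change ω (s + T) = ω ((τ (N + m) - T) + T)
      rw [a1, a2]

/-- The time shift `Θ_T ω = ω (· + T)`. -/
def PathSpace.shift {V : Type*} (T : ℝ≥0) (ω : PathSpace V) : PathSpace V :=
  ⟨fun t => ω.1 (t + T), ω.2.shift T⟩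

/-! ### Continuous-time Markov chains on a finite set -/

/-- `P = (P_x)` is the Markov chain with transition rates `q x y`, `x ≠ y`: each `P_x` is a
probability on trajectories that starts at `x`, jumps to `y` at infinitesimal rate `q x y`, and,
given `F_T`, the trajectory after time `T` has law `P_{X_T}`. -/
structure IsMarkovChain {V : Type*} (q : V → V → ℝ) (P : V → Measure (PathSpace V)) : Prop where
  isProb : ∀ x, IsProbabilityMeasure (P x)
  start : ∀ x, P x {ω | ω.eval 0 = x} = 1
  rate : ∀ x y, x ≠ y →
    Tendsto (fun h : ℝ≥0 => (P x).real {ω | ω.eval h = y} / (h : ℝ)) (𝓝[>] 0) (𝓝 (q x y))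
  markov : ∀ (x : V) (T : ℝ≥0) (A B : Set (PathSpace V)),
    MeasurableSet[PathSpace.past T] A → MeasurableSet B →
    P x (A ∩ PathSpace.shift T ⁻¹' B) = ∫⁻ ω in A, P (ω.eval T) B ∂(P x)

/-- `P_μ = ∑ x, μ(x) P_x`, the chain with initial distribution `μ`. -/
def startedFrom {V : Type*} [Fintype V] (P : V → Measure (PathSpace V)) (μ : PMF V) :
    Measure (PathSpace V) :=
  ∑ x, μ x • P x

/-- `π` is stationary: under `P_π`, `X ∘ Θ_T` has the same law as `X`. -/
def IsStationaryDist {V : Type*} [Fintype V] (P : V → Measure (PathSpace V)) (π : PMF V) : Prop :=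
  ∀ T : ℝ≥0, (startedFrom P π).map (PathSpace.shift T) = startedFrom P π

/-- The total variation distance `(1/2) ∑ y, |P_x(X_T = y) - π(y)|`. -/
def tvDist {V : Type*} [Fintype V] (P : V → Measure (PathSpace V)) (π : PMF V) (x : V)
    (T : ℝ≥0) : ℝ :=
  (1 / 2) * ∑ y, |(P x).real {ω | ω.eval T = y} - (π y).toReal|

/-- The mixing time `T_mix = T_mix(1/4)`. (For an irreducible chain on a finite set the set below
is non-empty and closed.) -/
def mixingTime {V : Type*} [Fintype V] (P : V → Measure (PathSpace V)) (π : PMF V) : ℝ≥0 :=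
  sInf {T : ℝ≥0 | ∀ x, tvDist P π x T ≤ 1 / 4}

/-! ### Meeting and coalescence times (infima in `[0,∞]`, so `inf ∅ = ∞`) -/

/-- The first time two trajectories are at the same place. -/
def meetingTime {V : Type*} (ω ω' : PathSpace V) : ℝ≥0∞ :=
  ⨅ (t : ℝ≥0) (_ : ω.eval t = ω'.eval t), (t : ℝ≥0∞)

/-- The expected meeting time of two independent walks, both started from `π`. -/
def meanMeetingTime {V : Type*} [Fintype V] (P : V → Measure (PathSpace V)) (π : PMF V) : ℝ≥0∞ :=
  ∫⁻ w, meetingTime w.1 w.2 ∂((startedFrom P π).prod (startedFrom P π))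

/-- The first time at which the path `x` meets one of the paths `Y 0, …, Y (j-1)`. -/
def firstContact {V : Type*} {j : ℕ} (x : ℝ≥0 → V) (Y : Fin j → ℝ≥0 → V) : ℝ≥0∞ :=
  ⨅ (s : ℝ≥0) (_ : ∃ i, x s = Y i s), (s : ℝ≥0∞)

open Classical in
/-- Follow `x` until the time `T` of its first contact with one of the paths `Y i`, and from then
on the path `Y i` with `Y i T = x T`, where `i` is the least such index. -/
def stickTo {V : Type*} {j : ℕ} (x : ℝ≥0 → V) (Y : Fin j → ℝ≥0 → V) (t : ℝ≥0) : V :=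
  if firstContact x Y ≤ t then
    if h : ∃ i, x (firstContact x Y).toNNReal = Y i (firstContact x Y).toNNReal then
      Y (Fin.find _ h) t
    -- not reached by step paths: their infimum is attained
    else x t
  else x t

/-- The coalescing trajectories built one by one from the trajectories `X 0, …, X (k-1)`:
walker `j` follows `X j` until it meets a (coalescing) walker of smaller index and moves along
with that walker from then on. All walkers of smaller index that are met at this time have
already met each other, so the choice among them does not matter. -/
def coalescing {V : Type*} {k : ℕ} (X : Fin k → PathSpace V) (j : Fin k) : ℝ≥0 → V :=
  stickTo (fun t => (X j).eval t) fun i : Fin j => coalescing X ⟨i, i.2.trans j.2⟩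
termination_by j.val
decreasing_by exact i.2

/-- `C_i`, the first time at which at most `i` distinct walkers are left. -/
def coalescenceTime {V : Type*} {k : ℕ} (i : ℕ) (X : Fin k → PathSpace V) : ℝ≥0∞ :=
  ⨅ (t : ℝ≥0) (_ : (Set.range fun j => coalescing X j t).ncard ≤ i), (t : ℝ≥0∞)

/-! ### Wasserstein distance and the mean-field law -/

/-- The `L₁` Wasserstein distance `∫ |λ₁(x,∞) - λ₂(x,∞)| dx` of probability measures on `ℝ`. -/
def wasserstein (μ₁ μ₂ : Measure ℝ) : ℝ≥0∞ :=
  ∫⁻ x : ℝ, ENNReal.ofReal |μ₁.real (Set.Ioi x) - μ₂.real (Set.Ioi x)|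

/-- The joint law of independent `Z_2, Z_3, …` (indexed from `0`), where `Z_i` is exponential
with `P(Z_i ≥ t) = exp(-t * binom(i,2))`. -/
def meanFieldSeqLaw : Measure (ℕ → ℝ) :=
  Measure.infinitePi fun i : ℕ => ProbabilityTheory.expMeasure ((i + 2).choose 2 : ℝ)

/-- The law of `∑_{i ≥ 2} Z_i`. -/
def meanFieldLaw : Measure ℝ := meanFieldSeqLaw.map fun z => ∑' i, z i

/-! ### Random walk on a graph -/

/-- Transition rates of the continuous-time simple random walk on `G`: at rate `1`, jump to a
uniformly chosen neighbour. -/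
def walkRate {V : Type*} [Fintype V] (G : SimpleGraph V) [DecidableRel G.Adj] (x y : V) : ℝ :=
  if G.Adj x y then 1 / (G.degree x : ℝ) else 0

/-- `[ε (1 + ln(1/ε) / ln ln n)]^{1/6}`. -/
def networkError (n : ℕ) (ε : ℝ) : ℝ :=
  (ε * (1 + Real.log (1 / ε) / Real.log (Real.log n))) ^ (1 / 6 : ℝ)

end

open MeasureTheory Filter Topology
open scoped NNReal ENNReal
set_option linter.unusedSectionVars false

noncomputable section

/-! The walks are observed on a fine grid of times. There the coalescing system is a Markov chain on
finite sets: all particles at `y` jump to `φ y`, with independent `φ y` (`flow`). Step paths have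
finitely many jumps in bounded time, so refining a dyadic grid recovers the coalescence time
(`IsMarkovChain.tendsto_flow`) and the mean meeting time (`tendsto_statMeet`).

The core is a corrected test function, `corrTail`. Write `g n u` for the probability that the first
`n` exponential variables sum to more than `u`; it solves the Kolmogorov equation `g (n+1)' = rate n
* (g n - g (n+1))`. Let `d x y = 1 - E[meeting time from x, y] / E[meeting time from π, π]`
(`meetDev`). Then `d = 1` on the diagonal, and by first-step analysis the mean of `d` over one step
exceeds `d` by a constant `κ` off the diagonal. Add to `g (|S| - 1) u` half the sum of `d` over
ordered pairs of particles, times the jump `g (|S| - 2) u - g (|S| - 1) u`. The drift of the pairs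
reproduces the Kolmogorov equation, and when two particles merge their two ordered pairs contribute
exactly the jump of `g`. So the functional is almost space-time harmonic
(`abs_flow_corrTail_sub_le`): apart from discretisation errors, which vanish with the mesh or carry
a small factor, an error arises only when a pair merges while another pair has `d` away from 0.

For stationary walkers `|d|` is small on average: `d` has mean zero, and `d ≥ -η` because mixing
bounds the meeting time from any two points by `1 + η` times the stationary one. Two walkers have
only one first meeting, so the merging errors of `k` walkers sum to a bound of order `k ^ 4` times
small quantities, uniformly in the number of steps (`sum_prodMean_flow_injSum_le`). Hence `k`
stationary walkers coalesce like Kingman's coalescent (`abs_stationary_sub_kingmanTail_le`).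

The full system dominates `k` stationary walkers by monotonicity. Conversely, a Bonferroni bound
shows that a walker is likely to hit one of `k` targets in a block of mixing and running; after a
short early phase at most `k` particles are left, and after one more mixing period they are
dominated by `k` stationary walkers (`flow_iterate_univ_le`, `flow_iterate_moreThan_univ_le`).

With `k` of order `ln n / a`, a mixing period of order `T_mix (ln ln n + ln (1/ε))`, and meeting
time at least a constant over `max π`, the pointwise error is of order `a ^ 2 (1 + u)` plus a delay
`2 a` (`IsWalkSemigroup.network_bounds`). The non-coalescence probability is submultiplicative, so
its tail is exponential; integrating the pointwise bound up to `a ^ (-1/2)` and the tail beyond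
gives distance `O(a)`. Cutting the infinite sum after `k - 1` terms costs `2 / k ≤ a`. -/

/-! ### Finite products of probability vectors -/

/-- A probability vector on a finite set. -/
structure IsProbVec {V : Type*} [Fintype V] (μ : V → ℝ) : Prop where
  nonneg : ∀ x, 0 ≤ μ x
  sum_eq_one : ∑ x, μ x = 1

/-- The mean of `F y` when the coordinates `y i` are independent with laws `μ i`. -/
def prodMean {V ι : Type*} [Fintype V] [Fintype ι] [DecidableEq ι] (μ : ι → V → ℝ)
    (F : (ι → V) → ℝ) : ℝ :=
  ∑ y : ι → V, (∏ i, μ i (y i)) * F y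

section ProdMean

variable {V ι κ : Type*} [Fintype V] [Fintype ι] [DecidableEq ι] [Fintype κ] [DecidableEq κ]
  {μ ν : ι → V → ℝ}

theorem prodMean_const (hμ : ∀ i, IsProbVec (μ i)) (c : ℝ) : prodMean μ (fun _ => c) = c := by
  classical
  unfold prodMean
  rw [← Finset.sum_mul]
  have := Finset.prod_univ_sum (fun _ : ι => (Finset.univ : Finset V)) μ
  rw [Fintype.piFinset_univ] at this
  rw [← this, Finset.prod_congr rfl fun i _ => (hμ i).sum_eq_one]
  simp

theorem prodMean_mono (hμ : ∀ i, IsProbVec (μ i)) {F G : (ι → V) → ℝ} (h : ∀ y, F y ≤ G y) :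
    prodMean μ F ≤ prodMean μ G :=
  Finset.sum_le_sum fun y _ =>
    mul_le_mul_of_nonneg_left (h y) (Finset.prod_nonneg fun i _ => (hμ i).nonneg _)

theorem prodMean_nonneg (hμ : ∀ i, IsProbVec (μ i)) {F : (ι → V) → ℝ} (h : ∀ y, 0 ≤ F y) :
    0 ≤ prodMean μ F :=
  Finset.sum_nonneg fun y _ =>
    mul_nonneg (Finset.prod_nonneg fun i _ => (hμ i).nonneg _) (h y)

theorem prodMean_add (μ : ι → V → ℝ) (F G : (ι → V) → ℝ) :
    prodMean μ (fun y => F y + G y) = prodMean μ F + prodMean μ G := by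
  simp [prodMean, mul_add, Finset.sum_add_distrib]

theorem prodMean_sub (μ : ι → V → ℝ) (F G : (ι → V) → ℝ) :
    prodMean μ (fun y => F y - G y) = prodMean μ F - prodMean μ G := by
  simp [prodMean, mul_sub, Finset.sum_sub_distrib]

theorem prodMean_const_mul (μ : ι → V → ℝ) (c : ℝ) (F : (ι → V) → ℝ) :
    prodMean μ (fun y => c * F y) = c * prodMean μ F := by
  simp only [prodMean, Finset.mul_sum]
  exact Finset.sum_congr rfl fun y _ => by ring

theorem prodMean_sum {α : Type*} (s : Finset α) (μ : ι → V → ℝ) (F : α → (ι → V) → ℝ) :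
    prodMean μ (fun y => ∑ a ∈ s, F a y) = ∑ a ∈ s, prodMean μ (F a) := by
  simp only [prodMean, Finset.mul_sum]
  exact Finset.sum_comm

theorem prodMean_abs_le (hμ : ∀ i, IsProbVec (μ i)) (F : (ι → V) → ℝ) :
    |prodMean μ F| ≤ prodMean μ (fun y => |F y|) := by
  unfold prodMean
  refine (Finset.abs_sum_le_sum_abs _ _).trans (Finset.sum_le_sum fun y _ => ?_)
  rw [abs_mul, abs_of_nonneg (Finset.prod_nonneg fun i _ => (hμ i).nonneg _)]

theorem prodMean_congr {F G : (ι → V) → ℝ} (h : ∀ y, F y = G y) :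
    prodMean μ F = prodMean μ G := by
  rw [show F = G from funext h]

/-- Marginalisation: a function of the coordinates `e j` only. -/
theorem prodMean_comp_injective (hμ : ∀ i, IsProbVec (μ i)) {e : κ → ι}
    (he : Function.Injective e) (F : (κ → V) → ℝ) :
    prodMean μ (fun y => F (fun j => y (e j))) = prodMean (fun j => μ (e j)) F := by
  classical
  unfold prodMean
  rw [← Finset.sum_fiberwise_of_maps_to (s := Finset.univ) (t := Finset.univ)
    (g := fun y : ι → V => fun j => y (e j)) (fun _ _ => Finset.mem_univ _)]
  refine Finset.sum_congr rfl fun z _ => ?_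
  have h1 : ∀ y ∈ Finset.univ.filter (fun y : ι → V => (fun j => y (e j)) = z),
      (∏ i, μ i (y i)) * F (fun j => y (e j)) = (∏ i, μ i (y i)) * F z := by
    intro y hy
    rw [(Finset.mem_filter.1 hy).2]
  rw [Finset.sum_congr rfl h1, ← Finset.sum_mul]
  congr 1
  -- The fibre over `z` is a box: the coordinates `e j` are pinned to `z j` and the others are free,
  -- so the sum over it factorises.
  have h2 : Finset.univ.filter (fun y : ι → V => (fun j => y (e j)) = z) =
      Fintype.piFinset fun i => Finset.univ.filter fun v => ∀ j, e j = i → v = z j := by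
    ext y
    simp only [Finset.mem_filter, Finset.mem_univ, true_and, Fintype.mem_piFinset]
    constructor
    · rintro rfl i j rfl; rfl
    · intro h; funext j; exact h (e j) j rfl
  rw [h2, ← Finset.prod_univ_sum]
  symm
  refine Fintype.prod_of_injective e he _ _ ?_ ?_
  · intro i hi
    rw [Finset.filter_true_of_mem]
    · exact (hμ i).sum_eq_one
    · intro v _ j hj; exact absurd ⟨j, hj⟩ hi
  · intro j
    have : (Finset.univ.filter fun v => ∀ j', e j' = e j → v = z j') = {z j} := by
      ext v
      simp only [Finset.mem_filter, Finset.mem_univ, true_and, Finset.mem_singleton]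
      exact ⟨fun h => h j rfl, fun h j' hj' => by rw [he hj', h]⟩
    rw [this, Finset.sum_singleton]

/-- Composition of independent random steps. -/
theorem prodMean_prodMean (μ : ι → V → ℝ) (p : ι → V → V → ℝ) (F : (ι → V) → ℝ) :
    prodMean μ (fun x => prodMean (fun i => p i (x i)) F) =
      prodMean (fun i y => ∑ x, μ i x * p i x y) F := by
  classical
  unfold prodMean
  simp only [Finset.mul_sum]
  rw [Finset.sum_comm]
  refine Finset.sum_congr rfl fun y _ => ?_
  have := Finset.prod_univ_sum (fun _ : ι => (Finset.univ : Finset V))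
    (fun i x => μ i x * p i x (y i))
  rw [Fintype.piFinset_univ] at this
  rw [this, Finset.sum_mul]
  refine Finset.sum_congr rfl fun x _ => ?_
  rw [Finset.prod_mul_distrib]; ring

/-- Hybrid argument: replace the factors `ν i` by `μ i` one at a time. Each replacement changes a
single factor, and the others sum to 1. -/
theorem sum_abs_prod_sub_prod_le (hμ : ∀ i, IsProbVec (μ i)) (hν : ∀ i, IsProbVec (ν i)) :
    ∑ y : ι → V, |∏ i, μ i (y i) - ∏ i, ν i (y i)| ≤ ∑ i, ∑ v, |μ i v - ν i v| := by
  classical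
  have key : ∀ s : Finset ι, ∑ y : ι → V, |∏ i, (if i ∈ s then μ i else ν i) (y i) -
      ∏ i, ν i (y i)| ≤ ∑ i ∈ s, ∑ v, |μ i v - ν i v| := by
    intro s
    induction s using Finset.induction_on with
    | empty => simp
    | insert a s ha ih =>
      rw [Finset.sum_insert ha]
      have hstep : ∑ y : ι → V, |∏ i, (if i ∈ insert a s then μ i else ν i) (y i) -
          ∏ i, (if i ∈ s then μ i else ν i) (y i)| ≤ ∑ v, |μ a v - ν a v| := by
        have h1 : ∀ y : ι → V, |∏ i, (if i ∈ insert a s then μ i else ν i) (y i) -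
            ∏ i, (if i ∈ s then μ i else ν i) (y i)| =
            ∏ i, (if i = a then fun v => |μ a v - ν a v| else if i ∈ s then μ i else ν i) (y i) := by
          intro y
          rw [← Finset.mul_prod_erase _ _ (Finset.mem_univ a),
            ← Finset.mul_prod_erase _ (fun i => (if i ∈ s then μ i else ν i) (y i))
              (Finset.mem_univ a),
            ← Finset.mul_prod_erase _ (fun i => (if i = a then fun v => |μ a v - ν a v| else
              if i ∈ s then μ i else ν i) (y i)) (Finset.mem_univ a)]
          have e1 : ∏ i ∈ Finset.univ.erase a, (if i ∈ insert a s then μ i else ν i) (y i) =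
              ∏ i ∈ Finset.univ.erase a, (if i ∈ s then μ i else ν i) (y i) := by
            refine Finset.prod_congr rfl fun i hi => ?_
            have : i ≠ a := Finset.ne_of_mem_erase hi
            simp [this]
          have e2 : ∏ i ∈ Finset.univ.erase a, (if i = a then fun v => |μ a v - ν a v| else
              if i ∈ s then μ i else ν i) (y i) =
              ∏ i ∈ Finset.univ.erase a, (if i ∈ s then μ i else ν i) (y i) := by
            refine Finset.prod_congr rfl fun i hi => ?_
            have : i ≠ a := Finset.ne_of_mem_erase hi
            simp [this]
          have e3 : 0 ≤ ∏ i ∈ Finset.univ.erase a, (if i ∈ s then μ i else ν i) (y i) := by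
            refine Finset.prod_nonneg fun i _ => ?_
            split_ifs
            · exact (hμ i).nonneg _
            · exact (hν i).nonneg _
          rw [e1, e2, ← sub_mul, abs_mul, abs_of_nonneg e3]
          simp [ha]
        rw [Finset.sum_congr rfl fun y _ => h1 y]
        have := Finset.prod_univ_sum (fun _ : ι => (Finset.univ : Finset V))
          (fun i => (if i = a then fun v => |μ a v - ν a v| else if i ∈ s then μ i else ν i))
        rw [Fintype.piFinset_univ] at this
        rw [← this, ← Finset.mul_prod_erase _ _ (Finset.mem_univ a), Finset.prod_eq_one]
        · simp
        · intro i hi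
          have : i ≠ a := Finset.ne_of_mem_erase hi
          simp only [this, if_false]
          split_ifs
          · exact (hμ i).sum_eq_one
          · exact (hν i).sum_eq_one
      refine le_trans ?_ (add_le_add hstep ih)
      rw [← Finset.sum_add_distrib]
      exact Finset.sum_le_sum fun y _ => abs_sub_le _ _ _
  simpa using key Finset.univ

theorem prodMean_sub_le (hμ : ∀ i, IsProbVec (μ i)) (hν : ∀ i, IsProbVec (ν i))
    {F : (ι → V) → ℝ} {B : ℝ} (hF : ∀ y, |F y| ≤ B) :
    prodMean μ F - prodMean ν F ≤ B * ∑ i, ∑ v, |μ i v - ν i v| := by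
  unfold prodMean
  rw [← Finset.sum_sub_distrib]
  have hB : ∀ y : ι → V, (∏ i, μ i (y i)) * F y - (∏ i, ν i (y i)) * F y ≤
      B * |∏ i, μ i (y i) - ∏ i, ν i (y i)| := by
    intro y
    rw [← sub_mul, mul_comm B]
    refine (le_abs_self _).trans ?_
    rw [abs_mul]
    exact mul_le_mul_of_nonneg_left (hF y) (abs_nonneg _)
  refine (Finset.sum_le_sum fun y _ => hB y).trans ?_
  rw [← Finset.mul_sum]
  -- `0 ≤ B` has to be read off from a point of `ι → V`. Such a point exists, since an empty `V`
  -- carries no probability vector.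
  by_cases hne : Nonempty (ι → V)
  · have hB0 : 0 ≤ B := (abs_nonneg _).trans (hF hne.some)
    exact mul_le_mul_of_nonneg_left (sum_abs_prod_sub_prod_le hμ hν) hB0
  · exfalso
    have h1 : ∀ i, Nonempty V := fun i => by
      by_contra h
      rw [not_nonempty_iff] at h
      have := (hμ i).sum_eq_one
      simp at this
    exact hne ⟨fun i => (h1 i).some⟩

end ProdMean

/-! ### Stochastic matrices and the coalescing flow -/

/-- A stochastic matrix. -/
def IsStochastic {V : Type*} [Fintype V] (p : V → V → ℝ) : Prop := ∀ x, IsProbVec (p x)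

/-- `π` is an invariant probability vector of `p`. -/
structure IsStationaryVec {V : Type*} [Fintype V] (p : V → V → ℝ) (π : V → ℝ) : Prop where
  prob : IsProbVec π
  inv : ∀ y, ∑ x, π x * p x y = π y

section Flow

variable {V : Type*} [Fintype V] [DecidableEq V] {p : V → V → ℝ} {π : V → ℝ}

/-- The `n`-step transition probabilities. -/
def stepPow (p : V → V → ℝ) : ℕ → V → V → ℝ
  | 0, x, y => if x = y then 1 else 0
  | n + 1, x, y => ∑ z, stepPow p n x z * p z y

theorem IsProbVec.comp {μ : V → ℝ} (hμ : IsProbVec μ) (hp : IsStochastic p) :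
    IsProbVec fun y => ∑ z, μ z * p z y :=
  ⟨fun y => Finset.sum_nonneg fun z _ => mul_nonneg (hμ.nonneg z) ((hp z).nonneg y), by
    rw [Finset.sum_comm]
    simp_rw [← Finset.mul_sum, (hp _).sum_eq_one, mul_one]
    exact hμ.sum_eq_one⟩

theorem IsStochastic.stepPow (hp : IsStochastic p) (n : ℕ) : IsStochastic (stepPow p n) := by
  induction n with
  | zero =>
    exact fun x => ⟨fun y => by simp only [_root_.stepPow]; split_ifs <;> norm_num,
      by simp [_root_.stepPow]⟩
  | succ n ih => exact fun x => (ih x).comp hp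

theorem IsStationaryVec.stepPow (hπ : IsStationaryVec p π) (n : ℕ) :
    IsStationaryVec (stepPow p n) π := by
  refine ⟨hπ.prob, ?_⟩
  induction n with
  | zero => intro y; simp [_root_.stepPow]
  | succ n ih =>
    intro y
    simp only [_root_.stepPow, Finset.mul_sum]
    rw [Finset.sum_comm]
    simp_rw [← mul_assoc, ← Finset.sum_mul, ih]
    exact hπ.inv y

/-- One step of the coalescing random walk: all particles at `y` jump to `φ y`, where the `φ y`
are independent with laws `p y`. -/
def flow (p : V → V → ℝ) (F : Finset V → ℝ) (S : Finset V) : ℝ :=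
  prodMean (fun y => p y) fun φ => F (S.image φ)

theorem flow_mono (hp : IsStochastic p) {F G : Finset V → ℝ} (h : ∀ S, F S ≤ G S) (S : Finset V) :
    flow p F S ≤ flow p G S :=
  prodMean_mono hp fun _ => h _

theorem flow_iterate_mono (hp : IsStochastic p) {F G : Finset V → ℝ} (h : ∀ S, F S ≤ G S) (n : ℕ)
    (S : Finset V) : (flow p)^[n] F S ≤ (flow p)^[n] G S := by
  induction n generalizing S with
  | zero => exact h S
  | succ n ih =>
    rw [Function.iterate_succ_apply', Function.iterate_succ_apply']
    exact flow_mono hp ih S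

theorem flow_const (hp : IsStochastic p) (c : ℝ) : flow p (fun _ => c) = fun _ => c :=
  funext fun _ => prodMean_const hp c

theorem flow_iterate_const (hp : IsStochastic p) (c : ℝ) (n : ℕ) :
    (flow p)^[n] (fun _ => c) = fun _ => c := by
  induction n with
  | zero => rfl
  | succ n ih => rw [Function.iterate_succ_apply', ih, flow_const hp]

theorem flow_add (p : V → V → ℝ) (F G : Finset V → ℝ) :
    flow p (fun S => F S + G S) = fun S => flow p F S + flow p G S :=
  funext fun _ => prodMean_add _ _ _

theorem flow_const_mul (p : V → V → ℝ) (c : ℝ) (F : Finset V → ℝ) :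
    flow p (fun S => c * F S) = fun S => c * flow p F S :=
  funext fun _ => prodMean_const_mul _ _ _

theorem flow_sub (p : V → V → ℝ) (F G : Finset V → ℝ) :
    flow p (fun S => F S - G S) = fun S => flow p F S - flow p G S :=
  funext fun _ => prodMean_sub _ _ _

theorem flow_iterate_add (p : V → V → ℝ) (F G : Finset V → ℝ) (n : ℕ) :
    (flow p)^[n] (fun S => F S + G S) = fun S => (flow p)^[n] F S + (flow p)^[n] G S := by
  induction n with
  | zero => rfl
  | succ n ih => simp only [Function.iterate_succ_apply', ih, flow_add]

theorem flow_iterate_const_mul (p : V → V → ℝ) (c : ℝ) (F : Finset V → ℝ) (n : ℕ) :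
    (flow p)^[n] (fun S => c * F S) = fun S => c * (flow p)^[n] F S := by
  induction n with
  | zero => rfl
  | succ n ih => simp only [Function.iterate_succ_apply', ih, flow_const_mul]

theorem flow_abs_le (hp : IsStochastic p) (F : Finset V → ℝ) (S : Finset V) :
    |flow p F S| ≤ flow p (fun S => |F S|) S :=
  prodMean_abs_le hp _

theorem Monotone.flow (hp : IsStochastic p) {F : Finset V → ℝ} (hF : Monotone F) :
    Monotone (flow p F) := fun _ _ h =>
  prodMean_mono hp fun φ => hF (Finset.image_subset_image (f := φ) h)

theorem Monotone.flow_iterate (hp : IsStochastic p) {F : Finset V → ℝ} (hF : Monotone F) (n : ℕ) :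
    Monotone ((_root_.flow p)^[n] F) := by
  induction n with
  | zero => exact hF
  | succ n ih => rw [Function.iterate_succ_apply']; exact ih.flow hp

/-- The value of `flow` at `S` only involves sets of at most `S.card` points. -/
theorem flow_le_of_card_le (hp : IsStochastic p) {F G : Finset V → ℝ} {k : ℕ}
    (h : ∀ S : Finset V, S.card ≤ k → F S ≤ G S) (S : Finset V) (hS : S.card ≤ k) :
    flow p F S ≤ flow p G S :=
  prodMean_mono hp fun _ => h _ (Finset.card_image_le.trans hS)

/-- A family of independent walkers, at most one of them at each site, moves like the flow. -/
theorem flow_image_of_injOn (hp : IsStochastic p) {ι : Type*} [Fintype ι] [DecidableEq ι]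
    (F : Finset V → ℝ) (x : ι → V) (A : Finset ι) (hx : Set.InjOn x A) :
    flow p F (A.image x) = prodMean (fun i => p (x i)) fun y => F (A.image y) := by
  classical
  have h1 := prodMean_comp_injective (μ := fun y => p y) hp
    (e := fun i : A => x i) (fun i j h => Subtype.ext (hx i.2 j.2 h))
    (fun z => F (Finset.univ.image z))
  have h2 := prodMean_comp_injective (μ := fun i => p (x i)) (fun i => hp _)
    (e := fun i : A => (i : ι)) Subtype.val_injective (fun z => F (Finset.univ.image z))
  have e1 : ∀ φ : V → V, (A.image x).image φ = Finset.univ.image fun j : A => φ (x j) := by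
    intro φ; ext v; simp
  have e2 : ∀ y : ι → V, A.image y = Finset.univ.image fun j : A => y j := by
    intro φ; ext v; simp
  rw [flow, prodMean_congr fun φ => congrArg F (e1 φ), h1,
    prodMean_congr fun y => congrArg F (e2 y), h2]

/-- Independent walkers visit more sites than coalescing ones. -/
theorem flow_image_le (hp : IsStochastic p) {ι : Type*} [Fintype ι] [DecidableEq ι]
    {F : Finset V → ℝ} (hF : Monotone F) (x : ι → V) :
    flow p F (Finset.univ.image x) ≤
      prodMean (fun i => p (x i)) fun y => F (Finset.univ.image y) := by
  classical
  -- One walker per occupied site: the walkers in `A` already move like the flow, and the others can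
  -- only add sites.
  obtain ⟨A, hA, hinj⟩ : ∃ A : Finset ι, A.image x = Finset.univ.image x ∧ Set.InjOn x A := by
    obtain ⟨A, -, hinj, hA⟩ := Finset.exists_subset_injOn_image_eq_of_surjOn
      (f := x) Set.univ (Finset.univ.image x) (by simp [Set.SurjOn])
    exact ⟨A, hA, hinj⟩
  rw [← hA, flow_image_of_injOn hp F x A hinj]
  exact prodMean_mono (fun i => hp _) fun y => hF (Finset.image_subset_image (Finset.subset_univ A))

/-- The one-step comparison iterates because `flow p F` is again monotone. -/
theorem flow_iterate_image_le (hp : IsStochastic p) {ι : Type*} [Fintype ι] [DecidableEq ι]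
    {F : Finset V → ℝ} (hF : Monotone F) (n : ℕ) (x : ι → V) :
    (flow p)^[n] F (Finset.univ.image x) ≤
      prodMean (fun i => stepPow p n (x i)) fun y => F (Finset.univ.image y) := by
  induction n generalizing F with
  | zero =>
    rw [prodMean, Finset.sum_eq_single x]
    · simp [stepPow]
    · intro y _ hy
      obtain ⟨i, hi⟩ := Function.ne_iff.1 hy
      rw [Finset.prod_eq_zero (Finset.mem_univ i) (by simp [stepPow, hi.symm]), zero_mul]
    · simp
  | succ n ih =>
    rw [Function.iterate_succ_apply]
    refine (ih (hF.flow hp)).trans ?_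
    have h1 : ∀ y : ι → V, flow p F (Finset.univ.image y) ≤
        prodMean (fun i => p (y i)) fun z => F (Finset.univ.image z) := flow_image_le hp hF
    refine (prodMean_mono (fun i => hp.stepPow n _) h1).trans (le_of_eq ?_)
    rw [prodMean_prodMean (fun i => stepPow p n (x i)) (fun _ => p)]
    rfl

end Flow
end

noncomputable section

/-! ### Two independent walkers -/

section Pair

variable {V : Type*} [Fintype V] {p : V → V → ℝ} {π : V → ℝ}

/-- The mean of `f` after one step of two independent walkers. -/
def pairMean (p : V → V → ℝ) (f : V → V → ℝ) (x y : V) : ℝ :=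
  ∑ u, ∑ w, p x u * p y w * f u w

/-- The mean of `f` at two independent points with law `π`. -/
def statMean (π : V → ℝ) (f : V → V → ℝ) : ℝ := ∑ x, ∑ y, π x * π y * f x y

theorem pairMean_mono (hp : IsStochastic p) {f g : V → V → ℝ} (h : ∀ x y, f x y ≤ g x y)
    (x y : V) : pairMean p f x y ≤ pairMean p g x y :=
  Finset.sum_le_sum fun _ _ => Finset.sum_le_sum fun _ _ =>
    mul_le_mul_of_nonneg_left (h _ _) (mul_nonneg ((hp _).nonneg _) ((hp _).nonneg _))

theorem pairMean_const (hp : IsStochastic p) (c : ℝ) (x y : V) :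
    pairMean p (fun _ _ => c) x y = c := by
  unfold pairMean
  simp_rw [mul_assoc, ← Finset.mul_sum, ← Finset.sum_mul, (hp _).sum_eq_one, one_mul]

theorem pairMean_add (p : V → V → ℝ) (f g : V → V → ℝ) (x y : V) :
    pairMean p (fun x y => f x y + g x y) x y = pairMean p f x y + pairMean p g x y := by
  simp only [pairMean, mul_add, Finset.sum_add_distrib]

theorem pairMean_sub (p : V → V → ℝ) (f g : V → V → ℝ) (x y : V) :
    pairMean p (fun x y => f x y - g x y) x y = pairMean p f x y - pairMean p g x y := by
  simp only [pairMean, mul_sub, Finset.sum_sub_distrib]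

theorem pairMean_const_mul (p : V → V → ℝ) (c : ℝ) (f : V → V → ℝ) (x y : V) :
    pairMean p (fun x y => c * f x y) x y = c * pairMean p f x y := by
  simp only [pairMean, Finset.mul_sum]
  exact Finset.sum_congr rfl fun _ _ => Finset.sum_congr rfl fun _ _ => by ring

theorem pairMean_sum {α : Type*} (s : Finset α) (p : V → V → ℝ) (f : α → V → V → ℝ) (x y : V) :
    pairMean p (fun x y => ∑ a ∈ s, f a x y) x y = ∑ a ∈ s, pairMean p (f a) x y := by
  classical
  induction s using Finset.induction_on with
  | empty => simp [pairMean]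
  | insert a s ha ih => simp only [Finset.sum_insert ha, pairMean_add, ih]

theorem pairMean_swap (p : V → V → ℝ) (f : V → V → ℝ) (x y : V) :
    pairMean p f x y = pairMean p (fun a b => f b a) y x := by
  unfold pairMean
  rw [Finset.sum_comm]
  exact Finset.sum_congr rfl fun _ _ => Finset.sum_congr rfl fun _ _ => by ring

theorem pairMean_eq_prodMean (p : V → V → ℝ) (f : V → V → ℝ) (x : Fin 2 → V) :
    pairMean p f (x 0) (x 1) = prodMean (fun i => p (x i)) fun y => f (y 0) (y 1) := by
  unfold pairMean prodMean
  rw [← (finTwoArrowEquiv V).symm.sum_comp, Fintype.sum_prod_type]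
  simp [Fin.prod_univ_two]

theorem statMean_mono (hπ : IsProbVec π) {f g : V → V → ℝ} (h : ∀ x y, f x y ≤ g x y) :
    statMean π f ≤ statMean π g :=
  Finset.sum_le_sum fun _ _ => Finset.sum_le_sum fun _ _ =>
    mul_le_mul_of_nonneg_left (h _ _) (mul_nonneg (hπ.nonneg _) (hπ.nonneg _))

theorem statMean_const (hπ : IsProbVec π) (c : ℝ) : statMean π (fun _ _ => c) = c := by
  unfold statMean
  simp_rw [mul_assoc, ← Finset.mul_sum, ← Finset.sum_mul, hπ.sum_eq_one, one_mul]

theorem statMean_add (π : V → ℝ) (f g : V → V → ℝ) :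
    statMean π (fun x y => f x y + g x y) = statMean π f + statMean π g := by
  simp only [statMean, mul_add, Finset.sum_add_distrib]

theorem statMean_sub (π : V → ℝ) (f g : V → V → ℝ) :
    statMean π (fun x y => f x y - g x y) = statMean π f - statMean π g := by
  simp only [statMean, mul_sub, Finset.sum_sub_distrib]

theorem statMean_const_mul (π : V → ℝ) (c : ℝ) (f : V → V → ℝ) :
    statMean π (fun x y => c * f x y) = c * statMean π f := by
  simp only [statMean, Finset.mul_sum]
  exact Finset.sum_congr rfl fun _ _ => Finset.sum_congr rfl fun _ _ => by ring

theorem statMean_sum {α : Type*} (s : Finset α) (π : V → ℝ) (f : α → V → V → ℝ) :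
    statMean π (fun x y => ∑ a ∈ s, f a x y) = ∑ a ∈ s, statMean π (f a) := by
  classical
  induction s using Finset.induction_on with
  | empty => simp [statMean]
  | insert a s ha ih => simp only [Finset.sum_insert ha, statMean_add, ih]

/-- Averaging the second walker over its stationary law. -/
def sndMean (π : V → ℝ) (f : V → V → ℝ) (x : V) : ℝ := ∑ y, π y * f x y

theorem statMean_eq_sum_sndMean (π : V → ℝ) (f : V → V → ℝ) :
    statMean π f = ∑ x, π x * sndMean π f x := by
  simp only [statMean, sndMean, Finset.mul_sum, mul_assoc]

/-- The second walker is still stationary after its step, so only the step of the first one is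
visible. -/
theorem sndMean_pairMean (hπ : IsStationaryVec p π) (f : V → V → ℝ) (x : V) :
    sndMean π (pairMean p f) x = ∑ x', p x x' * sndMean π f x' := by
  simp only [sndMean, pairMean, Finset.mul_sum]
  rw [Finset.sum_comm]
  refine Finset.sum_congr rfl fun x' _ => ?_
  rw [Finset.sum_comm]
  refine Finset.sum_congr rfl fun y' _ => ?_
  rw [← hπ.inv y', Finset.sum_mul, Finset.mul_sum]
  exact Finset.sum_congr rfl fun y _ => by ring

theorem statMean_pairMean (hπ : IsStationaryVec p π) (f : V → V → ℝ) :
    statMean π (pairMean p f) = statMean π f := by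
  rw [statMean_eq_sum_sndMean, statMean_eq_sum_sndMean]
  simp_rw [sndMean_pairMean hπ, Finset.mul_sum]
  rw [Finset.sum_comm]
  refine Finset.sum_congr rfl fun x _ => ?_
  simp_rw [← mul_assoc, ← Finset.sum_mul, hπ.inv]

theorem sndMean_mono (hπ : IsProbVec π) {f g : V → V → ℝ} (h : ∀ x y, f x y ≤ g x y) (x : V) :
    sndMean π f x ≤ sndMean π g x :=
  Finset.sum_le_sum fun _ _ => mul_le_mul_of_nonneg_left (h _ _) (hπ.nonneg _)

theorem sndMean_add (π : V → ℝ) (f g : V → V → ℝ) (x : V) :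
    sndMean π (fun x y => f x y + g x y) x = sndMean π f x + sndMean π g x := by
  simp only [sndMean, mul_add, Finset.sum_add_distrib]

theorem sndMean_sub (π : V → ℝ) (f g : V → V → ℝ) (x : V) :
    sndMean π (fun x y => f x y - g x y) x = sndMean π f x - sndMean π g x := by
  simp only [sndMean, mul_sub, Finset.sum_sub_distrib]

theorem sndMean_const_mul (π : V → ℝ) (c : ℝ) (f : V → V → ℝ) (x : V) :
    sndMean π (fun x y => c * f x y) x = c * sndMean π f x := by
  simp only [sndMean, Finset.mul_sum]
  exact Finset.sum_congr rfl fun _ _ => by ring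

theorem sndMean_const (hπ : IsProbVec π) (c : ℝ) (x : V) :
    sndMean π (fun _ _ => c) x = c := by
  simp only [sndMean, ← Finset.sum_mul, hπ.sum_eq_one, one_mul]

variable [DecidableEq V]

theorem pairMean_iterate_eq (p : V → V → ℝ) (n : ℕ) (f : V → V → ℝ) :
    (pairMean p)^[n] f = pairMean (stepPow p n) f := by
  induction n generalizing f with
  | zero => funext x y; simp [pairMean, stepPow]
  | succ n ih =>
    rw [Function.iterate_succ_apply, ih]
    funext x y
    simp only [pairMean, stepPow, Finset.mul_sum, Finset.sum_mul]
    calc ∑ a, ∑ b, ∑ c, ∑ d, stepPow p n x a * stepPow p n y b * (p a c * p b d * f c d)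
        = ∑ a, ∑ c, ∑ b, ∑ d, stepPow p n x a * stepPow p n y b * (p a c * p b d * f c d) :=
          Finset.sum_congr rfl fun _ _ => Finset.sum_comm
      _ = ∑ c, ∑ a, ∑ b, ∑ d, stepPow p n x a * stepPow p n y b * (p a c * p b d * f c d) :=
          Finset.sum_comm
      _ = ∑ c, ∑ a, ∑ d, ∑ b, stepPow p n x a * stepPow p n y b * (p a c * p b d * f c d) :=
          Finset.sum_congr rfl fun _ _ => Finset.sum_congr rfl fun _ _ => Finset.sum_comm
      _ = ∑ c, ∑ d, ∑ a, ∑ b, stepPow p n x a * stepPow p n y b * (p a c * p b d * f c d) :=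
          Finset.sum_congr rfl fun _ _ => Finset.sum_comm
      _ = _ := by
          refine Finset.sum_congr rfl fun c _ => Finset.sum_congr rfl fun d _ => ?_
          rw [Finset.sum_comm]
          exact Finset.sum_congr rfl fun _ _ => Finset.sum_congr rfl fun _ _ => by ring

/-- `p` brings every initial point within `ℓ¹`-distance `θ` of `π` in `T` steps. -/
def MixesBy (p : V → V → ℝ) (π : V → ℝ) (T : ℕ) (θ : ℝ) : Prop :=
  ∀ x, ∑ y, |stepPow p T x y - π y| ≤ θ

theorem abs_sum_mul_sub_sum_mul_le {μ ν f : V → ℝ} {B θ : ℝ} (hf : ∀ x, |f x| ≤ B)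
    (hB : 0 ≤ B) (h : ∑ y, |μ y - ν y| ≤ θ) : |∑ y, μ y * f y - ∑ y, ν y * f y| ≤ B * θ := by
  rw [← Finset.sum_sub_distrib]
  refine (Finset.abs_sum_le_sum_abs _ _).trans (le_trans ?_ (mul_le_mul_of_nonneg_left h hB))
  rw [Finset.mul_sum]
  refine Finset.sum_le_sum fun y _ => ?_
  rw [← sub_mul, abs_mul, mul_comm B]
  exact mul_le_mul_of_nonneg_left (hf y) (abs_nonneg _)

/-- The laws of the two walkers are replaced by `π` one after the other, at a cost of `B * θ` each.
-/
theorem pairMean_stepPow_le_statMean (hp : IsStochastic p) (hπ : IsProbVec π) {T : ℕ} {θ B : ℝ}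
    (hmix : MixesBy p π T θ) {f : V → V → ℝ} (hf : ∀ x y, |f x y| ≤ B) (hB : 0 ≤ B) (x y : V) :
    pairMean (stepPow p T) f x y ≤ statMean π f + 2 * θ * B := by
  have e1 : pairMean (stepPow p T) f x y =
      ∑ x', stepPow p T x x' * ∑ y', stepPow p T y y' * f x' y' := by
    simp only [pairMean, Finset.mul_sum, mul_assoc]
  have e2 : statMean π f = ∑ x', π x' * ∑ y', π y' * f x' y' := by
    simp only [statMean, Finset.mul_sum, mul_assoc]
  have hb : ∀ x', |∑ y', π y' * f x' y'| ≤ B := by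
    intro x'
    refine (Finset.abs_sum_le_sum_abs _ _).trans ?_
    calc ∑ y', |π y' * f x' y'| ≤ ∑ y', π y' * B := by
          refine Finset.sum_le_sum fun y' _ => ?_
          rw [abs_mul, abs_of_nonneg (hπ.nonneg _)]
          exact mul_le_mul_of_nonneg_left (hf _ _) (hπ.nonneg _)
      _ = B := by rw [← Finset.sum_mul, hπ.sum_eq_one, one_mul]
  have h1 := abs_le.1 (abs_sum_mul_sub_sum_mul_le hb hB (hmix x))
  have h2 : ∑ x', stepPow p T x x' * ∑ y', stepPow p T y y' * f x' y' ≤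
      ∑ x', stepPow p T x x' * (∑ y', π y' * f x' y' + B * θ) := by
    refine Finset.sum_le_sum fun x' _ => mul_le_mul_of_nonneg_left ?_ ((hp.stepPow T x).nonneg _)
    have := abs_le.1 (abs_sum_mul_sub_sum_mul_le (hf x') hB (hmix y))
    linarith [this.2]
  simp only [mul_add, Finset.sum_add_distrib, ← Finset.sum_mul,
    (hp.stepPow T x).sum_eq_one, one_mul] at h2
  rw [e1, e2]
  linarith [h1.2]

/-- The probability that two independent walkers do not meet up to step `l`. -/
def noMeet (p : V → V → ℝ) : ℕ → V → V → ℝ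
  | 0, x, y => if x = y then 0 else 1
  | l + 1, x, y => if x = y then 0 else pairMean p (noMeet p l) x y

theorem noMeet_self (p : V → V → ℝ) (l : ℕ) (x : V) : noMeet p l x x = 0 := by
  cases l <;> simp [noMeet]

theorem noMeet_nonneg (hp : IsStochastic p) (l : ℕ) (x y : V) : 0 ≤ noMeet p l x y := by
  induction l generalizing x y with
  | zero => simp only [noMeet]; split_ifs <;> norm_num
  | succ l ih =>
    simp only [noMeet]
    split_ifs
    · exact le_rfl
    · rw [← pairMean_const hp 0 x y]; exact pairMean_mono hp ih x y

theorem noMeet_le_one (hp : IsStochastic p) (l : ℕ) (x y : V) : noMeet p l x y ≤ 1 := by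
  induction l generalizing x y with
  | zero => simp only [noMeet]; split_ifs <;> norm_num
  | succ l ih =>
    simp only [noMeet]
    split_ifs
    · exact zero_le_one
    · rw [← pairMean_const hp 1 x y]; exact pairMean_mono hp ih x y

theorem noMeet_succ_le (hp : IsStochastic p) (l : ℕ) (x y : V) :
    noMeet p (l + 1) x y ≤ noMeet p l x y := by
  induction l generalizing x y with
  | zero =>
    by_cases h : x = y
    · subst h; simp [noMeet_self]
    · simpa [noMeet, h] using noMeet_le_one hp 1 x y
  | succ l ih =>
    by_cases h : x = y
    · subst h; simp [noMeet_self]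
    · rw [noMeet, if_neg h, noMeet, if_neg h]; exact pairMean_mono hp ih x y

theorem noMeet_antitone (hp : IsStochastic p) (x y : V) : Antitone fun l => noMeet p l x y :=
  antitone_nat_of_succ_le fun l => noMeet_succ_le hp l x y

theorem noMeet_comm (p : V → V → ℝ) (l : ℕ) (x y : V) : noMeet p l x y = noMeet p l y x := by
  induction l generalizing x y with
  | zero => simp [noMeet, eq_comm]
  | succ l ih =>
    simp only [noMeet, eq_comm (a := x)]
    split_ifs
    · rfl
    · rw [pairMean_swap]; congr 1; funext a b; exact ih b a

/-- The mean number of steps before two independent walkers meet. -/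
def meanMeet (p : V → V → ℝ) (x y : V) : ℝ := ∑' l, noMeet p l x y

theorem meanMeet_self (p : V → V → ℝ) (x : V) : meanMeet p x x = 0 := by
  simp [meanMeet, noMeet_self]

theorem meanMeet_nonneg (hp : IsStochastic p) (x y : V) : 0 ≤ meanMeet p x y :=
  tsum_nonneg fun l => noMeet_nonneg hp l x y

theorem meanMeet_comm (p : V → V → ℝ) (x y : V) : meanMeet p x y = meanMeet p y x :=
  tsum_congr fun l => noMeet_comm p l x y

/-- First-step analysis. The constant `-1` is the drift from which the Kingman rates arise. -/
theorem pairMean_meanMeet (hs : ∀ x y, Summable fun l => noMeet p l x y) {x y : V} (hxy : x ≠ y) :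
    pairMean p (meanMeet p) x y = meanMeet p x y - 1 := by
  have h1 : meanMeet p x y = noMeet p 0 x y + ∑' l, noMeet p (l + 1) x y :=
    (hs x y).tsum_eq_zero_add
  have h2 : ∑' l, noMeet p (l + 1) x y = pairMean p (meanMeet p) x y := by
    simp only [noMeet, if_neg hxy, pairMean, meanMeet]
    rw [Summable.tsum_finsetSum]
    · refine Finset.sum_congr rfl fun x' _ => ?_
      rw [Summable.tsum_finsetSum]
      · exact Finset.sum_congr rfl fun y' _ => tsum_mul_left
      · exact fun y' _ => (hs x' y').mul_left _
    · exact fun x' _ => summable_sum fun y' _ => (hs x' y').mul_left _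
  rw [h1, h2]
  simp [noMeet, hxy]

/-- `meanMeet` vanishes on the diagonal, so letting the walkers run on freely after a meeting can
only increase the count. -/
theorem meanMeet_le_add_pairMean (hs : ∀ x y, Summable fun l => noMeet p l x y)
    (hp : IsStochastic p) (T : ℕ) (x y : V) :
    meanMeet p x y ≤ T + pairMean (stepPow p T) (meanMeet p) x y := by
  rw [← pairMean_iterate_eq]
  induction T generalizing x y with
  | zero => simp
  | succ T ih =>
    have h1 : meanMeet p x y ≤ 1 + pairMean p (meanMeet p) x y := by
      by_cases h : x = y
      · subst h
        rw [meanMeet_self]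
        have := pairMean_mono hp (meanMeet_nonneg hp) x x
        rw [pairMean_const hp] at this
        linarith
      · rw [pairMean_meanMeet hs h]; linarith
    have h2 := pairMean_mono hp ih x y
    rw [pairMean_add, pairMean_const hp] at h2
    rw [Function.iterate_succ_apply']
    push_cast
    linarith

/-- Comparison of the walk stopped at the meeting with the free walk. -/
theorem pairMean_iterate_meanMeet_le (hs : ∀ x y, Summable fun l => noMeet p l x y)
    (hp : IsStochastic p) {B : ℝ} (hB : ∀ x y, meanMeet p x y ≤ B)
    (D : ℕ) (x y : V) :
    pairMean (stepPow p D) (meanMeet p) x y + ∑ l ∈ Finset.range D, noMeet p l x y ≤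
      meanMeet p x y + B * (1 - noMeet p D x y) := by
  rw [← pairMean_iterate_eq]
  have hB0 : 0 ≤ B := (meanMeet_nonneg hp x y).trans (hB x y)
  induction D generalizing x y with
  | zero =>
    have := mul_nonneg hB0 (sub_nonneg.2 (noMeet_le_one hp 0 x y))
    simpa using this
  | succ D ih =>
    by_cases h : x = y
    · subst h
      simp only [noMeet_self, meanMeet_self, Finset.sum_const_zero, sub_zero, mul_one, zero_add,
        add_zero]
      rw [pairMean_iterate_eq]
      refine (pairMean_mono (hp.stepPow _) hB x x).trans ?_
      rw [pairMean_const (hp.stepPow _)]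
    · have h2 := pairMean_mono hp ih x y
      have e1 : pairMean p (fun x y => B * (1 - noMeet p D x y)) x y =
          B * (1 - noMeet p (D + 1) x y) := by
        rw [pairMean_const_mul, pairMean_sub, pairMean_const hp, noMeet, if_neg h]
      have e2 : pairMean p (fun x y => ∑ l ∈ Finset.range D, noMeet p l x y) x y =
          ∑ l ∈ Finset.range D, noMeet p (l + 1) x y := by
        rw [pairMean_sum]
        exact Finset.sum_congr rfl fun l _ => by rw [noMeet, if_neg h]
      rw [pairMean_add, pairMean_add, e1, e2, pairMean_meanMeet hs h] at h2
      rw [Finset.sum_range_succ', Function.iterate_succ_apply']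
      have e3 : noMeet p 0 x y = 1 := by simp [noMeet, h]
      rw [e3]
      linarith

/-- The mean number of steps before two stationary walkers meet. -/
def statMeet (p : V → V → ℝ) (π : V → ℝ) : ℝ := statMean π (meanMeet p)

/-- The probability that two stationary walkers meet up to step `D`. -/
def statHit (p : V → V → ℝ) (π : V → ℝ) (D : ℕ) : ℝ := 1 - statMean π (noMeet p D)

/-- Run two walkers from the worst pair for `T` steps: the maximum `B` satisfies `B ≤ T + statMeet +
2 θ B`. The stated form uses `1 / (1 - 2θ) ≤ 1 + 4θ` and `≤ 2`, valid for `θ ≤ 1/4`. -/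
theorem meanMeet_le_of_mixesBy (hs : ∀ x y, Summable fun l => noMeet p l x y)
    (hp : IsStochastic p) (hπ : IsProbVec π) {T : ℕ} {θ : ℝ}
    (hmix : MixesBy p π T θ) (hθ : θ ≤ 1 / 4) (hm : 0 < statMeet p π) (x y : V) :
    meanMeet p x y ≤ statMeet p π * (1 + (2 * T / statMeet p π + 4 * θ)) := by
  have : Nonempty V := ⟨x⟩
  obtain ⟨⟨x₀, y₀⟩, hmax⟩ := Finite.exists_max fun z : V × V => meanMeet p z.1 z.2
  set B := meanMeet p x₀ y₀ with hBdef
  have hB : ∀ x y, meanMeet p x y ≤ B := fun x y => hmax (x, y)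
  have hB0 : 0 ≤ B := meanMeet_nonneg hp _ _
  have hθ0 : 0 ≤ θ := (Finset.sum_nonneg fun _ _ => abs_nonneg _).trans (hmix x)
  have h1 := meanMeet_le_add_pairMean hs hp T x₀ y₀
  have h2 := pairMean_stepPow_le_statMean hp hπ hmix (f := meanMeet p) (B := B)
    (fun x y => by rw [abs_of_nonneg (meanMeet_nonneg hp x y)]; exact hB x y) hB0 x₀ y₀
  change _ ≤ statMeet p π + _ at h2
  have h3 : B * (1 - 2 * θ) ≤ T + statMeet p π := by rw [← hBdef] at h1; linarith
  refine (hB x y).trans ?_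
  have e : statMeet p π * (1 + (2 * T / statMeet p π + 4 * θ)) =
      statMeet p π * (1 + 4 * θ) + 2 * T := by field_simp; ring
  rw [e]
  have hT : (0 : ℝ) ≤ T := Nat.cast_nonneg _
  have h4 : (T + statMeet p π) ≤ (statMeet p π * (1 + 4 * θ) + 2 * T) * (1 - 2 * θ) := by
    nlinarith [mul_nonneg hθ0 hm.le, mul_nonneg (mul_nonneg hθ0 hm.le) (sub_nonneg.2 hθ),
      mul_nonneg hT (sub_nonneg.2 hθ)]
  exact le_of_mul_le_mul_right (h3.trans h4) (by linarith)

/-- A walker started anywhere is unlikely to meet a stationary one soon. -/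
theorem sndMean_hit_le (hp : IsStochastic p) (hπ : IsStationaryVec p π) {b σ : ℝ}
    (hb : ∀ x, π x ≤ b) (hσ : ∀ x, 1 - p x x ≤ σ) (D : ℕ) (x : V) :
    sndMean π (fun x y => 1 - noMeet p D x y) x ≤ b * (1 + 2 * D * σ) := by
  -- `m` is the chance that two walkers at different sites meet in one step. With a stationary
  -- second walker it is at most `2 b σ`: either the first stays and the second jumps onto it, or
  -- the first moves, to a point that carries mass at most `b`.
  set m : V → V → ℝ := fun x y => if x = y then 0 else
    pairMean p (fun a b => if a = b then 1 else 0) x y with hm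
  have hm0 : ∀ x y, 0 ≤ m x y := by
    intro x y
    simp only [hm]
    by_cases h : x = y
    · rw [if_pos h]
    · rw [if_neg h]
      exact (pairMean_const hp 0 x y).ge.trans
        (pairMean_mono hp (fun a b => by split_ifs <;> norm_num) x y)
  have hb0 : 0 ≤ b := (hπ.prob.nonneg x).trans (hb x)
  have hσ0 : ∀ x, 0 ≤ 1 - p x x := by
    intro x
    have := Finset.single_le_sum (fun i _ => (hp x).nonneg i) (Finset.mem_univ x)
    rw [(hp x).sum_eq_one] at this
    linarith
  have hmσ : ∀ x, sndMean π m x ≤ 2 * b * σ := by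
    intro x
    have e1 : sndMean π m x = ∑ z, p x z * ∑ y ∈ Finset.univ.erase x, π y * p y z := by
      have e2 : ∀ y, pairMean p (fun a b => if a = b then (1 : ℝ) else 0) x y =
          ∑ z, p x z * p y z := by
        intro y; simp [pairMean]
      simp only [sndMean, hm, e2]
      rw [← Finset.add_sum_erase _ _ (Finset.mem_univ x)]
      simp only [if_true, mul_zero, zero_add]
      rw [Finset.sum_congr rfl fun y hy => by rw [if_neg (Finset.ne_of_mem_erase hy).symm]]
      simp only [Finset.mul_sum]
      rw [Finset.sum_comm]
      exact Finset.sum_congr rfl fun _ _ => Finset.sum_congr rfl fun _ _ => by ring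
    have e3 : ∀ z, ∑ y ∈ Finset.univ.erase x, π y * p y z = π z - π x * p x z := by
      intro z
      have := Finset.add_sum_erase Finset.univ (fun y => π y * p y z) (Finset.mem_univ x)
      rw [hπ.inv z] at this
      linarith
    rw [e1, ← Finset.add_sum_erase _ _ (Finset.mem_univ x)]
    have h1 : p x x * ∑ y ∈ Finset.univ.erase x, π y * p y x ≤ b * σ := by
      rw [e3]
      have hx1 : p x x ≤ 1 := by linarith [hσ0 x]
      have : π x - π x * p x x = π x * (1 - p x x) := by ring
      rw [this]
      calc p x x * (π x * (1 - p x x)) ≤ 1 * (π x * (1 - p x x)) :=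
            mul_le_mul_of_nonneg_right hx1 (mul_nonneg (hπ.prob.nonneg x) (hσ0 x))
        _ = π x * (1 - p x x) := one_mul _
        _ ≤ b * σ := mul_le_mul (hb x) (hσ x) (hσ0 x) hb0
    have h2 : ∑ z ∈ Finset.univ.erase x, p x z * ∑ y ∈ Finset.univ.erase x, π y * p y z ≤
        b * σ := by
      have h3 : ∀ z ∈ Finset.univ.erase x,
          p x z * ∑ y ∈ Finset.univ.erase x, π y * p y z ≤ p x z * b := by
        intro z _
        rw [e3]
        refine mul_le_mul_of_nonneg_left ?_ ((hp x).nonneg z)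
        have := mul_nonneg (hπ.prob.nonneg x) ((hp x).nonneg z)
        linarith [hb z]
      refine (Finset.sum_le_sum h3).trans ?_
      rw [← Finset.sum_mul, mul_comm]
      refine mul_le_mul_of_nonneg_left ?_ hb0
      have := Finset.add_sum_erase Finset.univ (p x) (Finset.mem_univ x)
      rw [(hp x).sum_eq_one] at this
      linarith [hσ x]
    linarith
  -- Union bound over the step of the meeting, with the free walk in place of the walk before its
  -- first meeting.
  have hdom : ∀ (D : ℕ) (x y : V), 1 - noMeet p D x y ≤ (if x = y then 1 else 0) +
      ∑ l ∈ Finset.range D, (pairMean p)^[l] m x y := by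
    intro D
    induction D with
    | zero => intro x y; simp only [noMeet]; split_ifs <;> simp
    | succ D ih =>
      intro x y
      have hit0 : ∀ l x y, 0 ≤ (pairMean p)^[l] m x y := by
        intro l
        induction l with
        | zero => exact hm0
        | succ l ihl =>
          intro x y
          rw [Function.iterate_succ_apply', ← pairMean_const hp 0 x y]
          exact pairMean_mono hp ihl x y
      by_cases h : x = y
      · subst h
        rw [noMeet_self, if_pos rfl]
        linarith [Finset.sum_nonneg fun l (_ : l ∈ Finset.range (D + 1)) => hit0 l x x]
      · have h2 := pairMean_mono hp ih x y
        rw [pairMean_sub, pairMean_const hp, pairMean_add, pairMean_sum] at h2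
        rw [Finset.sum_range_succ', noMeet, if_neg h, if_neg h]
        have e4 : (pairMean p)^[0] m x y =
            pairMean p (fun a b => if a = b then (1 : ℝ) else 0) x y := by simp [hm, h]
        rw [e4]
        simp only [Function.iterate_succ_apply']
        linarith
  have hiter : ∀ (l : ℕ) (x : V), sndMean π ((pairMean p)^[l] m) x ≤ 2 * b * σ := by
    intro l
    induction l with
    | zero => exact hmσ
    | succ l ihl =>
      intro x
      rw [Function.iterate_succ_apply', sndMean_pairMean hπ]
      calc ∑ x', p x x' * sndMean π ((pairMean p)^[l] m) x' ≤ ∑ x', p x x' * (2 * b * σ) :=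
            Finset.sum_le_sum fun x' _ => mul_le_mul_of_nonneg_left (ihl x') ((hp x).nonneg x')
        _ = 2 * b * σ := by rw [← Finset.sum_mul, (hp x).sum_eq_one, one_mul]
  refine (sndMean_mono hπ.prob (hdom D) x).trans ?_
  rw [sndMean_add]
  have e5 : sndMean π (fun x y => if x = y then (1 : ℝ) else 0) x = π x := by simp [sndMean]
  have e6 : sndMean π (fun x y => ∑ l ∈ Finset.range D, (pairMean p)^[l] m x y) x =
      ∑ l ∈ Finset.range D, sndMean π ((pairMean p)^[l] m) x := by
    simp only [sndMean, Finset.mul_sum]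
    exact Finset.sum_comm
  rw [e5, e6]
  have h7 : ∑ l ∈ Finset.range D, sndMean π ((pairMean p)^[l] m) x ≤ D * (2 * b * σ) := by
    have := Finset.sum_le_sum fun l (_ : l ∈ Finset.range D) => hiter l x
    simpa using this
  linarith [hb x]

theorem statHit_le (hp : IsStochastic p) (hπ : IsStationaryVec p π) {b σ : ℝ}
    (hb : ∀ x, π x ≤ b) (hσ : ∀ x, 1 - p x x ≤ σ) (D : ℕ) :
    statHit p π D ≤ b * (1 + 2 * D * σ) := by
  have e : statHit p π D = ∑ x, π x * sndMean π (fun x y => 1 - noMeet p D x y) x := by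
    rw [← statMean_eq_sum_sndMean, statMean_sub, statMean_const hπ.prob, statHit]
  rw [e]
  calc ∑ x, π x * sndMean π (fun x y => 1 - noMeet p D x y) x
      ≤ ∑ x, π x * (b * (1 + 2 * D * σ)) := Finset.sum_le_sum fun x _ =>
        mul_le_mul_of_nonneg_left (sndMean_hit_le hp hπ hb hσ D x) (hπ.prob.nonneg x)
    _ = b * (1 + 2 * D * σ) := by rw [← Finset.sum_mul, hπ.prob.sum_eq_one, one_mul]

/-- Already at step 0 two stationary walkers coincide with probability `∑ π x ^ 2`, which is at
least `1 / |V|` by Cauchy–Schwarz. -/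
theorem one_le_card_mul_statHit (hp : IsStochastic p) (hπ : IsProbVec π) (D : ℕ) :
    1 ≤ Fintype.card V * statHit p π D := by
  have h1 : ∑ x, π x ^ 2 ≤ statHit p π D := by
    have h2 : statMean π (fun x y => if x = y then 1 else 0) ≤
        statMean π (fun x y => 1 - noMeet p D x y) := by
      refine statMean_mono hπ fun x y => ?_
      split_ifs with h
      · subst h; simp [noMeet_self]
      · linarith [noMeet_le_one hp D x y]
    rw [statMean_sub, statMean_const hπ] at h2
    refine le_trans (le_of_eq ?_) h2
    simp [statMean, sq]
  have h3 := sq_sum_le_card_mul_sum_sq (s := Finset.univ) (f := π)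
  rw [hπ.sum_eq_one, one_pow, Finset.card_univ] at h3
  exact h3.trans (mul_le_mul_of_nonneg_left h1 (Nat.cast_nonneg _))

/-- Markov's inequality for the meeting time. -/
theorem mul_le_statMeet (hp : IsStochastic p) (hπ : IsProbVec π)
    (hs : ∀ x y, Summable fun l => noMeet p l x y) (D : ℕ) :
    D * (1 - statHit p π D) ≤ statMeet p π := by
  have h : ∀ x y, (D : ℝ) * noMeet p D x y ≤ meanMeet p x y := by
    intro x y
    refine le_trans ?_ ((hs x y).sum_le_tsum (Finset.range D) fun l _ => noMeet_nonneg hp l x y)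
    have := Finset.sum_le_sum fun l (hl : l ∈ Finset.range D) =>
      noMeet_antitone hp x y (Finset.mem_range.1 hl).le
    simpa using this
  have h2 := statMean_mono hπ h
  rw [statMean_const_mul] at h2
  simpa [statHit, statMeet] using h2

/-- A lower bound for the chance that two stationary walkers meet. -/
theorem mul_le_mul_statHit (hp : IsStochastic p) (hπ : IsStationaryVec p π)
    (hs : ∀ x y, Summable fun l => noMeet p l x y) {B : ℝ} (hB : ∀ x y, meanMeet p x y ≤ B)
    (D : ℕ) : D * (1 - statHit p π D) ≤ B * statHit p π D := by
  -- Averaged over `π`, the free walk preserves the mean of `meanMeet`, so this mean cancels from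
  -- both sides and leaves the first `D` non-meeting probabilities against `B` times the meeting
  -- probability.
  have h := statMean_mono hπ.prob (pairMean_iterate_meanMeet_le hs hp hB D)
  rw [statMean_add, statMean_add, statMean_pairMean (hπ.stepPow D), statMean_const_mul,
    statMean_sub, statMean_const hπ.prob, statMean_sum] at h
  have h2 : D * statMean π (noMeet p D) ≤ ∑ l ∈ Finset.range D, statMean π (noMeet p l) := by
    have := Finset.sum_le_sum fun l (hl : l ∈ Finset.range D) =>
      statMean_mono hπ.prob fun x y => noMeet_antitone hp x y (Finset.mem_range.1 hl).le
    simpa using this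
  have e : 1 - statHit p π D = statMean π (noMeet p D) := by simp [statHit]
  rw [e]
  unfold statHit
  linarith

/-- The deviation of the normalised mean meeting time from `1`. -/
def meetDev (p : V → V → ℝ) (π : V → ℝ) (x y : V) : ℝ := 1 - meanMeet p x y / statMeet p π

theorem meetDev_self (p : V → V → ℝ) (π : V → ℝ) (x : V) : meetDev p π x x = 1 := by
  simp [meetDev, meanMeet_self]

theorem meetDev_comm (p : V → V → ℝ) (π : V → ℝ) (x y : V) :
    meetDev p π x y = meetDev p π y x := by
  simp [meetDev, meanMeet_comm p x y]

theorem pairMean_meetDev (hp : IsStochastic p) (hs : ∀ x y, Summable fun l => noMeet p l x y)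
    {x y : V} (hxy : x ≠ y) :
    pairMean p (meetDev p π) x y = meetDev p π x y + (statMeet p π)⁻¹ := by
  have : meetDev p π = fun x y => 1 - (statMeet p π)⁻¹ * meanMeet p x y := by
    funext a b; simp [meetDev, div_eq_inv_mul]
  rw [this, pairMean_sub, pairMean_const hp, pairMean_const_mul, pairMean_meanMeet hs hxy]
  ring

/-- Since `meetDev ≥ -η`, taking absolute values adds at most `2 η`. An upper bound on meeting times
thus turns a bound on the mean of `meetDev` into an `L¹` bound. -/
theorem abs_meetDev_le (hm : 0 < statMeet p π) {η : ℝ} (hη : 0 ≤ η)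
    (hB : ∀ x y, meanMeet p x y ≤ statMeet p π * (1 + η)) (x y : V) :
    |meetDev p π x y| ≤ meetDev p π x y + 2 * η := by
  have h1 : meanMeet p x y / statMeet p π ≤ 1 + η := by
    rw [div_le_iff₀ hm]; linarith [hB x y]
  unfold meetDev
  rw [abs_le]
  constructor <;> linarith

theorem statMean_abs_meetDev_le (hπ : IsProbVec π) (hm : 0 < statMeet p π) {η : ℝ} (hη : 0 ≤ η)
    (hB : ∀ x y, meanMeet p x y ≤ statMeet p π * (1 + η)) :
    statMean π (fun x y => |meetDev p π x y|) ≤ 2 * η := by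
  refine (statMean_mono hπ (abs_meetDev_le hm hη hB)).trans (le_of_eq ?_)
  have e : statMean π (meetDev p π) = 0 := by
    have : meetDev p π = fun x y => 1 - (statMeet p π)⁻¹ * meanMeet p x y := by
      funext a b; simp [meetDev, div_eq_inv_mul]
    rw [this, statMean_sub, statMean_const hπ, statMean_const_mul]
    change 1 - (statMeet p π)⁻¹ * statMeet p π = 0
    rw [inv_mul_cancel₀ hm.ne', sub_self]
  rw [statMean_add, statMean_const hπ, e, zero_add]

/-- What is needed is a lower bound for the mean meeting time of a walker from `x` with a stationary
one. In `T` steps the first walker mixes, and it meets the other one with probability at most `ρ`;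
so this mean is at least the stationary one up to a relative loss `(1 + η) (θ + ρ)`. -/
theorem sndMean_abs_meetDev_le (hp : IsStochastic p) (hπ : IsStationaryVec p π)
    (hs : ∀ x y, Summable fun l => noMeet p l x y) (hm : 0 < statMeet p π) {η θ ρ : ℝ}
    (hη : 0 ≤ η) (hη1 : η ≤ 1) (hB : ∀ x y, meanMeet p x y ≤ statMeet p π * (1 + η)) {T : ℕ}
    (hmix : MixesBy p π T θ)
    (hρ : ∀ x, sndMean π (fun x y => 1 - noMeet p T x y) x ≤ ρ) (x : V) :
    sndMean π (fun x y => |meetDev p π x y|) x ≤ 2 * η + 2 * (θ + ρ) := by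
  set M := statMeet p π with hM
  have hθ0 : 0 ≤ θ := (Finset.sum_nonneg fun _ _ => abs_nonneg _).trans (hmix x)
  have hρ0 : 0 ≤ ρ := by
    refine le_trans ?_ (hρ x)
    rw [← sndMean_const hπ.prob 0 x]
    exact sndMean_mono hπ.prob (fun x y => sub_nonneg.2 (noMeet_le_one hp T x y)) x
  have hB0 : 0 ≤ M * (1 + η) := mul_nonneg hm.le (by linarith)
  have h1 : sndMean π (pairMean (stepPow p T) (meanMeet p)) x ≤
      sndMean π (meanMeet p) x + M * (1 + η) * ρ := by
    have h2 : ∀ x y, pairMean (stepPow p T) (meanMeet p) x y ≤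
        meanMeet p x y + M * (1 + η) * (1 - noMeet p T x y) := by
      intro x y
      have := pairMean_iterate_meanMeet_le hs hp hB T x y
      have h0 := Finset.sum_nonneg fun l (_ : l ∈ Finset.range T) => noMeet_nonneg hp l x y
      linarith
    have h3 := sndMean_mono hπ.prob h2 x
    rw [sndMean_add, sndMean_const_mul] at h3
    linarith [mul_le_mul_of_nonneg_left (hρ x) hB0]
  rw [sndMean_pairMean (hπ.stepPow T)] at h1
  have hsb : ∀ x', |sndMean π (meanMeet p) x'| ≤ M * (1 + η) := by
    intro x'
    have h0 : 0 ≤ sndMean π (meanMeet p) x' := by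
      rw [← sndMean_const hπ.prob 0 x']
      exact sndMean_mono hπ.prob (meanMeet_nonneg hp) x'
    rw [abs_of_nonneg h0, ← sndMean_const hπ.prob (M * (1 + η)) x']
    exact sndMean_mono hπ.prob hB x'
  have h4 := abs_le.1 (abs_sum_mul_sub_sum_mul_le hsb hB0 (hmix x))
  rw [← statMean_eq_sum_sndMean] at h4
  change _ ≤ _ - M ∧ _ at h4
  have h5 : M - M * (1 + η) * (θ + ρ) ≤ sndMean π (meanMeet p) x := by
    nlinarith [h4.1, h1]
  refine (sndMean_mono hπ.prob (abs_meetDev_le hm hη hB) x).trans ?_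
  have e : sndMean π (meetDev p π) x = 1 - M⁻¹ * sndMean π (meanMeet p) x := by
    have : meetDev p π = fun x y => 1 - M⁻¹ * meanMeet p x y := by
      funext a b; simp [meetDev, div_eq_inv_mul, hM]
    rw [this, sndMean_sub, sndMean_const hπ.prob, sndMean_const_mul]
  rw [sndMean_add, sndMean_const hπ.prob, e]
  have h6 : 1 - (1 + η) * (θ + ρ) ≤ M⁻¹ * sndMean π (meanMeet p) x := by
    have := mul_le_mul_of_nonneg_left h5 (inv_nonneg.2 hm.le)
    refine le_trans (le_of_eq ?_) this
    field_simp
  nlinarith [mul_nonneg (sub_nonneg.2 hη1) (add_nonneg hθ0 hρ0)]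

end Pair
end

noncomputable section

/-! ### Sums of independent exponential variables -/

section Kingman

/-- The rate of the `n`-th exponential variable. -/
def kingmanRate (n : ℕ) : ℝ := ((n + 2).choose 2 : ℝ)

theorem kingmanRate_eq (n : ℕ) : kingmanRate n = (n + 2) * (n + 1) / 2 := by
  rw [kingmanRate, Nat.cast_choose_two]
  push_cast; ring

theorem kingmanRate_pos (n : ℕ) : 0 < kingmanRate n := by
  rw [kingmanRate_eq]; positivity

theorem kingmanRate_mono : Monotone kingmanRate := by
  intro a b h
  have : (a : ℝ) ≤ b := by exact_mod_cast h
  rw [kingmanRate_eq, kingmanRate_eq]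
  have : (0 : ℝ) ≤ a := Nat.cast_nonneg a
  nlinarith

instance isProbabilityMeasure_expMeasure_choose (i : ℕ) :
    IsProbabilityMeasure (ProbabilityTheory.expMeasure ((i + 2).choose 2 : ℝ)) :=
  ProbabilityTheory.isProbabilityMeasure_expMeasure (kingmanRate_pos i)

instance : IsProbabilityMeasure meanFieldSeqLaw := by
  unfold meanFieldSeqLaw; infer_instance

/-- `P(z_0 + ⋯ + z_{n-1} > u)`. -/
def kingmanTail (n : ℕ) (u : ℝ) : ℝ :=
  meanFieldSeqLaw.real {z | u < ∑ i ∈ Finset.range n, z i}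

theorem kingmanTail_nonneg (n : ℕ) (u : ℝ) : 0 ≤ kingmanTail n u := measureReal_nonneg

theorem kingmanTail_le_one (n : ℕ) (u : ℝ) : kingmanTail n u ≤ 1 := measureReal_le_one

theorem kingmanTail_antitone (n : ℕ) : Antitone (kingmanTail n) := fun _ _ h =>
  measureReal_mono fun _ hz => lt_of_le_of_lt h hz

theorem map_eval_meanFieldSeqLaw (i : ℕ) :
    meanFieldSeqLaw.map (fun z => z i) = ProbabilityTheory.expMeasure (kingmanRate i) :=
  Measure.infinitePi_map_eval _ i

theorem expMeasure_Iio_zero (r : ℝ) : ProbabilityTheory.expMeasure r (Set.Iio 0) = 0 := by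
  rw [ProbabilityTheory.expMeasure, ProbabilityTheory.gammaMeasure,
    withDensity_apply _ measurableSet_Iio]
  exact ProbabilityTheory.lintegral_gammaPDF_of_nonpos le_rfl

theorem ae_meanFieldSeqLaw_nonneg : ∀ᵐ z ∂meanFieldSeqLaw, ∀ i, 0 ≤ z i := by
  rw [ae_all_iff]
  intro i
  have h := expMeasure_Iio_zero (kingmanRate i)
  rw [← map_eval_meanFieldSeqLaw i, Measure.map_apply (measurable_pi_apply i) measurableSet_Iio] at h
  rw [ae_iff]
  convert h using 2
  ext z; simp

theorem kingmanTail_le_succ (n : ℕ) (u : ℝ) : kingmanTail n u ≤ kingmanTail (n + 1) u := by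
  refine ENNReal.toReal_mono (measure_ne_top _ _) (measure_mono_ae ?_)
  filter_upwards [ae_meanFieldSeqLaw_nonneg] with z hz h
  change u < _ at h ⊢
  rw [Finset.sum_range_succ]
  linarith [hz n]

theorem kingmanTail_mono (u : ℝ) : Monotone fun n => kingmanTail n u :=
  monotone_nat_of_le_succ fun n => kingmanTail_le_succ n u

theorem kingmanTail_of_neg (n : ℕ) {u : ℝ} (hu : u < 0) : kingmanTail n u = 1 := by
  have h0 : kingmanTail 0 u = 1 := by simp [kingmanTail, hu]
  exact le_antisymm (kingmanTail_le_one n u) (h0 ▸ kingmanTail_mono u (Nat.zero_le n))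

theorem kingmanTail_zero {u : ℝ} (hu : 0 ≤ u) : kingmanTail 0 u = 0 := by
  simp [kingmanTail, not_lt.2 hu]

theorem measurable_kingmanTail (n : ℕ) : Measurable (kingmanTail n) :=
  (kingmanTail_antitone n).measurable

theorem kingmanTail_succ_eq_integral (n : ℕ) (u : ℝ) :
    kingmanTail (n + 1) u =
      ∫ z, ProbabilityTheory.exponentialPDFReal (kingmanRate n) z * kingmanTail n (u - z) := by
  have hm : ∀ i : ℕ, Measurable fun z : ℕ → ℝ => z i := fun i => measurable_pi_apply i
  have hind : ProbabilityTheory.iIndepFun (fun (i : ℕ) (z : ℕ → ℝ) => z i) meanFieldSeqLaw :=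
    ProbabilityTheory.iIndepFun_infinitePi (X := fun _ x => x) fun _ => measurable_id
  have h1 : ProbabilityTheory.IndepFun (fun z : ℕ → ℝ => ∑ i ∈ Finset.range n, z i)
      (fun z => z n) meanFieldSeqLaw := by
    have := hind.indepFun_finsetSum_of_notMem hm (s := Finset.range n) (i := n) (by simp)
    convert this using 1
    funext z; simp
  have hS : Measurable fun z : ℕ → ℝ => ∑ i ∈ Finset.range n, z i :=
    Finset.measurable_sum _ fun i _ => hm i
  have h2 := (ProbabilityTheory.indepFun_iff_map_prod_eq_prod_map_map hS.aemeasurable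
    (hm n).aemeasurable).1 h1
  rw [map_eval_meanFieldSeqLaw] at h2
  have hset : MeasurableSet {w : ℝ × ℝ | u < w.1 + w.2} :=
    measurableSet_lt measurable_const (measurable_fst.add measurable_snd)
  have h3 : meanFieldSeqLaw {z | u < ∑ i ∈ Finset.range (n + 1), z i} =
      ((meanFieldSeqLaw.map fun z => ∑ i ∈ Finset.range n, z i).prod
        (ProbabilityTheory.expMeasure (kingmanRate n))) {w | u < w.1 + w.2} := by
    rw [← h2, Measure.map_apply (hS.prodMk (hm n)) hset]
    congr 1; ext z; simp [Finset.sum_range_succ]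
  have : IsProbabilityMeasure (ProbabilityTheory.expMeasure (kingmanRate n)) :=
    ProbabilityTheory.isProbabilityMeasure_expMeasure (kingmanRate_pos n)
  have : IsProbabilityMeasure (meanFieldSeqLaw.map fun z => ∑ i ∈ Finset.range n, z i) :=
    Measure.isProbabilityMeasure_map hS.aemeasurable
  rw [Measure.prod_apply_symm hset] at h3
  have h4 : ∀ y : ℝ, (meanFieldSeqLaw.map fun z => ∑ i ∈ Finset.range n, z i)
      ((fun x => (x, y)) ⁻¹' {w : ℝ × ℝ | u < w.1 + w.2}) =
      ENNReal.ofReal (kingmanTail n (u - y)) := by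
    intro y
    rw [Measure.map_apply hS (measurable_prodMk_right hset), kingmanTail, ofReal_measureReal]
    congr 1; ext z; simp [sub_lt_iff_lt_add]
  simp_rw [h4] at h3
  rw [ProbabilityTheory.expMeasure, ProbabilityTheory.gammaMeasure,
    lintegral_withDensity_eq_lintegral_mul _ (by unfold ProbabilityTheory.gammaPDF; fun_prop)
      (by have := measurable_kingmanTail n; fun_prop)] at h3
  rw [kingmanTail, measureReal_def, h3, integral_eq_lintegral_of_nonneg_ae]
  · congr 1
    refine lintegral_congr fun z => ?_
    rw [ENNReal.ofReal_mul (ProbabilityTheory.exponentialPDFReal_nonneg (kingmanRate_pos n) z)]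
    rfl
  · exact Eventually.of_forall fun z => mul_nonneg
      (ProbabilityTheory.exponentialPDFReal_nonneg (kingmanRate_pos n) z) (kingmanTail_nonneg _ _)
  · have := measurable_kingmanTail n
    exact Measurable.aestronglyMeasurable (by fun_prop)

/-- Condition on the last variable: if it exceeds `u`, the remaining sum has to exceed a negative
number, which has probability 1 by `kingmanTail_of_neg`; otherwise substitute `v = u - z`. -/
theorem kingmanTail_succ (n : ℕ) {u : ℝ} (hu : 0 ≤ u) :
    kingmanTail (n + 1) u = Real.exp (-(kingmanRate n * u)) +
      ∫ v in (0)..u, kingmanRate n * Real.exp (-(kingmanRate n * (u - v))) * kingmanTail n v := by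
  set r := kingmanRate n with hr
  have hr0 : 0 < r := kingmanRate_pos n
  have hexp : IntegrableOn (fun z => r * Real.exp (-(r * z))) (Set.Ioi 0) := by
    have := (exp_neg_integrableOn_Ioi 0 hr0).const_mul r
    simp only [neg_mul] at this
    exact this
  have hintegrable : IntegrableOn (fun z => r * Real.exp (-(r * z)) * kingmanTail n (u - z))
      (Set.Ioi 0) := by
    refine Integrable.mono hexp ?_ ?_
    · have := measurable_kingmanTail n
      exact Measurable.aestronglyMeasurable (by fun_prop)
    · refine Eventually.of_forall fun z => ?_
      rw [norm_mul]
      refine mul_le_of_le_one_right (norm_nonneg _) ?_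
      rw [Real.norm_eq_abs, abs_of_nonneg (kingmanTail_nonneg _ _)]
      exact kingmanTail_le_one _ _
  have hpdf : ∀ z, 0 ≤ z → ProbabilityTheory.exponentialPDFReal r z = r * Real.exp (-(r * z)) := by
    intro z hz
    simp [ProbabilityTheory.exponentialPDFReal, ProbabilityTheory.gammaPDFReal, hz]
  have hpdf' : ∀ z, z < 0 → ProbabilityTheory.exponentialPDFReal r z = 0 := by
    intro z hz
    simp [ProbabilityTheory.exponentialPDFReal, ProbabilityTheory.gammaPDFReal, hz]
  rw [kingmanTail_succ_eq_integral, ← hr,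
    ← setIntegral_eq_integral_of_forall_compl_eq_zero (s := Set.Ici 0)
      (fun z hz => by rw [hpdf' z (by simpa using hz), zero_mul]),
    integral_Ici_eq_integral_Ioi,
    setIntegral_congr_fun (g := fun z => r * Real.exp (-(r * z)) * kingmanTail n (u - z))
      measurableSet_Ioi (fun z hz => by simp only [hpdf z (le_of_lt hz)]),
    ← Set.Ioc_union_Ioi_eq_Ioi hu,
    setIntegral_union (Set.Ioc_disjoint_Ioi le_rfl) measurableSet_Ioi
      (hintegrable.mono_set Set.Ioc_subset_Ioi_self)
      (hintegrable.mono_set (Set.Ioi_subset_Ioi hu)), add_comm]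
  congr 1
  · rw [setIntegral_congr_fun (g := fun z => r * Real.exp (-r * z)) measurableSet_Ioi
      (fun z hz => by
        simp only
        rw [kingmanTail_of_neg n (sub_neg.2 hz), mul_one, neg_mul])]
    rw [integral_const_mul, integral_exp_mul_Ioi (by linarith) u]
    field_simp
  · rw [← intervalIntegral.integral_of_le hu]
    have := intervalIntegral.integral_comp_sub_left (a := 0) (b := u)
      (fun v => r * Real.exp (-(r * (u - v))) * kingmanTail n v) u
    simp only [sub_self, sub_zero, sub_sub_cancel] at this
    exact this

theorem intervalIntegrable_exp_mul_kingmanTail (n : ℕ) (r u a b : ℝ) :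
    IntervalIntegrable (fun v => r * Real.exp (-(r * (u - v))) * kingmanTail n v) volume a b := by
  have h1 : IntervalIntegrable (kingmanTail n) volume a b :=
    (kingmanTail_antitone n).intervalIntegrable
  exact h1.continuousOn_mul (by fun_prop)

theorem integral_exp_window (r u a b : ℝ) :
    ∫ v in a..b, r * Real.exp (-(r * (u - v))) =
      Real.exp (-(r * (u - b))) - Real.exp (-(r * (u - a))) := by
  refine intervalIntegral.integral_eq_sub_of_hasDerivAt
    (f := fun v => Real.exp (-(r * (u - v)))) ?_ (by
      exact Continuous.intervalIntegrable (by fun_prop) _ _)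
  intro x _
  have h : HasDerivAt (fun v => -(r * (u - v))) r x := by
    refine ((((hasDerivAt_id x).const_sub u).const_mul r).neg).congr_deriv ?_
    simp
  simpa [mul_comm] using h.exp

/-- The Duhamel formula `kingmanTail_succ` restarted at time `u`. -/
theorem kingmanTail_succ_add (n : ℕ) {u κ : ℝ} (hu : 0 ≤ u) (hκ : 0 ≤ κ) :
    kingmanTail (n + 1) (u + κ) = Real.exp (-(kingmanRate n * κ)) * kingmanTail (n + 1) u +
      ∫ v in u..(u + κ), kingmanRate n * Real.exp (-(kingmanRate n * (u + κ - v))) *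
        kingmanTail n v := by
  rw [kingmanTail_succ n hu, kingmanTail_succ n (by linarith : 0 ≤ u + κ),
    ← intervalIntegral.integral_add_adjacent_intervals (b := u)
      (intervalIntegrable_exp_mul_kingmanTail _ _ _ _ _)
      (intervalIntegrable_exp_mul_kingmanTail _ _ _ _ _),
    mul_add (Real.exp (-(kingmanRate n * κ))), ← Real.exp_add,
    ← intervalIntegral.integral_const_mul, ← add_assoc]
  congr 2
  · ring_nf
  refine intervalIntegral.integral_congr fun v _ => ?_
  rw [show -(kingmanRate n * (u + κ - v)) = -(kingmanRate n * κ) + -(kingmanRate n * (u - v)) by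
    ring, Real.exp_add]
  ring

/-- Over a window of length `κ` the tail keeps at least a fraction `exp (-rate * κ)`. For `n + 1`
summands the rate with index `n` would do; the larger index also covers `n = 0`. -/
theorem kingmanTail_sub_le (n : ℕ) {u κ : ℝ} (hu : 0 ≤ u) (hκ : 0 ≤ κ) :
    kingmanTail n u - kingmanTail n (u + κ) ≤ kingmanRate n * κ := by
  cases n with
  | zero =>
    rw [kingmanTail_zero hu, kingmanTail_zero (by linarith), sub_zero]
    exact mul_nonneg (kingmanRate_pos 0).le hκ
  | succ n =>
    rw [kingmanTail_succ_add n hu hκ]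
    have h0 : 0 ≤ ∫ v in u..(u + κ), kingmanRate n *
        Real.exp (-(kingmanRate n * (u + κ - v))) * kingmanTail n v :=
      intervalIntegral.integral_nonneg (by linarith) fun v _ =>
        mul_nonneg (mul_nonneg (kingmanRate_pos n).le (Real.exp_pos _).le) (kingmanTail_nonneg _ _)
    have h1 : 1 - kingmanRate n * κ ≤ Real.exp (-(kingmanRate n * κ)) := by
      have := Real.add_one_le_exp (-(kingmanRate n * κ)); linarith
    have h2 : kingmanRate n * κ ≤ kingmanRate (n + 1) * κ :=
      mul_le_mul_of_nonneg_right (kingmanRate_mono n.le_succ) hκ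
    have h3 := kingmanTail_nonneg (n + 1) u
    have h4 := kingmanTail_le_one (n + 1) u
    have h5 : 0 ≤ kingmanRate n * κ := mul_nonneg (kingmanRate_pos n).le hκ
    nlinarith

/-- The Kolmogorov equation for `kingmanTail`, with an error term of second order. -/
theorem abs_kingmanTail_succ_add_sub_le (n : ℕ) {u κ : ℝ} (hu : 0 ≤ u) (hκ : 0 ≤ κ) :
    |kingmanTail (n + 1) (u + κ) - kingmanTail (n + 1) u -
      κ * kingmanRate n * (kingmanTail n u - kingmanTail (n + 1) u)| ≤
      2 * (kingmanRate n * κ) ^ 2 := by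
  set r := kingmanRate n with hr
  set E := Real.exp (-(r * κ)) with hE
  have hr0 : 0 < r := kingmanRate_pos n
  have hx : 0 ≤ r * κ := mul_nonneg hr0.le hκ
  have hE1 : E ≤ 1 := Real.exp_le_one_iff.2 (by linarith)
  have hE2 : 1 - r * κ ≤ E := by have := Real.add_one_le_exp (-(r * κ)); linarith
  have hE3 : E ≤ 1 - r * κ + (r * κ) ^ 2 := by
    by_cases h1 : r * κ ≤ 1
    · have := Real.abs_exp_sub_one_sub_id_le (x := -(r * κ)) (by rw [abs_neg, abs_of_nonneg hx]; exact h1)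
      have := (abs_le.1 this).2
      nlinarith
    · nlinarith
  have hw := integral_exp_window r (u + κ) u (u + κ)
  have e1 : -(r * (u + κ - (u + κ))) = 0 := by ring
  have e2 : -(r * (u + κ - u)) = -(r * κ) := by ring
  rw [e1, e2, Real.exp_zero] at hw
  have hwi : IntervalIntegrable (fun v => r * Real.exp (-(r * (u + κ - v)))) volume u (u + κ) :=
    Continuous.intervalIntegrable (by fun_prop) _ _
  -- On the window `kingmanTail n` varies by at most `r * κ`, so the integral is `(1 - E) *
  -- kingmanTail n u` up to second order.
  have hup : ∫ v in u..(u + κ), r * Real.exp (-(r * (u + κ - v))) * kingmanTail n v ≤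
      (1 - E) * kingmanTail n u := by
    rw [hE, ← hw, ← intervalIntegral.integral_mul_const]
    refine intervalIntegral.integral_mono_on (by linarith)
      (intervalIntegrable_exp_mul_kingmanTail _ _ _ _ _) (hwi.mul_const _) fun v hv => ?_
    exact mul_le_mul_of_nonneg_left (kingmanTail_antitone n hv.1)
      (mul_nonneg hr0.le (Real.exp_pos _).le)
  have hlow : (1 - E) * (kingmanTail n u - r * κ) ≤
      ∫ v in u..(u + κ), r * Real.exp (-(r * (u + κ - v))) * kingmanTail n v := by
    rw [hE, ← hw, ← intervalIntegral.integral_mul_const]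
    refine intervalIntegral.integral_mono_on (by linarith) (hwi.mul_const _)
      (intervalIntegrable_exp_mul_kingmanTail _ _ _ _ _) fun v hv => ?_
    refine mul_le_mul_of_nonneg_left ?_ (mul_nonneg hr0.le (Real.exp_pos _).le)
    have h1 := kingmanTail_sub_le n hu hκ
    have h2 := kingmanTail_antitone n hv.2
    rw [← hr] at h1
    linarith
  rw [kingmanTail_succ_add n hu hκ, ← hr, ← hE]
  have a1 := kingmanTail_nonneg n u
  have a2 := kingmanTail_le_one (n + 1) u
  have a3 := kingmanTail_le_succ n u
  have a4 := kingmanTail_nonneg (n + 1) u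
  have hd : 0 ≤ kingmanTail (n + 1) u - kingmanTail n u := by linarith
  have hd1 : kingmanTail (n + 1) u - kingmanTail n u ≤ 1 := by linarith
  rw [abs_le]
  constructor
  · nlinarith
  · nlinarith

/-- Induction through the convolution: each variable multiplies the prefactor of `exp (-u/2)` by `r
/ (r - 1/2)`. These factors have a bounded product, dominated by the explicit sequence `6 (n + 1) /
(n + 3)`, which starts at 2 and increases to 6. -/
theorem kingmanTail_le_exp (n : ℕ) {u : ℝ} (hu : 0 ≤ u) :
    kingmanTail n u ≤ 6 * Real.exp (-(u / 2)) := by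
  have key : ∀ (n : ℕ) (u : ℝ), 0 ≤ u →
      kingmanTail (n + 1) u ≤ 6 * (n + 1) / (n + 3) * Real.exp (-(u / 2)) := by
    intro n
    induction n with
    | zero =>
      intro u hu
      rw [kingmanTail_succ 0 hu, intervalIntegral.integral_congr (g := fun _ => (0 : ℝ))]
      · have h1 : kingmanRate 0 = 1 := by rw [kingmanRate_eq]; norm_num
        have h2 : Real.exp (-u) ≤ Real.exp (-(u / 2)) := Real.exp_le_exp.2 (by linarith)
        have := Real.exp_pos (-(u / 2))
        simp [h1]
        linarith
      · intro v hv
        rw [Set.uIcc_of_le hu] at hv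
        simp [kingmanTail_zero hv.1]
    | succ n ih =>
      intro u hu
      set r := kingmanRate (n + 1) with hr
      have hr3 : r = (n + 3) * (n + 2) / 2 := by rw [hr, kingmanRate_eq]; push_cast; ring
      have hn : (0 : ℝ) ≤ n := Nat.cast_nonneg n
      have hr2 : 1 / 2 < r := by rw [hr3]; nlinarith
      set c : ℝ := 6 * (n + 1) / (n + 3) with hc
      have hc2 : 2 ≤ c := by rw [hc, le_div_iff₀ (by positivity)]; linarith
      rw [kingmanTail_succ (n + 1) hu, ← hr]
      have hintegrable : ∫ v in (0)..u, r * Real.exp (-(r * (u - v))) * kingmanTail (n + 1) v ≤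
          ∫ v in (0)..u, c * (r / (r - 1 / 2)) * Real.exp (-(u / 2)) *
            ((r - 1 / 2) * Real.exp (-((r - 1 / 2) * (u - v)))) := by
        refine intervalIntegral.integral_mono_on hu
          (intervalIntegrable_exp_mul_kingmanTail _ _ _ _ _)
          (Continuous.intervalIntegrable (by fun_prop) _ _) fun v hv => ?_
        have h1 := ih v hv.1
        have h2 : r * Real.exp (-(r * (u - v))) * (c * Real.exp (-(v / 2))) =
            c * (r / (r - 1 / 2)) * Real.exp (-(u / 2)) *
            ((r - 1 / 2) * Real.exp (-((r - 1 / 2) * (u - v)))) := by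
          have e : Real.exp (-(u / 2)) * Real.exp (-((r - 1 / 2) * (u - v))) =
              Real.exp (-(r * (u - v))) * Real.exp (-(v / 2)) := by
            rw [← Real.exp_add, ← Real.exp_add]; congr 1; ring
          have h0 : r - 1 / 2 ≠ 0 := by linarith
          have h3 : r / (r - 1 / 2) * (r - 1 / 2) = r := div_mul_cancel₀ _ h0
          calc _ = c * r * (Real.exp (-(r * (u - v))) * Real.exp (-(v / 2))) := by ring
            _ = c * (r / (r - 1 / 2) * (r - 1 / 2)) *
                (Real.exp (-(u / 2)) * Real.exp (-((r - 1 / 2) * (u - v)))) := by rw [← e, h3]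
            _ = _ := by ring
        rw [← h2]
        exact mul_le_mul_of_nonneg_left h1 (mul_nonneg (by linarith) (Real.exp_pos _).le)
      rw [intervalIntegral.integral_const_mul, integral_exp_window] at hintegrable
      simp only [sub_self, mul_zero, neg_zero, Real.exp_zero, sub_zero] at hintegrable
      have hq : 1 ≤ r / (r - 1 / 2) := by rw [le_div_iff₀ (by linarith)]; linarith
      have e : Real.exp (-(u / 2)) * Real.exp (-((r - 1 / 2) * u)) = Real.exp (-(r * u)) := by
        rw [← Real.exp_add]; congr 1; ring
      have hcc : c * (r / (r - 1 / 2)) ≤ 6 * ((n + 1 : ℕ) + 1) / ((n + 1 : ℕ) + 3) := by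
        have hr4 : r - 1 / 2 = ((n + 3) * (n + 2) - 1) / 2 := by rw [hr3]; ring
        have h0 : 0 < ((n : ℝ) + 3) * (n + 2) - 1 := by nlinarith
        rw [hr4, hr3, hc]
        push_cast
        rw [div_div_div_cancel_right₀ (by norm_num), div_mul_div_comm,
          div_le_div_iff₀ (by positivity) (by positivity)]
        have h5 : 0 ≤ (n : ℝ) ^ 3 := by positivity
        have h6 : 0 ≤ (n : ℝ) ^ 2 := by positivity
        nlinarith [mul_nonneg h5 hn]
      have hE := Real.exp_pos (-(u / 2))
      have hE' := Real.exp_pos (-(r * u))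
      calc Real.exp (-(r * u)) + ∫ v in (0)..u, r * Real.exp (-(r * (u - v))) *
            kingmanTail (n + 1) v
          ≤ Real.exp (-(r * u)) + c * (r / (r - 1 / 2)) * Real.exp (-(u / 2)) *
            (1 - Real.exp (-((r - 1 / 2) * u))) := by linarith
        _ = c * (r / (r - 1 / 2)) * Real.exp (-(u / 2)) +
            (1 - c * (r / (r - 1 / 2))) * Real.exp (-(r * u)) := by rw [← e]; ring
        _ ≤ c * (r / (r - 1 / 2)) * Real.exp (-(u / 2)) := by
            have : 1 - c * (r / (r - 1 / 2)) ≤ 0 := by nlinarith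
            nlinarith
        _ ≤ _ := mul_le_mul_of_nonneg_right hcc hE.le
  refine (kingmanTail_le_succ n u).trans ((key n u hu).trans ?_)
  refine mul_le_mul_of_nonneg_right ?_ (Real.exp_pos _).le
  rw [div_le_iff₀ (by positivity)]
  linarith

/-! ### Means of the exponential variables and truncation of the infinite sum. -/

theorem lintegral_eval_meanFieldSeqLaw_le (i : ℕ) :
    ∫⁻ z, ENNReal.ofReal (z i) ∂meanFieldSeqLaw ≤ ENNReal.ofReal (kingmanRate i)⁻¹ := by
  have hr0 := kingmanRate_pos i
  have : IsProbabilityMeasure (ProbabilityTheory.expMeasure (kingmanRate i)) :=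
    ProbabilityTheory.isProbabilityMeasure_expMeasure hr0
  have h1 : ∫⁻ z, ENNReal.ofReal (z i) ∂meanFieldSeqLaw =
      ∫⁻ x, ENNReal.ofReal x ∂(ProbabilityTheory.expMeasure (kingmanRate i)) := by
    rw [← map_eval_meanFieldSeqLaw, lintegral_map ENNReal.measurable_ofReal (measurable_pi_apply i)]
  have hnn : 0 ≤ᵐ[ProbabilityTheory.expMeasure (kingmanRate i)] fun x : ℝ => x := by
    rw [EventuallyLE, ae_iff]
    convert expMeasure_Iio_zero (kingmanRate i) using 2
    ext x; simp
  rw [h1, lintegral_eq_lintegral_meas_lt _ hnn aemeasurable_id]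
  have h2 : ∀ t ∈ Set.Ioi (0 : ℝ), ProbabilityTheory.expMeasure (kingmanRate i) {a | t < a} =
      ENNReal.ofReal (Real.exp (-kingmanRate i * t)) := by
    intro t ht
    have h3 := ProbabilityTheory.cdf_expMeasure_eq hr0 t
    rw [ProbabilityTheory.cdf_eq_real, if_pos (le_of_lt ht)] at h3
    have h4 : (ProbabilityTheory.expMeasure (kingmanRate i)).real {a | t < a} =
        Real.exp (-kingmanRate i * t) := by
      have : {a : ℝ | t < a} = (Set.Iic t)ᶜ := by ext a; simp
      rw [this, probReal_compl_eq_one_sub measurableSet_Iic, h3]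
      simp
    rw [← h4, ofReal_measureReal]
  rw [setLIntegral_congr_fun measurableSet_Ioi h2,
    ← ofReal_integral_eq_lintegral_ofReal (exp_neg_integrableOn_Ioi 0 hr0)
      (Eventually.of_forall fun x => (Real.exp_pos _).le),
    integral_exp_mul_Ioi (by linarith) 0]
  refine ENNReal.ofReal_le_ofReal (le_of_eq ?_)
  simp

/-- The series telescopes, as `2 / ((N + 1) (N + 2)) = 2 / (N + 1) - 2 / (N + 2)`. -/
theorem hasSum_inv_kingmanRate_shift (n : ℕ) :
    HasSum (fun i => (kingmanRate (n + i))⁻¹) (2 / (n + 1)) := by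
  have h1 : ∀ N : ℕ, ∑ i ∈ Finset.range N, (kingmanRate (n + i))⁻¹ =
      2 / (n + 1) - 2 / (n + 1 + N) := by
    intro N
    induction N with
    | zero => simp
    | succ N ih =>
      rw [Finset.sum_range_succ, ih, kingmanRate_eq]
      push_cast
      have a : (n : ℝ) + 1 ≠ 0 := by positivity
      have b : (n : ℝ) + 1 + N ≠ 0 := by positivity
      have c : (n : ℝ) + 1 + (N + 1) ≠ 0 := by positivity
      have d : (n : ℝ) + N + 2 ≠ 0 := by positivity
      have e : (n : ℝ) + N + 1 ≠ 0 := by positivity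
      field_simp
      ring
  rw [hasSum_iff_tendsto_nat_of_nonneg fun i => (inv_pos.2 (kingmanRate_pos _)).le]
  simp_rw [h1]
  have h2 : Tendsto (fun N : ℕ => 2 / ((n : ℝ) + 1 + N)) atTop (𝓝 0) :=
    Tendsto.const_div_atTop (tendsto_atTop_add_const_left _ _ tendsto_natCast_atTop_atTop) 2
  simpa using h2.const_sub (2 / ((n : ℝ) + 1))

theorem lintegral_tsum_shift_le (n : ℕ) :
    ∫⁻ z, ∑' i, ENNReal.ofReal (z (n + i)) ∂meanFieldSeqLaw ≤ ENNReal.ofReal (2 / (n + 1)) := by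
  have hm : ∀ i, AEMeasurable (fun z : ℕ → ℝ => ENNReal.ofReal (z (n + i))) meanFieldSeqLaw :=
    fun i => (ENNReal.measurable_ofReal.comp (measurable_pi_apply (n + i))).aemeasurable
  rw [lintegral_tsum hm]
  refine (ENNReal.tsum_le_tsum fun i => lintegral_eval_meanFieldSeqLaw_le (n + i)).trans ?_
  rw [← ENNReal.ofReal_tsum_of_nonneg (fun i => (inv_pos.2 (kingmanRate_pos _)).le)
    (hasSum_inv_kingmanRate_shift n).summable, (hasSum_inv_kingmanRate_shift n).tsum_eq]

theorem ae_meanFieldSeqLaw_summable : ∀ᵐ z ∂meanFieldSeqLaw, Summable z := by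
  have h := lintegral_tsum_shift_le 0
  have hm : Measurable fun z : ℕ → ℝ => ∑' i, ENNReal.ofReal (z (0 + i)) :=
    Measurable.tsum fun i => ENNReal.measurable_ofReal.comp (measurable_pi_apply (0 + i))
  filter_upwards [ae_lt_top hm (lt_of_le_of_lt h ENNReal.ofReal_lt_top).ne,
    ae_meanFieldSeqLaw_nonneg] with z hz h0
  simp only [zero_add] at hz
  have := ENNReal.summable_toReal hz.ne
  simpa [ENNReal.toReal_ofReal, h0] using this

theorem measurable_tsum_seq : Measurable fun z : ℕ → ℝ => ∑' i, z i := by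
  exact Measurable.tsum fun i => measurable_pi_apply i

/-- The Wasserstein distance between the infinite sum and its partial sums. -/
theorem lintegral_abs_meanFieldLaw_sub_kingmanTail_le (n : ℕ) :
    ∫⁻ x : ℝ, ENNReal.ofReal |meanFieldLaw.real (Set.Ioi x) - kingmanTail n x| ≤
      ENNReal.ofReal (2 / (n + 1)) := by
  have hS : Measurable fun z : ℕ → ℝ => ∑ i ∈ Finset.range n, z i :=
    Finset.measurable_sum _ fun i _ => measurable_pi_apply i
  have hT := measurable_tsum_seq
  have hle : ∀ᵐ z ∂meanFieldSeqLaw, ENNReal.ofReal (∑' i, z i - ∑ i ∈ Finset.range n, z i) ≤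
      ∑' i, ENNReal.ofReal (z (n + i)) ∧ ∑ i ∈ Finset.range n, z i ≤ ∑' i, z i := by
    filter_upwards [ae_meanFieldSeqLaw_summable, ae_meanFieldSeqLaw_nonneg] with z hz h0
    refine ⟨?_, hz.sum_le_tsum _ fun i _ => h0 i⟩
    have h1 := hz.sum_add_tsum_nat_add n
    have h2 : Summable fun i => z (i + n) := (summable_nat_add_iff n).2 hz
    rw [← h1, add_sub_cancel_left, ENNReal.ofReal_tsum_of_nonneg (fun i => h0 _) h2]
    simp [add_comm]
  have hset : MeasurableSet {w : ℝ × (ℕ → ℝ) | ∑ i ∈ Finset.range n, w.2 i ≤ w.1 ∧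
      w.1 < ∑' i, w.2 i} :=
    (measurableSet_le (hS.comp measurable_snd) measurable_fst).inter
      (measurableSet_lt measurable_fst (hT.comp measurable_snd))
  have h1 : ∀ x : ℝ, ENNReal.ofReal |meanFieldLaw.real (Set.Ioi x) - kingmanTail n x| =
      meanFieldSeqLaw {z | ∑ i ∈ Finset.range n, z i ≤ x ∧ x < ∑' i, z i} := by
    intro x
    have e1 : meanFieldLaw.real (Set.Ioi x) = meanFieldSeqLaw.real {z | x < ∑' i, z i} := by
      rw [meanFieldLaw, measureReal_def, Measure.map_apply hT measurableSet_Ioi]; rfl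
    have e2 : meanFieldSeqLaw.real {z | x < ∑' i, z i} = kingmanTail n x +
        meanFieldSeqLaw.real {z | ∑ i ∈ Finset.range n, z i ≤ x ∧ x < ∑' i, z i} := by
      rw [kingmanTail, ← measureReal_union]
      · refine congrArg ENNReal.toReal (measure_congr ?_)
        filter_upwards [hle] with z hz
        refine propext ⟨fun h => ?_, fun h => ?_⟩
        · rcases le_or_gt (∑ i ∈ Finset.range n, z i) x with h' | h'
          · exact Or.inr ⟨h', h⟩
          · exact Or.inl h'
        · rcases h with h | h
          · exact lt_of_lt_of_le h hz.2
          · exact h.2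
      · rw [Set.disjoint_left]
        rintro z h ⟨h', -⟩
        exact absurd h (not_lt.2 h')
      · exact (measurableSet_le hS measurable_const).inter (measurableSet_lt measurable_const hT)
    rw [e1, e2, add_sub_cancel_left, abs_of_nonneg measureReal_nonneg, ofReal_measureReal]
  simp_rw [h1]
  -- By Tonelli the integral is the mean length of the interval between the partial sum and the full
  -- sum.
  have h2 : ∫⁻ x : ℝ, meanFieldSeqLaw {z | ∑ i ∈ Finset.range n, z i ≤ x ∧ x < ∑' i, z i} =
      ∫⁻ z, volume {x : ℝ | ∑ i ∈ Finset.range n, z i ≤ x ∧ x < ∑' i, z i} ∂meanFieldSeqLaw := by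
    have a1 := Measure.prod_apply (μ := (volume : Measure ℝ)) (ν := meanFieldSeqLaw) hset
    have a2 := Measure.prod_apply_symm (μ := (volume : Measure ℝ)) (ν := meanFieldSeqLaw) hset
    rw [a1] at a2
    exact a2
  rw [h2]
  refine le_trans (lintegral_mono_ae ?_) (lintegral_tsum_shift_le n)
  filter_upwards [hle] with z hz
  have : {x : ℝ | ∑ i ∈ Finset.range n, z i ≤ x ∧ x < ∑' i, z i} =
      Set.Ico (∑ i ∈ Finset.range n, z i) (∑' i, z i) := rfl
  rw [this, Real.volume_Ico]
  exact hz.1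

end Kingman
end

noncomputable section

/-! ### Sums over tuples of distinct particles -/

section Tuples

variable {V : Type*} [Fintype V] [DecidableEq V] {p : V → V → ℝ} {π : V → ℝ} {r : ℕ}

/-- The injective `r`-tuples with entries in `S`. -/
def injTuples {α : Type*} [DecidableEq α] (r : ℕ) (S : Finset α) : Finset (Fin r → α) := by
  classical exact (Fintype.piFinset fun _ => S).filter Function.Injective

theorem mem_injTuples {α : Type*} [DecidableEq α] {S : Finset α} {x : Fin r → α} :
    x ∈ injTuples r S ↔ (∀ i, x i ∈ S) ∧ Function.Injective x := by
  simp [injTuples]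

theorem card_injTuples_le {α : Type*} [DecidableEq α] (S : Finset α) :
    (injTuples r S).card ≤ S.card ^ r := by
  classical
  refine (Finset.card_filter_le _ _).trans ?_
  simp

/-- The sum of `g` over all tuples of distinct elements of `S`. -/
def injSum (g : (Fin r → V) → ℝ) (S : Finset V) : ℝ := ∑ x ∈ injTuples r S, g x

open Classical in
/-- Restriction of a function to injective tuples. -/
def onInj (g : (Fin r → V) → ℝ) (y : Fin r → V) : ℝ := if Function.Injective y then g y else 0

theorem onInj_nonneg {g : (Fin r → V) → ℝ} (hg : ∀ y, 0 ≤ g y) (y : Fin r → V) :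
    0 ≤ onInj g y := by
  unfold onInj; split_ifs; exacts [hg y, le_rfl]

theorem onInj_le {g : (Fin r → V) → ℝ} (hg : ∀ y, 0 ≤ g y) (y : Fin r → V) :
    onInj g y ≤ g y := by
  unfold onInj; split_ifs; exacts [le_rfl, hg y]

/-- Tuples of distinct points of an image come from tuples of distinct points. -/
theorem injSum_image_le {α : Type*} [DecidableEq α] {g : (Fin r → V) → ℝ} (hg : ∀ y, 0 ≤ g y)
    (φ : α → V) (A : Finset α) :
    injSum g (A.image φ) ≤ ∑ x ∈ injTuples r A, onInj g fun i => φ (x i) := by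
  classical
  have hsub : injTuples r (A.image φ) ⊆
      ((injTuples r A).filter fun x => Function.Injective fun i => φ (x i)).image
        fun x i => φ (x i) := by
    intro y hy
    rw [mem_injTuples] at hy
    have h1 : ∀ i, ∃ a ∈ A, φ a = y i := fun i => Finset.mem_image.1 (hy.1 i)
    choose x hxA hx using h1
    have hxy : (fun i => φ (x i)) = y := funext hx
    refine Finset.mem_image.2 ⟨x, Finset.mem_filter.2 ⟨mem_injTuples.2 ⟨hxA, fun i j h => ?_⟩, ?_⟩,
      hxy⟩
    · exact hy.2 (by rw [← hx i, ← hx j, h])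
    · rw [hxy]; exact hy.2
  calc injSum g (A.image φ)
      ≤ ∑ y ∈ ((injTuples r A).filter fun x => Function.Injective fun i => φ (x i)).image
        (fun x i => φ (x i)), g y :=
        Finset.sum_le_sum_of_subset_of_nonneg hsub fun y _ _ => hg y
    _ ≤ ∑ x ∈ (injTuples r A).filter (fun x => Function.Injective fun i => φ (x i)),
        g fun i => φ (x i) := Finset.sum_image_le_of_nonneg fun y _ => hg y
    _ = ∑ x ∈ injTuples r A, onInj g fun i => φ (x i) := by
        rw [Finset.sum_filter]; rfl

/-- One step of `r` independent walkers that are killed as soon as two of them meet. -/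
def killStep (p : V → V → ℝ) (g : (Fin r → V) → ℝ) (x : Fin r → V) : ℝ :=
  prodMean (fun i => p (x i)) (onInj g)

theorem killStep_nonneg (hp : IsStochastic p) {g : (Fin r → V) → ℝ} (hg : ∀ y, 0 ≤ g y)
    (x : Fin r → V) : 0 ≤ killStep p g x :=
  prodMean_nonneg (fun _ => hp _) (onInj_nonneg hg)

theorem killStep_iterate_nonneg (hp : IsStochastic p) {g : (Fin r → V) → ℝ} (hg : ∀ y, 0 ≤ g y)
    (n : ℕ) (x : Fin r → V) : 0 ≤ (killStep p)^[n] g x := by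
  induction n generalizing x with
  | zero => exact hg x
  | succ n ih => rw [Function.iterate_succ_apply']; exact killStep_nonneg hp ih x

/-- Particles at distinct sites jump independently, so a tuple of distinct particles makes
independent steps; it stops being counted once two of its entries merge. -/
theorem flow_injSum_le (hp : IsStochastic p) {g : (Fin r → V) → ℝ} (hg : ∀ y, 0 ≤ g y)
    (S : Finset V) : flow p (injSum g) S ≤ injSum (killStep p g) S := by
  refine (prodMean_mono hp fun φ => injSum_image_le hg φ S).trans (le_of_eq ?_)
  rw [prodMean_sum]
  refine Finset.sum_congr rfl fun x hx => ?_
  exact prodMean_comp_injective hp (mem_injTuples.1 hx).2 (onInj g)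

theorem flow_iterate_injSum_le (hp : IsStochastic p) {g : (Fin r → V) → ℝ} (hg : ∀ y, 0 ≤ g y)
    (n : ℕ) (S : Finset V) : (flow p)^[n] (injSum g) S ≤ injSum ((killStep p)^[n] g) S := by
  induction n generalizing S with
  | zero => exact le_rfl
  | succ n ih =>
    rw [Function.iterate_succ_apply', Function.iterate_succ_apply']
    exact (flow_mono hp ih S).trans (flow_injSum_le hp (killStep_iterate_nonneg hp hg n) S)

/-- Tuples of distinct points among `k` independent points with law `π`. -/
theorem prodMean_injSum_image_le (hπ : IsProbVec π) {g : (Fin r → V) → ℝ} (hg : ∀ y, 0 ≤ g y)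
    (k : ℕ) :
    prodMean (fun _ : Fin k => π) (fun x => injSum g (Finset.univ.image x)) ≤
      k ^ r * prodMean (fun _ : Fin r => π) g := by
  have h1 : prodMean (fun _ : Fin k => π) (fun x => injSum g (Finset.univ.image x)) ≤
      prodMean (fun _ : Fin k => π) (fun x => ∑ i ∈ injTuples r Finset.univ,
        onInj g fun j => x (i j)) :=
    prodMean_mono (fun _ => hπ) fun x => injSum_image_le hg x Finset.univ
  refine h1.trans ?_
  rw [prodMean_sum]
  have h2 : ∀ i ∈ injTuples r (Finset.univ : Finset (Fin k)),
      prodMean (fun _ : Fin k => π) (fun x => onInj g fun j => x (i j)) ≤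
        prodMean (fun _ : Fin r => π) g := by
    intro i hi
    rw [prodMean_comp_injective (μ := fun _ : Fin k => π) (fun _ => hπ) (mem_injTuples.1 hi).2]
    exact prodMean_mono (fun _ => hπ) (onInj_le hg)
  refine (Finset.sum_le_sum h2).trans ?_
  rw [Finset.sum_const, nsmul_eq_mul]
  refine mul_le_mul_of_nonneg_right ?_ (prodMean_nonneg (fun _ => hπ) hg)
  have := card_injTuples_le (r := r) (Finset.univ : Finset (Fin k))
  rw [Finset.card_univ, Fintype.card_fin] at this
  exact_mod_cast this

theorem prodMean_step_eq (hπ : IsStationaryVec p π) {ι : Type*} [Fintype ι] [DecidableEq ι]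
    (F : (ι → V) → ℝ) :
    prodMean (fun _ : ι => π) (fun x => prodMean (fun i => p (x i)) F) =
      prodMean (fun _ : ι => π) F := by
  rw [prodMean_prodMean (fun _ : ι => π) (fun _ => p)]
  congr 1
  funext i y
  exact hπ.inv y

theorem prodMean_killStep_iterate_le (hp : IsStochastic p) (hπ : IsStationaryVec p π)
    {g : (Fin r → V) → ℝ} (hg : ∀ y, 0 ≤ g y) (n : ℕ) :
    prodMean (fun _ : Fin r => π) ((killStep p)^[n] g) ≤ prodMean (fun _ : Fin r => π) g := by
  induction n with
  | zero => exact le_rfl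
  | succ n ih =>
    refine le_trans ?_ ih
    rw [Function.iterate_succ_apply']
    conv_rhs => rw [← prodMean_step_eq hπ]
    exact prodMean_mono (fun _ => hπ.prob) fun x => prodMean_mono (fun _ => hp _)
      (onInj_le (killStep_iterate_nonneg hp hg n))

theorem prodMean_fin_succ (μ : Fin (r + 1) → V → ℝ) (F : (Fin (r + 1) → V) → ℝ) :
    prodMean μ F = ∑ a, μ 0 a * prodMean (fun i => μ i.succ) fun z => F (Fin.cons a z) := by
  unfold prodMean
  rw [← (Fin.consEquiv fun _ => V).sum_comp, Fintype.sum_prod_type]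
  refine Finset.sum_congr rfl fun a _ => ?_
  rw [Finset.mul_sum]
  refine Finset.sum_congr rfl fun z _ => ?_
  simp [Fin.consEquiv, Fin.prod_univ_succ, mul_assoc]

/-- Average over all coordinates but the first two. -/
def restMean (π : V → ℝ) (g : (Fin (r + 2) → V) → ℝ) (a b : V) : ℝ :=
  prodMean (fun _ : Fin r => π) fun z => g (Fin.cons a (Fin.cons b z))

theorem restMean_mono (hπ : IsProbVec π) {g h : (Fin (r + 2) → V) → ℝ} (hgh : ∀ x, g x ≤ h x)
    (a b : V) : restMean π g a b ≤ restMean π h a b :=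
  prodMean_mono (fun _ => hπ) fun _ => hgh _

theorem prodMean_eq_statMean_restMean (g : (Fin (r + 2) → V) → ℝ) :
    prodMean (fun _ : Fin (r + 2) => π) g = statMean π (restMean π g) := by
  rw [prodMean_fin_succ, statMean]
  refine Finset.sum_congr rfl fun a _ => ?_
  rw [prodMean_fin_succ, Finset.mul_sum]
  refine Finset.sum_congr rfl fun b _ => ?_
  rw [← mul_assoc]; rfl

/-- The averaged coordinates stay independent with the invariant law `π`, so only the step of the
first two walkers remains. -/
theorem restMean_step (hπ : IsStationaryVec p π) (F : (Fin (r + 2) → V) → ℝ) (a b : V) :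
    restMean π (fun x => prodMean (fun i => p (x i)) F) a b = pairMean p (restMean π F) a b := by
  have h1 : ∀ z : Fin r → V, prodMean (fun i => p ((Fin.cons a (Fin.cons b z) : Fin (r + 2) → V) i)) F
      = ∑ a', ∑ b', p a a' * p b b' *
        prodMean (fun i => p (z i)) fun z' => F (Fin.cons a' (Fin.cons b' z')) := by
    intro z
    rw [prodMean_fin_succ]
    refine Finset.sum_congr rfl fun a' _ => ?_
    rw [prodMean_fin_succ, Finset.mul_sum]
    refine Finset.sum_congr rfl fun b' _ => ?_
    rw [← mul_assoc]; rfl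
  unfold restMean pairMean
  rw [prodMean_congr h1, prodMean_sum]
  refine Finset.sum_congr rfl fun a' _ => ?_
  rw [prodMean_sum]
  refine Finset.sum_congr rfl fun b' _ => ?_
  rw [prodMean_const_mul, prodMean_step_eq hπ]

/-- One step of two walkers that are killed when they meet. -/
def pairKill (p : V → V → ℝ) (f : V → V → ℝ) : V → V → ℝ :=
  pairMean p fun x y => if x = y then 0 else f x y

theorem pairKill_mono (hp : IsStochastic p) {f g : V → V → ℝ} (h : ∀ x y, f x y ≤ g x y)
    (x y : V) : pairKill p f x y ≤ pairKill p g x y :=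
  pairMean_mono hp (fun a b => by split_ifs; exacts [le_rfl, h a b]) x y

theorem pairKill_iterate_mono (hp : IsStochastic p) {f g : V → V → ℝ} (h : ∀ x y, f x y ≤ g x y)
    (n : ℕ) (x y : V) : (pairKill p)^[n] f x y ≤ (pairKill p)^[n] g x y := by
  induction n generalizing x y with
  | zero => exact h x y
  | succ n ih =>
    rw [Function.iterate_succ_apply', Function.iterate_succ_apply']
    exact pairKill_mono hp ih x y

theorem pairKill_add (p : V → V → ℝ) (f g : V → V → ℝ) (x y : V) :
    pairKill p (fun x y => f x y + g x y) x y = pairKill p f x y + pairKill p g x y := by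
  unfold pairKill
  rw [← pairMean_add]
  congr 1; funext a b; split_ifs <;> simp

theorem pairKill_iterate_const_mul (p : V → V → ℝ) (c : ℝ) (f : V → V → ℝ) (n : ℕ) (x y : V) :
    (pairKill p)^[n] (fun x y => c * f x y) x y = c * (pairKill p)^[n] f x y := by
  induction n generalizing x y with
  | zero => rfl
  | succ n ih =>
    rw [Function.iterate_succ_apply', Function.iterate_succ_apply',
      show (pairKill p)^[n] (fun x y => c * f x y) = fun x y => c * (pairKill p)^[n] f x y from
        funext fun a => funext fun b => ih a b]
    unfold pairKill
    rw [← pairMean_const_mul]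
    congr 1; funext a b; split_ifs <;> simp

/-- The probability that two walkers are at the same place after one step. -/
def hitStep (p : V → V → ℝ) : V → V → ℝ := pairMean p fun x y => if x = y then 1 else 0

/-- The `l`-th term is the probability that the first meeting at a positive time happens at step `l
+ 1`. These events are disjoint; their sum and the survival probability add up to 1. -/
theorem sum_pairKill_hitStep_le_one (hp : IsStochastic p) (L : ℕ) (x y : V) :
    ∑ l ∈ Finset.range L, (pairKill p)^[l] (hitStep p) x y ≤ 1 := by
  have h1 : ∀ x y, hitStep p x y + pairKill p (fun _ _ => 1) x y = 1 := by
    intro x y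
    unfold hitStep pairKill
    rw [← pairMean_add]
    refine Eq.trans ?_ (pairMean_const hp 1 x y)
    congr 1; funext a b; split_ifs <;> simp
  have h2 : ∀ (L : ℕ) (x y : V), ∑ l ∈ Finset.range L, (pairKill p)^[l] (hitStep p) x y +
      (pairKill p)^[L] (fun _ _ => 1) x y = 1 := by
    intro L
    induction L with
    | zero => intro x y; simp
    | succ L ih =>
      intro x y
      rw [Finset.sum_range_succ, add_assoc]
      have h3 : ∀ n x y, (pairKill p)^[n] (hitStep p) x y +
          (pairKill p)^[n + 1] (fun _ _ => 1) x y = (pairKill p)^[n] (fun _ _ => 1) x y := by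
        intro n
        induction n with
        | zero => exact h1
        | succ n ihn =>
          intro x y
          rw [Function.iterate_succ_apply', Function.iterate_succ_apply' _ (n + 1),
            ← pairKill_add, Function.iterate_succ_apply' _ n]
          congr 1; funext a b; rw [← ihn a b, Function.iterate_succ_apply' _ n]
      rw [h3, ih]
  have h4 : 0 ≤ (pairKill p)^[L] (fun _ _ => 1) x y := by
    have : ∀ n x y, 0 ≤ (pairKill p)^[n] (fun _ _ => (1 : ℝ)) x y := by
      intro n
      induction n with
      | zero => intro x y; exact zero_le_one
      | succ n ih =>
        intro x y
        rw [Function.iterate_succ_apply']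
        refine (pairMean_const hp 0 x y).ge.trans (pairMean_mono hp (fun a b => ?_) x y)
        split_ifs; exacts [le_rfl, ih a b]
    exact this L x y
  linarith [h2 L x y]

/-- Only the killing by a collision of the first two walkers is kept. Without the other collisions
the remaining walkers are independent and stationary and can be averaged out. -/
theorem restMean_killStep_iterate_le (hp : IsStochastic p) (hπ : IsStationaryVec p π)
    {g : (Fin (r + 2) → V) → ℝ} (hg : ∀ y, 0 ≤ g y) (n : ℕ) (a b : V) :
    restMean π ((killStep p)^[n] g) a b ≤ (pairKill p)^[n] (restMean π g) a b := by
  induction n generalizing a b with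
  | zero => exact le_rfl
  | succ n ih =>
    rw [Function.iterate_succ_apply', Function.iterate_succ_apply']
    refine le_trans ?_ (pairKill_mono hp ih a b)
    refine (restMean_step hπ (onInj ((killStep p)^[n] g)) a b).le.trans ?_
    refine pairMean_mono hp (fun x y => ?_) a b
    split_ifs with h
    · subst h
      refine le_of_eq ?_
      have : ∀ z : Fin r → V, onInj ((killStep p)^[n] g) (Fin.cons x (Fin.cons x z)) = 0 := by
        intro z
        rw [onInj, if_neg]
        intro hinj
        have := @hinj 0 1 (by simp)
        exact absurd this (by simp)
      unfold restMean
      rw [prodMean_congr this, prodMean_const fun _ => hπ.prob]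
    · exact restMean_mono hπ.prob (onInj_le (killStep_iterate_nonneg hp hg n)) x y

/-- The total expected weight collected along the flow by a functional that charges tuples whose
first two particles merge. -/
theorem sum_prodMean_flow_injSum_le (hp : IsStochastic p) (hπ : IsStationaryVec p π)
    {g : (Fin (r + 2) → V) → ℝ} (hg : ∀ y, 0 ≤ g y) {c : ℝ} (hc : 0 ≤ c)
    (hgc : ∀ a b, restMean π g a b ≤ c * hitStep p a b) (k L : ℕ) :
    ∑ l ∈ Finset.range L, prodMean (fun _ : Fin k => π)
      (fun x => (flow p)^[l] (injSum g) (Finset.univ.image x)) ≤ k ^ (r + 2) * c := by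
  have h1 : ∀ l, prodMean (fun _ : Fin k => π)
      (fun x => (flow p)^[l] (injSum g) (Finset.univ.image x)) ≤
      k ^ (r + 2) * (c * statMean π ((pairKill p)^[l] (hitStep p))) := by
    intro l
    refine (prodMean_mono (fun _ => hπ.prob) fun x =>
      flow_iterate_injSum_le hp hg l (Finset.univ.image x)).trans ?_
    refine (prodMean_injSum_image_le hπ.prob (killStep_iterate_nonneg hp hg l) k).trans ?_
    refine mul_le_mul_of_nonneg_left ?_ (by positivity)
    rw [prodMean_eq_statMean_restMean, ← statMean_const_mul]
    refine statMean_mono hπ.prob fun a b => ?_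
    refine (restMean_killStep_iterate_le hp hπ hg l a b).trans ?_
    rw [← pairKill_iterate_const_mul]
    exact pairKill_iterate_mono hp hgc l a b
  refine (Finset.sum_le_sum fun l _ => h1 l).trans ?_
  rw [← Finset.mul_sum, ← Finset.mul_sum, ← statMean_sum]
  -- A pair has at most one first meeting, so the sum over all steps is bounded uniformly in `L`.
  -- Bounding step by step would lose a factor `L`.
  have h2 : statMean π (fun x y => ∑ l ∈ Finset.range L, (pairKill p)^[l] (hitStep p) x y) ≤ 1 := by
    rw [← statMean_const hπ.prob 1]
    exact statMean_mono hπ.prob (sum_pairKill_hitStep_le_one hp L)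
  calc (k : ℝ) ^ (r + 2) * (c * _) ≤ k ^ (r + 2) * (c * 1) := by gcongr
    _ = _ := by ring

end Tuples
end

noncomputable section

/-! ### The corrected Kingman functional -/

section Corrector

variable {V : Type*} [Fintype V] [DecidableEq V] {p : V → V → ℝ} {π : V → ℝ}

/-- The jump of the Kingman tail when `j` particles become `j - 1`. -/
def kingmanJump (j : ℕ) (u : ℝ) : ℝ := kingmanTail (j - 2) u - kingmanTail (j - 1) u

theorem abs_kingmanJump_le (j : ℕ) (u : ℝ) : |kingmanJump j u| ≤ 1 := by
  have h1 := kingmanTail_nonneg (j - 2) u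
  have h2 := kingmanTail_le_one (j - 2) u
  have h3 := kingmanTail_nonneg (j - 1) u
  have h4 := kingmanTail_le_one (j - 1) u
  unfold kingmanJump
  rw [abs_le]
  constructor <;> linarith

theorem abs_kingmanTail_sub_le_one (i j : ℕ) (u : ℝ) :
    |kingmanTail i u - kingmanTail j u| ≤ 1 := by
  have h1 := kingmanTail_nonneg i u
  have h2 := kingmanTail_le_one i u
  have h3 := kingmanTail_nonneg j u
  have h4 := kingmanTail_le_one j u
  rw [abs_le]
  constructor <;> linarith

/-- The Kingman tail for the particles in `S`, corrected by the deviations of the pairs of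
particles from stationarity. -/
def corrTail (d : V → V → ℝ) (u : ℝ) (S : Finset V) : ℝ :=
  kingmanTail (S.card - 1) u + 1 / 2 * (∑ q ∈ S.offDiag, d q.1 q.2) * kingmanJump S.card u

/-- The pairs of particles of `S` that are merged by `φ`. -/
def mergedPairs (φ : V → V) (S : Finset V) : Finset (V × V) :=
  S.offDiag.filter fun q => φ q.1 = φ q.2

/-- The weights of the pairs of particles other than `q` and its reverse. -/
def otherWeight (w : V → V → ℝ) (φ : V → V) (S : Finset V) (q : V × V) : ℝ :=
  ∑ q' ∈ (S.offDiag.erase q).erase q.swap, w (φ q'.1) (φ q'.2)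

theorem sum_offDiag_image_le {w : V → V → ℝ} (hw : ∀ x y, 0 ≤ w x y) (φ : V → V) (S : Finset V) :
    ∑ q ∈ (S.image φ).offDiag, w q.1 q.2 ≤
      ∑ q ∈ S.offDiag.filter (fun q => φ q.1 ≠ φ q.2), w (φ q.1) (φ q.2) := by
  have hsub : (S.image φ).offDiag ⊆
      (S.offDiag.filter fun q => φ q.1 ≠ φ q.2).image fun q => (φ q.1, φ q.2) := by
    rintro ⟨a, b⟩ h
    rw [Finset.mem_offDiag] at h
    obtain ⟨ha, hb, hab⟩ := h
    obtain ⟨x, hx, rfl⟩ := Finset.mem_image.1 ha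
    obtain ⟨y, hy, rfl⟩ := Finset.mem_image.1 hb
    refine Finset.mem_image.2 ⟨(x, y), Finset.mem_filter.2 ⟨Finset.mem_offDiag.2 ⟨hx, hy, ?_⟩,
      hab⟩, rfl⟩
    exact fun h => hab (congrArg φ h)
  refine (Finset.sum_le_sum_of_subset_of_nonneg hsub fun q _ _ => hw _ _).trans ?_
  exact Finset.sum_image_le_of_nonneg fun q _ => hw _ _

/-- Replacing the set of particles after a step by the particles before it costs at most the
weights of the pairs that are close when another pair merges. -/
theorem abs_corrTail_image_sub_le {d : V → V → ℝ} (hd1 : ∀ x, d x x = 1) (u : ℝ) (φ : V → V)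
    (S : Finset V) :
    |kingmanTail (S.card - 1) u + 1 / 2 * (∑ q ∈ S.offDiag, d (φ q.1) (φ q.2)) *
        kingmanJump S.card u - corrTail d u (S.image φ)| ≤
      2 * ∑ q ∈ mergedPairs φ S, otherWeight (fun x y => |d x y|) φ S q := by
  set w : V → V → ℝ := fun x y => |d x y| with hw
  have hw0 : ∀ x y, 0 ≤ w x y := fun x y => abs_nonneg _
  set m := (mergedPairs φ S).card with hm
  set W := ∑ q ∈ S.offDiag, w (φ q.1) (φ q.2) with hW
  have hsplit : W = m + ∑ q ∈ S.offDiag.filter (fun q => φ q.1 ≠ φ q.2), w (φ q.1) (φ q.2) := by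
    rw [hW, ← Finset.sum_filter_add_sum_filter_not _ (fun q : V × V => φ q.1 = φ q.2)]
    congr 1
    rw [Finset.sum_congr rfl (g := fun _ => (1 : ℝ))]
    · simp [hm, mergedPairs]
    · intro q hq
      simp [hw, (Finset.mem_filter.1 hq).2, hd1]
  have himg := sum_offDiag_image_le hw0 φ S
  have hWm : ∑ q ∈ (S.image φ).offDiag, w q.1 q.2 ≤ W - m := by linarith
  have hWm0 : 0 ≤ W - m := le_trans (Finset.sum_nonneg fun q _ => hw0 _ _) hWm
  -- Of the total weight `W`, the pair `q` and its reverse carry 1 each, because the deviation is 1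
  -- on the diagonal.
  have hother : ∀ q ∈ mergedPairs φ S, otherWeight w φ S q = W - 2 := by
    intro q hq
    have hq' := Finset.mem_filter.1 hq
    have hoff := Finset.mem_offDiag.1 hq'.1
    have hne : q.swap ≠ q := by
      intro h
      exact hoff.2.2 (congrArg Prod.snd h)
    have hsw : q.swap ∈ S.offDiag.erase q :=
      Finset.mem_erase.2 ⟨hne, Finset.mem_offDiag.2 ⟨hoff.2.1, hoff.1, hoff.2.2.symm⟩⟩
    have e1 := Finset.add_sum_erase (S.offDiag.erase q) (fun q' => w (φ q'.1) (φ q'.2)) hsw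
    have e2 := Finset.add_sum_erase S.offDiag (fun q' => w (φ q'.1) (φ q'.2)) hq'.1
    have e3 : w (φ q.1) (φ q.2) = 1 := by simp [hw, hq'.2, hd1]
    have e4 : w (φ q.swap.1) (φ q.swap.2) = 1 := by simp [hw, hq'.2, hd1]
    simp only [e3, e4] at e1 e2
    unfold otherWeight
    linarith
  rw [Finset.sum_congr rfl hother, Finset.sum_const, nsmul_eq_mul, ← hm]
  have hj := abs_kingmanJump_le S.card u
  have hj' := abs_kingmanJump_le (S.image φ).card u
  have hsumd : |∑ q ∈ S.offDiag, d (φ q.1) (φ q.2)| ≤ W := Finset.abs_sum_le_sum_abs _ _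
  have hsumd' : |∑ q ∈ (S.image φ).offDiag, d q.1 q.2| ≤ W - m :=
    (Finset.abs_sum_le_sum_abs _ _).trans hWm
  have hcross' : |1 / 2 * (∑ q ∈ (S.image φ).offDiag, d q.1 q.2) *
      kingmanJump (S.image φ).card u| ≤ 1 / 2 * (W - m) := by
    rw [abs_mul, abs_mul, abs_of_pos (by norm_num : (0 : ℝ) < 1 / 2)]
    calc 1 / 2 * |∑ q ∈ (S.image φ).offDiag, d q.1 q.2| * |kingmanJump (S.image φ).card u|
        ≤ 1 / 2 * |∑ q ∈ (S.image φ).offDiag, d q.1 q.2| * 1 := by gcongr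
      _ ≤ 1 / 2 * (W - m) := by linarith
  -- `m` counts ordered merged pairs. For `m = 0` nothing changes. For `m = 2` the merged pair
  -- contributes `1/2 * 2 * kingmanJump`, which is exactly the change of the Kingman tail, and only
  -- weights of other pairs remain. For `m ≥ 3` the right side is `2 m (W - 2)` with `W ≥ m`, so
  -- crude bounds suffice.
  rcases Nat.eq_zero_or_pos m with h0 | hpos
  · have hinj : Set.InjOn φ S := by
      intro a ha b hb hab
      by_contra hne
      have : (a, b) ∈ mergedPairs φ S :=
        Finset.mem_filter.2 ⟨Finset.mem_offDiag.2 ⟨ha, hb, hne⟩, hab⟩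
      rw [hm, Finset.card_eq_zero] at h0
      rw [h0] at this
      simp at this
    have hcard : (S.image φ).card = S.card := Finset.card_image_of_injOn hinj
    have hsum : ∑ q ∈ (S.image φ).offDiag, d q.1 q.2 = ∑ q ∈ S.offDiag, d (φ q.1) (φ q.2) := by
      have : (S.image φ).offDiag = S.offDiag.image fun q => (φ q.1, φ q.2) := by
        ext ⟨a, b⟩
        simp only [Finset.mem_offDiag, Finset.mem_image, Prod.exists, Prod.mk.injEq]
        constructor
        · rintro ⟨⟨x, hx, rfl⟩, ⟨y, hy, rfl⟩, hab⟩
          exact ⟨x, y, ⟨hx, hy, fun h => hab (by rw [h])⟩, rfl, rfl⟩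
        · rintro ⟨x, y, ⟨hx, hy, hxy⟩, rfl, rfl⟩
          exact ⟨⟨x, hx, rfl⟩, ⟨y, hy, rfl⟩, fun h => hxy (hinj hx hy h)⟩
      rw [this, Finset.sum_image]
      intro q hq q' hq' h
      have h1 := Finset.mem_offDiag.1 hq
      have h2 := Finset.mem_offDiag.1 hq'
      rw [Prod.mk.injEq] at h
      exact Prod.ext (hinj h1.1 h2.1 h.1) (hinj h1.2.1 h2.2.1 h.2)
    rw [corrTail, hcard, hsum, sub_self, abs_zero, h0]
    simp
  obtain ⟨⟨a, b⟩, hab⟩ := Finset.card_pos.1 hpos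
  have hab' := Finset.mem_filter.1 hab
  have haS := (Finset.mem_offDiag.1 hab'.1).1
  have hbS := (Finset.mem_offDiag.1 hab'.1).2.1
  have habne : a ≠ b := (Finset.mem_offDiag.1 hab'.1).2.2
  have hφ : φ a = φ b := hab'.2
  have hba : (b, a) ∈ mergedPairs φ S :=
    Finset.mem_filter.2 ⟨Finset.mem_offDiag.2 ⟨hbS, haS, habne.symm⟩, hφ.symm⟩
  have hpair : ({(a, b), (b, a)} : Finset (V × V)) ⊆ mergedPairs φ S := by
    intro q hq
    simp only [Finset.mem_insert, Finset.mem_singleton] at hq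
    rcases hq with rfl | rfl <;> assumption
  have hpc : ({(a, b), (b, a)} : Finset (V × V)).card = 2 :=
    Finset.card_pair (by simp [habne])
  have hm2 : 2 ≤ m := hpc ▸ Finset.card_le_card hpair
  rcases hm2.eq_or_lt with h2 | h3
  · have heq : mergedPairs φ S = {(a, b), (b, a)} :=
      (Finset.eq_of_subset_of_card_le hpair (by rw [hpc, ← hm, ← h2])).symm
    have himage : S.image φ = (S.erase b).image φ := by
      ext v
      simp only [Finset.mem_image, Finset.mem_erase]
      constructor
      · rintro ⟨x, hx, rfl⟩
        by_cases hxb : x = b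
        · exact ⟨a, ⟨habne, haS⟩, by rw [hxb, hφ]⟩
        · exact ⟨x, ⟨hxb, hx⟩, rfl⟩
      · rintro ⟨x, ⟨-, hx⟩, rfl⟩
        exact ⟨x, hx, rfl⟩
    have hinj : Set.InjOn φ (S.erase b) := by
      intro x hx y hy hxy
      by_contra hne
      rw [Finset.mem_coe, Finset.mem_erase] at hx hy
      have : (x, y) ∈ mergedPairs φ S :=
        Finset.mem_filter.2 ⟨Finset.mem_offDiag.2 ⟨hx.2, hy.2, hne⟩, hxy⟩
      rw [heq] at this
      simp only [Finset.mem_insert, Finset.mem_singleton, Prod.mk.injEq] at this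
      rcases this with ⟨-, h⟩ | ⟨h, -⟩
      · exact hy.1 h
      · exact hx.1 h
    have hcard : (S.image φ).card = S.card - 1 := by
      rw [himage, Finset.card_image_of_injOn hinj, Finset.card_erase_of_mem hbS]
    have hmd : ∑ q ∈ S.offDiag, d (φ q.1) (φ q.2) =
        2 + ∑ q ∈ S.offDiag.filter (fun q => φ q.1 ≠ φ q.2), d (φ q.1) (φ q.2) := by
      rw [← Finset.sum_filter_add_sum_filter_not S.offDiag (fun q : V × V => φ q.1 = φ q.2)]
      congr 1
      rw [Finset.sum_congr rfl (g := fun _ => (1 : ℝ))]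
      · have : ((mergedPairs φ S).card : ℝ) = 2 := by rw [← hm, ← h2]; norm_num
        simpa [mergedPairs] using this
      · intro q hq
        simp [(Finset.mem_filter.1 hq).2, hd1]
    set R := ∑ q ∈ S.offDiag.filter (fun q => φ q.1 ≠ φ q.2), d (φ q.1) (φ q.2) with hR
    have hRle : |R| ≤ W - m := by
      refine (Finset.abs_sum_le_sum_abs _ _).trans ?_
      rw [hsplit]; simp [hw]
    have hmR : (m : ℝ) = 2 := by rw [← h2]; norm_num
    have hmain : |1 / 2 * R * kingmanJump S.card u| ≤ 1 / 2 * (W - m) := by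
      rw [abs_mul, abs_mul, abs_of_pos (by norm_num : (0 : ℝ) < 1 / 2)]
      calc 1 / 2 * |R| * |kingmanJump S.card u| ≤ 1 / 2 * |R| * 1 := by gcongr
        _ ≤ 1 / 2 * (W - m) := by linarith
    have e : kingmanTail (S.card - 1) u + 1 / 2 * (2 + R) * kingmanJump S.card u -
        corrTail d u (S.image φ) = 1 / 2 * R * kingmanJump S.card u -
          1 / 2 * (∑ q ∈ (S.image φ).offDiag, d q.1 q.2) * kingmanJump (S.image φ).card u := by
      have : kingmanTail ((S.image φ).card - 1) u = kingmanTail (S.card - 2) u := by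
        rw [hcard, Nat.sub_sub]
      rw [corrTail, this, kingmanJump]
      ring
    rw [hmd, e]
    refine (abs_sub _ _).trans ?_
    rw [hmR] at hmain hcross' hWm0 ⊢
    linarith
  · have hm3 : (3 : ℝ) ≤ m := by exact_mod_cast h3
    have hmain : |1 / 2 * (∑ q ∈ S.offDiag, d (φ q.1) (φ q.2)) * kingmanJump S.card u| ≤
        1 / 2 * W := by
      rw [abs_mul, abs_mul, abs_of_pos (by norm_num : (0 : ℝ) < 1 / 2)]
      calc 1 / 2 * |∑ q ∈ S.offDiag, d (φ q.1) (φ q.2)| * |kingmanJump S.card u|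
          ≤ 1 / 2 * |∑ q ∈ S.offDiag, d (φ q.1) (φ q.2)| * 1 := by gcongr
        _ ≤ 1 / 2 * W := by linarith
    have hT := abs_kingmanTail_sub_le_one (S.card - 1) ((S.image φ).card - 1) u
    have hfin : 1 + 1 / 2 * W + 1 / 2 * (W - m) ≤ 2 * (m * (W - 2)) := by nlinarith
    refine le_trans ?_ hfin
    rw [corrTail]
    rw [abs_le] at hT hmain hcross' ⊢
    constructor <;> linarith [hT.1, hT.2, hmain.1, hmain.2, hcross'.1, hcross'.2]

/-! ### Charging coinciding mergers to quadruples and triples of particles. -/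

theorem Finset.sum_union_le_of_nonneg {α : Type*} [DecidableEq α] {A B : Finset α} {f : α → ℝ}
    (hf : ∀ a, 0 ≤ f a) : ∑ a ∈ A ∪ B, f a ≤ ∑ a ∈ A, f a + ∑ a ∈ B, f a := by
  rw [← Finset.sum_union_inter]
  linarith [Finset.sum_nonneg fun a (_ : a ∈ A ∩ B) => hf a]

/-- Charge for a quadruple: the first two particles merge, the weight is that of the others. -/
def mergeQuad (w : V → V → ℝ) (y : Fin 4 → V) : ℝ := if y 0 = y 1 then w (y 2) (y 3) else 0

/-- Charge for a triple: the first two particles merge, the weight is that of the merged particle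
and the third one. -/
def mergeTriple (w : V → V → ℝ) (y : Fin 3 → V) : ℝ := if y 0 = y 1 then w (y 0) (y 2) else 0

theorem mergeQuad_nonneg {w : V → V → ℝ} (hw : ∀ x y, 0 ≤ w x y) (y : Fin 4 → V) :
    0 ≤ mergeQuad w y := by
  unfold mergeQuad; split_ifs; exacts [hw _ _, le_rfl]

theorem mergeTriple_nonneg {w : V → V → ℝ} (hw : ∀ x y, 0 ≤ w x y) (y : Fin 3 → V) :
    0 ≤ mergeTriple w y := by
  unfold mergeTriple; split_ifs; exacts [hw _ _, le_rfl]

/-- A second pair, different from the merged one and its reverse, is either disjoint from it, giving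
a quadruple, or shares one particle with it. The shared particle can be either of the merged ones
and can come first or second, whence the 4 triples; they all carry the same charge, because the
merged particles are at the same site and `w` is symmetric. -/
theorem sum_mergedPairs_otherWeight_le {w : V → V → ℝ} (hw : ∀ x y, 0 ≤ w x y)
    (hsymm : ∀ x y, w x y = w y x) (φ : V → V) (S : Finset V) :
    ∑ q ∈ mergedPairs φ S, otherWeight w φ S q ≤
      ∑ x ∈ injTuples 4 S, mergeQuad w (fun i => φ (x i)) +
        4 * ∑ x ∈ injTuples 3 S, mergeTriple w (fun i => φ (x i)) := by
  set f : (V × V) × (V × V) → ℝ := fun z =>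
    if φ z.1.1 = φ z.1.2 then w (φ z.2.1) (φ z.2.2) else 0 with hf
  have hf0 : ∀ z, 0 ≤ f z := by
    intro z; simp only [hf]; split_ifs; exacts [hw _ _, le_rfl]
  set Z := (S.offDiag ×ˢ S.offDiag).filter fun z => z.2 ≠ z.1 ∧ z.2 ≠ z.1.swap with hZ
  have hLHS : ∑ q ∈ mergedPairs φ S, otherWeight w φ S q = ∑ z ∈ Z, f z := by
    rw [hZ, Finset.sum_filter, Finset.sum_product, mergedPairs, Finset.sum_filter]
    refine Finset.sum_congr rfl fun q _ => ?_
    split_ifs with h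
    · rw [otherWeight, ← Finset.filter_ne', ← Finset.filter_ne', Finset.filter_filter,
        Finset.sum_filter]
      exact Finset.sum_congr rfl fun q' _ => by simp [hf, h]
    · symm
      exact Finset.sum_eq_zero fun q' _ => by simp [hf, h]
  set T4 : (Fin 4 → V) → (V × V) × (V × V) := fun x => ((x 0, x 1), (x 2, x 3)) with hT4
  set Ta : (Fin 3 → V) → (V × V) × (V × V) := fun x => ((x 0, x 1), (x 0, x 2)) with hTa
  set Tb : (Fin 3 → V) → (V × V) × (V × V) := fun x => ((x 0, x 1), (x 1, x 2)) with hTb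
  set Tc : (Fin 3 → V) → (V × V) × (V × V) := fun x => ((x 0, x 1), (x 2, x 0)) with hTc
  set Td : (Fin 3 → V) → (V × V) × (V × V) := fun x => ((x 0, x 1), (x 2, x 1)) with hTd
  have hsub : Z ⊆ (injTuples 4 S).image T4 ∪ ((injTuples 3 S).image Ta ∪
      ((injTuples 3 S).image Tb ∪ ((injTuples 3 S).image Tc ∪ (injTuples 3 S).image Td))) := by
    rintro ⟨⟨a, b⟩, ⟨c, e⟩⟩ hz
    simp only [hZ, Finset.mem_filter, Finset.mem_product, Finset.mem_offDiag, Prod.swap_prod_mk,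
      ne_eq, Prod.mk.injEq, not_and] at hz
    obtain ⟨⟨⟨ha, hb, hab⟩, hc, he, hce⟩, h1, h2⟩ := hz
    have t3 : ∀ x y z : V, x ∈ S → y ∈ S → z ∈ S → x ≠ y → x ≠ z → y ≠ z →
        ![x, y, z] ∈ injTuples 3 S := by
      intro x y z hx hy hz hxy hxz hyz
      rw [mem_injTuples]
      refine ⟨by simp [Fin.forall_fin_succ, hx, hy, hz], ?_⟩
      intro i j
      fin_cases i <;> fin_cases j <;>
        simp [hxy, hxz, hyz, hxy.symm, hxz.symm, hyz.symm]
    simp only [Finset.mem_union, Finset.mem_image]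
    by_cases hca : c = a
    · subst hca
      right; left
      exact ⟨![c, b, e], t3 c b e ha hb he hab hce (fun h => h1 rfl h.symm), rfl⟩
    by_cases hcb : c = b
    · subst hcb
      right; right; left
      exact ⟨![a, c, e], t3 a c e ha hb he hab (fun h => h2 rfl h.symm) hce, rfl⟩
    by_cases hea : e = a
    · subst hea
      right; right; right; left
      exact ⟨![e, b, c], t3 e b c ha hb hc hab (Ne.symm hca) (Ne.symm hcb), rfl⟩
    by_cases heb : e = b
    · subst heb
      right; right; right; right
      exact ⟨![a, e, c], t3 a e c ha hb hc hab (Ne.symm hca) (Ne.symm hcb), rfl⟩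
    · left
      refine ⟨![a, b, c, e], ?_, rfl⟩
      rw [mem_injTuples]
      refine ⟨by simp [Fin.forall_fin_succ, ha, hb, hc, he], ?_⟩
      intro i j
      fin_cases i <;> fin_cases j <;>
        simp [hab, hce, hca, hcb, hea, heb, Ne.symm hab, Ne.symm hce, Ne.symm hca, Ne.symm hcb,
          Ne.symm hea, Ne.symm heb]
  have hTa' : ∀ x, f (Ta x) = mergeTriple w fun i => φ (x i) := fun x => rfl
  have hTb' : ∀ x, f (Tb x) = mergeTriple w fun i => φ (x i) := by
    intro x
    simp only [hf, hTb, mergeTriple]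
    split_ifs with h
    · rw [h]
    · rfl
  have hTc' : ∀ x, f (Tc x) = mergeTriple w fun i => φ (x i) := by
    intro x
    simp only [hf, hTc, mergeTriple, hsymm (φ (x 2))]
  have hTd' : ∀ x, f (Td x) = mergeTriple w fun i => φ (x i) := by
    intro x
    simp only [hf, hTd, mergeTriple, hsymm (φ (x 2))]
    split_ifs with h
    · rw [h]
    · rfl
  have him : ∀ T : (Fin 3 → V) → (V × V) × (V × V),
      (∀ x, f (T x) = mergeTriple w fun i => φ (x i)) →
      ∑ z ∈ (injTuples 3 S).image T, f z ≤
        ∑ x ∈ injTuples 3 S, mergeTriple w (fun i => φ (x i)) := by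
    intro T hT
    refine (Finset.sum_image_le_of_nonneg fun z _ => hf0 z).trans (le_of_eq ?_)
    exact Finset.sum_congr rfl fun x _ => hT x
  have him4 : ∑ z ∈ (injTuples 4 S).image T4, f z ≤
      ∑ x ∈ injTuples 4 S, mergeQuad w (fun i => φ (x i)) :=
    Finset.sum_image_le_of_nonneg fun z _ => hf0 z
  rw [hLHS]
  have u1 := Finset.sum_le_sum_of_subset_of_nonneg hsub fun z _ _ => hf0 z
  have u2 := Finset.sum_union_le_of_nonneg (A := (injTuples 4 S).image T4)
    (B := (injTuples 3 S).image Ta ∪ ((injTuples 3 S).image Tb ∪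
      ((injTuples 3 S).image Tc ∪ (injTuples 3 S).image Td))) hf0
  have u3 := Finset.sum_union_le_of_nonneg (A := (injTuples 3 S).image Ta)
    (B := (injTuples 3 S).image Tb ∪ ((injTuples 3 S).image Tc ∪ (injTuples 3 S).image Td)) hf0
  have u4 := Finset.sum_union_le_of_nonneg (A := (injTuples 3 S).image Tb)
    (B := (injTuples 3 S).image Tc ∪ (injTuples 3 S).image Td) hf0
  have u5 := Finset.sum_union_le_of_nonneg (A := (injTuples 3 S).image Tc)
    (B := (injTuples 3 S).image Td) hf0
  linarith [him Ta hTa', him Tb hTb', him Tc hTc', him Td hTd']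

theorem prodMean_pair (hp : IsStochastic p) (f : V → V → ℝ) {a b : V} (hab : a ≠ b) :
    prodMean (fun y => p y) (fun φ : V → V => f (φ a) (φ b)) = pairMean p f a b := by
  have hinj : Function.Injective (![a, b] : Fin 2 → V) := by
    intro i j
    fin_cases i <;> fin_cases j <;> simp [hab, hab.symm]
  have h := prodMean_comp_injective (μ := fun y => p y) hp hinj (fun y => f (y 0) (y 1))
  rw [← pairMean_eq_prodMean p f ![a, b]] at h
  exact h

/-- One step of a family of walkers charged by `g`. -/
def stepMean {r : ℕ} (p : V → V → ℝ) (g : (Fin r → V) → ℝ) (x : Fin r → V) : ℝ :=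
  prodMean (fun i => p (x i)) g

theorem stepMean_nonneg (hp : IsStochastic p) {r : ℕ} {g : (Fin r → V) → ℝ} (hg : ∀ y, 0 ≤ g y)
    (x : Fin r → V) : 0 ≤ stepMean p g x := prodMean_nonneg (fun _ => hp _) hg

theorem prodMean_sum_injTuples (hp : IsStochastic p) {r : ℕ} (g : (Fin r → V) → ℝ)
    (S : Finset V) :
    prodMean (fun y => p y) (fun φ : V → V => ∑ x ∈ injTuples r S, g fun i => φ (x i)) =
      injSum (stepMean p g) S := by
  rw [prodMean_sum]
  exact Finset.sum_congr rfl fun x hx => prodMean_comp_injective hp (mem_injTuples.1 hx).2 g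

/-- The weight of all pairs of particles. -/
def pairWeight (w : V → V → ℝ) : Finset V → ℝ := injSum fun x : Fin 2 → V => w (x 0) (x 1)

theorem pairWeight_eq (w : V → V → ℝ) (S : Finset V) :
    pairWeight w S = ∑ q ∈ S.offDiag, w q.1 q.2 := by
  unfold pairWeight injSum
  refine Finset.sum_bij' (fun x _ => (x 0, x 1)) (fun q _ => ![q.1, q.2]) ?_ ?_ ?_ ?_ ?_
  · intro x hx
    rw [mem_injTuples] at hx
    exact Finset.mem_offDiag.2 ⟨hx.1 0, hx.1 1, fun h => absurd (hx.2 h) (by simp)⟩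
  · intro q hq
    have h := Finset.mem_offDiag.1 hq
    rw [mem_injTuples]
    refine ⟨by simp [Fin.forall_fin_succ, h.1, h.2.1], ?_⟩
    intro i j
    fin_cases i <;> fin_cases j <;> simp [h.2.2, Ne.symm h.2.2]
  · intro x _
    funext i; fin_cases i <;> rfl
  · intro q _; rfl
  · intro x _; rfl

theorem kingmanRate_sub_two {j : ℕ} (hj : 2 ≤ j) :
    kingmanRate (j - 2) = (j * j - j) / 2 := by
  obtain ⟨n, rfl⟩ := Nat.exists_eq_add_of_le' hj
  rw [Nat.add_sub_cancel, kingmanRate_eq]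
  push_cast; ring

/-- The corrected functional is almost space-time harmonic. -/
theorem abs_flow_corrTail_sub_le (hp : IsStochastic p) {d : V → V → ℝ} {κ u : ℝ} (hκ : 0 ≤ κ)
    (hu : 0 ≤ u) (hd1 : ∀ x, d x x = 1) (hds : ∀ x y, d x y = d y x)
    (hdp : ∀ x y, x ≠ y → pairMean p d x y = d x y + κ) {k : ℕ} {S : Finset V}
    (hS : S.card ≤ k) :
    |flow p (corrTail d u) S - corrTail d (u + κ) S| ≤
      2 * (injSum (stepMean p (mergeQuad fun x y => |d x y|)) S +
        4 * injSum (stepMean p (mergeTriple fun x y => |d x y|)) S) +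
      (k ^ 2 * κ * pairWeight (fun x y => |d x y|) S + 2 * k ^ 4 * κ ^ 2) := by
  set w : V → V → ℝ := fun x y => |d x y| with hw
  have hw0 : ∀ x y, 0 ≤ w x y := fun x y => abs_nonneg _
  have hk0 : (0 : ℝ) ≤ k := Nat.cast_nonneg k
  set U : (V → V) → ℝ := fun φ => kingmanTail (S.card - 1) u +
    1 / 2 * (∑ q ∈ S.offDiag, d (φ q.1) (φ q.2)) * kingmanJump S.card u with hU
  have h1 : |flow p (corrTail d u) S - prodMean (fun y => p y) U| ≤
      2 * (injSum (stepMean p (mergeQuad w)) S + 4 * injSum (stepMean p (mergeTriple w)) S) := by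
    rw [abs_sub_comm, flow, ← prodMean_sub]
    refine (prodMean_abs_le hp _).trans ?_
    have h2 : ∀ φ : V → V, |U φ - corrTail d u (S.image φ)| ≤
        2 * (∑ x ∈ injTuples 4 S, mergeQuad w (fun i => φ (x i)) +
        4 * ∑ x ∈ injTuples 3 S, mergeTriple w (fun i => φ (x i))) := by
      intro φ
      refine (abs_corrTail_image_sub_le hd1 u φ S).trans ?_
      exact mul_le_mul_of_nonneg_left (sum_mergedPairs_otherWeight_le hw0
        (fun x y => by simp [hw, hds x y]) φ S) (by norm_num)
    refine (prodMean_mono hp h2).trans (le_of_eq ?_)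
    rw [prodMean_const_mul, prodMean_add, prodMean_const_mul, prodMean_sum_injTuples hp,
      prodMean_sum_injTuples hp]
  -- Each ordered pair of distinct particles gains `κ` on average; with the factor `1/2` the total
  -- gain is `κ` times the number of pairs, the Kingman rate.
  have h3 : prodMean (fun y => p y) U = kingmanTail (S.card - 1) u +
      1 / 2 * (∑ q ∈ S.offDiag, (d q.1 q.2 + κ)) * kingmanJump S.card u := by
    have e : U = fun φ => kingmanTail (S.card - 1) u + (1 / 2 * kingmanJump S.card u) *
        ∑ q ∈ S.offDiag, d (φ q.1) (φ q.2) := by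
      funext φ; simp only [hU]; ring
    rw [e, prodMean_add, prodMean_const hp, prodMean_const_mul, prodMean_sum]
    have : ∀ q ∈ S.offDiag, prodMean (fun y => p y) (fun φ : V → V => d (φ q.1) (φ q.2)) =
        d q.1 q.2 + κ := by
      intro q hq
      have hne := (Finset.mem_offDiag.1 hq).2.2
      rw [prodMean_pair hp d hne, hdp _ _ hne]
    rw [Finset.sum_congr rfl this]
    ring
  have hpw0 : 0 ≤ pairWeight w S := Finset.sum_nonneg fun x _ => hw0 _ _
  have h4 : |prodMean (fun y => p y) U - corrTail d (u + κ) S| ≤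
      k ^ 2 * κ * pairWeight w S + 2 * k ^ 4 * κ ^ 2 := by
    rw [h3, corrTail]
    -- With at most one particle, truncated subtraction makes both indices in `kingmanJump` equal to
    -- 0, so the correction vanishes.
    rcases Nat.lt_or_ge S.card 2 with hlt | hge
    · have e1 : S.card - 1 = 0 := by omega
      have e2 : S.card - 2 = 0 := by omega
      have e3 : kingmanJump S.card u = 0 := by rw [kingmanJump, e1, e2, sub_self]
      have e4 : kingmanJump S.card (u + κ) = 0 := by rw [kingmanJump, e1, e2, sub_self]
      rw [e3, e4, e1, kingmanTail_zero hu, kingmanTail_zero (by linarith)]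
      simp only [mul_zero, add_zero, sub_self, abs_zero]
      positivity
    · set n := S.card - 2 with hn
      have e1 : S.card - 1 = n + 1 := by omega
      have hrate : kingmanRate n = ((S.card : ℝ) * S.card - S.card) / 2 := kingmanRate_sub_two hge
      have hcardk : (S.card : ℝ) ≤ k := by exact_mod_cast hS
      have hcard2 : (2 : ℝ) ≤ S.card := by exact_mod_cast hge
      have hrk : kingmanRate n ≤ k ^ 2 := by rw [hrate]; nlinarith
      have hrk' : kingmanRate (n + 1) ≤ k ^ 2 := by
        have : (n : ℝ) + 2 = S.card := by
          have : n + 2 = S.card := by omega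
          exact_mod_cast this
        rw [kingmanRate_eq]
        push_cast
        nlinarith
      have hconst : ∑ q ∈ S.offDiag, (d q.1 q.2 + κ) =
          ∑ q ∈ S.offDiag, d q.1 q.2 + 2 * kingmanRate n * κ := by
        rw [Finset.sum_add_distrib, Finset.sum_const, Finset.offDiag_card, nsmul_eq_mul, hrate,
          Nat.cast_sub (Nat.le_mul_self _)]
        push_cast; ring
      have hJ : ∀ v, kingmanJump S.card v = kingmanTail n v - kingmanTail (n + 1) v := by
        intro v; rw [kingmanJump, e1]
      rw [hconst, e1, hJ, hJ]
      set D := ∑ q ∈ S.offDiag, d q.1 q.2 with hD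
      have hDle : |D| ≤ pairWeight w S := by
        rw [pairWeight_eq]; exact Finset.abs_sum_le_sum_abs _ _
      have hT := abs_kingmanTail_succ_add_sub_le n hu hκ
      have hg : |(kingmanTail n u - kingmanTail (n + 1) u) -
          (kingmanTail n (u + κ) - kingmanTail (n + 1) (u + κ))| ≤ k ^ 2 * κ := by
        have a1 := kingmanTail_sub_le n hu hκ
        have a2 := kingmanTail_sub_le (n + 1) hu hκ
        have a3 := kingmanTail_antitone n (show u ≤ u + κ by linarith)
        have a4 := kingmanTail_antitone (n + 1) (show u ≤ u + κ by linarith)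
        have a5 := mul_le_mul_of_nonneg_right hrk hκ
        have a6 := mul_le_mul_of_nonneg_right hrk' hκ
        rw [abs_le]; constructor <;> linarith
      -- The drift of the pairs cancels the first-order term of the Kolmogorov equation. What
      -- remains is its second-order error and the variation of the jump over time `κ`, weighted by
      -- the pairs.
      have e2 : kingmanTail (n + 1) u + 1 / 2 * (D + 2 * kingmanRate n * κ) *
          (kingmanTail n u - kingmanTail (n + 1) u) -
          (kingmanTail (n + 1) (u + κ) + 1 / 2 * D *
            (kingmanTail n (u + κ) - kingmanTail (n + 1) (u + κ))) =
          1 / 2 * D * ((kingmanTail n u - kingmanTail (n + 1) u) -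
            (kingmanTail n (u + κ) - kingmanTail (n + 1) (u + κ))) -
          (kingmanTail (n + 1) (u + κ) - kingmanTail (n + 1) u -
            κ * kingmanRate n * (kingmanTail n u - kingmanTail (n + 1) u)) := by ring
      rw [e2]
      refine (abs_sub _ _).trans (add_le_add ?_ (hT.trans ?_))
      · rw [abs_mul, abs_mul, abs_of_pos (by norm_num : (0 : ℝ) < 1 / 2)]
        calc 1 / 2 * |D| * _ ≤ 1 / 2 * pairWeight w S * (k ^ 2 * κ) := by gcongr
          _ ≤ _ := by
            have : 0 ≤ pairWeight w S * (k ^ 2 * κ) := by positivity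
            linarith
      · have h0 := (kingmanRate_pos n).le
        calc 2 * (kingmanRate n * κ) ^ 2 ≤ 2 * ((k : ℝ) ^ 2 * κ) ^ 2 := by gcongr
          _ = 2 * k ^ 4 * κ ^ 2 := by ring
  refine (abs_sub_le _ (prodMean (fun y => p y) U) _).trans (add_le_add h1 h4)

end Corrector
end

noncomputable section

/-! ### Stationary walkers and the Kingman coalescent -/

section MeanField

variable {V : Type*} [Fintype V] [DecidableEq V] {p : V → V → ℝ} {π : V → ℝ}

/-- The indicator of at least two particles. -/
def atLeastTwo (S : Finset V) : ℝ := if 2 ≤ S.card then 1 else 0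

theorem flow_sum {α : Type*} (s : Finset α) (p : V → V → ℝ) (F : α → Finset V → ℝ)
    (S : Finset V) : flow p (fun S => ∑ a ∈ s, F a S) S = ∑ a ∈ s, flow p (F a) S :=
  prodMean_sum s _ _

theorem flow_iterate_abs_sub_le (hp : IsStochastic p) {F G H : Finset V → ℝ}
    (h : ∀ S, |F S - G S| ≤ H S) (n : ℕ) (S : Finset V) :
    |(flow p)^[n] F S - (flow p)^[n] G S| ≤ (flow p)^[n] H S := by
  induction n generalizing S with
  | zero => exact h S
  | succ n ih =>
    simp only [Function.iterate_succ_apply']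
    have := congrFun (flow_sub p ((flow p)^[n] F) ((flow p)^[n] G)) S
    rw [← this]
    exact (flow_abs_le hp _ S).trans (flow_mono hp ih S)

/-- Telescoping of the one-step errors of an almost space-time harmonic functional. -/
theorem abs_flow_iterate_sub_le (hp : IsStochastic p) {F : ℕ → Finset V → ℝ} {e : Finset V → ℝ}
    {k : ℕ} (h : ∀ l S, S.card ≤ k → |flow p (F l) S - F (l + 1) S| ≤ e S) (L : ℕ) {S : Finset V}
    (hS : S.card ≤ k) :
    |(flow p)^[L] (F 0) S - F L S| ≤ ∑ l ∈ Finset.range L, (flow p)^[l] e S := by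
  induction L generalizing S with
  | zero => simp
  | succ L ih =>
    rw [Finset.sum_range_succ', Function.iterate_succ_apply']
    have h1 : |flow p ((flow p)^[L] (F 0)) S - flow p (F L) S| ≤
        ∑ l ∈ Finset.range L, (flow p)^[l + 1] e S := by
      have e1 := congrFun (flow_sub p ((flow p)^[L] (F 0)) (F L)) S
      rw [← e1]
      refine (flow_abs_le hp _ S).trans ?_
      refine (flow_le_of_card_le hp (G := fun S => ∑ l ∈ Finset.range L, (flow p)^[l] e S)
        (fun S hS => ih hS) S hS).trans (le_of_eq ?_)
      rw [flow_sum]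
      exact Finset.sum_congr rfl fun l _ => by rw [Function.iterate_succ_apply']
    exact (abs_sub_le _ (flow p (F L) S) _).trans (add_le_add h1 (h L S hS))

theorem restMean_mergeQuad (w : V → V → ℝ) (a b : V) :
    restMean π (mergeQuad w) a b = statMean π w * (if a = b then 1 else 0) := by
  have h : ∀ z : Fin 2 → V, mergeQuad w (Fin.cons a (Fin.cons b z)) =
      (if a = b then 1 else 0) * w (z 0) (z 1) := by
    intro z
    simp only [mergeQuad, ite_mul, one_mul, zero_mul]
    rfl
  unfold restMean
  rw [prodMean_congr h, prodMean_const_mul, mul_comm]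
  congr 1
  unfold prodMean statMean
  rw [← (finTwoArrowEquiv V).symm.sum_comp, Fintype.sum_prod_type]
  simp [Fin.prod_univ_two]

theorem restMean_mergeTriple (w : V → V → ℝ) (a b : V) :
    restMean π (mergeTriple w) a b = sndMean π w a * (if a = b then 1 else 0) := by
  have h : ∀ z : Fin 1 → V, mergeTriple w (Fin.cons a (Fin.cons b z)) =
      (if a = b then 1 else 0) * w a (z 0) := by
    intro z
    simp only [mergeTriple, ite_mul, one_mul, zero_mul]
    rfl
  unfold restMean
  rw [prodMean_congr h, prodMean_const_mul, mul_comm]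
  congr 1
  unfold prodMean sndMean
  rw [← (Equiv.funUnique (Fin 1) V).symm.sum_comp]
  simp

/-- The two particles other than the merging pair are stationary, so after averaging them the charge
is a constant times the meeting probability, as `sum_prodMean_flow_injSum_le` requires. -/
theorem restMean_stepMean_mergeQuad_le (hp : IsStochastic p) (hπ : IsStationaryVec p π)
    {w : V → V → ℝ} {W : ℝ} (hW : statMean π w ≤ W) (a b : V) :
    restMean π (stepMean p (mergeQuad w)) a b ≤ W * hitStep p a b := by
  refine (restMean_step hπ (mergeQuad w) a b).le.trans ?_
  rw [hitStep, ← pairMean_const_mul]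
  refine pairMean_mono hp (fun x y => ?_) a b
  rw [restMean_mergeQuad]
  exact mul_le_mul_of_nonneg_right hW (by split_ifs <;> norm_num)

/-- The merged particle is itself part of the weighted pair and its site is not stationary; hence a
bound `ω` uniform in that site is needed. -/
theorem restMean_stepMean_mergeTriple_le (hp : IsStochastic p) (hπ : IsStationaryVec p π)
    {w : V → V → ℝ} {ω : ℝ} (hω : ∀ x, sndMean π w x ≤ ω) (a b : V) :
    restMean π (stepMean p (mergeTriple w)) a b ≤ ω * hitStep p a b := by
  refine (restMean_step hπ (mergeTriple w) a b).le.trans ?_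
  rw [hitStep, ← pairMean_const_mul]
  refine pairMean_mono hp (fun x y => ?_) a b
  rw [restMean_mergeTriple]
  exact mul_le_mul_of_nonneg_right (hω x) (by split_ifs <;> norm_num)

theorem prodMean_flow_pairWeight_le (hp : IsStochastic p) (hπ : IsStationaryVec p π)
    {w : V → V → ℝ} (hw : ∀ x y, 0 ≤ w x y) {W : ℝ} (hW : statMean π w ≤ W) (k l : ℕ) :
    prodMean (fun _ : Fin k => π) (fun x => (flow p)^[l] (pairWeight w) (Finset.univ.image x)) ≤
      k ^ 2 * W := by
  refine (prodMean_mono (fun _ => hπ.prob) fun x =>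
    flow_iterate_injSum_le hp (fun _ => hw _ _) l (Finset.univ.image x)).trans ?_
  refine (prodMean_injSum_image_le hπ.prob
    (killStep_iterate_nonneg hp (fun _ => hw _ _) l) k).trans ?_
  refine mul_le_mul_of_nonneg_left ?_ (by positivity)
  refine (prodMean_killStep_iterate_le hp hπ (fun _ => hw _ _) l).trans (le_trans (le_of_eq ?_) hW)
  unfold prodMean statMean
  rw [← (finTwoArrowEquiv V).symm.sum_comp, Fintype.sum_prod_type]
  simp [Fin.prod_univ_two]

theorem kingmanTail_succ_zero (n : ℕ) : kingmanTail (n + 1) 0 = 1 := by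
  rw [kingmanTail_succ n le_rfl]; simp

/-- At `u = 0` the Kingman tail is the indicator of at least two particles, so only the correction
is left. -/
theorem abs_atLeastTwo_sub_corrTail_le (d : V → V → ℝ) (S : Finset V) :
    |atLeastTwo S - corrTail d 0 S| ≤ pairWeight (fun x y => |d x y|) S := by
  have h1 : kingmanTail (S.card - 1) 0 = atLeastTwo S := by
    unfold atLeastTwo
    split_ifs with h
    · obtain ⟨n, hn⟩ : ∃ n, S.card - 1 = n + 1 := ⟨S.card - 2, by omega⟩
      rw [hn, kingmanTail_succ_zero]
    · rw [show S.card - 1 = 0 by omega, kingmanTail_zero le_rfl]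
  have h2 : |∑ q ∈ S.offDiag, d q.1 q.2| ≤ pairWeight (fun x y => |d x y|) S := by
    rw [pairWeight_eq]; exact Finset.abs_sum_le_sum_abs _ _
  rw [corrTail, h1, sub_add_cancel_left, abs_neg, abs_mul, abs_mul,
    abs_of_pos (by norm_num : (0 : ℝ) < 1 / 2)]
  have h3 := abs_kingmanJump_le S.card 0
  calc 1 / 2 * |∑ q ∈ S.offDiag, d q.1 q.2| * |kingmanJump S.card 0|
      ≤ 1 / 2 * |∑ q ∈ S.offDiag, d q.1 q.2| * 1 := by gcongr
    _ ≤ _ := by linarith [abs_nonneg (∑ q ∈ S.offDiag, d q.1 q.2)]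

theorem abs_corrTail_image_sub_kingmanTail_le {d : V → V → ℝ} (hd1 : ∀ x, d x x = 1) (u : ℝ)
    {k : ℕ} (x : Fin k → V) :
    |corrTail d u (Finset.univ.image x) - kingmanTail (k - 1) u| ≤
      pairWeight (fun x y => |d x y|) (Finset.univ.image x) +
        ∑ q ∈ (Finset.univ : Finset (Fin k)).offDiag, |d (x q.1) (x q.2)| := by
  set S := Finset.univ.image x with hS
  have h2 : |∑ q ∈ S.offDiag, d q.1 q.2| ≤ pairWeight (fun x y => |d x y|) S := by
    rw [pairWeight_eq]; exact Finset.abs_sum_le_sum_abs _ _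
  have h3 := abs_kingmanJump_le S.card u
  have h4 : |1 / 2 * (∑ q ∈ S.offDiag, d q.1 q.2) * kingmanJump S.card u| ≤
      pairWeight (fun x y => |d x y|) S := by
    rw [abs_mul, abs_mul, abs_of_pos (by norm_num : (0 : ℝ) < 1 / 2)]
    calc 1 / 2 * |∑ q ∈ S.offDiag, d q.1 q.2| * |kingmanJump S.card u|
        ≤ 1 / 2 * |∑ q ∈ S.offDiag, d q.1 q.2| * 1 := by gcongr
      _ ≤ _ := by linarith [abs_nonneg (∑ q ∈ S.offDiag, d q.1 q.2)]
  have h5 : |kingmanTail (S.card - 1) u - kingmanTail (k - 1) u| ≤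
      ∑ q ∈ (Finset.univ : Finset (Fin k)).offDiag, |d (x q.1) (x q.2)| := by
    by_cases hinj : Function.Injective x
    · have : S.card = k := by
        rw [hS, Finset.card_image_of_injective _ hinj, Finset.card_univ, Fintype.card_fin]
      rw [this, sub_self, abs_zero]
      exact Finset.sum_nonneg fun q _ => abs_nonneg _
    -- If two starting points coincide, that pair has deviation 1 and pays for the trivial bound.
    · refine (abs_kingmanTail_sub_le_one _ _ u).trans ?_
      simp only [Function.Injective, not_forall] at hinj
      obtain ⟨i, j, hij, hne⟩ := hinj
      have hmem : (i, j) ∈ (Finset.univ : Finset (Fin k)).offDiag := by simp [hne]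
      refine le_trans ?_ (Finset.single_le_sum
        (f := fun q : Fin k × Fin k => |d (x q.1) (x q.2)|) (fun q _ => abs_nonneg _) hmem)
      simp [hij, hd1]
  rw [corrTail, add_sub_right_comm]
  exact (abs_add_le _ _).trans (by linarith)

/-- `k` stationary walkers coalesce like the Kingman coalescent. -/
theorem abs_stationary_sub_kingmanTail_le (hp : IsStochastic p) (hπ : IsStationaryVec p π)
    {d : V → V → ℝ} {κ W ω : ℝ} (hκ : 0 ≤ κ) (hd1 : ∀ x, d x x = 1) (hds : ∀ x y, d x y = d y x)
    (hdp : ∀ x y, x ≠ y → pairMean p d x y = d x y + κ)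
    (hW : statMean π (fun x y => |d x y|) ≤ W) (hω : ∀ x, sndMean π (fun x y => |d x y|) x ≤ ω)
    {k : ℕ} (hk : 1 ≤ k) (L : ℕ) :
    |prodMean (fun _ : Fin k => π) (fun x => (flow p)^[L] atLeastTwo (Finset.univ.image x)) -
      kingmanTail (k - 1) (L * κ)| ≤
      k ^ 4 * (5 * W + 8 * ω + W * (L * κ) + 2 * κ * (L * κ)) := by
  set w : V → V → ℝ := fun x y => |d x y| with hw
  have hw0 : ∀ x y, 0 ≤ w x y := fun x y => abs_nonneg _
  have hπk : ∀ _ : Fin k, IsProbVec π := fun _ => hπ.prob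
  have hW0 : 0 ≤ W := by
    refine le_trans ?_ hW
    rw [← statMean_const hπ.prob 0]; exact statMean_mono hπ.prob hw0
  have hV : Nonempty V := by
    by_contra h
    rw [not_nonempty_iff] at h
    have := hπ.prob.sum_eq_one
    simp at this
  have hω0 : 0 ≤ ω := by
    refine le_trans ?_ (hω hV.some)
    rw [← sndMean_const hπ.prob 0 hV.some]; exact sndMean_mono hπ.prob hw0 _
  set E4 : Finset V → ℝ := injSum (stepMean p (mergeQuad w)) with hE4
  set E3 : Finset V → ℝ := injSum (stepMean p (mergeTriple w)) with hE3
  set pw : Finset V → ℝ := pairWeight w with hpw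
  set e : Finset V → ℝ := fun S =>
    2 * (E4 S + 4 * E3 S) + (k ^ 2 * κ * pw S + 2 * k ^ 4 * κ ^ 2) with he
  have hLκ : ∀ l : ℕ, (0 : ℝ) ≤ l * κ := fun l => mul_nonneg (Nat.cast_nonneg _) hκ
  have hstep : ∀ (l : ℕ) (S : Finset V), S.card ≤ k →
      |flow p (corrTail d ((l : ℝ) * κ)) S - corrTail d (((l + 1 : ℕ) : ℝ) * κ) S| ≤ e S := by
    intro l S hS
    have := abs_flow_corrTail_sub_le hp hκ (hLκ l) hd1 hds hdp hS
    rw [show ((l + 1 : ℕ) : ℝ) * κ = l * κ + κ by push_cast; ring]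
    exact this
  have htel : ∀ x : Fin k → V, |(flow p)^[L] (corrTail d 0) (Finset.univ.image x) -
      corrTail d (L * κ) (Finset.univ.image x)| ≤
      ∑ l ∈ Finset.range L, (flow p)^[l] e (Finset.univ.image x) := by
    intro x
    have hc : (Finset.univ.image x).card ≤ k := Finset.card_image_le.trans (by simp)
    have := abs_flow_iterate_sub_le hp (F := fun l : ℕ => corrTail d ((l : ℝ) * κ)) hstep L hc
    simpa using this
  -- Three errors: dropping the correction at the end, the accumulated one-step errors, and passing
  -- to the Kingman tail of exactly `k` particles at the start. The argument of `corrTail` is the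
  -- remaining time, from `L * κ` down to 0.
  have hpoint : ∀ x : Fin k → V, |(flow p)^[L] atLeastTwo (Finset.univ.image x) -
      kingmanTail (k - 1) (L * κ)| ≤ (flow p)^[L] pw (Finset.univ.image x) +
      (∑ l ∈ Finset.range L, (flow p)^[l] e (Finset.univ.image x) +
      (pw (Finset.univ.image x) +
        ∑ q ∈ (Finset.univ : Finset (Fin k)).offDiag, w (x q.1) (x q.2))) := by
    intro x
    have h1 := flow_iterate_abs_sub_le hp (abs_atLeastTwo_sub_corrTail_le d) L (Finset.univ.image x)
    have h2 := htel x
    have h3 := abs_corrTail_image_sub_kingmanTail_le hd1 (L * κ) x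
    refine (abs_sub_le _ ((flow p)^[L] (corrTail d 0) (Finset.univ.image x)) _).trans
      (add_le_add h1 ?_)
    exact (abs_sub_le _ (corrTail d (L * κ) (Finset.univ.image x)) _).trans (add_le_add h2 h3)
  have hflowe : ∀ l S, (flow p)^[l] e S = 2 * (flow p)^[l] E4 S + 8 * (flow p)^[l] E3 S +
      (k ^ 2 * κ * (flow p)^[l] pw S + 2 * k ^ 4 * κ ^ 2) := by
    intro l S
    have : e = fun S => (2 * E4 S + 8 * E3 S) + (k ^ 2 * κ * pw S + 2 * k ^ 4 * κ ^ 2) := by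
      funext S; simp only [he]; ring
    rw [this]
    simp only [flow_iterate_add, flow_iterate_const_mul, flow_iterate_const hp]
  -- The merging errors sum up without a factor `L`. The other one-step errors do carry it, but only
  -- together with `κ`, and `L * κ` is the rescaled time.
  have hP4 := sum_prodMean_flow_injSum_le hp hπ (stepMean_nonneg hp (mergeQuad_nonneg hw0)) hW0
    (restMean_stepMean_mergeQuad_le hp hπ hW) k L
  have hP3 := sum_prodMean_flow_injSum_le hp hπ (stepMean_nonneg hp (mergeTriple_nonneg hw0)) hω0
    (restMean_stepMean_mergeTriple_le hp hπ hω) k L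
  have hPw := prodMean_flow_pairWeight_le hp hπ hw0 hW k
  have hPe : prodMean (fun _ : Fin k => π)
      (fun x => ∑ l ∈ Finset.range L, (flow p)^[l] e (Finset.univ.image x)) ≤
      2 * (k ^ 4 * W) + 8 * (k ^ 3 * ω) +
        (L * (k ^ 2 * κ * (k ^ 2 * W)) + L * (2 * k ^ 4 * κ ^ 2)) := by
    rw [prodMean_sum]
    have h1 : ∀ l, prodMean (fun _ : Fin k => π) (fun x => (flow p)^[l] e (Finset.univ.image x)) ≤
        2 * prodMean (fun _ : Fin k => π) (fun x => (flow p)^[l] E4 (Finset.univ.image x)) +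
        8 * prodMean (fun _ : Fin k => π) (fun x => (flow p)^[l] E3 (Finset.univ.image x)) +
        (k ^ 2 * κ * (k ^ 2 * W) + 2 * k ^ 4 * κ ^ 2) := by
      intro l
      rw [prodMean_congr fun x => hflowe l _, prodMean_add, prodMean_add, prodMean_const_mul,
        prodMean_const_mul, prodMean_add, prodMean_const_mul, prodMean_const hπk]
      have := mul_le_mul_of_nonneg_left (hPw l) (by positivity : 0 ≤ (k : ℝ) ^ 2 * κ)
      linarith
    refine (Finset.sum_le_sum fun l _ => h1 l).trans ?_
    rw [Finset.sum_add_distrib, Finset.sum_add_distrib, ← Finset.mul_sum, ← Finset.mul_sum,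
      Finset.sum_const, Finset.card_range, nsmul_eq_mul]
    have := mul_le_mul_of_nonneg_left hP4 (by norm_num : (0 : ℝ) ≤ 2)
    have := mul_le_mul_of_nonneg_left hP3 (by norm_num : (0 : ℝ) ≤ 8)
    norm_num at *
    linarith
  have hPd : prodMean (fun _ : Fin k => π) (fun x => ∑ q ∈ (Finset.univ : Finset (Fin k)).offDiag,
      w (x q.1) (x q.2)) ≤ k ^ 2 * W := by
    rw [prodMean_sum]
    have h1 : ∀ q ∈ (Finset.univ : Finset (Fin k)).offDiag,
        prodMean (fun _ : Fin k => π) (fun x => w (x q.1) (x q.2)) ≤ W := by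
      intro q hq
      have hne := (Finset.mem_offDiag.1 hq).2.2
      have hinj : Function.Injective (![q.1, q.2] : Fin 2 → Fin k) := by
        intro i j
        fin_cases i <;> fin_cases j <;> simp [hne, hne.symm]
      have h := prodMean_comp_injective (μ := fun _ : Fin k => π) hπk hinj
        (fun y => w (y 0) (y 1))
      refine le_trans (le_of_eq (h.trans ?_)) hW
      unfold prodMean statMean
      rw [← (finTwoArrowEquiv V).symm.sum_comp, Fintype.sum_prod_type]
      simp [Fin.prod_univ_two]
    refine (Finset.sum_le_sum h1).trans ?_
    rw [Finset.sum_const, nsmul_eq_mul]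
    refine mul_le_mul_of_nonneg_right ?_ hW0
    rw [Finset.offDiag_card, Finset.card_univ, Fintype.card_fin]
    have : k * k - k ≤ k ^ 2 := by rw [sq]; exact Nat.sub_le _ _
    exact_mod_cast this
  have hfinal : |prodMean (fun _ : Fin k => π)
      (fun x => (flow p)^[L] atLeastTwo (Finset.univ.image x)) - kingmanTail (k - 1) (L * κ)| ≤
      k ^ 2 * W + ((2 * (k ^ 4 * W) + 8 * (k ^ 3 * ω) +
        (L * (k ^ 2 * κ * (k ^ 2 * W)) + L * (2 * k ^ 4 * κ ^ 2))) + (k ^ 2 * W + k ^ 2 * W)) := by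
    rw [← prodMean_const hπk (kingmanTail (k - 1) (L * κ)), ← prodMean_sub]
    refine (prodMean_abs_le hπk _).trans ((prodMean_mono hπk hpoint).trans ?_)
    rw [prodMean_add, prodMean_add, prodMean_add]
    exact add_le_add (hPw L) (add_le_add hPe (add_le_add (hPw 0) hPd))
  refine hfinal.trans ?_
  have hk1 : (1 : ℝ) ≤ k := by exact_mod_cast hk
  have k24 : (k : ℝ) ^ 2 ≤ k ^ 4 := pow_le_pow_right₀ hk1 (by norm_num)
  have k34 : (k : ℝ) ^ 3 ≤ k ^ 4 := pow_le_pow_right₀ hk1 (by norm_num)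
  have a1 := mul_le_mul_of_nonneg_right k24 hW0
  have a2 := mul_le_mul_of_nonneg_right k34 hω0
  nlinarith

end MeanField
end

noncomputable section

/-! ### Reducing the full system to stationary walkers -/

section Reduction

variable {V : Type*} [Fintype V] [DecidableEq V] {p : V → V → ℝ} {π : V → ℝ}
  {ι : Type*} [Fintype ι] [DecidableEq ι]

theorem monotone_atLeastTwo : Monotone (atLeastTwo (V := V)) := by
  intro S S' h
  have := Finset.card_le_card h
  unfold atLeastTwo
  split_ifs <;> first | omega | norm_num

theorem atLeastTwo_nonneg (S : Finset V) : 0 ≤ atLeastTwo S := by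
  unfold atLeastTwo; split_ifs <;> norm_num

theorem atLeastTwo_le_one (S : Finset V) : atLeastTwo S ≤ 1 := by
  unfold atLeastTwo; split_ifs <;> norm_num

theorem flow_iterate_nonneg (hp : IsStochastic p) {F : Finset V → ℝ} (h : ∀ S, 0 ≤ F S) (n : ℕ)
    (S : Finset V) : 0 ≤ (flow p)^[n] F S := by
  have := flow_iterate_mono hp (F := fun _ => 0) h n S
  rwa [flow_iterate_const hp] at this

theorem flow_iterate_le_one (hp : IsStochastic p) {F : Finset V → ℝ} (h : ∀ S, F S ≤ 1) (n : ℕ)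
    (S : Finset V) : (flow p)^[n] F S ≤ 1 := by
  have := flow_iterate_mono hp (G := fun _ => 1) h n S
  rwa [flow_iterate_const hp] at this

theorem flow_iterate_le_of_card_le (hp : IsStochastic p) {F G : Finset V → ℝ} {k : ℕ}
    (h : ∀ S : Finset V, S.card ≤ k → F S ≤ G S) (n : ℕ) (S : Finset V) (hS : S.card ≤ k) :
    (flow p)^[n] F S ≤ (flow p)^[n] G S := by
  induction n generalizing S with
  | zero => exact h S hS
  | succ n ih =>
    rw [Function.iterate_succ_apply', Function.iterate_succ_apply']
    exact flow_le_of_card_le hp ih S hS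

/-- A set with two particles is dominated by the full system; a smaller one can never have two
particles again. -/
theorem flow_iterate_atLeastTwo_le_mul (hp : IsStochastic p) (n : ℕ) (S : Finset V) :
    (flow p)^[n] atLeastTwo S ≤ (flow p)^[n] atLeastTwo Finset.univ * atLeastTwo S := by
  by_cases hS : 2 ≤ S.card
  · rw [show atLeastTwo S = 1 from if_pos hS, mul_one]
    exact monotone_atLeastTwo.flow_iterate hp n (Finset.subset_univ S)
  · rw [show atLeastTwo S = 0 from if_neg hS, mul_zero]
    have := flow_iterate_le_of_card_le hp (F := atLeastTwo) (G := fun _ => 0) (k := 1)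
      (fun S hS => le_of_eq (if_neg (by omega))) n S (by omega)
    rwa [flow_iterate_const hp] at this

/-- Submultiplicativity of the non-coalescence probability. -/
theorem flow_iterate_add_atLeastTwo_le (hp : IsStochastic p) (m n : ℕ) :
    (flow p)^[m + n] atLeastTwo Finset.univ ≤
      (flow p)^[m] atLeastTwo (Finset.univ : Finset V) * (flow p)^[n] atLeastTwo Finset.univ := by
  rw [Function.iterate_add_apply]
  refine (flow_iterate_mono hp (flow_iterate_atLeastTwo_le_mul hp n) m _).trans ?_
  rw [flow_iterate_const_mul, mul_comm]

theorem flow_iterate_mul_atLeastTwo_le (hp : IsStochastic p) (m j : ℕ) :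
    (flow p)^[j * m] atLeastTwo Finset.univ ≤
      ((flow p)^[m] atLeastTwo (Finset.univ : Finset V)) ^ j := by
  induction j with
  | zero => simpa using atLeastTwo_le_one _
  | succ j ih =>
    rw [Nat.succ_mul, pow_succ]
    exact (flow_iterate_add_atLeastTwo_le hp _ _).trans
      (mul_le_mul_of_nonneg_right ih (flow_iterate_nonneg hp atLeastTwo_nonneg _ _))

/-- `k` stationary walkers are dominated by the full system. -/
theorem prodMean_flow_le_univ (hp : IsStochastic p) (hπ : IsProbVec π) (k L : ℕ) :
    prodMean (fun _ : Fin k => π) (fun x => (flow p)^[L] atLeastTwo (Finset.univ.image x)) ≤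
      (flow p)^[L] atLeastTwo Finset.univ := by
  rw [← prodMean_const (μ := fun _ : Fin k => π) (fun _ => hπ)
    ((flow p)^[L] atLeastTwo Finset.univ)]
  exact prodMean_mono (fun _ => hπ) fun x =>
    monotone_atLeastTwo.flow_iterate hp L (Finset.subset_univ _)

/-- After the mixing time at most `k` walkers are dominated by `k` stationary ones. -/
theorem flow_iterate_add_le_of_mixesBy (hp : IsStochastic p) (hπ : IsProbVec π) {T : ℕ} {θ : ℝ}
    (hmix : MixesBy p π T θ) {k : ℕ} (L : ℕ) {S : Finset V} (hS : S.card ≤ k)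
    (hS0 : S.Nonempty) :
    (flow p)^[T + L] atLeastTwo S ≤ prodMean (fun _ : Fin k => π)
      (fun x => (flow p)^[L] atLeastTwo (Finset.univ.image x)) + k * θ := by
  -- Enumerate `S` by exactly `k` walkers; surplus walkers repeat a point of `S`, which is why `S`
  -- must be nonempty.
  obtain ⟨x, hx⟩ : ∃ x : Fin k → V, Finset.univ.image x = S := by
    obtain ⟨s₀, hs₀⟩ := hS0
    refine ⟨fun i => if h : i.1 < S.card then (S.equivFin.symm ⟨i, h⟩ : V) else s₀, ?_⟩
    ext s
    simp only [Finset.mem_image, Finset.mem_univ, true_and]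
    constructor
    · rintro ⟨i, rfl⟩
      split_ifs
      · exact Subtype.prop _
      · exact hs₀
    · intro hs
      refine ⟨⟨S.equivFin ⟨s, hs⟩, (S.equivFin ⟨s, hs⟩).2.trans_le hS⟩, ?_⟩
      simp
  rw [Function.iterate_add_apply, ← hx]
  refine (flow_iterate_image_le hp (monotone_atLeastTwo.flow_iterate hp L) T x).trans ?_
  have h := prodMean_sub_le (μ := fun i => stepPow p T (x i)) (ν := fun _ => π)
    (fun i => hp.stepPow T (x i)) (fun _ => hπ)
    (F := fun y => (flow p)^[L] atLeastTwo (Finset.univ.image y)) (B := 1) (fun y => by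
      rw [abs_of_nonneg (flow_iterate_nonneg hp atLeastTwo_nonneg _ _)]
      exact flow_iterate_le_one hp atLeastTwo_le_one _ _)
  have h2 : ∑ i : Fin k, ∑ v, |stepPow p T (x i) v - π v| ≤ k * θ := by
    refine (Finset.sum_le_sum fun i _ => hmix (x i)).trans ?_
    simp
  linarith

/-- The indicator of more than `k` particles. -/
def moreThan (k : ℕ) (S : Finset V) : ℝ := if k < S.card then 1 else 0

theorem monotone_moreThan (k : ℕ) : Monotone (moreThan (V := V) k) := by
  intro S S' h
  have := Finset.card_le_card h
  unfold moreThan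
  split_ifs <;> first | omega | norm_num

/-- The full system is compared with `k` stationary walkers as soon as it has at most `k`
particles. -/
theorem flow_iterate_univ_le (hp : IsStochastic p) (hπ : IsProbVec π) {T : ℕ} {θ : ℝ}
    (hmix : MixesBy p π T θ) (hθ : 0 ≤ θ) (k L₀ L : ℕ) :
    (flow p)^[L₀ + (T + L)] atLeastTwo Finset.univ ≤ (flow p)^[L₀] (moreThan k) Finset.univ +
      (prodMean (fun _ : Fin k => π)
        (fun x => (flow p)^[L] atLeastTwo (Finset.univ.image x)) + k * θ) := by
  set c := prodMean (fun _ : Fin k => π)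
        (fun x => (flow p)^[L] atLeastTwo (Finset.univ.image x)) + k * θ with hc
  have hc0 : 0 ≤ c := add_nonneg (prodMean_nonneg (fun _ => hπ) fun _ =>
    flow_iterate_nonneg hp atLeastTwo_nonneg _ _) (by positivity)
  rw [Function.iterate_add_apply]
  have h : ∀ S : Finset V, (flow p)^[T + L] atLeastTwo S ≤ moreThan k S + c := by
    intro S
    by_cases hk : k < S.card
    · rw [show moreThan k S = 1 from if_pos hk]
      have := flow_iterate_le_one hp atLeastTwo_le_one (T + L) S
      linarith
    · rw [show moreThan k S = 0 from if_neg hk, zero_add]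
      rcases S.eq_empty_or_nonempty with rfl | hS
      · have := flow_iterate_atLeastTwo_le_mul hp (T + L) ∅
        simp only [atLeastTwo, Finset.card_empty] at this
        simp only [nonpos_iff_eq_zero, OfNat.ofNat_ne_zero, if_false, mul_zero] at this
        exact this.trans hc0
      · exact flow_iterate_add_le_of_mixesBy hp hπ hmix L (not_lt.1 hk) hS
  refine (flow_iterate_mono hp h L₀ _).trans (le_of_eq ?_)
  rw [flow_iterate_add, flow_iterate_const hp]

/-! ### A walker avoiding independent targets -/

open Classical in
/-- The probability that the walker `none` avoids all walkers `some i` up to step `L`. -/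
def avoid (p : V → V → ℝ) : ℕ → (Option ι → V) → ℝ
  | 0, z => if ∃ i, z none = z (some i) then 0 else 1
  | L + 1, z => if ∃ i, z none = z (some i) then 0
      else prodMean (fun o => p (z o)) (avoid p L)

theorem avoid_of_exists (L : ℕ) {z : Option ι → V} (h : ∃ i, z none = z (some i)) :
    avoid p L z = 0 := by
  cases L <;> simp only [avoid] <;> rw [if_pos h]

theorem avoid_zero_of_not {z : Option ι → V} (h : ¬ ∃ i, z none = z (some i)) :
    avoid p 0 z = 1 := by
  simp only [avoid]; rw [if_neg h]

theorem avoid_succ_of_not (L : ℕ) {z : Option ι → V} (h : ¬ ∃ i, z none = z (some i)) :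
    avoid p (L + 1) z = prodMean (fun o => p (z o)) (avoid p L) := by
  simp only [avoid]; rw [if_neg h]

theorem avoid_nonneg (hp : IsStochastic p) (L : ℕ) (z : Option ι → V) : 0 ≤ avoid p L z := by
  induction L generalizing z with
  | zero => by_cases h : ∃ i, z none = z (some i)
            · rw [avoid_of_exists 0 h]
            · rw [avoid_zero_of_not h]; norm_num
  | succ L ih => by_cases h : ∃ i, z none = z (some i)
                 · rw [avoid_of_exists _ h]
                 · rw [avoid_succ_of_not _ h]; exact prodMean_nonneg (fun o => hp _) ih

theorem avoid_le_one (hp : IsStochastic p) (L : ℕ) (z : Option ι → V) : avoid p L z ≤ 1 := by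
  induction L generalizing z with
  | zero => by_cases h : ∃ i, z none = z (some i)
            · rw [avoid_of_exists 0 h]; norm_num
            · rw [avoid_zero_of_not h]
  | succ L ih => by_cases h : ∃ i, z none = z (some i)
                 · rw [avoid_of_exists _ h]; norm_num
                 · rw [avoid_succ_of_not _ h]
                   exact (prodMean_mono (fun o => hp _) ih).trans
                     (prodMean_const (fun o => hp _) 1).le

theorem avoid_add_le (hp : IsStochastic p) (L : ℕ) {L' : ℕ} {c : ℝ}
    (hc : ∀ z : Option ι → V, avoid p L' z ≤ c) (z : Option ι → V) :
    avoid p (L + L') z ≤ avoid p L z * c := by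
  induction L generalizing z with
  | zero =>
    rw [Nat.zero_add]
    by_cases h : ∃ i, z none = z (some i)
    · rw [avoid_of_exists _ h, avoid_of_exists _ h, zero_mul]
    · rw [avoid_zero_of_not h, one_mul]; exact hc z
  | succ L ih =>
    rw [Nat.succ_add]
    by_cases h : ∃ i, z none = z (some i)
    · rw [avoid_of_exists _ h, avoid_of_exists _ h, zero_mul]
    · rw [avoid_succ_of_not _ h, avoid_succ_of_not _ h, mul_comm, ← prodMean_const_mul]
      exact prodMean_mono (fun o => hp _) fun y => (ih y).trans (mul_comm _ _).le

theorem avoid_mul_le (hp : IsStochastic p) {L : ℕ} {c : ℝ}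
    (hc : ∀ z : Option ι → V, avoid p L z ≤ c) (N : ℕ) (z : Option ι → V) :
    avoid p (N * L) z ≤ c ^ N := by
  induction N generalizing z with
  | zero => simpa using avoid_le_one hp 0 z
  | succ N ih =>
    rw [Nat.succ_mul, Nat.add_comm, pow_succ']
    have hc0 : 0 ≤ c := (avoid_nonneg hp L z).trans (hc z)
    exact (avoid_add_le hp L ih z).trans (mul_le_mul_of_nonneg_right (hc z) (pow_nonneg hc0 N))

/-- Hits during the first `T` steps are ignored. -/
theorem avoid_add_le_prodMean (hp : IsStochastic p) (T L : ℕ) (z : Option ι → V) :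
    avoid p (T + L) z ≤ prodMean (fun o => stepPow p T (z o)) (avoid p L) := by
  have key : ∀ T, ∀ z : Option ι → V, avoid p (T + L) z ≤
      (fun F (z : Option ι → V) => prodMean (fun o => p (z o)) F)^[T] (avoid p L) z := by
    intro T
    induction T with
    | zero => intro z; simp
    | succ T ih =>
      intro z
      rw [Nat.succ_add, Function.iterate_succ_apply']
      by_cases h : ∃ i, z none = z (some i)
      · rw [avoid_of_exists _ h]
        exact prodMean_nonneg (fun o => hp _) fun y => (avoid_nonneg hp _ y).trans (ih y)
      · rw [avoid_succ_of_not _ h]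
        exact prodMean_mono (fun o => hp _) ih
  refine (key T z).trans (le_of_eq ?_)
  generalize avoid (ι := ι) p L = F
  clear key
  induction T generalizing F with
  | zero =>
    rw [Function.iterate_zero, id, prodMean, Finset.sum_eq_single z]
    · simp [stepPow]
    · intro y _ hy
      obtain ⟨o, ho⟩ := Function.ne_iff.1 hy
      rw [Finset.prod_eq_zero (Finset.mem_univ o), zero_mul]
      simp [stepPow, Ne.symm ho]
    · simp
  | succ T ih =>
    rw [Function.iterate_succ_apply, ih, prodMean_prodMean]
    rfl

theorem avoid_add_le_of_mixesBy (hp : IsStochastic p) (hπ : IsProbVec π) {T : ℕ} {θ : ℝ}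
    (hmix : MixesBy p π T θ) (L : ℕ) (z : Option ι → V) :
    avoid p (T + L) z ≤ prodMean (fun _ : Option ι => π) (avoid p L) +
      (Fintype.card ι + 1) * θ := by
  refine (avoid_add_le_prodMean hp T L z).trans ?_
  have h := prodMean_sub_le (μ := fun o => stepPow p T (z o)) (ν := fun _ => π)
    (fun o => hp.stepPow T (z o)) (fun _ => hπ) (F := avoid p L) (B := 1) (fun y => by
      rw [abs_of_nonneg (avoid_nonneg hp _ _)]
      exact avoid_le_one hp _ _)
  have h2 : ∑ o : Option ι, ∑ v, |stepPow p T (z o) v - π v| ≤ (Fintype.card ι + 1) * θ := by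
    refine (Finset.sum_le_sum fun o _ => hmix (z o)).trans ?_
    simp
  linarith

/-- If more than `k` particles remain, some walker has avoided `k` given ones. -/
theorem flow_iterate_moreThan_le (hp : IsStochastic p) {k : ℕ} (L : ℕ) (S : Finset V)
    (x : Fin k → V) (hx : ∀ i, x i ∈ S) :
    (flow p)^[L] (moreThan k) S ≤ ∑ y ∈ S, avoid p L (fun o : Option (Fin k) => o.elim y x) := by
  induction L generalizing S x with
  | zero =>
    by_cases hk : k < S.card
    · rw [Function.iterate_zero, id, show moreThan k S = 1 from if_pos hk]
      obtain ⟨y, hyS, hy⟩ : ∃ y ∈ S, y ∉ Finset.univ.image x := by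
        by_contra! h
        have := Finset.card_le_card (show S ⊆ Finset.univ.image x from h)
        have := Finset.card_image_le (s := Finset.univ) (f := x)
        simp at this; omega
      refine le_trans (le_of_eq ?_) (Finset.single_le_sum
        (f := fun y => avoid p 0 (fun o : Option (Fin k) => o.elim y x))
        (fun y _ => avoid_nonneg hp _ _) hyS)
      refine (avoid_zero_of_not ?_).symm
      rintro ⟨i, hi⟩
      exact hy (Finset.mem_image.2 ⟨i, Finset.mem_univ _, hi.symm⟩)
    · rw [Function.iterate_zero, id, show moreThan k S = 0 from if_neg hk]
      exact Finset.sum_nonneg fun y _ => avoid_nonneg hp _ _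
  | succ L ih =>
    -- The `k` targets and the particles away from them together occupy all of `S` and are moved as
    -- independent walkers, which dominates the flow. The moved targets serve as targets for the
    -- induction hypothesis.
    set R := S \ Finset.univ.image x with hR
    set w : Fin k ⊕ R → V := Sum.elim x (fun r => r.1) with hw
    have hS : Finset.univ.image w = S := by
      ext s
      simp only [Finset.mem_image, Finset.mem_univ, true_and, Sum.exists, hw, Sum.elim_inl,
        Sum.elim_inr]
      constructor
      · rintro (⟨i, rfl⟩ | ⟨r, rfl⟩)
        · exact hx i
        · exact (Finset.mem_sdiff.1 r.2).1
      · intro hs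
        by_cases h : s ∈ Finset.univ.image x
        · obtain ⟨i, -, hi⟩ := Finset.mem_image.1 h
          exact Or.inl ⟨i, hi⟩
        · exact Or.inr ⟨⟨s, Finset.mem_sdiff.2 ⟨hs, h⟩⟩, rfl⟩
    have h1 : (flow p)^[L + 1] (moreThan k) S ≤ prodMean (fun i => p (w i))
        (fun y => ∑ r : R, avoid p L
          (fun o : Option (Fin k) => o.elim (y (Sum.inr r)) fun i => y (Sum.inl i))) := by
      rw [Function.iterate_succ_apply']
      conv_lhs => rw [← hS]
      refine (flow_image_le hp ((monotone_moreThan k).flow_iterate hp L) w).trans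
        (prodMean_mono (fun i => hp _) fun y => ?_)
      refine (ih (Finset.univ.image y) (fun i => y (Sum.inl i))
        fun i => Finset.mem_image_of_mem _ (Finset.mem_univ _)).trans ?_
      set g : V → ℝ := fun s =>
        avoid p L (fun o : Option (Fin k) => o.elim s fun i => y (Sum.inl i)) with hg
      have hg0 : ∀ s, 0 ≤ g s := fun s => avoid_nonneg hp _ _
      -- A particle at the site of a target has `avoid` equal to 0, so only the walkers from `R`
      -- matter.
      have h2 : ∑ s ∈ Finset.univ.image y, g s ≤
          ∑ s ∈ (Finset.univ : Finset R).image (fun r => y (Sum.inr r)), g s := by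
        rw [← Finset.sum_filter_ne_zero]
        refine Finset.sum_le_sum_of_subset_of_nonneg (fun s hs => ?_) fun s _ _ => hg0 s
        obtain ⟨hs, hne⟩ := Finset.mem_filter.1 hs
        obtain ⟨i, -, rfl⟩ := Finset.mem_image.1 hs
        rcases i with i | r
        · exact absurd (avoid_of_exists L ⟨i, rfl⟩) hne
        · exact Finset.mem_image_of_mem _ (Finset.mem_univ _)
      refine h2.trans ?_
      exact Finset.sum_image_le_of_nonneg (g := fun r : R => y (Sum.inr r)) (f := g) fun s _ => hg0 s
    refine h1.trans ?_
    rw [prodMean_sum]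
    have h3 : ∀ r : R, prodMean (fun i => p (w i)) (fun y => avoid p L
          (fun o : Option (Fin k) => o.elim (y (Sum.inr r)) fun i => y (Sum.inl i))) =
        avoid p (L + 1) (fun o : Option (Fin k) => o.elim r.1 x) := by
      intro r
      rw [avoid_succ_of_not]
      · have hinj : Function.Injective
            (fun o : Option (Fin k) => o.elim (Sum.inr r : Fin k ⊕ R) Sum.inl) := by
          intro o o'
          rcases o with _ | i <;> rcases o' with _ | j <;> simp
        have := prodMean_comp_injective (μ := fun i => p (w i)) (fun i => hp _) hinj (avoid p L)
        refine Eq.trans (prodMean_congr fun y => ?_) (this.trans ?_)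
        · congr 1; funext o; cases o <;> rfl
        · congr 1; funext o; cases o <;> rfl
      · rintro ⟨i, hi⟩
        exact (Finset.mem_sdiff.1 r.2).2 (Finset.mem_image.2 ⟨i, Finset.mem_univ _, hi.symm⟩)
    rw [Finset.sum_congr rfl fun r _ => h3 r, Finset.sum_coe_sort R
      (fun s => avoid p (L + 1) (fun o : Option (Fin k) => o.elim s x))]
    exact Finset.sum_le_sum_of_subset_of_nonneg Finset.sdiff_subset
      fun y _ _ => avoid_nonneg hp _ _

/-- The probability that walker `0` meets walker `1` up to step `L` and, at the same step or later,
walker `2`. -/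
def hitThen (p : V → V → ℝ) : ℕ → (Fin 3 → V) → ℝ
  | 0, z => if z 0 = z 1 then 1 - noMeet p 0 (z 0) (z 2) else 0
  | L + 1, z => if z 0 = z 1 then 1 - noMeet p (L + 1) (z 0) (z 2)
      else prodMean (fun i => p (z i)) (hitThen p L)

theorem hitThen_of_eq (L : ℕ) {z : Fin 3 → V} (h : z 0 = z 1) :
    hitThen p L z = 1 - noMeet p L (z 0) (z 2) := by
  cases L <;> simp [hitThen, h]

theorem hitThen_nonneg (hp : IsStochastic p) (L : ℕ) (z : Fin 3 → V) : 0 ≤ hitThen p L z := by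
  induction L generalizing z with
  | zero =>
    simp only [hitThen]; split_ifs
    · linarith [noMeet_le_one hp 0 (z 0) (z 2)]
    · exact le_rfl
  | succ L ih =>
    simp only [hitThen]; split_ifs
    · linarith [noMeet_le_one hp (L + 1) (z 0) (z 2)]
    · exact prodMean_nonneg (fun i => hp _) ih

theorem noMeet_succ_of_ne {x y : V} (h : x ≠ y) (L : ℕ) :
    noMeet p (L + 1) x y = pairMean p (noMeet p L) x y := by
  simp [noMeet, h]

theorem prodMean_noMeet (hp : IsStochastic p) {κ : Type*} [Fintype κ] [DecidableEq κ]
    (z : κ → V) {i j : κ} (hij : i ≠ j) (f : V → V → ℝ) :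
    prodMean (fun o => p (z o)) (fun y => f (y i) (y j)) = pairMean p f (z i) (z j) := by
  have hinj : Function.Injective (![i, j] : Fin 2 → κ) := by
    intro a b
    fin_cases a <;> fin_cases b <;> simp [hij, hij.symm]
  have h := prodMean_comp_injective (μ := fun o => p (z o)) (fun o => hp _) hinj
    (fun y => f (y 0) (y 1))
  have h2 := pairMean_eq_prodMean p f ![z i, z j]
  refine Eq.trans h (Eq.trans ?_ h2.symm)
  congr 1; funext a; fin_cases a <;> rfl

/-- A Bonferroni inequality for the number of targets that are hit. -/
theorem sum_hit_sub_sum_hitThen_le (hp : IsStochastic p) (L : ℕ) (z : Option ι → V) :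
    ∑ i, (1 - noMeet p L (z none) (z (some i))) -
      ∑ q ∈ (Finset.univ : Finset ι).offDiag,
        hitThen p L ![z none, z (some q.1), z (some q.2)] ≤ 1 - avoid p L z := by
  induction L generalizing z with
  | zero =>
    by_cases h : ∃ i, z none = z (some i)
    · rw [avoid_of_exists _ h]; exact sum_hit_sub_le_of_hit hp 0 z h
    · rw [avoid_zero_of_not h]
      have h1 : ∀ i, noMeet p 0 (z none) (z (some i)) = 1 := fun i => by
        simp only [noMeet]; exact if_neg fun hi => h ⟨i, hi⟩
      simp only [h1, sub_self, Finset.sum_const_zero, zero_sub, Left.neg_nonpos_iff]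
      exact Finset.sum_nonneg fun q _ => hitThen_nonneg hp _ _
  | succ L ih =>
    by_cases h : ∃ i, z none = z (some i)
    · rw [avoid_of_exists _ h]; exact sum_hit_sub_le_of_hit hp (L + 1) z h
    · rw [avoid_succ_of_not _ h]
      have h0 : ∀ i, z none ≠ z (some i) := fun i hi => h ⟨i, hi⟩
      have h1 := prodMean_mono (μ := fun o => p (z o)) (fun o => hp _) ih
      rw [prodMean_sub, prodMean_sum, prodMean_sum, prodMean_sub, prodMean_const fun o => hp _] at h1
      refine le_trans (le_of_eq ?_) h1
      congr 1
      · refine Finset.sum_congr rfl fun i _ => ?_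
        rw [prodMean_sub, prodMean_const fun o => hp _, noMeet_succ_of_ne (h0 i),
          prodMean_noMeet hp z (by simp)]
      · refine Finset.sum_congr rfl fun q hq => ?_
        have hne := (Finset.mem_offDiag.1 hq).2.2
        have hinj : Function.Injective (![none, some q.1, some q.2] : Fin 3 → Option ι) := by
          intro a b
          fin_cases a <;> fin_cases b <;> simp [hne, hne.symm]
        have h2 := prodMean_comp_injective (μ := fun o => p (z o)) (fun o => hp _) hinj
          (hitThen p L)
        have h3 : ∀ y : Option ι → V, (fun j => y ((![none, some q.1, some q.2] :
            Fin 3 → Option ι) j)) = ![y none, y (some q.1), y (some q.2)] := by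
          intro y; funext j; fin_cases j <;> rfl
        simp only [h3] at h2
        rw [h2]
        have h4 : hitThen p (L + 1) ![z none, z (some q.1), z (some q.2)] =
            prodMean (fun i => p ((![z none, z (some q.1), z (some q.2)] : Fin 3 → V) i))
              (hitThen p L) := by
          simp only [hitThen]
          rw [if_neg]
          exact h0 q.1
        rw [h4]
        congr 1; funext j; fin_cases j <;> rfl
where
  sum_hit_sub_le_of_hit (hp : IsStochastic p) (L : ℕ) (z : Option ι → V)
      (h : ∃ i, z none = z (some i)) : ∑ i, (1 - noMeet p L (z none) (z (some i))) -
      ∑ q ∈ (Finset.univ : Finset ι).offDiag,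
        hitThen p L ![z none, z (some q.1), z (some q.2)] ≤ 1 - 0 := by
    obtain ⟨i, hi⟩ := h
    -- Target `i` accounts for the 1 on the right. A hit of another target `j` is cancelled by the
    -- ordered pair `(i, j)`, since `hitThen` counts from this very step on.
    rw [← Finset.add_sum_erase _ _ (Finset.mem_univ i), hi, noMeet_self]
    have h1 : ∑ j ∈ Finset.univ.erase i, (1 - noMeet p L (z (some i)) (z (some j))) ≤
        ∑ q ∈ (Finset.univ : Finset ι).offDiag,
          hitThen p L ![z (some i), z (some q.1), z (some q.2)] := by
      have h2 : ∀ j ∈ Finset.univ.erase i, (1 - noMeet p L (z (some i)) (z (some j))) =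
          hitThen p L ![z (some i), z (some i), z (some j)] := fun j _ => by
        rw [hitThen_of_eq] <;> simp
      rw [Finset.sum_congr rfl h2]
      rw [← Finset.sum_image (s := Finset.univ.erase i) (g := fun j => (i, j))
        (f := fun q : ι × ι => hitThen p L ![z (some i), z (some q.1), z (some q.2)])
        (fun a _ b _ hab => (Prod.mk.inj hab).2)]
      refine Finset.sum_le_sum_of_subset_of_nonneg ?_ fun q _ _ => hitThen_nonneg hp _ _
      intro q hq
      obtain ⟨j, hj, rfl⟩ := Finset.mem_image.1 hq
      simp [Finset.mem_offDiag, (Finset.ne_of_mem_erase hj).symm]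
    linarith

/-- When the first target is met, the second is stationary and independent of where this happens, so
it is met in the remaining at most `D` steps with probability at most `ρ`. -/
theorem restMean_hitThen_le (hp : IsStochastic p) (hπ : IsStationaryVec p π) {ρ : ℝ} {D : ℕ}
    (hρ : ∀ x, sndMean π (fun x y => 1 - noMeet p D x y) x ≤ ρ) {L : ℕ} (hL : L ≤ D) (a b : V) :
    restMean π (hitThen p L) a b ≤ ρ * (1 - noMeet p L a b) := by
  have hself : ∀ L ≤ D, ∀ a, restMean π (hitThen p L) a a ≤ ρ * (1 - noMeet p L a a) := by
    intro L hL a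
    rw [noMeet_self, sub_zero, mul_one]
    refine le_trans (le_of_eq ?_) ((sndMean_mono hπ.prob (f := fun x y => 1 - noMeet p L x y)
      (fun x y => sub_le_sub_left (noMeet_antitone hp x y hL) 1) a).trans (hρ a))
    unfold restMean
    rw [prodMean_congr fun z => hitThen_of_eq L (by rfl)]
    unfold prodMean sndMean
    rw [← (Equiv.funUnique (Fin 1) V).symm.sum_comp]
    simp only [Finset.univ_unique, Fin.default_eq_zero, Finset.prod_singleton]
    rfl
  induction L generalizing a b with
  | zero =>
    by_cases hab : a = b
    · subst hab; exact hself 0 hL a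
    · have h1 : ∀ z : Fin 1 → V, hitThen p 0 (Fin.cons a (Fin.cons b z)) = 0 := by
        intro z; simp only [hitThen]; exact if_neg hab
      unfold restMean
      rw [prodMean_congr h1, prodMean_const (fun _ => hπ.prob)]
      simp [noMeet, hab]
  | succ L ih =>
    by_cases hab : a = b
    · subst hab; exact hself _ hL a
    · have h1 : ∀ z : Fin 1 → V, hitThen p (L + 1) (Fin.cons a (Fin.cons b z)) =
          prodMean (fun i => p ((Fin.cons a (Fin.cons b z) : Fin 3 → V) i)) (hitThen p L) := by
        intro z; simp only [hitThen]; exact if_neg hab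
      have h2 : restMean π (hitThen p (L + 1)) a b =
          restMean π (fun x => prodMean (fun i => p (x i)) (hitThen p L)) a b := by
        unfold restMean
        exact prodMean_congr h1
      rw [h2, restMean_step hπ]
      refine (pairMean_mono hp (ih (by omega)) a b).trans (le_of_eq ?_)
      rw [pairMean_const_mul, pairMean_sub, pairMean_const hp, noMeet_succ_of_ne hab]

/-- A stationary walker is likely to hit one of `k` stationary targets. -/
theorem prodMean_avoid_le (hp : IsStochastic p) (hπ : IsStationaryVec p π) {ρ : ℝ} {D : ℕ}
    (hρ : ∀ x, sndMean π (fun x y => 1 - noMeet p D x y) x ≤ ρ) (hρ1 : Fintype.card ι * ρ ≤ 1 / 2) :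
    prodMean (fun _ : Option ι => π) (avoid p D) ≤ 1 - Fintype.card ι * statHit p π D / 2 := by
  have hπo : ∀ _ : Option ι, IsProbVec π := fun _ => hπ.prob
  have h1 := prodMean_mono hπo (sum_hit_sub_sum_hitThen_le hp D)
  rw [prodMean_sub, prodMean_sum, prodMean_sum, prodMean_sub, prodMean_const hπo] at h1
  have h2 : ∀ i : ι, prodMean (fun _ : Option ι => π)
      (fun z => 1 - noMeet p D (z none) (z (some i))) = statHit p π D := by
    intro i
    rw [prodMean_sub, prodMean_const hπo, statHit]
    congr 1
    have hinj : Function.Injective (![none, some i] : Fin 2 → Option ι) := by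
      intro a b
      fin_cases a <;> fin_cases b <;> simp
    have h := prodMean_comp_injective hπo hinj (fun y => noMeet p D (y 0) (y 1))
    refine Eq.trans h ?_
    unfold prodMean statMean
    rw [← (finTwoArrowEquiv V).symm.sum_comp, Fintype.sum_prod_type]
    simp [Fin.prod_univ_two]
  have h3 : ∀ q ∈ (Finset.univ : Finset ι).offDiag, prodMean (fun _ : Option ι => π)
      (fun z => hitThen p D ![z none, z (some q.1), z (some q.2)]) ≤ ρ * statHit p π D := by
    intro q hq
    have hne := (Finset.mem_offDiag.1 hq).2.2
    have hinj : Function.Injective (![none, some q.1, some q.2] : Fin 3 → Option ι) := by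
      intro a b
      fin_cases a <;> fin_cases b <;> simp [hne, hne.symm]
    have h2 := prodMean_comp_injective hπo hinj (hitThen p D)
    have h3 : ∀ y : Option ι → V, (fun j => y ((![none, some q.1, some q.2] :
        Fin 3 → Option ι) j)) = ![y none, y (some q.1), y (some q.2)] := by
      intro y; funext j; fin_cases j <;> rfl
    simp only [h3] at h2
    rw [h2, prodMean_eq_statMean_restMean]
    refine (statMean_mono hπ.prob (restMean_hitThen_le hp hπ hρ le_rfl)).trans (le_of_eq ?_)
    rw [statMean_const_mul, statMean_sub, statMean_const hπ.prob, statHit]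
  have hs0 : 0 ≤ statHit p π D := by
    rw [statHit, sub_nonneg, ← statMean_const hπ.prob 1]
    exact statMean_mono hπ.prob (noMeet_le_one hp D)
  rw [Finset.sum_congr rfl fun i _ => h2 i, Finset.sum_const, Finset.card_univ, nsmul_eq_mul] at h1
  have h4 := Finset.sum_le_sum h3
  rw [Finset.sum_const, nsmul_eq_mul] at h4
  set N : ℝ := (Fintype.card ι : ℝ) with hN
  have hρ0 : 0 ≤ ρ := by
    obtain ⟨x⟩ : Nonempty V := by
      by_contra h
      rw [not_nonempty_iff] at h
      have := hπ.prob.sum_eq_one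
      simp at this
    refine le_trans ?_ (hρ x)
    rw [← sndMean_const hπ.prob 0 x]
    exact sndMean_mono hπ.prob (fun a b => by linarith [noMeet_le_one hp D a b]) x
  have hcard : (((Finset.univ : Finset ι).offDiag.card : ℕ) : ℝ) ≤ N * N := by
    rw [Finset.offDiag_card, Finset.card_univ, hN]
    exact_mod_cast Nat.sub_le _ _
  -- The assumption that the number of targets times `ρ` is at most `1/2` makes the pair term of the
  -- Bonferroni inequality at most half of the main term.
  have h5 : (((Finset.univ : Finset ι).offDiag.card : ℕ) : ℝ) * (ρ * statHit p π D) ≤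
      N * statHit p π D / 2 := by
    have hN0 : 0 ≤ N := Nat.cast_nonneg _
    calc _ ≤ N * N * (ρ * statHit p π D) := by gcongr
      _ = (N * ρ) * (N * statHit p π D) := by ring
      _ ≤ 1 / 2 * (N * statHit p π D) := by gcongr
      _ = _ := by ring
  linarith

/-- After `N` blocks of mixing and hitting, few particles remain. -/
theorem flow_iterate_moreThan_univ_le (hp : IsStochastic p) (hπ : IsStationaryVec p π) {ρ θ : ℝ}
    {T D k : ℕ} (hmix : MixesBy p π T θ)
    (hρ : ∀ x, sndMean π (fun x y => 1 - noMeet p D x y) x ≤ ρ) (hk : 1 ≤ k) (hρ1 : k * ρ ≤ 1 / 2)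
    (hθ : 8 * θ ≤ statHit p π D) (N : ℕ) :
    (flow p)^[N * (T + D)] (moreThan k) Finset.univ ≤
      Fintype.card V * Real.exp (-(N * (k * statHit p π D / 4))) := by
  obtain ⟨x₀⟩ : Nonempty V := by
    by_contra h
    rw [not_nonempty_iff] at h
    have := hπ.prob.sum_eq_one
    simp at this
  have hk1 : (1 : ℝ) ≤ k := by exact_mod_cast hk
  have h1 : ∀ z : Option (Fin k) → V, avoid p (T + D) z ≤
      Real.exp (-(k * statHit p π D / 4)) := by
    intro z
    have h2 := avoid_add_le_of_mixesBy hp hπ.prob hmix D z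
    have h3 := prodMean_avoid_le (ι := Fin k) hp hπ hρ (by simpa using hρ1)
    rw [Fintype.card_fin] at h2 h3
    have h4 := Real.add_one_le_exp (-(k * statHit p π D / 4))
    have hθ0 : 0 ≤ θ := le_trans (Finset.sum_nonneg fun _ _ => abs_nonneg _) (hmix x₀)
    -- By `k + 1 ≤ 2 k` and `8 θ ≤ statHit` the mixing error uses up at most half of the gain `k *
    -- statHit / 2`; the other half becomes the exponent.
    have h5 : ((k : ℝ) + 1) * θ ≤ k * statHit p π D / 4 := by nlinarith
    linarith
  refine (flow_iterate_moreThan_le hp _ Finset.univ (fun _ : Fin k => x₀)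
    fun _ => Finset.mem_univ _).trans ?_
  refine (Finset.sum_le_sum fun y _ => avoid_mul_le hp h1 N _).trans (le_of_eq ?_)
  rw [Finset.sum_const, Finset.card_univ, nsmul_eq_mul, ← Real.exp_nat_mul]
  congr 2
  ring

end Reduction
end

noncomputable section

/-! ### Geometric decay of the non-meeting probability -/

section Decay

variable {V : Type*} [Fintype V] [DecidableEq V] {p : V → V → ℝ} {π : V → ℝ}

theorem noMeet_add_le_pairMean (hp : IsStochastic p) (N L : ℕ) (x y : V) :
    noMeet p (N + L) x y ≤ pairMean (stepPow p N) (noMeet p L) x y := by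
  rw [← pairMean_iterate_eq]
  induction N generalizing x y with
  | zero => simp
  | succ N ih =>
    rw [Function.iterate_succ_apply', Nat.succ_add]
    have h0 : ∀ x y, 0 ≤ (pairMean p)^[N] (noMeet p L) x y :=
      fun x y => (noMeet_nonneg hp _ x y).trans (ih x y)
    by_cases hxy : x = y
    · subst hxy
      rw [noMeet_self, ← pairMean_const hp 0 x x]
      exact pairMean_mono hp h0 x x
    · rw [noMeet_succ_of_ne hxy]
      exact pairMean_mono hp ih x y

/-- Whatever the walkers do inside a block of `N` steps, they coincide at its end with probability
at least `c`. -/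
theorem noMeet_mul_le (hp : IsStochastic p) {N : ℕ} {c : ℝ} (hc1 : c ≤ 1)
    (hc : ∀ x y, c ≤ hitStep (stepPow p N) x y) (j : ℕ) (x y : V) :
    noMeet p (N * j) x y ≤ (1 - c) ^ j := by
  induction j generalizing x y with
  | zero => simpa using noMeet_le_one hp 0 x y
  | succ j ih =>
    rw [Nat.mul_succ, Nat.add_comm]
    refine (noMeet_add_le_pairMean hp N _ x y).trans ?_
    have h0 : (0 : ℝ) ≤ (1 - c) ^ j := pow_nonneg (by linarith) j
    have h1 : ∀ x y, noMeet p (N * j) x y ≤ (1 - c) ^ j * (1 - if x = y then 1 else 0) := by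
      intro x y
      by_cases h : x = y
      · subst h; simp [noMeet_self]
      · simpa [h] using ih x y
    refine (pairMean_mono (hp.stepPow N) h1 x y).trans ?_
    rw [pairMean_const_mul, pairMean_sub, pairMean_const (hp.stepPow N), pow_succ]
    exact mul_le_mul_of_nonneg_left (sub_le_sub_left (hc x y) 1) h0

theorem hitStep_le_one (hp : IsStochastic p) (x y : V) : hitStep p x y ≤ 1 := by
  refine (pairMean_mono hp (g := fun _ _ => 1) (fun x y => ?_) x y).trans
    (pairMean_const hp 1 x y).le
  split_ifs <;> norm_num

theorem exists_pos_le_hitStep [Nonempty V] (hpos : ∀ x y, 0 < p x y) :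
    ∃ c : ℝ, 0 < c ∧ ∀ x y, c ≤ hitStep p x y := by
  have h : ∀ q : V × V, 0 < hitStep p q.1 q.2 := by
    intro q
    have h1 : hitStep p q.1 q.2 = ∑ z, p q.1 z * p q.2 z := by
      simp [hitStep, pairMean]
    rw [h1]
    exact Finset.sum_pos (fun z _ => mul_pos (hpos _ _) (hpos _ _)) Finset.univ_nonempty
  obtain ⟨q, hq⟩ := Finite.exists_min fun q : V × V => hitStep p q.1 q.2
  exact ⟨_, h q, fun x y => hq (x, y)⟩

theorem stepPow_one (p : V → V → ℝ) : stepPow p 1 = p := by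
  funext x y
  simp [stepPow]

theorem summable_noMeet (hp : IsStochastic p) (hpos : ∀ x y, 0 < p x y) (x y : V) :
    Summable fun l => noMeet p l x y := by
  have : Nonempty V := ⟨x⟩
  obtain ⟨c, hc0, hc⟩ := exists_pos_le_hitStep hpos
  have hc1 : c ≤ 1 := (hc x x).trans (hitStep_le_one hp x x)
  refine Summable.of_nonneg_of_le (fun l => noMeet_nonneg hp l x y) (fun l => ?_)
    (summable_geometric_of_lt_one (r := 1 - c) (by linarith) (by linarith))
  have := noMeet_mul_le hp (N := 1) hc1 (by rwa [stepPow_one]) l x y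
  rwa [one_mul] at this

/-- Union bound over ordered pairs of particles, each moving as two walkers killed when they meet.
-/
theorem flow_iterate_atLeastTwo_le_sum_noMeet (hp : IsStochastic p) (L : ℕ) (S : Finset V) :
    (flow p)^[L] atLeastTwo S ≤ ∑ q ∈ S.offDiag, noMeet p L q.1 q.2 := by
  have h1 : ∀ S : Finset V, atLeastTwo S ≤ injSum (fun _ : Fin 2 → V => 1) S := by
    intro S
    have h := pairWeight_eq (V := V) (fun _ _ => 1) S
    rw [pairWeight] at h
    rw [h, atLeastTwo]
    split_ifs with h2
    · obtain ⟨a, ha, b, hb, hab⟩ := Finset.one_lt_card.1 h2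
      exact Finset.single_le_sum (f := fun _ : V × V => (1 : ℝ)) (fun _ _ => zero_le_one)
        (Finset.mem_offDiag.2 ⟨ha, hb, hab⟩ : (a, b) ∈ S.offDiag)
    · exact Finset.sum_nonneg fun _ _ => zero_le_one
  have h2 : ∀ L, ∀ x : Fin 2 → V, Function.Injective x →
      (killStep p)^[L] (fun _ => 1) x ≤ noMeet p L (x 0) (x 1) := by
    intro L
    induction L with
    | zero =>
      intro x hx
      have : x 0 ≠ x 1 := fun h => by simpa using hx h
      simp [noMeet, this]
    | succ L ih =>
      intro x hx
      have hne : x 0 ≠ x 1 := fun h => by simpa using hx h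
      rw [Function.iterate_succ_apply', noMeet_succ_of_ne hne, pairMean_eq_prodMean, killStep]
      refine prodMean_mono (fun i => hp _) fun y => ?_
      unfold onInj
      split_ifs with hy
      · exact ih y hy
      · exact noMeet_nonneg hp _ _ _
  refine (flow_iterate_mono hp h1 L S).trans ?_
  refine (flow_iterate_injSum_le hp (fun _ => zero_le_one) L S).trans ?_
  have h3 := pairWeight_eq (noMeet p L) S
  rw [← h3, pairWeight]
  exact Finset.sum_le_sum fun x hx => h2 L x (mem_injTuples.1 hx).2

end Decay

/-! ### Approximation by the Kingman coalescent in discrete time -/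

section Discrete

variable {V : Type*} [Fintype V] [DecidableEq V] {p : V → V → ℝ} {π : V → ℝ}

/-- The deviation is `meetDev`, with drift `κ = 1 / statMeet`, `W = 2 η` and `ω = 2 η + 2 (θ + ρ)`;
then `5 W + 8 ω = 26 η + 16 (θ + ρ)`. -/
theorem abs_stationary_sub_kingmanTail_le_of_mixesBy (hp : IsStochastic p)
    (hπ : IsStationaryVec p π) (hs : ∀ x y, Summable fun l => noMeet p l x y)
    (hm : 0 < statMeet p π) {T : ℕ} {θ η ρ : ℝ} (hmix : MixesBy p π T θ) (hθ0 : 0 ≤ θ)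
    (hη : 2 * T / statMeet p π + 4 * θ ≤ η) (hη1 : η ≤ 1)
    (hρ : ∀ x, sndMean π (fun x y => 1 - noMeet p T x y) x ≤ ρ) {k : ℕ} (hk : 1 ≤ k) (L : ℕ) :
    |prodMean (fun _ : Fin k => π) (fun x => (flow p)^[L] atLeastTwo (Finset.univ.image x)) -
      kingmanTail (k - 1) (L / statMeet p π)| ≤
      k ^ 4 * (26 * η + 16 * (θ + ρ) + 2 * η * (L / statMeet p π) +
        2 * (statMeet p π)⁻¹ * (L / statMeet p π)) := by
  have hη0 : 0 ≤ η := le_trans (by positivity) hη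
  have hT0 : (0 : ℝ) ≤ 2 * T / statMeet p π := by positivity
  have hB : ∀ x y, meanMeet p x y ≤ statMeet p π * (1 + η) := fun x y =>
    (meanMeet_le_of_mixesBy hs hp hπ.prob hmix (by linarith) hm x y).trans
      (mul_le_mul_of_nonneg_left (by linarith) hm.le)
  have hA := abs_stationary_sub_kingmanTail_le hp hπ (d := meetDev p π) (inv_nonneg.2 hm.le)
    (meetDev_self p π) (meetDev_comm p π) (fun x y h => pairMean_meetDev hp hs h)
    (statMean_abs_meetDev_le hπ.prob hm hη0 hB)
    (sndMean_abs_meetDev_le hp hπ hs hm hη0 hη1 hB hmix hρ) hk L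
  rw [← div_eq_mul_inv] at hA
  refine hA.trans (le_of_eq ?_)
  ring

/-- A lower bound for the meeting probability of two stationary walkers. -/
theorem div_le_statHit (hp : IsStochastic p) (hπ : IsStationaryVec p π)
    (hs : ∀ x y, Summable fun l => noMeet p l x y) (hm : 0 < statMeet p π)
    (hB : ∀ x y, meanMeet p x y ≤ statMeet p π * 2) {D : ℕ} (hD : statHit p π D ≤ 1 / 2) :
    D / (4 * statMeet p π) ≤ statHit p π D := by
  have h := mul_le_mul_statHit hp hπ hs hB D
  rw [div_le_iff₀ (by positivity)]
  have : (D : ℝ) * (1 / 2) ≤ D * (1 - statHit p π D) :=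
    mul_le_mul_of_nonneg_left (by linarith) (Nat.cast_nonneg _)
  linarith

end Discrete

/-! ### Semigroups of transition probabilities -/

theorem stepPow_eq_of_add {V : Type*} [Fintype V] [DecidableEq V] {p : ℝ≥0 → V → V → ℝ}
    (h0 : ∀ x y, p 0 x y = if x = y then 1 else 0)
    (hadd : ∀ s t x y, p (s + t) x y = ∑ z, p s x z * p t z y) (h : ℝ≥0) (n : ℕ) :
    stepPow (p h) n = p (n * h) := by
  induction n with
  | zero => funext x y; simp [stepPow, h0]
  | succ n ih =>
    funext x y
    rw [show ((n + 1 : ℕ) : ℝ≥0) * h = n * h + h by push_cast; ring, hadd]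
    simp only [stepPow, ih]

/-- `p t` are the transition probabilities of an irreducible walk on a finite set, with
stationary law `π` and jump rates at most `2`. -/
structure IsWalkSemigroup {V : Type*} [Fintype V] [DecidableEq V] (p : ℝ≥0 → V → V → ℝ)
    (π : V → ℝ) : Prop where
  stochastic : ∀ t, IsStochastic (p t)
  zero : ∀ x y, p 0 x y = if x = y then 1 else 0
  add : ∀ s t x y, p (s + t) x y = ∑ z, p s x z * p t z y
  stationary : ∀ t, IsStationaryVec (p t) π
  rate : ∀ᶠ h : ℝ≥0 in 𝓝[>] 0, ∀ x, 1 - p h x x ≤ 2 * h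
  pos : ∀ t, 0 < t → ∀ x y, 0 < p t x y

namespace IsWalkSemigroup

variable {V : Type*} [Fintype V] [DecidableEq V] {p : ℝ≥0 → V → V → ℝ} {π : V → ℝ}

theorem stepPow_eq (H : IsWalkSemigroup p π) (h : ℝ≥0) (n : ℕ) :
    stepPow (p h) n = p (n * h) :=
  stepPow_eq_of_add H.zero H.add h n

/-- Stochastic matrices contract the `ℓ¹` norm and fix `π`. -/
theorem sum_abs_sub_antitone (H : IsWalkSemigroup p π) {s t : ℝ≥0} (hst : s ≤ t) (x : V) :
    ∑ y, |p t x y - π y| ≤ ∑ y, |p s x y - π y| := by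
  obtain ⟨r, rfl⟩ := exists_add_of_le hst
  have h1 : ∀ y, |p (s + r) x y - π y| ≤ ∑ z, |p s x z - π z| * p r z y := by
    intro y
    rw [H.add, ← (H.stationary r).inv y, ← Finset.sum_sub_distrib]
    refine (Finset.abs_sum_le_sum_abs _ _).trans (Finset.sum_le_sum fun z _ => ?_)
    rw [← sub_mul, abs_mul, abs_of_nonneg ((H.stochastic r z).nonneg y)]
  refine (Finset.sum_le_sum fun y _ => h1 y).trans ?_
  rw [Finset.sum_comm]
  refine Finset.sum_le_sum fun z _ => ?_
  rw [← Finset.mul_sum, (H.stochastic r z).sum_eq_one, mul_one]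

theorem mixesBy_ceil (H : IsWalkSemigroup p π) {T h : ℝ≥0} (hh : 0 < h) {θ : ℝ}
    (hmix : ∀ x, ∑ y, |p T x y - π y| ≤ θ) : MixesBy (p h) π ⌈T / h⌉₊ θ := by
  intro x
  rw [H.stepPow_eq]
  refine (H.sum_abs_sub_antitone ?_ x).trans (hmix x)
  rw [← div_le_iff₀ hh]
  exact Nat.le_ceil _

theorem summable (H : IsWalkSemigroup p π) {h : ℝ≥0} (hh : 0 < h) (x y : V) :
    Summable fun l => noMeet (p h) l x y :=
  summable_noMeet (H.stochastic h) (H.pos h hh) x y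

theorem ceil_mul_le {T h : ℝ≥0} (hh : 0 < h) : (⌈T / h⌉₊ : ℝ) * h ≤ T + h := by
  have h1 := (Nat.ceil_lt_add_one (zero_le (a := T / h))).le
  have h2 : ((⌈T / h⌉₊ : ℝ≥0) : ℝ≥0) * h ≤ (T / h + 1) * h := mul_le_mul_left h1 h
  rw [add_mul, one_mul, div_mul_cancel₀ _ hh.ne'] at h2
  exact_mod_cast h2

theorem le_ceil_mul {T h : ℝ≥0} (hh : 0 < h) : (T : ℝ) ≤ (⌈T / h⌉₊ : ℝ) * h := by
  have h2 : T ≤ (⌈T / h⌉₊ : ℝ≥0) * h := by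
    rw [← div_le_iff₀ hh]
    exact Nat.le_ceil _
  exact_mod_cast h2

theorem tendsto_ceil_mul {h : ℕ → ℝ≥0} (hh : ∀ N, 0 < h N) (hlim : Tendsto h atTop (𝓝 0))
    (T : ℝ≥0) : Tendsto (fun N => (⌈T / h N⌉₊ : ℝ) * h N) atTop (𝓝 T) := by
  have h0 : Tendsto (fun N => (h N : ℝ)) atTop (𝓝 0) := by
    rw [← NNReal.coe_zero]; exact NNReal.tendsto_coe.2 hlim
  refine tendsto_of_tendsto_of_tendsto_of_le_of_le tendsto_const_nhds
    (by simpa using tendsto_const_nhds.add h0) (fun N => le_ceil_mul (hh N))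
    (fun N => ceil_mul_le (hh N))

theorem eventually_rate (H : IsWalkSemigroup p π) {h : ℕ → ℝ≥0} (hh : ∀ N, 0 < h N)
    (hlim : Tendsto h atTop (𝓝 0)) : ∀ᶠ N in atTop, ∀ x, 1 - p (h N) x x ≤ 2 * h N :=
  (tendsto_nhdsWithin_iff.2 ⟨hlim, Eventually.of_forall hh⟩).eventually H.rate

/-- A uniform bound for the meeting probability with a stationary walker, in real time. -/
theorem eventually_sndMean_hit_le (H : IsWalkSemigroup p π) {b : ℝ} (hb : ∀ x, π x ≤ b)
    (hb0 : 0 ≤ b) {h : ℕ → ℝ≥0} (hh : ∀ N, 0 < h N) (hlim : Tendsto h atTop (𝓝 0))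
    {T : ℝ≥0} (hT : 0 < T) :
    ∀ᶠ N in atTop, ∀ x,
      sndMean π (fun x y => 1 - noMeet (p (h N)) ⌈T / h N⌉₊ x y) x ≤ b * (1 + 5 * T) := by
  -- The slack `5/4` absorbs the rounding: with holding defect `2 h` per step the factor is `1 + 4 D
  -- h ≤ 1 + 5 T`.
  have h1 := (tendsto_ceil_mul hh hlim T).eventually_lt_const
    (show (T : ℝ) < 5 / 4 * T by
      have : (0 : ℝ) < T := hT
      linarith)
  filter_upwards [h1, H.eventually_rate hh hlim] with N hN hσ x
  refine (sndMean_hit_le (H.stochastic _) (H.stationary _) hb hσ _ x).trans ?_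
  refine mul_le_mul_of_nonneg_left ?_ hb0
  nlinarith

theorem eventually_statHit_le (H : IsWalkSemigroup p π) {b : ℝ} (hb : ∀ x, π x ≤ b)
    (hb0 : 0 ≤ b) {h : ℕ → ℝ≥0} (hh : ∀ N, 0 < h N) (hlim : Tendsto h atTop (𝓝 0))
    {T : ℝ≥0} (hT : 0 < T) :
    ∀ᶠ N in atTop, statHit (p (h N)) π ⌈T / h N⌉₊ ≤ b * (1 + 5 * T) := by
  have h1 := (tendsto_ceil_mul hh hlim T).eventually_lt_const
    (show (T : ℝ) < 5 / 4 * T by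
      have : (0 : ℝ) < T := hT
      linarith)
  filter_upwards [h1, H.eventually_rate hh hlim] with N hN hσ
  refine (statHit_le (H.stochastic _) (H.stationary _) hb hσ _).trans ?_
  refine mul_le_mul_of_nonneg_left ?_ hb0
  nlinarith

/-- A lower bound for the mean meeting time. -/
theorem mul_le_of_tendsto (H : IsWalkSemigroup p π) {b : ℝ} (hb : ∀ x, π x ≤ b)
    (hb0 : 0 ≤ b) {h : ℕ → ℝ≥0} (hh : ∀ N, 0 < h N) (hlim : Tendsto h atTop (𝓝 0)) {m : ℝ}
    (hm : Tendsto (fun N => h N * statMeet (p (h N)) π) atTop (𝓝 m)) {T : ℝ≥0} (hT : 0 < T) :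
    T * (1 - b * (1 + 5 * T)) ≤ m := by
  refine le_of_tendsto_of_tendsto ((tendsto_ceil_mul hh hlim T).mul_const _) hm ?_
  filter_upwards [H.eventually_statHit_le hb hb0 hh hlim hT] with N hN
  have h1 := mul_le_statMeet (H.stochastic (h N)) (H.stationary (h N)).prob
    (H.summable (hh N)) ⌈T / h N⌉₊
  calc (⌈T / h N⌉₊ : ℝ) * h N * (1 - b * (1 + 5 * T))
      ≤ ⌈T / h N⌉₊ * h N * (1 - statHit (p (h N)) π ⌈T / h N⌉₊) :=
        mul_le_mul_of_nonneg_left (by linarith) (by positivity)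
    _ = h N * (⌈T / h N⌉₊ * (1 - statHit (p (h N)) π ⌈T / h N⌉₊)) := by ring
    _ ≤ _ := mul_le_mul_of_nonneg_left h1 (h N).2

end IsWalkSemigroup

theorem tendsto_div_two_pow (t : ℝ≥0) :
    Tendsto (fun N : ℕ => t / 2 ^ N) atTop (𝓝 0) := by
  have := (NNReal.tendsto_pow_atTop_nhds_zero_of_lt_one (r := (1 / 2 : ℝ≥0)) (by
    rw [div_lt_one (by norm_num)]; norm_num)).const_mul t
  rw [mul_zero] at this
  refine this.congr fun N => ?_
  rw [one_div, inv_pow, div_eq_mul_inv]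

theorem tendsto_kingmanTail (n : ℕ) {u : ℕ → ℝ} {v : ℝ} (hu : ∀ᶠ N in atTop, 0 ≤ u N) (hv : 0 ≤ v)
    (h : Tendsto u atTop (𝓝 v)) :
    Tendsto (fun N => kingmanTail n (u N)) atTop (𝓝 (kingmanTail n v)) := by
  have key : ∀ {a c : ℝ}, 0 ≤ a → 0 ≤ c →
      |kingmanTail n a - kingmanTail n c| ≤ kingmanRate n * |a - c| := by
    have h1 : ∀ {a c : ℝ}, 0 ≤ a → a ≤ c →
        |kingmanTail n a - kingmanTail n c| ≤ kingmanRate n * |a - c| := by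
      intro a c ha hac
      rw [abs_of_nonneg (sub_nonneg.2 (kingmanTail_antitone n hac)), abs_sub_comm,
        abs_of_nonneg (sub_nonneg.2 hac)]
      have := kingmanTail_sub_le n ha (sub_nonneg.2 hac)
      rwa [add_sub_cancel] at this
    intro a c ha hc
    rcases le_total a c with hac | hac
    · exact h1 ha hac
    · rw [abs_sub_comm, abs_sub_comm a]; exact h1 hc hac
  rw [tendsto_iff_norm_sub_tendsto_zero]
  have h2 : Tendsto (fun N => kingmanRate n * |u N - v|) atTop (𝓝 0) := by
    have := (tendsto_iff_norm_sub_tendsto_zero.1 h).const_mul (kingmanRate n)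
    simpa using this
  refine squeeze_zero' (Eventually.of_forall fun _ => norm_nonneg _) ?_ h2
  filter_upwards [hu] with N hN
  exact key hN hv

/-! ### Bounds in continuous time by refinement of the grid. -/

namespace IsWalkSemigroup

variable {V : Type*} [Fintype V] [DecidableEq V] {p : ℝ≥0 → V → V → ℝ} {π : V → ℝ}

/-- Bounds for the non-coalescence probability `U` at time `t` in terms of the Kingman
coalescent, in the limit of fine time discretisation. -/
theorem kingman_bounds (H : IsWalkSemigroup p π) {b : ℝ} (hb : ∀ x, π x ≤ b) (hb0 : 0 ≤ b)
    {t : ℝ≥0} (ht : 0 < t) {U m : ℝ}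
    (hU : Tendsto (fun N : ℕ => (flow (p (t / 2 ^ N)))^[2 ^ N] atLeastTwo Finset.univ)
      atTop (𝓝 U)) (hm0 : 0 < m)
    (hm : Tendsto (fun N : ℕ => ((t / 2 ^ N : ℝ≥0) : ℝ) * statMeet (p (t / 2 ^ N)) π)
      atTop (𝓝 m)) {T : ℝ≥0} (hT : 0 < T) {θ η : ℝ} (hθ0 : 0 ≤ θ)
    (hmix : ∀ x, ∑ y, |p T x y - π y| ≤ θ) (hη : 2 * T / m + 4 * θ < η) (hη1 : η ≤ 1)
    {k : ℕ} (hk : 2 ≤ k) :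
    kingmanTail (k - 1) (t / m) -
        k ^ 4 * (26 * η + 16 * (θ + b * (1 + 5 * T)) + 2 * η * (t / m)) ≤ U ∧
      ∀ (T' : ℝ≥0) (θ' δ : ℝ) (M : ℕ), 0 < T' → (∀ x, ∑ y, |p T' x y - π y| ≤ θ') →
        8 * θ' ≤ (Fintype.card V : ℝ)⁻¹ → k * (b * (1 + 5 * T')) ≤ 1 / 2 →
        (2 * M * T' + T) / m < δ →
        U ≤ Fintype.card V * Real.exp (-(M * (k * T' / (32 * m)))) +
          (kingmanTail (k - 1) (t / m - δ) +
            k ^ 4 * (26 * η + 16 * (θ + b * (1 + 5 * T)) + 2 * η * (t / m)) + k * θ) := by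
  set h : ℕ → ℝ≥0 := fun N => t / 2 ^ N with hdef
  have hh : ∀ N, 0 < h N := fun N => by positivity
  have hlim : Tendsto h atTop (𝓝 0) := tendsto_div_two_pow t
  have hlimR : Tendsto (fun N => (h N : ℝ)) atTop (𝓝 0) := by
    rw [← NNReal.coe_zero]; exact NNReal.tendsto_coe.2 hlim
  have hth : ∀ N, ((2 : ℝ) ^ N) * h N = t := fun N => by
    simp only [hdef]; push_cast; field_simp
  set sm : ℕ → ℝ := fun N => statMeet (p (h N)) π with hsm
  have hsmpos : ∀ᶠ N in atTop, 0 < sm N := by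
    filter_upwards [hm.eventually_const_lt hm0] with N hN
    exact pos_of_mul_pos_right hN (h N).2
  have hratio : ∀ {c : ℕ → ℕ} {x : ℝ}, Tendsto (fun N => (c N : ℝ) * h N) atTop (𝓝 x) →
      Tendsto (fun N => (c N : ℝ) / sm N) atTop (𝓝 (x / m)) := by
    intro c x hc
    refine (hc.div hm hm0.ne').congr fun N => ?_
    have := (NNReal.coe_pos.2 (hh N)).ne'
    rw [Pi.div_apply, mul_comm, mul_div_mul_left _ _ this]
  -- The rescaled length of one step tends to 0, so the second-order error of the discrete
  -- comparison disappears in the limit.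
  have hκ : Tendsto (fun N => (sm N)⁻¹) atTop (𝓝 0) := by
    have := hlimR.div hm hm0.ne'
    rw [zero_div] at this
    refine this.congr fun N => ?_
    have := (NNReal.coe_pos.2 (hh N)).ne'
    rw [Pi.div_apply]
    change (h N : ℝ) / (h N * sm N) = (sm N)⁻¹
    field_simp
  set L : ℕ → ℕ := fun N => 2 ^ N with hL
  have hLh : ∀ N, (L N : ℝ) * h N = t := fun N => by
    rw [← hth N]; simp [hL]
  have hLκ : Tendsto (fun N => (L N : ℝ) / sm N) atTop (𝓝 (t / m)) :=
    hratio (tendsto_const_nhds.congr fun N => (hLh N).symm)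
  have hmixN : ∀ N, MixesBy (p (h N)) π ⌈T / h N⌉₊ θ := fun N => H.mixesBy_ceil (hh N) hmix
  have hηN : ∀ᶠ N in atTop, 2 * (⌈T / h N⌉₊ : ℝ) / sm N + 4 * θ ≤ η := by
    have h1 := ((hratio (tendsto_ceil_mul hh hlim T)).const_mul 2).add_const (4 * θ)
    rw [← mul_div_assoc] at h1
    filter_upwards [h1.eventually_lt_const hη] with N hN
    rw [mul_div_assoc]; exact hN.le
  have hη0 : 0 ≤ η := by
    have : (0 : ℝ) ≤ 2 * T / m := by positivity
    linarith
  have hρN := H.eventually_sndMean_hit_le hb hb0 hh hlim hT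
  set e : ℕ → ℝ := fun N => k ^ 4 * (26 * η + 16 * (θ + b * (1 + 5 * T)) +
    2 * η * (L N / sm N) + 2 * (sm N)⁻¹ * (L N / sm N)) with he
  have helim : Tendsto e atTop (𝓝 (k ^ 4 * (26 * η + 16 * (θ + b * (1 + 5 * T)) +
      2 * η * (t / m)))) := by
    have := (((hLκ.const_mul (2 * η)).const_add (26 * η + 16 * (θ + b * (1 + 5 * T)))).add
      ((hκ.const_mul 2).mul hLκ)).const_mul ((k : ℝ) ^ 4)
    simpa using this
  have hmain : ∀ᶠ N in atTop, ∀ L' : ℕ, L' ≤ L N → |prodMean (fun _ : Fin k => π)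
      (fun x => (flow (p (h N)))^[L'] atLeastTwo (Finset.univ.image x)) -
      kingmanTail (k - 1) (L' / sm N)| ≤ e N := by
    filter_upwards [hsmpos, hηN, hρN] with N h1 h2 h3 L' hL'
    refine (abs_stationary_sub_kingmanTail_le_of_mixesBy (H.stochastic _) (H.stationary _)
      (H.summable (hh N)) h1 (hmixN N) hθ0 h2 hη1 h3 (by omega) L').trans ?_
    have h4 : (L' : ℝ) ≤ L N := by exact_mod_cast hL'
    simp only [he]
    have h5 : (0 : ℝ) ≤ (sm N)⁻¹ := by positivity
    change _ * (_ + _ + 2 * η * (L' / sm N) + 2 * (sm N)⁻¹ * (L' / sm N)) ≤ _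
    gcongr
  have htm : (0 : ℝ) ≤ t / m := by positivity
  refine ⟨?_, ?_⟩
  · have hG := tendsto_kingmanTail (k - 1) (u := fun N => (L N : ℝ) / sm N)
      (by filter_upwards [hsmpos] with N hN; positivity) htm hLκ
    refine le_of_tendsto_of_tendsto (hG.sub helim) hU ?_
    filter_upwards [hmain] with N hN
    have h1 := (abs_le.1 (hN (L N) le_rfl)).1
    have h2 := prodMean_flow_le_univ (H.stochastic (h N)) (H.stationary (h N)).prob k (L N)
    change kingmanTail (k - 1) (L N / sm N) - e N ≤ _
    linarith
  · intro T' θ' δ M hT' hmix' hθ' hρ' hδ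
    have hU1 : U ≤ 1 := le_of_tendsto' hU fun N =>
      flow_iterate_le_one (H.stochastic _) atLeastTwo_le_one _ _
    have hE0 : 0 ≤ (k : ℝ) ^ 4 * (26 * η + 16 * (θ + b * (1 + 5 * T)) + 2 * η * (t / m)) := by
      positivity
    -- For `t / m ≤ δ` there may be no time for the early phase, but then the Kingman tail on the
    -- right is 1 and the bound is trivial.
    rcases le_or_gt (t / m) δ with htδ | htδ
    · have h1 : kingmanTail (k - 1) (t / m - δ) = 1 := by
        rcases htδ.lt_or_eq with h2 | h2
        · exact kingmanTail_of_neg _ (by linarith)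
        · rw [h2, sub_self, show k - 1 = (k - 2) + 1 by omega, kingmanTail_succ_zero]
      rw [h1]
      have : (0 : ℝ) ≤ Fintype.card V * Real.exp (-(M * (k * T' / (32 * m)))) := by positivity
      have : 0 ≤ k * θ := by positivity
      linarith
    · set a : ℕ → ℕ := fun N => ⌈T' / h N⌉₊ with ha
      set c : ℕ → ℕ := fun N => ⌈T / h N⌉₊ with hc
      -- The time is split into `M` blocks, each of `a N` mixing and `a N` hitting steps, then `c N`
      -- steps for the remaining walkers to mix, then `L' N` steps of the stationary comparison.
      set L' : ℕ → ℕ := fun N => L N - (M * (a N + a N) + c N) with hL'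
      have hsum : Tendsto (fun N => ((M * (a N + a N) + c N : ℕ) : ℝ) * h N) atTop
          (𝓝 (2 * M * T' + T)) := by
        have h1 := ((tendsto_ceil_mul hh hlim T').const_mul (2 * M : ℝ)).add
          (tendsto_ceil_mul hh hlim T)
        refine h1.congr fun N => ?_
        simp only [ha, hc]; push_cast; ring
      have hle : ∀ᶠ N in atTop, M * (a N + a N) + c N ≤ L N := by
        have h1 : 2 * M * (T' : ℝ) + T < t := by
          have := hδ.trans htδ
          rwa [div_lt_div_iff_of_pos_right hm0] at this
        filter_upwards [hsum.eventually_lt_const h1] with N hN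
        rw [← hLh N] at hN
        exact_mod_cast (lt_of_mul_lt_mul_right hN (h N).2).le
      have hL'lim : Tendsto (fun N => (L' N : ℝ) / sm N) atTop
          (𝓝 (t / m - (2 * M * T' + T) / m)) := by
        refine (hLκ.sub (hratio hsum)).congr' ?_
        filter_upwards [hle] with N hN
        rw [← sub_div]
        simp only [hL']
        rw [Nat.cast_sub hN]
      have hkT : ∀ᶠ N in atTop, M * (k * T' / (32 * m)) ≤
          M * (k * statHit (p (h N)) π (a N) / 4) := by
        have h1 : Tendsto (fun N => (a N : ℝ) / sm N) atTop (𝓝 (T' / m)) :=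
          hratio (tendsto_ceil_mul hh hlim T')
        have h2 : (T' : ℝ) / (2 * m) < T' / m := by
          have : (0 : ℝ) < T' := hT'
          exact div_lt_div_of_pos_left this hm0 (by linarith)
        filter_upwards [h1.eventually_const_lt h2, hsmpos, hηN,
          H.eventually_statHit_le hb hb0 hh hlim hT'] with N hN hp1 hp2 hp3
        -- `η ≤ 1` bounds every mean meeting time by twice the stationary one, as the lower bound
        -- for `statHit` requires.
        have hB : ∀ x y, meanMeet (p (h N)) x y ≤ sm N * 2 := fun x y => by
          have : (0 : ℝ) ≤ 2 * ⌈T / h N⌉₊ / sm N := by positivity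
          refine (meanMeet_le_of_mixesBy (H.summable (hh N)) (H.stochastic _)
            (H.stationary (h N)).prob (hmixN N) (by linarith) hp1 x y).trans
            (mul_le_mul_of_nonneg_left ?_ hp1.le)
          change 1 + (2 * ⌈T / h N⌉₊ / sm N + 4 * θ) ≤ 2
          linarith
        have hk1 : (2 : ℝ) ≤ k := by exact_mod_cast hk
        have hbT : 0 ≤ b * (1 + 5 * T') := by positivity
        have h3 := div_le_statHit (H.stochastic (h N)) (H.stationary (h N)) (H.summable (hh N))
          hp1 hB (D := a N) (hp3.trans (by nlinarith))
        have h4 : (T' : ℝ) / (8 * m) ≤ statHit (p (h N)) π (a N) := by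
          refine le_trans ?_ h3
          change _ ≤ (a N : ℝ) / (4 * sm N)
          rw [show (T' : ℝ) / (8 * m) = T' / (2 * m) / 4 by field_simp; norm_num,
            show (a N : ℝ) / (4 * sm N) = a N / sm N / 4 by field_simp]
          linarith
        refine mul_le_mul_of_nonneg_left ?_ (Nat.cast_nonneg _)
        rw [show (k : ℝ) * T' / (32 * m) = k * (T' / (8 * m)) / 4 by field_simp; norm_num]
        gcongr
      have hrhs : Tendsto (fun N => Fintype.card V * Real.exp (-(M * (k * T' / (32 * m)))) +
          (kingmanTail (k - 1) (t / m - δ) + e N + k * θ)) atTop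
          (𝓝 (Fintype.card V * Real.exp (-(M * (k * T' / (32 * m)))) +
          (kingmanTail (k - 1) (t / m - δ) +
            k ^ 4 * (26 * η + 16 * (θ + b * (1 + 5 * T)) + 2 * η * (t / m)) + k * θ))) :=
        ((helim.const_add _).add_const _).const_add _
      refine le_of_tendsto_of_tendsto hU hrhs ?_
      have hδ' : t / m - δ < t / m - (2 * M * T' + T) / m := by linarith
      filter_upwards [hmain, hle, hL'lim.eventually_const_lt hδ', hkT,
        H.eventually_sndMean_hit_le hb hb0 hh hlim hT'] with N h1 h2 h3 h4 h5
      have h6 := flow_iterate_univ_le (H.stochastic (h N)) (H.stationary (h N)).prob (hmixN N)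
        hθ0 k (M * (a N + a N)) (L' N)
      have h7 : M * (a N + a N) + (⌈T / h N⌉₊ + L' N) = 2 ^ N := by
        change M * (a N + a N) + (c N + (L N - (M * (a N + a N) + c N))) = L N
        omega
      rw [h7] at h6
      have hcard : (0 : ℝ) < Fintype.card V := by
        obtain ⟨x⟩ : Nonempty V := by
          by_contra hV
          rw [not_nonempty_iff] at hV
          have := (H.stationary 0).prob.sum_eq_one
          simp at this
        exact_mod_cast Fintype.card_pos_iff.2 ⟨x⟩
      have h8 : 8 * θ' ≤ statHit (p (h N)) π (a N) := by
        refine hθ'.trans ?_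
        rw [inv_eq_one_div, div_le_iff₀ hcard, mul_comm]
        exact one_le_card_mul_statHit (H.stochastic _) (H.stationary (h N)).prob _
      have h9 := flow_iterate_moreThan_univ_le (H.stochastic (h N)) (H.stationary (h N))
        (H.mixesBy_ceil (hh N) hmix') h5 (by omega) hρ' h8 M
      have h10 := (abs_le.1 (h1 (L' N) (Nat.sub_le _ _))).2
      have h11 : kingmanTail (k - 1) (L' N / sm N) ≤ kingmanTail (k - 1) (t / m - δ) :=
        kingmanTail_antitone _ h3.le
      have h12 : (Fintype.card V : ℝ) * Real.exp (-(M * (k * statHit (p (h N)) π (a N) / 4))) ≤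
          Fintype.card V * Real.exp (-(M * (k * T' / (32 * m)))) := by
        gcongr
      change (flow (p (h N)))^[2 ^ N] atLeastTwo Finset.univ ≤ _
      linarith

end IsWalkSemigroup
end

noncomputable section

/-! ### Jumps of trajectories -/

/-- Up to time `t` the trajectory `ω` only changes its value at times in `F`. -/
def HasJumps {α : Type*} (ω : ℝ≥0 → α) (t : ℝ≥0) (F : Finset ℝ≥0) : Prop :=
  ∀ s u, s ≤ u → u ≤ t → (∀ f ∈ F, s < f → u < f) → ω u = ω s

theorem IsStepPath.exists_hasJumps {V : Type*} {ω : ℝ≥0 → V} (h : IsStepPath ω) (t : ℝ≥0) :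
    ∃ F, HasJumps ω t F := by
  classical
  obtain ⟨τ, h0, hmono, htop, hconst⟩ := h
  obtain ⟨N, hN⟩ := (htop.eventually_gt_atTop t).exists
  refine ⟨(Finset.range (N + 1)).image τ, fun s u hsu hut hF => ?_⟩
  have hex : ∃ n, s < τ n := ⟨N, (hsu.trans hut).trans_lt hN⟩
  set M := Nat.find hex with hM
  have hMspec : s < τ M := Nat.find_spec hex
  have hMN : M ≤ N := Nat.find_le ((hsu.trans hut).trans_lt hN)
  have hM0 : M ≠ 0 := by
    intro h'
    rw [h', h0] at hMspec
    exact absurd hMspec (by simp)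
  obtain ⟨n, hn⟩ := Nat.exists_eq_succ_of_ne_zero hM0
  have hprev : τ n ≤ s := not_lt.1 (Nat.find_min hex (m := n) (by omega))
  rw [hn] at hMspec
  have hu : u < τ (n + 1) := hF _ (Finset.mem_image.2 ⟨n + 1, by simp; omega, rfl⟩) hMspec
  rw [hconst n u (hprev.trans hsu) hu, hconst n s hprev hMspec]

theorem exists_hasJumps_pi {V ι : Type*} [Fintype ι] (X : ι → PathSpace V) (t : ℝ≥0) :
    ∃ F, HasJumps (fun s i => (X i).eval s) t F := by
  classical
  choose F hF using fun i => (X i).2.exists_hasJumps t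
  refine ⟨Finset.univ.biUnion F, fun s u hsu hut h => funext fun i => ?_⟩
  exact hF i s u hsu hut fun f hf => h f (Finset.mem_biUnion.2 ⟨i, Finset.mem_univ _, hf⟩)

theorem HasJumps.eventually_eq {α : Type*} {ω : ℝ≥0 → α} {s : ℝ≥0} {F : Finset ℝ≥0}
    (h : HasJumps ω (s + 1) F) : ∀ᶠ u in 𝓝[≥] s, ω u = ω s := by
  have h1 : ∀ᶠ u in 𝓝[≥] s, ∀ f ∈ F, s < f → u < f := by
    rw [Finset.eventually_all]
    intro f _
    by_cases hf : s < f
    · filter_upwards [mem_nhdsWithin_of_mem_nhds (Iio_mem_nhds hf)] with u hu _ using hu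
    · exact Eventually.of_forall fun u h' => absurd h' hf
  filter_upwards [h1, self_mem_nhdsWithin, mem_nhdsWithin_of_mem_nhds
    (Iio_mem_nhds (show s < s + 1 from lt_add_one s))] with u hu hsu hu1
  exact h s u hsu (le_of_lt hu1) hu

theorem eventually_pi_eq {V ι : Type*} [Fintype ι] (X : ι → PathSpace V) (s : ℝ≥0) :
    ∀ᶠ u in 𝓝[≥] s, ∀ i, (X i).eval u = (X i).eval s := by
  obtain ⟨F, hF⟩ := exists_hasJumps_pi X (s + 1)
  filter_upwards [hF.eventually_eq] with u hu i
  exact congrFun hu i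

/-- Points of `S` accumulate at its infimum from the right, and `S` is closed under such limits, so
the infimum is attained. Constancy of step paths to the right of each time provides the hypothesis.
-/
theorem iInf_toNNReal_mem {S : Set ℝ≥0} (hS : ∀ s, (∃ᶠ u in 𝓝[≥] s, u ∈ S) → s ∈ S)
    (h : ⨅ (s : ℝ≥0) (_ : s ∈ S), (s : ℝ≥0∞) ≠ ∞) :
    (⨅ (s : ℝ≥0) (_ : s ∈ S), (s : ℝ≥0∞)).toNNReal ∈ S := by
  set T := ⨅ (s : ℝ≥0) (_ : s ∈ S), (s : ℝ≥0∞) with hT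
  refine hS _ ?_
  rw [(nhdsGE_basis T.toNNReal).frequently_iff]
  intro c hc
  have h1 : T < (c : ℝ≥0∞) := by
    rw [← ENNReal.coe_toNNReal h]; exact_mod_cast hc
  simp only [hT, iInf_lt_iff] at h1
  obtain ⟨s, hs, hsc⟩ := h1
  refine ⟨s, ⟨?_, by exact_mod_cast hsc⟩, hs⟩
  have h2 : T ≤ s := iInf₂_le s hs
  exact ENNReal.toNNReal_mono ENNReal.coe_ne_top h2

theorem iInf_le_coe_iff {S : Set ℝ≥0} (hS : ∀ s, (∃ᶠ u in 𝓝[≥] s, u ∈ S) → s ∈ S) (t : ℝ≥0) :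
    ⨅ (s : ℝ≥0) (_ : s ∈ S), (s : ℝ≥0∞) ≤ t ↔ ∃ s ∈ S, s ≤ t := by
  constructor
  · intro h
    refine ⟨_, iInf_toNNReal_mem hS (ne_top_of_le_ne_top ENNReal.coe_ne_top h), ?_⟩
    exact ENNReal.toNNReal_mono ENNReal.coe_ne_top h
  · rintro ⟨s, hs, hst⟩
    exact (iInf₂_le s hs).trans (by exact_mod_cast hst)

/-! ### Walkers that have not yet coalesced -/

section Alive

variable {V : Type*} {k : ℕ}

/-- Walker `j` has met no surviving walker of smaller index up to time `t`. -/
def alive {τ : Type*} [LE τ] (Y : τ → Fin k → V) (j : Fin k) (t : τ) : Prop :=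
  ∀ s, s ≤ t → ∀ i : Fin j, alive Y ⟨i, i.2.trans j.2⟩ s → Y s ⟨i, i.2.trans j.2⟩ ≠ Y s j
termination_by j.val
decreasing_by exact i.2

theorem alive_iff {τ : Type*} [LE τ] (Y : τ → Fin k → V) (j : Fin k) (t : τ) :
    alive Y j t ↔ ∀ s, s ≤ t → ∀ i < j, alive Y i s → Y s i ≠ Y s j := by
  rw [alive]
  exact ⟨fun h s hs i hi => h s hs ⟨i, hi⟩, fun h s hs i => h s hs ⟨i, i.2.trans j.2⟩ i.2⟩

theorem alive.mono {τ : Type*} [Preorder τ] {Y : τ → Fin k → V} {j : Fin k} {s t : τ}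
    (h : alive Y j t) (hst : s ≤ t) : alive Y j s := by
  rw [alive_iff] at h ⊢
  exact fun s' hs' => h s' (hs'.trans hst)

theorem alive.ne {τ : Type*} [Preorder τ] {Y : τ → Fin k → V} {i j : Fin k} {t : τ}
    (hi : alive Y i t) (hj : alive Y j t) (hij : i ≠ j) : Y t i ≠ Y t j := by
  rcases lt_or_gt_of_ne hij with h | h
  · exact (alive_iff Y j t).1 hj t le_rfl i h hi
  · exact ((alive_iff Y i t).1 hi t le_rfl j h hj).symm

theorem alive_of_const {Y : ℝ≥0 → Fin k → V} {j : Fin k} {s u : ℝ≥0} (hs : alive Y j s)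
    (h : ∀ r, s ≤ r → r ≤ u → Y r = Y s) : alive Y j u := by
  rw [alive_iff]
  intro r hr i hij hi
  rcases le_total r s with hrs | hrs
  · exact (alive_iff Y j s).1 hs r hrs i hij hi
  · rw [h r hrs hr]
    exact (alive_iff Y j s).1 hs s le_rfl i hij (hi.mono hrs)

variable (X : Fin k → PathSpace V)

theorem eventually_alive_iff (s : ℝ≥0) :
    ∀ᶠ u in 𝓝[≥] s, ∀ j, alive (fun t i => (X i).eval t) j u ↔
      alive (fun t i => (X i).eval t) j s := by
  obtain ⟨c, hc, h⟩ := (nhdsGE_basis s).eventually_iff.1 (eventually_pi_eq X s)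
  refine (nhdsGE_basis s).eventually_iff.2 ⟨c, hc, fun u hu j => ?_⟩
  refine ⟨fun h' => h'.mono hu.1, fun h' => alive_of_const h' fun r hr hru => ?_⟩
  exact funext fun i => h ⟨hr, hru.trans_lt hu.2⟩ i

/-- Strong induction on the index. The paths of smaller index always sit at surviving walkers, so a
contact with one of them is a meeting with a surviving walker, and `firstContact ≤ t` says exactly
that `j` is no longer alive. -/
theorem coalescing_spec (j : Fin k) (t : ℝ≥0) :
    (alive (fun t i => (X i).eval t) j t → coalescing X j t = (X j).eval t) ∧
      ∃ i, alive (fun t i => (X i).eval t) i t ∧ i ≤ j ∧ coalescing X j t = (X i).eval t := by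
  set Y : ℝ≥0 → Fin k → V := fun t i => (X i).eval t with hY
  induction hn : j.val using Nat.strong_induction_on generalizing j t with
  | _ n ih =>
  subst hn
  have ih' : ∀ i < j, ∀ t, (alive Y i t → coalescing X i t = (X i).eval t) ∧
      ∃ i', alive Y i' t ∧ i' ≤ i ∧ coalescing X i t = (X i').eval t :=
    fun i hi t => ih i.val hi i t rfl
  set Z : Fin j → ℝ≥0 → V := fun i => coalescing X ⟨i, i.2.trans j.2⟩ with hZ
  set S : Set ℝ≥0 := {s | ∃ i, (X j).eval s = Z i s} with hS
  have hcon : ∀ s, s ∈ S ↔ ∃ i < j, alive Y i s ∧ (X i).eval s = (X j).eval s := by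
    intro s
    constructor
    · rintro ⟨i, hi⟩
      obtain ⟨i', h1, h2, h3⟩ := (ih' ⟨i, i.2.trans j.2⟩ i.2 s).2
      exact ⟨i', lt_of_le_of_lt h2 i.2, h1, h3.symm.trans hi.symm⟩
    · rintro ⟨i, hij, h1, h2⟩
      exact ⟨⟨i, hij⟩, h2.symm.trans ((ih' i hij s).1 h1).symm⟩
  have hcl : ∀ s, (∃ᶠ u in 𝓝[≥] s, u ∈ S) → s ∈ S := by
    intro s hs
    obtain ⟨u, hu, h1, h2⟩ := (hs.and_eventually ((eventually_pi_eq X s).and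
      (eventually_alive_iff X s))).exists
    rw [hcon] at hu ⊢
    obtain ⟨i, hij, h3, h4⟩ := hu
    exact ⟨i, hij, (h2 i).1 h3, by rw [← h1, ← h1, h4]⟩
  have hfc : firstContact (fun t => (X j).eval t) Z = ⨅ (s : ℝ≥0) (_ : s ∈ S), (s : ℝ≥0∞) := rfl
  have hle : firstContact (fun t => (X j).eval t) Z ≤ t ↔ ¬ alive Y j t := by
    rw [hfc, iInf_le_coe_iff hcl, alive_iff]
    push Not
    constructor
    · rintro ⟨s, hs, hst⟩
      obtain ⟨i, hij, h1, h2⟩ := (hcon s).1 hs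
      exact ⟨s, hst, i, hij, h1, h2⟩
    · rintro ⟨s, hst, i, hij, h1, h2⟩
      exact ⟨s, (hcon s).2 ⟨i, hij, h1, h2⟩, hst⟩
  have hval : coalescing X j t = stickTo (fun t => (X j).eval t) Z t := by rw [coalescing]
  by_cases hal : alive Y j t
  · have : coalescing X j t = (X j).eval t := by
      rw [hval, stickTo, if_neg (by rw [hle]; exact not_not.2 hal)]
    exact ⟨fun _ => this, j, hal, le_rfl, this⟩
  · refine ⟨fun h => absurd h hal, ?_⟩
    have h1 := hle.2 hal
    have h2 : ∃ i, (X j).eval (firstContact (fun t => (X j).eval t) Z).toNNReal =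
        Z i (firstContact (fun t => (X j).eval t) Z).toNNReal :=
      iInf_toNNReal_mem hcl (ne_top_of_le_ne_top ENNReal.coe_ne_top h1)
    rw [hval, stickTo, if_pos h1, dif_pos h2]
    -- This holds for every smaller index, so it does not matter which one the tie-breaking rule
    -- selects.
    have h6 : ∀ r : Fin j, ∃ i, alive Y i t ∧ i ≤ j ∧ Z r t = (X i).eval t := fun r => by
      obtain ⟨i', h3, h4, h5⟩ := (ih' ⟨r, r.2.trans j.2⟩ r.2 t).2
      exact ⟨i', h3, h4.trans (le_of_lt r.2), h5⟩
    exact h6 _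

theorem range_coalescing (t : ℝ≥0) :
    (Set.range fun j => coalescing X j t) =
      (fun j => (X j).eval t) '' {j | alive (fun t i => (X i).eval t) j t} := by
  ext v
  constructor
  · rintro ⟨j, rfl⟩
    obtain ⟨i, h1, -, h3⟩ := (coalescing_spec X j t).2
    exact ⟨i, h1, h3.symm⟩
  · rintro ⟨j, hj, rfl⟩
    exact ⟨j, (coalescing_spec X j t).1 hj⟩

theorem ncard_range_coalescing (t : ℝ≥0) :
    (Set.range fun j => coalescing X j t).ncard =
      {j | alive (fun t i => (X i).eval t) j t}.ncard := by
  rw [range_coalescing]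
  refine Set.InjOn.ncard_image fun i hi j hj h => ?_
  by_contra hij
  exact alive.ne (Y := fun t i => (X i).eval t) hi hj hij h

/-- The alive walkers only decrease and occupy distinct sites, and the infimum is attained by
right-constancy; so the condition can be tested at time `t` alone. -/
theorem coe_lt_coalescenceTime_iff (n : ℕ) (t : ℝ≥0) :
    (t : ℝ≥0∞) < coalescenceTime n X ↔
      n < {j | alive (fun t i => (X i).eval t) j t}.ncard := by
  set S : Set ℝ≥0 := {t | (Set.range fun j => coalescing X j t).ncard ≤ n} with hS
  have hfc : coalescenceTime n X = ⨅ (s : ℝ≥0) (_ : s ∈ S), (s : ℝ≥0∞) := rfl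
  have hmem : ∀ s, s ∈ S ↔ {j | alive (fun t i => (X i).eval t) j s}.ncard ≤ n := by
    intro s
    rw [← ncard_range_coalescing]; rfl
  have hcl : ∀ s, (∃ᶠ u in 𝓝[≥] s, u ∈ S) → s ∈ S := by
    intro s hs
    obtain ⟨u, hu, h1⟩ := (hs.and_eventually (eventually_alive_iff X s)).exists
    rw [hmem] at hu ⊢
    simpa only [h1] using hu
  rw [← not_le, ← not_le, not_iff_not, hfc, iInf_le_coe_iff hcl]
  constructor
  · rintro ⟨s, hs, hst⟩
    refine le_trans (Set.ncard_le_ncard (fun j hj => ?_) (Set.toFinite _)) ((hmem s).1 hs)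
    exact alive.mono hj hst
  · intro h
    exact ⟨t, (hmem t).2 h, le_rfl⟩

/-! ### Discretisation -/

/-- If the mesh is smaller than the gaps between jump times, a configuration entered before the last
grid time is still in place at the next grid point, so the grid sees every meeting. -/
theorem alive_grid_iff {t h : ℝ≥0} {F : Finset ℝ≥0}
    (hF : HasJumps (fun s i => (X i).eval s) t F)
    (hgap : ∀ f ∈ insert 0 F, ∀ g ∈ F, f < g → f + h < g) {L : ℕ} (hL : L * h ≤ t) (j : Fin k) :
    alive (fun (l : ℕ) i => (X i).eval (l * h)) j L ↔
      alive (fun t i => (X i).eval t) j (L * h) := by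
  set Y : ℝ≥0 → Fin k → V := fun s i => (X i).eval s with hY
  induction hn : j.val using Nat.strong_induction_on generalizing j L with
  | _ n ih =>
  subst hn
  rw [alive_iff, alive_iff]
  constructor
  · intro H s hs i hij hi
    -- `f` is the last possible jump time up to `s`, and `l * h` below is the first grid time from
    -- `f` on; nothing changes between `f` and either of `s` and `l * h`. The time 0 is included so
    -- that `f` exists before the first jump.
    obtain ⟨f, hf, hfs, hmax⟩ : ∃ f ∈ insert 0 F, f ≤ s ∧ ∀ g ∈ F, f < g → s < g := by
      have hne : ((insert 0 F).filter (· ≤ s)).Nonempty := ⟨0, by simp⟩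
      obtain ⟨f, hf, hmax⟩ := Finset.exists_max_image _ id hne
      refine ⟨f, (Finset.mem_filter.1 hf).1, (Finset.mem_filter.1 hf).2, fun g hg hfg => ?_⟩
      by_contra hsg
      have := hmax g (Finset.mem_filter.2 ⟨Finset.mem_insert_of_mem hg, not_lt.1 hsg⟩)
      exact absurd hfg (not_lt.2 this)
    have hex : ∃ l : ℕ, f ≤ l * h := ⟨L, hfs.trans hs⟩
    classical
    set l := Nat.find hex with hl
    have hlspec : f ≤ l * h := Nat.find_spec hex
    have hlL : l ≤ L := Nat.find_le (hfs.trans hs)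
    have hlh : (l : ℝ≥0) * h ≤ f + h := by
      rcases Nat.eq_zero_or_pos l with h0 | h0
      · rw [h0]; simp
      · obtain ⟨l', hl'⟩ := Nat.exists_eq_succ_of_ne_zero h0.ne'
        have h1 : (l' : ℝ≥0) * h < f := not_le.1 (Nat.find_min hex (m := l') (by omega))
        rw [hl']
        push_cast
        rw [add_mul, one_mul]
        gcongr
    have hlLt : (l : ℝ≥0) * h ≤ t := le_trans (by gcongr) hL
    have hc : ∀ r, f ≤ r → (r ≤ s ∨ r ≤ l * h) → Y r = Y f := by
      intro r hfr hr
      refine hF f r hfr ?_ fun g hg hfg => ?_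
      · rcases hr with hr | hr
        · exact hr.trans (hs.trans hL)
        · exact hr.trans hlLt
      · rcases hr with hr | hr
        · exact hr.trans_lt (hmax g hg hfg)
        · exact (hr.trans hlh).trans_lt (hgap f hf g hg hfg)
    have e1 : Y s = Y f := hc s hfs (Or.inl le_rfl)
    have e2 : Y (l * h) = Y f := hc _ hlspec (Or.inr le_rfl)
    have hi' : alive Y i (l * h) :=
      alive_of_const (hi.mono hfs) fun r hr hrl => hc r hr (Or.inr hrl)
    have := H l hlL i hij ((ih i hij hlLt i rfl).2 hi')
    change Y (l * h) i ≠ Y (l * h) j at this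
    rwa [e1, ← e2]
  · intro H l hl i hij hi
    have hlL : (l : ℝ≥0) * h ≤ L * h := by gcongr
    exact H (l * h) hlL i hij ((ih i hij (hlL.trans hL) i rfl).1 hi)

theorem eventually_alive_grid_iff (t : ℝ≥0) :
    ∀ᶠ N : ℕ in atTop, ∀ j, alive (fun (l : ℕ) i => (X i).eval (l * (t / 2 ^ N))) j (2 ^ N) ↔
      alive (fun t i => (X i).eval t) j t := by
  obtain ⟨F, hF⟩ := exists_hasJumps_pi X t
  have h1 : ∀ᶠ h in 𝓝 (0 : ℝ≥0), ∀ f ∈ insert 0 F, ∀ g ∈ F, f < g → f + h < g := by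
    rw [Finset.eventually_all]
    intro f _
    rw [Finset.eventually_all]
    intro g _
    by_cases hfg : f < g
    · have : Tendsto (fun h => f + h) (𝓝 0) (𝓝 (f + 0)) := tendsto_const_nhds.add tendsto_id
      rw [add_zero] at this
      filter_upwards [this.eventually_lt_const hfg] with h hh _ using hh
    · exact Eventually.of_forall fun _ h' => absurd h' hfg
  filter_upwards [(tendsto_div_two_pow t).eventually h1] with N hN j
  have e : ((2 ^ N : ℕ) : ℝ≥0) * (t / 2 ^ N) = t := by
    push_cast
    exact mul_div_cancel₀ t (by positivity)
  have := alive_grid_iff X hF hN (L := 2 ^ N) e.le j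
  rwa [e] at this

end Alive
end

noncomputable section

/-! ### Transition probabilities -/

section Trans

variable {V : Type*}

theorem PathSpace.measurableSet_eval_mem (t : ℝ≥0) (s : Set V) :
    MeasurableSet {ω : PathSpace V | ω.eval t ∈ s} :=
  le_iSup (fun t : ℝ≥0 => MeasurableSpace.comap (PathSpace.eval (V := V) t) ⊤) t _
    ⟨s, trivial, rfl⟩

theorem PathSpace.measurableSet_eval_eq (t : ℝ≥0) (y : V) :
    MeasurableSet {ω : PathSpace V | ω.eval t = y} :=
  PathSpace.measurableSet_eval_mem t {y}

theorem PathSpace.measurable_shift (T : ℝ≥0) : Measurable (PathSpace.shift (V := V) T) := by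
  rw [measurable_iff_le_map]
  refine iSup_le fun t => ?_
  rintro _ ⟨s, -, rfl⟩
  exact PathSpace.measurableSet_eval_mem (t + T) s

variable [Fintype V]

/-- The transition probabilities `P_x(X_t = y)`. -/
def transProb (P : V → Measure (PathSpace V)) (t : ℝ≥0) (x y : V) : ℝ :=
  (P x).real {ω | ω.eval t = y}

theorem lintegral_comp_eval (μ : Measure (PathSpace V)) (t : ℝ≥0) (g : V → ℝ≥0∞) :
    ∫⁻ ω, g (ω.eval t) ∂μ = ∑ y, g y * μ {ω | ω.eval t = y} := by
  classical
  have h : ∀ ω : PathSpace V, g (ω.eval t) =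
      ∑ y, ({ω : PathSpace V | ω.eval t = y}).indicator (fun _ => g y) ω := by
    intro ω
    rw [Finset.sum_eq_single (ω.eval t)]
    · simp
    · intro y _ hy
      simp [hy.symm]
    · simp
  simp_rw [h]
  rw [lintegral_finsetSum _ fun y _ =>
    measurable_const.indicator (PathSpace.measurableSet_eval_eq t y)]
  exact Finset.sum_congr rfl fun y _ =>
    lintegral_indicator_const (PathSpace.measurableSet_eval_eq t y) _

variable {q : V → V → ℝ} {P : V → Measure (PathSpace V)}

/-- The Markov property without conditioning on the past: the shifted walk is a mixture of the `P
y`, which is what permits induction over grid steps. -/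
theorem IsMarkovChain.map_shift (hP : IsMarkovChain q P) (x : V) (T : ℝ≥0) :
    (P x).map (PathSpace.shift T) = ∑ y, ENNReal.ofReal (transProb P T x y) • P y := by
  have := hP.isProb x
  ext B hB
  rw [Measure.map_apply (PathSpace.measurable_shift T) hB, Measure.finsetSum_apply]
  have h := hP.markov x T Set.univ B (@MeasurableSet.univ _ (PathSpace.past T)) hB
  rw [Set.univ_inter, Measure.restrict_univ, lintegral_comp_eval _ T fun y => P y B] at h
  rw [h]
  refine Finset.sum_congr rfl fun y _ => ?_
  rw [Measure.smul_apply, smul_eq_mul, mul_comm, transProb, ofReal_measureReal]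

theorem IsMarkovChain.stochastic (hP : IsMarkovChain q P) (t : ℝ≥0) :
    IsStochastic (transProb P t) := by
  intro x
  have := hP.isProb x
  refine ⟨fun y => measureReal_nonneg, ?_⟩
  have h := lintegral_comp_eval (P x) t fun _ => 1
  simp only [lintegral_const, measure_univ, one_mul] at h
  have h2 := congrArg ENNReal.toReal h
  rw [ENNReal.toReal_sum fun _ _ => measure_ne_top _ _] at h2
  simpa [transProb, Measure.real] using h2.symm

theorem IsMarkovChain.ae_start (hP : IsMarkovChain q P) (x : V) : ∀ᵐ ω ∂(P x), ω.eval 0 = x := by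
  have := hP.isProb x
  exact (prob_compl_eq_zero_iff (PathSpace.measurableSet_eval_eq 0 x)).2 (hP.start x)

end Trans

/-! ### Products of mixtures -/

theorem Measure.pi_sum_smul {V ι Ω : Type*} [Fintype V] [Fintype ι] [DecidableEq ι]
    [MeasurableSpace Ω] (P : V → Measure Ω) [∀ y, IsFiniteMeasure (P y)] (c : ι → V → ℝ≥0∞)
    (hc : ∀ i y, c i y ≠ ∞) :
    Measure.pi (fun i => ∑ y, c i y • P y) =
      ∑ y : ι → V, (∏ i, c i (y i)) • Measure.pi fun i => P (y i) := by
  have : ∀ i, IsFiniteMeasure (∑ y, c i y • P y) := fun i => ⟨by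
    rw [Measure.finsetSum_apply]
    exact ENNReal.sum_lt_top.2 fun y _ =>
      ENNReal.mul_lt_top (hc i y).lt_top (measure_lt_top _ _)⟩
  refine Measure.pi_eq fun s _ => ?_
  simp only [Measure.finsetSum_apply, Measure.smul_apply, smul_eq_mul, Measure.pi_pi,
    ← Finset.prod_mul_distrib]
  rw [Finset.prod_univ_sum, Fintype.piFinset_univ]

theorem Measure.prod_sum_smul {V Ω : Type*} [Fintype V]
    [MeasurableSpace Ω] (P : V → Measure Ω) [∀ y, IsFiniteMeasure (P y)] (c d : V → ℝ≥0∞)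
    (hc : ∀ y, c y ≠ ∞) (hd : ∀ y, d y ≠ ∞) :
    (∑ y, c y • P y).prod (∑ y, d y • P y) =
      ∑ y, ∑ z, (c y * d z) • (P y).prod (P z) := by
  have h : ∀ c : V → ℝ≥0∞, (∀ y, c y ≠ ∞) → IsFiniteMeasure (∑ y, c y • P y) := fun c hc => ⟨by
    rw [Measure.finsetSum_apply]
    exact ENNReal.sum_lt_top.2 fun y _ =>
      ENNReal.mul_lt_top (hc y).lt_top (measure_lt_top _ _)⟩
  have := h c hc
  have := h d hd
  refine Measure.prod_eq fun s t _ _ => ?_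
  simp only [Measure.finsetSum_apply, Measure.smul_apply, smul_eq_mul, Measure.prod_prod]
  rw [Finset.sum_mul_sum]
  exact Finset.sum_congr rfl fun y _ => Finset.sum_congr rfl fun z _ => by ring

/-! ### The coalescing system on a grid -/

section Grid

variable {V : Type*} [DecidableEq V] {k : ℕ}

/-- Remove from `B` all walkers that share their site with a walker of smaller index in `B`. -/
def prune (y : Fin k → V) (B : Finset (Fin k)) : Finset (Fin k) :=
  B.filter fun j => ∀ i ∈ B, i < j → y i ≠ y j

theorem exists_mem_prune (y : Fin k → V) {B : Finset (Fin k)} {j : Fin k} (hj : j ∈ B) :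
    ∃ i ∈ prune y B, i ≤ j ∧ y i = y j := by
  have hne : (B.filter fun i => y i = y j).Nonempty := ⟨j, by simp [hj]⟩
  obtain ⟨i, hi, hmin⟩ := Finset.exists_min_image _ id hne
  rw [Finset.mem_filter] at hi
  refine ⟨i, Finset.mem_filter.2 ⟨hi.1, fun i' hi' hlt heq => ?_⟩,
    hmin j (by simp [hj]), hi.2⟩
  exact absurd hlt (not_lt.2 (hmin i' (Finset.mem_filter.2 ⟨hi', heq.trans hi.2⟩)))

/-- It makes no difference whether walkers are compared with all of `B` or only with those that
stay; the latter is the recursion that defines `alive`. -/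
theorem mem_prune_iff (y : Fin k → V) (B : Finset (Fin k)) (j : Fin k) :
    j ∈ prune y B ↔ j ∈ B ∧ ∀ i < j, i ∈ prune y B → y i ≠ y j := by
  constructor
  · intro h
    refine ⟨(Finset.mem_filter.1 h).1, fun i hij hi => ?_⟩
    exact (Finset.mem_filter.1 h).2 i (Finset.mem_filter.1 hi).1 hij
  · rintro ⟨hj, h⟩
    refine Finset.mem_filter.2 ⟨hj, fun i hi hij heq => ?_⟩
    obtain ⟨i', h1, h2, h3⟩ := exists_mem_prune y hi
    exact h i' (lt_of_le_of_lt h2 hij) h1 (h3.trans heq)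

theorem image_prune (y : Fin k → V) (B : Finset (Fin k)) : (prune y B).image y = B.image y := by
  refine le_antisymm (Finset.image_subset_image (Finset.filter_subset _ _)) fun v hv => ?_
  obtain ⟨j, hj, rfl⟩ := Finset.mem_image.1 hv
  obtain ⟨i, h1, -, h3⟩ := exists_mem_prune y hj
  exact Finset.mem_image.2 ⟨i, h1, h3⟩

theorem injOn_prune (y : Fin k → V) (B : Finset (Fin k)) : Set.InjOn y (prune y B) := by
  intro i hi j hj h
  rcases lt_trichotomy i j with hij | hij | hij
  · exact absurd h (((mem_prune_iff y B j).1 hj).2 i hij hi)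
  · exact hij
  · exact absurd h.symm (((mem_prune_iff y B i).1 hi).2 j hij hj)

/-- The walkers left after step `l` if the walkers in `B` move along `Y` and coalesce. -/
def survivors (Y : ℕ → Fin k → V) (B : Finset (Fin k)) : ℕ → Finset (Fin k)
  | 0 => prune (Y 0) B
  | l + 1 => prune (Y (l + 1)) (survivors Y B l)

/-- The first step is peeled off instead of the last one, in order to match the Markov property
under the time shift. -/
theorem survivors_succ (Y : ℕ → Fin k → V) (B : Finset (Fin k)) (l : ℕ) :
    survivors Y B (l + 1) = survivors (fun l => Y (l + 1)) (prune (Y 0) B) l := by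
  induction l with
  | zero => rfl
  | succ l ih => rw [survivors, ih]; rfl

theorem mem_survivors_iff (Y : ℕ → Fin k → V) (l : ℕ) (j : Fin k) :
    j ∈ survivors Y Finset.univ l ↔ alive Y j l := by
  induction l generalizing j with
  | zero =>
    induction hn : j.val using Nat.strong_induction_on generalizing j with
    | _ n ih =>
    subst hn
    rw [survivors, mem_prune_iff, alive_iff]
    simp only [Finset.mem_univ, true_and, Nat.le_zero, forall_eq]
    exact forall₂_congr fun i hij => imp_congr_left (ih i hij i rfl)
  | succ l ihl =>
    induction hn : j.val using Nat.strong_induction_on generalizing j with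
    | _ n ih =>
    subst hn
    rw [survivors, mem_prune_iff, ihl]
    have h1 : ∀ i < j, i ∈ prune (Y (l + 1)) (survivors Y Finset.univ l) ↔ alive Y i (l + 1) :=
      fun i hij => ih i hij i rfl
    constructor
    · rintro ⟨h2, h3⟩
      rw [alive_iff] at h2 ⊢
      intro s hs i hij hi
      rcases Nat.lt_or_ge l s with hls | hls
      · obtain rfl : s = l + 1 := by omega
        exact h3 i hij ((h1 i hij).2 hi)
      · exact h2 s hls i hij hi
    · intro h
      refine ⟨h.mono (Nat.le_succ l), fun i hij hi => ?_⟩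
      exact (alive_iff Y j (l + 1)).1 h _ le_rfl i hij ((h1 i hij).1 hi)

theorem ncard_alive_eq (Y : ℕ → Fin k → V) (l : ℕ) :
    {j | alive Y j l}.ncard = (survivors Y Finset.univ l).card := by
  rw [← Set.ncard_coe_finset]
  congr 1
  ext j
  exact (mem_survivors_iff Y l j).symm

end Grid

/-! ### The law of the coalescing system and its grid approximation. -/

section Law

variable {V : Type*} [Fintype V] [DecidableEq V] {k : ℕ} {q : V → V → ℝ}
  {P : V → Measure (PathSpace V)}

theorem measurableSet_pi_eval_eq (t : ℝ≥0) (y : Fin k → V) :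
    MeasurableSet {X : Fin k → PathSpace V | ∀ i, (X i).eval t = y i} := by
  rw [Set.ofPred_forall]
  exact MeasurableSet.iInter fun i => (PathSpace.measurableSet_eval_eq t (y i)).preimage
    (measurable_pi_apply i)

theorem measurable_pi_shift (T : ℝ≥0) :
    Measurable fun (X : Fin k → PathSpace V) i => (X i).shift T :=
  measurable_pi_lambda _ fun i => (PathSpace.measurable_shift T).comp (measurable_pi_apply i)

theorem survivors_grid_succ (X : Fin k → PathSpace V) (h : ℝ≥0) (B : Finset (Fin k)) (L : ℕ) :
    survivors (fun l i => (X i).eval (l * h)) B (L + 1) =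
      survivors (fun l i => ((X i).shift h).eval (l * h))
        (prune (fun i => (X i).eval 0) B) L := by
  rw [survivors_succ]
  congr 1
  · funext l i
    exact congrArg (X i).1 (by push_cast; ring)
  · simp

theorem measurableSet_survivors (h : ℝ≥0) (L : ℕ) (B : Finset (Fin k))
    (S : Set (Finset (Fin k))) : MeasurableSet {X : Fin k → PathSpace V |
      survivors (fun l i => (X i).eval (l * h)) B L ∈ S} := by
  induction L generalizing B with
  | zero =>
    have : {X : Fin k → PathSpace V | survivors (fun l i => (X i).eval (l * h)) B 0 ∈ S} =
        ⋃ y ∈ {y : Fin k → V | prune y B ∈ S}, {X | ∀ i, (X i).eval 0 = y i} := by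
      ext X
      simp only [survivors, Nat.cast_zero, zero_mul, Set.mem_ofPred_eq, Set.mem_iUnion, exists_prop]
      constructor
      · exact fun h => ⟨_, h, fun i => rfl⟩
      · rintro ⟨y, hy, h⟩
        rwa [show (fun i => (X i).eval 0) = y from funext h]
    rw [this]
    exact MeasurableSet.biUnion (Set.to_countable _) fun y _ => measurableSet_pi_eval_eq 0 y
  | succ L ih =>
    have : {X : Fin k → PathSpace V | survivors (fun l i => (X i).eval (l * h)) B (L + 1) ∈ S} =
        ⋃ y : Fin k → V, ({X | ∀ i, (X i).eval 0 = y i} ∩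
          (fun (X : Fin k → PathSpace V) i => (X i).shift h) ⁻¹'
            {X | survivors (fun l i => (X i).eval (l * h)) (prune y B) L ∈ S}) := by
      ext X
      simp only [survivors_grid_succ, Set.mem_ofPred_eq, Set.mem_iUnion, Set.mem_inter_iff,
        Set.mem_preimage]
      constructor
      · exact fun h => ⟨_, fun i => rfl, h⟩
      · rintro ⟨y, hy, h⟩
        rwa [show (fun i => (X i).eval 0) = y from funext hy]
    rw [this]
    exact MeasurableSet.iUnion fun y => (measurableSet_pi_eval_eq 0 y).inter
      ((ih _).preimage (measurable_pi_shift h))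

theorem ofReal_prodMean {ι : Type*} [Fintype ι] [DecidableEq ι] {μ : ι → V → ℝ}
    (hμ : ∀ i, IsProbVec (μ i)) {F : (ι → V) → ℝ} (hF : ∀ y, 0 ≤ F y) :
    ENNReal.ofReal (prodMean μ F) =
      ∑ y : ι → V, (∏ i, ENNReal.ofReal (μ i (y i))) * ENNReal.ofReal (F y) := by
  unfold prodMean
  have h0 : ∀ y : ι → V, 0 ≤ ∏ i, μ i (y i) := fun y =>
    Finset.prod_nonneg fun i _ => (hμ i).nonneg _
  rw [ENNReal.ofReal_sum_of_nonneg fun y _ => mul_nonneg (h0 y) (hF y)]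
  refine Finset.sum_congr rfl fun y _ => ?_
  rw [ENNReal.ofReal_mul (h0 y), ENNReal.ofReal_prod_of_nonneg fun i _ => (hμ i).nonneg _]

theorem IsMarkovChain.ae_pi_start (hP : IsMarkovChain q P) (x : Fin k → V) :
    ∀ᵐ X ∂(Measure.pi fun j => P (x j)), ∀ i, (X i).eval 0 = x i := by
  have := hP.isProb
  rw [ae_all_iff]
  intro i
  exact (measurePreserving_eval (fun j => P (x j)) i).quasiMeasurePreserving.ae (hP.ae_start (x i))

/-- On a grid, independent walkers that coalesce move like the random flow. -/
theorem IsMarkovChain.pi_survivors (hP : IsMarkovChain q P) (h : ℝ≥0) (L : ℕ) (x : Fin k → V)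
    (B : Finset (Fin k)) :
    (Measure.pi fun j => P (x j)) {X | 2 ≤ (survivors (fun l i => (X i).eval (l * h)) B L).card} =
      ENNReal.ofReal ((flow (transProb P h))^[L] atLeastTwo (B.image x)) := by
  have hprob := hP.isProb
  have hs := hP.stochastic h
  induction L generalizing x B with
  | zero =>
    have h1 : (B.image x).card = (prune x B).card := by
      rw [← image_prune, Finset.card_image_of_injOn (injOn_prune x B)]
    rw [Function.iterate_zero, id, atLeastTwo, h1]
    have h2 : {X : Fin k → PathSpace V | 2 ≤ (survivors (fun l i => (X i).eval (l * h)) B 0).card}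
        =ᵐ[Measure.pi fun j => P (x j)] {_X | 2 ≤ (prune x B).card} := by
      filter_upwards [hP.ae_pi_start x] with X hX
      have : (fun i => (X i).eval 0) = x := funext hX
      apply propext
      change 2 ≤ (survivors (fun l i => (X i).eval (l * h)) B 0).card ↔ 2 ≤ (prune x B).card
      simp only [survivors, Nat.cast_zero, zero_mul]
      rw [this]
    rw [measure_congr h2]
    split_ifs with h3 <;> simp [h3]
  | succ L ih =>
    set B' := prune x B with hB'
    have h2 : {X : Fin k → PathSpace V |
          2 ≤ (survivors (fun l i => (X i).eval (l * h)) B (L + 1)).card}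
        =ᵐ[Measure.pi fun j => P (x j)] (fun (X : Fin k → PathSpace V) i => (X i).shift h) ⁻¹'
          {X | 2 ≤ (survivors (fun l i => (X i).eval (l * h)) B' L).card} := by
      filter_upwards [hP.ae_pi_start x] with X hX
      have : (fun i => (X i).eval 0) = x := funext hX
      apply propext
      change 2 ≤ (survivors (fun l i => (X i).eval (l * h)) B (L + 1)).card ↔
        2 ≤ (survivors (fun l i => ((X i).shift h).eval (l * h)) B' L).card
      rw [survivors_grid_succ, this]
    have hfin : ∀ j, IsProbabilityMeasure ((P (x j)).map (PathSpace.shift h)) := fun j =>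
      Measure.isProbabilityMeasure_map (PathSpace.measurable_shift h).aemeasurable
    have hmeas : MeasurableSet {X : Fin k → PathSpace V |
        2 ≤ (survivors (fun l i => (X i).eval (l * h)) B' L).card} :=
      measurableSet_survivors h L B' {C | 2 ≤ C.card}
    rw [measure_congr h2, ← Measure.map_apply (measurable_pi_shift h) hmeas,
      Measure.pi_map_pi fun j => (PathSpace.measurable_shift h).aemeasurable]
    simp_rw [hP.map_shift]
    -- The shifted walkers are a mixture over the sites reached in one step. The walkers left by
    -- `prune` occupy distinct sites, so their independent steps are one step of the flow.
    rw [Measure.pi_sum_smul _ _ fun _ _ => ENNReal.ofReal_ne_top, Measure.finsetSum_apply,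
      Function.iterate_succ_apply', ← image_prune x B, flow_image_of_injOn hs _ x _
        (injOn_prune x B), ofReal_prodMean (fun i => hs _) fun y =>
        flow_iterate_nonneg hs atLeastTwo_nonneg _ _]
    refine Finset.sum_congr rfl fun y _ => ?_
    rw [Measure.smul_apply, smul_eq_mul]
    congr 1
    exact ih y B'

theorem eventually_survivors_iff (X : Fin k → PathSpace V) (t : ℝ≥0) :
    ∀ᶠ N : ℕ in atTop,
      2 ≤ (survivors (fun l i => (X i).eval (l * (t / 2 ^ N))) Finset.univ (2 ^ N)).card ↔
        (t : ℝ≥0∞) < coalescenceTime 1 X := by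
  filter_upwards [eventually_alive_grid_iff X t] with N hN
  rw [coe_lt_coalescenceTime_iff, ← ncard_alive_eq]
  simp only [hN]
  rfl

theorem measurableSet_lt_coalescenceTime (t : ℝ≥0) :
    MeasurableSet {X : Fin k → PathSpace V | (t : ℝ≥0∞) < coalescenceTime 1 X} :=
  measurableSet_of_tendsto_indicator atTop
    (fun N : ℕ => measurableSet_survivors (t / 2 ^ N) (2 ^ N) Finset.univ {C | 2 ≤ C.card})
    fun X => eventually_survivors_iff X t

theorem measurable_coalescenceTime :
    Measurable fun X : Fin k → PathSpace V => coalescenceTime 1 X := by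
  refine measurable_of_Ioi fun a => ?_
  induction a with
  | top => simp
  | coe t => exact measurableSet_lt_coalescenceTime t

/-- The law of the coalescence time is the limit of the grid approximations. -/
theorem IsMarkovChain.tendsto_flow (hP : IsMarkovChain q P) {x : Fin k → V}
    (hx : Function.Surjective x) (t : ℝ≥0) :
    Tendsto (fun N : ℕ => (flow (transProb P (t / 2 ^ N)))^[2 ^ N] atLeastTwo Finset.univ) atTop
      (𝓝 ((Measure.pi fun j => P (x j)).real {X | (t : ℝ≥0∞) < coalescenceTime 1 X})) := by
  have hprob := hP.isProb
  have h := tendsto_measure_of_tendsto_indicator_of_isFiniteMeasure atTop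
    (Measure.pi fun j => P (x j))
    (fun N : ℕ => measurableSet_survivors (V := V) (t / 2 ^ N) (2 ^ N) Finset.univ {C | 2 ≤ C.card})
    fun X => eventually_survivors_iff X t
  have h2 := (ENNReal.tendsto_toReal (measure_ne_top _ _)).comp h
  refine h2.congr fun N => ?_
  have h3 := hP.pi_survivors (t / 2 ^ N) (2 ^ N) x Finset.univ
  rw [Finset.image_univ_of_surjective hx] at h3
  simp only [Function.comp_apply]
  refine (congrArg ENNReal.toReal h3).trans ?_
  exact ENNReal.toReal_ofReal (flow_iterate_nonneg (hP.stochastic _) atLeastTwo_nonneg _ _)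

/-! ### The meeting time on a grid -/

/-- Two trajectories are at different places at the first `L + 1` grid times. -/
def apartUpTo (h : ℝ≥0) (L : ℕ) : Set (PathSpace V × PathSpace V) :=
  {w | ∀ l ≤ L, w.1.eval (l * h) ≠ w.2.eval (l * h)}

theorem measurableSet_apartUpTo (h : ℝ≥0) (L : ℕ) :
    MeasurableSet (apartUpTo (V := V) h L) := by
  have : apartUpTo (V := V) h L = ⋂ l ∈ Set.Iic L, ⋂ y : V,
      {w | ¬ (w.1.eval (l * h) = y ∧ w.2.eval (l * h) = y)} := by
    ext w
    simp only [apartUpTo, Set.mem_ofPred_eq, Set.mem_iInter, Set.mem_Iic]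
    refine forall₂_congr fun l _ => ⟨fun h y hy => h (hy.1.trans hy.2.symm), fun h he => ?_⟩
    exact h _ ⟨rfl, he.symm⟩
  rw [this]
  refine MeasurableSet.biInter (Set.to_countable _) fun l _ => MeasurableSet.iInter fun y => ?_
  exact (((PathSpace.measurableSet_eval_eq _ y).preimage measurable_fst).inter
    ((PathSpace.measurableSet_eval_eq _ y).preimage measurable_snd)).compl

theorem mem_apartUpTo_succ (h : ℝ≥0) (L : ℕ) (w : PathSpace V × PathSpace V) :
    w ∈ apartUpTo h (L + 1) ↔ w.1.eval 0 ≠ w.2.eval 0 ∧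
      Prod.map (PathSpace.shift h) (PathSpace.shift h) w ∈ apartUpTo h L := by
  have e : ∀ (l : ℕ) (ω : PathSpace V), (ω.shift h).eval (l * h) =
      ω.eval ((l + 1 : ℕ) * h) := by
    intro l ω
    exact congrArg ω.1 (by push_cast; ring)
  simp only [apartUpTo, Set.mem_ofPred_eq, Prod.map_fst, Prod.map_snd, e]
  constructor
  · intro H
    exact ⟨by simpa using H 0 (Nat.zero_le _), fun l hl => H (l + 1) (by omega)⟩
  · rintro ⟨h0, H⟩ l hl
    rcases l with _ | l
    · simpa using h0
    · exact H l (by omega)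

theorem IsMarkovChain.prod_apartUpTo (hP : IsMarkovChain q P) (h : ℝ≥0) (L : ℕ) (x y : V) :
    ((P x).prod (P y)) (apartUpTo h L) = ENNReal.ofReal (noMeet (transProb P h) L x y) := by
  have hprob := hP.isProb
  have hs := hP.stochastic h
  have hae : ∀ x y, ∀ᵐ w ∂((P x).prod (P y)), w.1.eval 0 = x ∧ w.2.eval 0 = y := fun x y =>
    (Measure.quasiMeasurePreserving_fst.ae (hP.ae_start x)).and
      (Measure.quasiMeasurePreserving_snd.ae (hP.ae_start y))
  induction L generalizing x y with
  | zero =>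
    have h2 : apartUpTo (V := V) h 0 =ᵐ[(P x).prod (P y)] {_w | x ≠ y} := by
      filter_upwards [hae x y] with w hw
      apply propext
      change (∀ l : ℕ, l ≤ 0 → w.1.eval (l * h) ≠ w.2.eval (l * h)) ↔ x ≠ y
      simp [hw.1, hw.2]
    rw [measure_congr h2, noMeet]
    split_ifs with h3 <;> simp [h3]
  | succ L ih =>
    by_cases hxy : x = y
    · subst hxy
      rw [noMeet_self, ENNReal.ofReal_zero]
      refine measure_mono_null (t := {w | ¬ (w.1.eval 0 = x ∧ w.2.eval 0 = x)}) ?_ (hae x x)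
      intro w hw hw'
      exact ((mem_apartUpTo_succ h L w).1 hw).1 (hw'.1.trans hw'.2.symm)
    · have h2 : apartUpTo (V := V) h (L + 1) =ᵐ[(P x).prod (P y)]
          Prod.map (PathSpace.shift h) (PathSpace.shift h) ⁻¹' apartUpTo h L := by
        filter_upwards [hae x y] with w hw
        apply propext
        refine (mem_apartUpTo_succ h L w).trans ⟨fun h => h.2, fun h => ⟨?_, h⟩⟩
        rw [hw.1, hw.2]
        exact hxy
      have hm := PathSpace.measurable_shift (V := V) h
      rw [measure_congr h2, ← Measure.map_apply (hm.prodMap hm) (measurableSet_apartUpTo h L),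
        ← Measure.map_prod_map _ _ hm hm, hP.map_shift, hP.map_shift,
        Measure.prod_sum_smul _ _ _ (fun _ => ENNReal.ofReal_ne_top) fun _ => ENNReal.ofReal_ne_top]
      simp only [Measure.finsetSum_apply, Measure.smul_apply, smul_eq_mul, ih]
      rw [noMeet_succ_of_ne hxy, pairMean]
      have h0 : ∀ a b, 0 ≤ transProb P h x a * transProb P h y b := fun a b =>
        mul_nonneg ((hs x).nonneg a) ((hs y).nonneg b)
      rw [ENNReal.ofReal_sum_of_nonneg fun a _ => Finset.sum_nonneg fun b _ =>
        mul_nonneg (h0 a b) (noMeet_nonneg hs L a b)]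
      refine Finset.sum_congr rfl fun a _ => ?_
      rw [ENNReal.ofReal_sum_of_nonneg fun b _ => mul_nonneg (h0 a b) (noMeet_nonneg hs L a b)]
      refine Finset.sum_congr rfl fun b _ => ?_
      rw [ENNReal.ofReal_mul (h0 a b), ENNReal.ofReal_mul ((hs x).nonneg a)]

/-- The first meeting at a multiple of `h`. -/
def gridMeeting (h : ℝ≥0) (w : PathSpace V × PathSpace V) : ℝ≥0∞ :=
  ⨅ (l : ℕ) (_ : w.1.eval (l * h) = w.2.eval (l * h)), (l : ℝ≥0∞) * h

-- Layer-cake formula: the index of the first meeting is the number of `L` for which the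
-- trajectories are apart up to step `L`.
open Classical in
theorem gridMeeting_eq_tsum {h : ℝ≥0} (hh : 0 < h) (w : PathSpace V × PathSpace V) :
    gridMeeting h w = ∑' L : ℕ, (apartUpTo h L).indicator (fun _ => (h : ℝ≥0∞)) w := by
  by_cases hex : ∃ l : ℕ, w.1.eval (l * h) = w.2.eval (l * h)
  · set l := Nat.find hex with hl
    have hspec : w.1.eval (l * h) = w.2.eval (l * h) := Nat.find_spec hex
    have h1 : gridMeeting h w = l * h := by
      refine le_antisymm (iInf₂_le l hspec) (le_iInf₂ fun l' hl' => ?_)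
      have : l ≤ l' := Nat.find_le hl'
      gcongr
    have h2 : ∀ L, w ∈ apartUpTo h L ↔ L < l := by
      intro L
      constructor
      · intro hL
        by_contra hlt
        exact hL l (not_lt.1 hlt) hspec
      · intro hL l' hl'
        exact Nat.find_min hex (lt_of_le_of_lt hl' hL)
    rw [h1, tsum_eq_sum (s := Finset.range l)]
    · rw [Finset.sum_congr rfl fun L hL => Set.indicator_of_mem
        ((h2 L).2 (Finset.mem_range.1 hL)) _]
      simp
    · intro L hL
      exact Set.indicator_of_notMem (fun h' => hL (Finset.mem_range.2 ((h2 L).1 h'))) _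
  · push Not at hex
    have h1 : gridMeeting h w = ∞ := by
      simp [gridMeeting, hex]
    have h2 : ∀ L, w ∈ apartUpTo h L := fun L l _ => hex l
    rw [h1]
    simp only [Set.indicator_of_mem (h2 _)]
    exact (ENNReal.tsum_const_eq_top_of_ne_zero (by simpa using hh.ne')).symm

theorem measurable_gridMeeting {h : ℝ≥0} (hh : 0 < h) : Measurable (gridMeeting (V := V) h) := by
  have : gridMeeting (V := V) h =
      fun w => ∑' L : ℕ, (apartUpTo h L).indicator (fun _ => (h : ℝ≥0∞)) w :=
    funext fun w => gridMeeting_eq_tsum hh w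
  rw [this]
  exact Measurable.tsum fun L => measurable_const.indicator (measurableSet_apartUpTo h L)

theorem meetingTime_le_gridMeeting (h : ℝ≥0) (w : PathSpace V × PathSpace V) :
    meetingTime w.1 w.2 ≤ gridMeeting h w :=
  le_iInf₂ fun l hl => (iInf₂_le ((l : ℝ≥0) * h) hl).trans (by simp)

theorem antitone_gridMeeting (t : ℝ≥0) :
    Antitone fun N : ℕ => gridMeeting (V := V) (t / 2 ^ N) := by
  refine antitone_nat_of_succ_le fun N w => le_iInf₂ fun l hl => ?_
  have e : ((2 * l : ℕ) : ℝ≥0) * (t / 2 ^ (N + 1)) = l * (t / 2 ^ N) := by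
    push_cast
    rw [pow_succ]
    field_simp
  have h := iInf₂_le (f := fun (l : ℕ)
    (_ : w.1.eval (l * (t / 2 ^ (N + 1))) = w.2.eval (l * (t / 2 ^ (N + 1)))) =>
      (l : ℝ≥0∞) * ((t / 2 ^ (N + 1) : ℝ≥0) : ℝ≥0∞)) (2 * l) (by rw [e]; exact hl)
  refine h.trans (le_of_eq ?_)
  exact_mod_cast congrArg (fun r : ℝ≥0 => (r : ℝ≥0∞)) e

/-- Trajectories that meet at time `s` stay together for a while afterwards, and a sufficiently fine
dyadic grid has a point in this interval. -/
theorem iInf_gridMeeting {t : ℝ≥0} (ht : 0 < t) (w : PathSpace V × PathSpace V) :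
    ⨅ N : ℕ, gridMeeting (t / 2 ^ N) w = meetingTime w.1 w.2 := by
  refine le_antisymm (le_iInf₂ fun s hs => ?_) (le_iInf fun N => meetingTime_le_gridMeeting _ w)
  obtain ⟨c, hc, hconst⟩ := (nhdsGE_basis s).eventually_iff.1
    (eventually_pi_eq ![w.1, w.2] s)
  refine ENNReal.le_of_forall_pos_le_add fun ε hε _ => ?_
  have hpos : 0 < min ε (c - s) := lt_min hε (tsub_pos_of_lt hc)
  obtain ⟨N, hN⟩ := ((tendsto_div_two_pow t).eventually_lt_const hpos).exists
  set h := t / 2 ^ N with hh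
  have hh0 : 0 < h := by positivity
  set l := ⌈s / h⌉₊ with hl
  have h1 : s ≤ l * h := by
    rw [← div_le_iff₀ hh0]; exact Nat.le_ceil _
  have h2 : (l : ℝ≥0) * h ≤ s + h := by
    have := IsWalkSemigroup.ceil_mul_le (T := s) hh0
    exact_mod_cast this
  have h3 : (l : ℝ≥0) * h < c := by
    refine h2.trans_lt ?_
    have := hN.trans_le (min_le_right _ _)
    rwa [lt_tsub_iff_left] at this
  have h4 := hconst ⟨h1, h3⟩
  have h5 : w.1.eval (l * h) = w.2.eval (l * h) := (h4 0).trans (hs.trans (h4 1).symm)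
  refine (iInf_le _ N).trans ((iInf₂_le l h5).trans ?_)
  have h6 : (l : ℝ≥0) * h ≤ s + ε := h2.trans (by gcongr; exact hN.le.trans (min_le_left _ _))
  calc (l : ℝ≥0∞) * (h : ℝ≥0∞) = ((l * h : ℝ≥0) : ℝ≥0∞) := by push_cast; rfl
    _ ≤ ((s + ε : ℝ≥0) : ℝ≥0∞) := ENNReal.coe_le_coe.2 h6
    _ = s + ε := ENNReal.coe_add _ _

end Law
end

noncomputable section

/-! ### The semigroup of the random walk on a graph -/

section Semigroup

variable {V : Type*} [Fintype V] [DecidableEq V] {q : V → V → ℝ}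
  {P : V → Measure (PathSpace V)} {π : PMF V}

theorem IsMarkovChain.transProb_zero (hP : IsMarkovChain q P) (x y : V) :
    transProb P 0 x y = if x = y then 1 else 0 := by
  have := hP.isProb x
  have h : {ω : PathSpace V | ω.eval 0 = y} =ᵐ[P x] {_ω | x = y} := by
    filter_upwards [hP.ae_start x] with ω hω
    apply propext
    change ω.eval 0 = y ↔ x = y
    rw [hω]
  rw [transProb, measureReal_congr h]
  split_ifs with hxy
  · subst hxy; simp
  · simp [hxy]

theorem IsMarkovChain.transProb_add (hP : IsMarkovChain q P) (s t : ℝ≥0) (x y : V) :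
    transProb P (s + t) x y = ∑ z, transProb P s x z * transProb P t z y := by
  have hprob := hP.isProb
  have h := congrArg (fun μ => μ {ω : PathSpace V | ω.eval t = y}) (hP.map_shift x s)
  simp only [Measure.finsetSum_apply, Measure.smul_apply, smul_eq_mul] at h
  rw [Measure.map_apply (PathSpace.measurable_shift s) (PathSpace.measurableSet_eval_eq t y)] at h
  have e : PathSpace.shift s ⁻¹' {ω : PathSpace V | ω.eval t = y} =
      {ω | ω.eval (s + t) = y} := by
    rw [add_comm]; rfl
  rw [e] at h
  have h2 := congrArg ENNReal.toReal h
  rw [ENNReal.toReal_sum fun z _ => ENNReal.mul_ne_top ENNReal.ofReal_ne_top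
    (measure_ne_top _ _)] at h2
  refine h2.trans (Finset.sum_congr rfl fun z _ => ?_)
  rw [ENNReal.toReal_mul, ENNReal.toReal_ofReal ((hP.stochastic s x).nonneg z)]
  rfl

theorem PMF.isProbVec (π : PMF V) : IsProbVec fun x => (π x).toReal := by
  refine ⟨fun x => ENNReal.toReal_nonneg, ?_⟩
  rw [← ENNReal.toReal_sum fun x _ => π.apply_ne_top x]
  have := π.tsum_coe
  rw [tsum_fintype] at this
  rw [this, ENNReal.toReal_one]

theorem IsMarkovChain.stationary (hP : IsMarkovChain q P) (hπ : IsStationaryDist P π) (t : ℝ≥0) :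
    IsStationaryVec (transProb P t) fun x => (π x).toReal := by
  have hprob := hP.isProb
  refine ⟨π.isProbVec, fun y => ?_⟩
  have key : ∀ s : ℝ≥0, (startedFrom P π {ω | ω.eval s = y}).toReal =
      ∑ x, (π x).toReal * transProb P s x y := by
    intro s
    rw [startedFrom, Measure.finsetSum_apply, ENNReal.toReal_sum fun x _ => by
      rw [Measure.smul_apply, smul_eq_mul]
      exact ENNReal.mul_ne_top (π.apply_ne_top x) (measure_ne_top _ _)]
    refine Finset.sum_congr rfl fun x _ => ?_
    rw [Measure.smul_apply, smul_eq_mul, ENNReal.toReal_mul]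
    rfl
  have h := congrArg (fun μ => (μ {ω : PathSpace V | ω.eval 0 = y}).toReal) (hπ t)
  rw [Measure.map_apply (PathSpace.measurable_shift t) (PathSpace.measurableSet_eval_eq 0 y)] at h
  have e : PathSpace.shift t ⁻¹' {ω : PathSpace V | ω.eval 0 = y} = {ω | ω.eval t = y} := by
    change {ω : PathSpace V | ω.1 (0 + t) = y} = {ω | ω.1 t = y}
    rw [zero_add]
  rw [e, key, key] at h
  rw [h]
  simp [hP.transProb_zero]

theorem IsMarkovChain.tendsto_transProb_div (hP : IsMarkovChain q P) {x y : V} (hxy : x ≠ y) :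
    Tendsto (fun h : ℝ≥0 => transProb P h x y / h) (𝓝[>] 0) (𝓝 (q x y)) :=
  hP.rate x y hxy

theorem IsMarkovChain.tendsto_one_sub_div (hP : IsMarkovChain q P) (x : V) :
    Tendsto (fun h : ℝ≥0 => (1 - transProb P h x x) / h) (𝓝[>] 0)
      (𝓝 (∑ y ∈ Finset.univ.erase x, q x y)) := by
  have h := tendsto_finsetSum (Finset.univ.erase x) fun y hy =>
    hP.tendsto_transProb_div (Finset.ne_of_mem_erase hy).symm
  refine h.congr fun t => ?_
  rw [← Finset.sum_div]
  congr 1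
  have h2 := (hP.stochastic t x).sum_eq_one
  rw [← Finset.add_sum_erase _ _ (Finset.mem_univ x)] at h2
  linarith

/-- The balance equations, as the derivative at time 0 of the invariance of `π`. -/
theorem IsMarkovChain.sum_rate_eq (hP : IsMarkovChain q P) (hπ : IsStationaryDist P π) (y : V) :
    ∑ x ∈ Finset.univ.erase y, (π x).toReal * q x y =
      (π y).toReal * ∑ z ∈ Finset.univ.erase y, q y z := by
  have h1 := tendsto_finsetSum (Finset.univ.erase y) fun x hx =>
    (hP.tendsto_transProb_div (Finset.ne_of_mem_erase hx)).const_mul (π x).toReal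
  have h2 := (hP.tendsto_one_sub_div y).const_mul (π y).toReal
  have : (𝓝[>] (0 : ℝ≥0)).NeBot := inferInstance
  refine tendsto_nhds_unique (h1.congr fun t => ?_) h2
  have h3 := (hP.stationary hπ t).inv y
  rw [← Finset.add_sum_erase _ _ (Finset.mem_univ y)] at h3
  simp_rw [← mul_div_assoc]
  rw [← Finset.sum_div]
  congr 1
  linarith

end Semigroup

/-! ### Rates, irreducibility and stationary law of the walk on the graph. -/

section Graph

variable {V : Type*} [Fintype V] [DecidableEq V] {G : SimpleGraph V} [DecidableRel G.Adj]
  {P : V → Measure (PathSpace V)} {π : PMF V}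

theorem sum_walkRate (hdeg : ∀ x, 0 < G.degree x) (x : V) :
    ∑ y ∈ Finset.univ.erase x, walkRate G x y = 1 := by
  have h1 : ∑ y ∈ Finset.univ.erase x, walkRate G x y = ∑ y, walkRate G x y := by
    rw [← Finset.add_sum_erase _ (walkRate G x) (Finset.mem_univ x)]
    simp [walkRate]
  rw [h1]
  unfold walkRate
  rw [← Finset.sum_filter, ← SimpleGraph.neighborFinset_eq_filter, Finset.sum_const,
    SimpleGraph.card_neighborFinset_eq_degree, nsmul_eq_mul]
  have : (G.degree x : ℝ) ≠ 0 := by exact_mod_cast (hdeg x).ne'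
  field_simp

/-- The total jump rate is 1; the factor 2 is the room needed to pass from a limit to an inequality.
-/
theorem IsMarkovChain.eventually_rate_le (hP : IsMarkovChain (walkRate G) P)
    (hdeg : ∀ x, 0 < G.degree x) :
    ∀ᶠ h : ℝ≥0 in 𝓝[>] 0, ∀ x, 1 - transProb P h x x ≤ 2 * h := by
  rw [eventually_all]
  intro x
  have h := hP.tendsto_one_sub_div x
  rw [sum_walkRate hdeg] at h
  filter_upwards [h.eventually_lt_const one_lt_two, self_mem_nhdsWithin] with t ht ht0
  rw [div_lt_iff₀ (by exact_mod_cast ht0)] at ht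
  exact ht.le

theorem IsMarkovChain.eventually_pos (hP : IsMarkovChain (walkRate G) P)
    (hdeg : ∀ x, 0 < G.degree x) :
    ∀ᶠ h : ℝ≥0 in 𝓝[>] 0, ∀ x y, (x = y ∨ G.Adj x y) → 0 < transProb P h x y := by
  rw [eventually_all]
  intro x
  rw [eventually_all]
  intro y
  by_cases hxy : x = y
  · subst hxy
    have h2 : ∀ᶠ h : ℝ≥0 in 𝓝[>] 0, h < 1 / 2 :=
      mem_nhdsWithin_of_mem_nhds (Iio_mem_nhds (by positivity))
    filter_upwards [hP.eventually_rate_le hdeg, h2] with h h1 h2 _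
    have : (h : ℝ) < 1 / 2 := by exact_mod_cast h2
    linarith [h1 x]
  · by_cases hadj : G.Adj x y
    · have h1 : 0 < walkRate G x y := by
        rw [walkRate, if_pos hadj]
        have : (0 : ℝ) < G.degree x := by exact_mod_cast hdeg x
        positivity
      filter_upwards [(hP.tendsto_transProb_div hxy).eventually_const_lt h1,
        self_mem_nhdsWithin] with t ht ht0 _
      have h0 : (0 : ℝ) < t := by exact_mod_cast ht0
      exact (div_pos_iff_of_pos_right h0).1 ht
    · exact Eventually.of_forall fun h h' => absurd h' (by tauto)

/-- Wait at the start and then follow the edges of the walk. The direction is reversed because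
`stepPow` appends its last step, while `cons` exposes the first edge. -/
theorem exists_stepPow_pos {p : V → V → ℝ} (hp : IsStochastic p)
    (hpos : ∀ x y, (x = y ∨ G.Adj x y) → 0 < p x y) {x y : V} {d N : ℕ} (w : G.Walk x y)
    (hd : w.length = d) (hN : d ≤ N) : 0 < stepPow p N y x := by
  induction w generalizing d N with
  | nil =>
    rename_i u
    clear hd hN
    induction N with
    | zero => simp [stepPow]
    | succ N ih =>
      refine lt_of_lt_of_le (mul_pos ih (hpos u u (Or.inl rfl))) ?_
      exact Finset.single_le_sum (f := fun z => stepPow p N u z * p z u)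
        (fun z _ => mul_nonneg ((hp.stepPow N u).nonneg z) ((hp z).nonneg u)) (Finset.mem_univ u)
  | cons hadj w ih =>
    rename_i u v z
    simp only [SimpleGraph.Walk.length_cons] at hd
    obtain ⟨M, rfl⟩ : ∃ M, N = M + 1 := ⟨N - 1, by omega⟩
    refine lt_of_lt_of_le (mul_pos (ih (N := M) rfl (by omega))
      (hpos v u (Or.inr hadj.symm))) ?_
    exact Finset.single_le_sum (f := fun a => stepPow p M z a * p a u)
      (fun a _ => mul_nonneg ((hp.stepPow M z).nonneg a) ((hp a).nonneg u)) (Finset.mem_univ v)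

theorem IsMarkovChain.transProb_pos (hP : IsMarkovChain (walkRate G) P) (hG : G.Connected)
    (hdeg : ∀ x, 0 < G.degree x) {t : ℝ≥0} (ht : 0 < t) (x y : V) : 0 < transProb P t x y := by
  obtain ⟨w⟩ := hG.preconnected y x
  have h1 : Tendsto (fun N : ℕ => t / 2 ^ N) atTop (𝓝[>] 0) :=
    tendsto_nhdsWithin_iff.2 ⟨tendsto_div_two_pow t,
      Eventually.of_forall fun N => show 0 < t / 2 ^ N by positivity⟩
  obtain ⟨N, hN, hle⟩ := ((h1.eventually (hP.eventually_pos hdeg)).and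
    (eventually_ge_atTop w.length)).exists
  have h2 := exists_stepPow_pos (hP.stochastic _) hN w rfl
    (hle.trans (Nat.lt_two_pow_self (n := N)).le)
  rw [stepPow_eq_of_add hP.transProb_zero hP.transProb_add] at h2
  have e : ((2 ^ N : ℕ) : ℝ≥0) * (t / 2 ^ N) = t := by
    push_cast
    exact mul_div_cancel₀ t (by positivity)
  rwa [e] at h2

theorem IsMarkovChain.isWalkSemigroup (hP : IsMarkovChain (walkRate G) P) (hG : G.Connected)
    (hdeg : ∀ x, 0 < G.degree x) (hπ : IsStationaryDist P π) :
    IsWalkSemigroup (transProb P) fun x => (π x).toReal where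
  stochastic := hP.stochastic
  zero := hP.transProb_zero
  add := hP.transProb_add
  stationary := hP.stationary hπ
  rate := hP.eventually_rate_le hdeg
  pos _ ht := hP.transProb_pos hG hdeg ht

/-- The stationary distribution is proportional to the degrees. -/
theorem IsMarkovChain.stationary_eq (hP : IsMarkovChain (walkRate G) P) (hG : G.Connected)
    (hdeg : ∀ x, 0 < G.degree x) (hπ : IsStationaryDist P π) (x : V) :
    (π x).toReal = G.degree x / ∑ z, (G.degree z : ℝ) := by
  have hd : ∀ x, (0 : ℝ) < G.degree x := fun x => by exact_mod_cast hdeg x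
  -- By the balance equations `f = π / degree` equals its average over the neighbours, so
  -- connectedness and the maximum principle make it constant.
  set f : V → ℝ := fun x => (π x).toReal / G.degree x with hf
  have hbal : ∀ y, ∑ x ∈ G.neighborFinset y, f x = ∑ x ∈ G.neighborFinset y, f y := by
    intro y
    have h := hP.sum_rate_eq hπ y
    rw [sum_walkRate hdeg, mul_one] at h
    have h1 : ∑ x ∈ Finset.univ.erase y, (π x).toReal * walkRate G x y =
        ∑ x ∈ G.neighborFinset y, f x := by
      rw [SimpleGraph.neighborFinset_eq_filter, Finset.sum_filter,
        ← Finset.add_sum_erase _ (fun x => if G.Adj y x then f x else 0) (Finset.mem_univ y)]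
      simp only [SimpleGraph.irrefl, if_false, zero_add]
      refine Finset.sum_congr rfl fun x _ => ?_
      rw [walkRate]
      by_cases hadj : G.Adj x y
      · rw [if_pos hadj, if_pos hadj.symm, hf, mul_one_div]
      · rw [if_neg hadj, if_neg fun h => hadj h.symm, mul_zero]
    rw [← h1, h, Finset.sum_const, SimpleGraph.card_neighborFinset_eq_degree, nsmul_eq_mul, hf]
    field_simp [(hd y).ne']
  have : Nonempty V := ⟨x⟩
  obtain ⟨x₀, hx₀⟩ := Finite.exists_max f
  have hconst : ∀ y, f y = f x₀ := by
    intro y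
    obtain ⟨w⟩ := hG.preconnected y x₀
    induction w with
    | nil => rfl
    | cons hadj w ih =>
      rename_i u v z
      have hv : f v = f z := ih hx₀
      have h1 := (Finset.sum_eq_sum_iff_of_le (s := G.neighborFinset v) (f := f)
        (g := fun _ => f v) fun a _ => hv ▸ hx₀ a).1 (hbal v) u (by
          rw [SimpleGraph.mem_neighborFinset]; exact hadj.symm)
      exact h1.trans hv
  have hpi : ∀ y, (π y).toReal = f x₀ * G.degree y := fun y => by
    rw [← hconst y, hf]; exact (div_mul_cancel₀ _ (hd y).ne').symm
  have hsum := π.isProbVec.sum_eq_one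
  simp only [hpi, ← Finset.mul_sum] at hsum
  have hS : (∑ z, (G.degree z : ℝ)) ≠ 0 := fun h0 => by rw [h0] at hsum; simp at hsum
  rw [hpi, eq_div_iff hS, mul_right_comm, hsum, one_mul]

end Graph

/-! ### Mixing -/

section Mixing

variable {V : Type*} [Fintype V] [DecidableEq V]

/-- As `v` has total mass zero, a common row `g` can be subtracted from all rows of `p`. -/
theorem sum_abs_comp_le {p : V → V → ℝ} {v g : V → ℝ} {r : ℝ} (hv : ∑ x, v x = 0)
    (h : ∀ x, ∑ y, |p x y - g y| ≤ r) : ∑ y, |∑ x, v x * p x y| ≤ r * ∑ x, |v x| := by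
  have h1 : ∀ y, |∑ x, v x * p x y| ≤ ∑ x, |v x| * |p x y - g y| := by
    intro y
    have : ∑ x, v x * p x y = ∑ x, v x * (p x y - g y) := by
      simp_rw [mul_sub, Finset.sum_sub_distrib, ← Finset.sum_mul, hv, zero_mul, sub_zero]
    rw [this]
    refine (Finset.abs_sum_le_sum_abs _ _).trans (le_of_eq ?_)
    exact Finset.sum_congr rfl fun x _ => abs_mul _ _
  refine (Finset.sum_le_sum fun y _ => h1 y).trans ?_
  rw [Finset.sum_comm, Finset.mul_sum]
  refine Finset.sum_le_sum fun x _ => ?_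
  rw [← Finset.mul_sum, mul_comm]
  exact mul_le_mul_of_nonneg_right (h x) (abs_nonneg _)

variable {p : ℝ≥0 → V → V → ℝ} {π : V → ℝ}

/-- Each block of time `T` contracts the distance to `π` by the factor `r`. The row `g` is free: a
constant gives Doeblin's condition, and `g = π` the iteration of the mixing time. -/
theorem IsWalkSemigroup.sum_abs_sub_mul_le (H : IsWalkSemigroup p π) {T : ℝ≥0} {g : V → ℝ} {r : ℝ}
    (hr : 0 ≤ r) (h : ∀ x, ∑ y, |p T x y - g y| ≤ r) (j : ℕ) (x : V) :
    ∑ y, |p (j * T) x y - π y| ≤ 2 * r ^ j := by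
  induction j with
  | zero =>
    simp only [Nat.cast_zero, zero_mul, pow_zero, mul_one]
    calc ∑ y, |p 0 x y - π y| ≤ ∑ y, (p 0 x y + π y) := Finset.sum_le_sum fun y _ => by
          rw [abs_le]
          constructor <;> linarith [(H.stochastic 0 x).nonneg y, (H.stationary 0).prob.nonneg y]
      _ = 2 := by
          rw [Finset.sum_add_distrib, (H.stochastic 0 x).sum_eq_one,
            (H.stationary 0).prob.sum_eq_one]
          norm_num
  | succ j ih =>
    have e : ((j + 1 : ℕ) : ℝ≥0) * T = j * T + T := by push_cast; ring
    have h1 : ∀ y, p (((j + 1 : ℕ) : ℝ≥0) * T) x y - π y =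
        ∑ z, (p (j * T) x z - π z) * p T z y := by
      intro y
      rw [e, H.add, ← (H.stationary T).inv y, ← Finset.sum_sub_distrib]
      exact Finset.sum_congr rfl fun z _ => by ring
    simp_rw [h1]
    refine (sum_abs_comp_le ?_ h).trans ?_
    · rw [Finset.sum_sub_distrib, (H.stochastic _ x).sum_eq_one, (H.stationary 0).prob.sum_eq_one,
        sub_self]
    · rw [pow_succ]
      calc r * ∑ z, |p (j * T) x z - π z| ≤ r * (2 * r ^ j) := by gcongr
        _ = _ := by ring

/-- Doeblin's condition at time 1, where all transition probabilities are at least some `c > 0`. -/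
theorem IsWalkSemigroup.exists_mixed (H : IsWalkSemigroup p π) {θ : ℝ} (hθ : 0 < θ) :
    ∃ T, ∀ x, ∑ y, |p T x y - π y| ≤ θ := by
  rcases isEmpty_or_nonempty V with hV | hV
  · exact ⟨0, fun x => (hV.false x).elim⟩
  obtain ⟨a, ha⟩ := Finite.exists_min fun a : V × V => p 1 a.1 a.2
  set c := p 1 a.1 a.2 with hc
  have hc0 : 0 < c := H.pos 1 one_pos _ _
  have hmin : ∀ x y, c ≤ p 1 x y := fun x y => ha (x, y)
  set r : ℝ := 1 - Fintype.card V * c with hr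
  have hsum : ∀ x, ∑ y, |p 1 x y - c| = r := by
    intro x
    rw [Finset.sum_congr rfl fun y _ => abs_of_nonneg (sub_nonneg.2 (hmin x y)),
      Finset.sum_sub_distrib, (H.stochastic 1 x).sum_eq_one]
    simp [hr]
  have hr0 : 0 ≤ r := by
    rw [← hsum hV.some]; exact Finset.sum_nonneg fun _ _ => abs_nonneg _
  have hr1 : r < 1 := by
    have : (0 : ℝ) < Fintype.card V := by exact_mod_cast Fintype.card_pos
    have := mul_pos this hc0
    linarith
  have hlim := (tendsto_pow_atTop_nhds_zero_of_lt_one hr0 hr1).const_mul 2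
  rw [mul_zero] at hlim
  obtain ⟨j, hj⟩ := (hlim.eventually_lt_const hθ).exists
  exact ⟨j * 1, fun x => (H.sum_abs_sub_mul_le hr0 (g := fun _ => c) (fun x => (hsum x).le) j x).trans
    hj.le⟩

/-- The rate bound is only assumed for small times. Staying put through `2 ^ N` small steps and
Bernoulli's inequality extend it to all times. -/
theorem IsWalkSemigroup.one_sub_le (H : IsWalkSemigroup p π) (t : ℝ≥0) (x : V) :
    1 - 2 * t ≤ p t x x := by
  rcases eq_or_ne t 0 with rfl | ht
  · simp [H.zero]
  have ht0 : 0 < t := pos_iff_ne_zero.2 ht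
  rcases le_or_gt (1 : ℝ) (2 * t) with h1 | h1
  · linarith [(H.stochastic t x).nonneg x]
  obtain ⟨N, hN⟩ := (H.eventually_rate (fun N => show 0 < t / 2 ^ N by positivity)
    (tendsto_div_two_pow t)).exists
  set h : ℝ≥0 := t / 2 ^ N with hh
  have hmul : ∀ M : ℕ, p h x x ^ M ≤ stepPow (p h) M x x := by
    intro M
    induction M with
    | zero => simp [stepPow]
    | succ M ih =>
      rw [pow_succ]
      refine (mul_le_mul_of_nonneg_right ih ((H.stochastic h x).nonneg x)).trans ?_
      exact Finset.single_le_sum (f := fun z => stepPow (p h) M x z * p h z x)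
        (fun z _ => mul_nonneg (((H.stochastic h).stepPow M x).nonneg z)
          ((H.stochastic h z).nonneg x)) (Finset.mem_univ x)
  have h2 := hmul (2 ^ N)
  have e : ((2 ^ N : ℕ) : ℝ≥0) * h = t := by
    push_cast
    exact mul_div_cancel₀ t (by positivity)
  rw [H.stepPow_eq, e] at h2
  refine le_trans ?_ h2
  have e' : ((2 ^ N : ℕ) : ℝ) * h = t := by exact_mod_cast congrArg NNReal.toReal e
  have hht : (h : ℝ) ≤ t := by
    rw [← e']
    exact le_mul_of_one_le_left h.2 (by exact_mod_cast Nat.one_le_two_pow)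
  have h3 := one_add_mul_le_pow (a := -(2 * (h : ℝ))) (by linarith) (2 ^ N)
  refine le_trans (le_of_eq ?_) (h3.trans ?_)
  · have : ((2 ^ N : ℕ) : ℝ) * -(2 * (h : ℝ)) = -(2 * t) := by rw [← e']; ring
    rw [this]; ring
  · refine pow_le_pow_left₀ (by linarith) ?_ _
    linarith [hN x]

end Mixing
end

noncomputable section

/-! ### The mean meeting time and the coalescence time -/

section Times

variable {V : Type*} [Fintype V] [DecidableEq V] {q : V → V → ℝ}
  {P : V → Measure (PathSpace V)} {π : PMF V}

theorem IsMarkovChain.lintegral_gridMeeting (hP : IsMarkovChain q P) {h : ℝ≥0} (hh : 0 < h)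
    (hs : ∀ x y, Summable fun l => noMeet (transProb P h) l x y) :
    ∫⁻ w, gridMeeting h w ∂((startedFrom P π).prod (startedFrom P π)) =
      ENNReal.ofReal (h * statMeet (transProb P h) fun x => (π x).toReal) := by
  have hprob := hP.isProb
  have hst := hP.stochastic h
  have h1 : ∀ x y, ∫⁻ w, gridMeeting h w ∂((P x).prod (P y)) =
      ENNReal.ofReal (h * meanMeet (transProb P h) x y) := by
    intro x y
    simp_rw [gridMeeting_eq_tsum hh]
    rw [lintegral_tsum fun L =>
      (measurable_const.indicator (measurableSet_apartUpTo h L)).aemeasurable]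
    simp_rw [lintegral_indicator_const (measurableSet_apartUpTo h _), hP.prod_apartUpTo]
    rw [ENNReal.tsum_mul_left, ← ENNReal.ofReal_tsum_of_nonneg
      (fun L => noMeet_nonneg hst L x y) (hs x y), ENNReal.ofReal_mul (NNReal.coe_nonneg h),
      ENNReal.ofReal_coe_nnreal]
    rfl
  rw [startedFrom, Measure.prod_sum_smul _ _ _ π.apply_ne_top π.apply_ne_top]
  simp only [lintegral_finsetSum_measure, lintegral_smul_measure, h1]
  have h0 : ∀ x y, 0 ≤ (h : ℝ) * meanMeet (transProb P h) x y := fun x y =>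
    mul_nonneg h.2 (meanMeet_nonneg hst x y)
  rw [statMeet, ← statMean_const_mul, statMean]
  rw [ENNReal.ofReal_sum_of_nonneg fun x _ => Finset.sum_nonneg fun y _ =>
    mul_nonneg (mul_nonneg ENNReal.toReal_nonneg ENNReal.toReal_nonneg) (h0 x y)]
  refine Finset.sum_congr rfl fun x _ => ?_
  rw [ENNReal.ofReal_sum_of_nonneg fun y _ =>
    mul_nonneg (mul_nonneg ENNReal.toReal_nonneg ENNReal.toReal_nonneg) (h0 x y)]
  refine Finset.sum_congr rfl fun y _ => ?_
  rw [ENNReal.ofReal_mul (mul_nonneg ENNReal.toReal_nonneg ENNReal.toReal_nonneg),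
    ENNReal.ofReal_mul ENNReal.toReal_nonneg, ENNReal.ofReal_toReal (π.apply_ne_top x),
    ENNReal.ofReal_toReal (π.apply_ne_top y), smul_eq_mul]

/-- Monotone convergence for a decreasing sequence, which is legitimate because its first integral
is finite. -/
theorem meanMeetingTime_eq_iInf (hP : IsMarkovChain q P)
    (H : IsWalkSemigroup (transProb P) fun x => (π x).toReal) {t : ℝ≥0} (ht : 0 < t) :
    meanMeetingTime P π = ⨅ N : ℕ, ∫⁻ w, gridMeeting (t / 2 ^ N) w
      ∂((startedFrom P π).prod (startedFrom P π)) := by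
  rw [← lintegral_iInf (fun N => measurable_gridMeeting (by positivity)) (antitone_gridMeeting t)]
  · exact lintegral_congr fun w => (iInf_gridMeeting ht w).symm
  · rw [hP.lintegral_gridMeeting (by positivity) (H.summable (by positivity))]
    exact ENNReal.ofReal_ne_top

theorem meanMeetingTime_lt_top (hP : IsMarkovChain q P)
    (H : IsWalkSemigroup (transProb P) fun x => (π x).toReal) : meanMeetingTime P π < ∞ := by
  rw [meanMeetingTime_eq_iInf hP H one_pos]
  refine (iInf_le _ 0).trans_lt ?_
  rw [hP.lintegral_gridMeeting (by positivity) (H.summable (by positivity))]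
  exact ENNReal.ofReal_lt_top

/-- The mean meeting time is the limit of the grid approximations. -/
theorem tendsto_statMeet (hP : IsMarkovChain q P)
    (H : IsWalkSemigroup (transProb P) fun x => (π x).toReal) {t : ℝ≥0} (ht : 0 < t) :
    Tendsto (fun N : ℕ => ((t / 2 ^ N : ℝ≥0) : ℝ) *
      statMeet (transProb P (t / 2 ^ N)) fun x => (π x).toReal) atTop
      (𝓝 (meanMeetingTime P π).toReal) := by
  have h1 : Antitone fun N : ℕ => ∫⁻ w, gridMeeting (t / 2 ^ N) w
      ∂((startedFrom P π).prod (startedFrom P π)) :=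
    fun i j hij => lintegral_mono (antitone_gridMeeting t hij)
  have h2 := tendsto_atTop_iInf h1
  rw [← meanMeetingTime_eq_iInf hP H ht] at h2
  refine ((ENNReal.tendsto_toReal (meanMeetingTime_lt_top hP H).ne).comp h2).congr fun N => ?_
  rw [Function.comp_apply, hP.lintegral_gridMeeting (by positivity) (H.summable (by positivity))]
  refine ENNReal.toReal_ofReal (mul_nonneg (NNReal.coe_nonneg _) ?_)
  rw [statMeet, ← statMean_const (H.stationary 0).prob 0]
  exact statMean_mono (H.stationary 0).prob (meanMeet_nonneg (hP.stochastic _))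

variable {k : ℕ} {x : Fin k → V}

/-- The probability that the system has not coalesced at time `t`. -/
def notCoalesced (P : V → Measure (PathSpace V)) (x : Fin k → V) (t : ℝ≥0) : ℝ :=
  (Measure.pi fun j => P (x j)).real {X | (t : ℝ≥0∞) < coalescenceTime 1 X}

theorem notCoalesced_nonneg (t : ℝ≥0) : 0 ≤ notCoalesced P x t := measureReal_nonneg

theorem notCoalesced_antitone (hP : IsMarkovChain q P) : Antitone (notCoalesced P x) := by
  have hprob := hP.isProb
  intro s t hst
  refine measureReal_mono fun X hX => ?_
  exact lt_of_le_of_lt (ENNReal.coe_le_coe.2 hst) hX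

theorem two_pow_mul_div (t : ℝ≥0) (i N : ℕ) : 2 ^ i * t / 2 ^ (N + i) = t / 2 ^ N := by
  rw [pow_add]
  field_simp

/-- Submultiplicativity on the grid passes to the limit. Powers of two are used because `2 ^ i * t`
and `t` then share the same dyadic grids. -/
theorem notCoalesced_two_pow_le (hP : IsMarkovChain q P) (hx : Function.Surjective x) (t : ℝ≥0)
    (i : ℕ) : notCoalesced P x (2 ^ i * t) ≤ notCoalesced P x t ^ (2 ^ i) := by
  refine le_of_tendsto_of_tendsto
    ((tendsto_add_atTop_iff_nat i).2 (hP.tendsto_flow hx (2 ^ i * t)))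
    ((hP.tendsto_flow hx t).pow (2 ^ i)) (Eventually.of_forall fun N => ?_)
  simp only [two_pow_mul_div]
  rw [show 2 ^ (N + i) = 2 ^ i * 2 ^ N by rw [pow_add, mul_comm]]
  exact flow_iterate_mul_atLeastTwo_le (hP.stochastic _) _ _

theorem notCoalesced_le_geometric (hP : IsMarkovChain q P) (hx : Function.Surjective x)
    {c : ℝ} (hc1 : c ≤ 1) (hc : ∀ a b, c ≤ hitStep (transProb P 1) a b) (i : ℕ) :
    notCoalesced P x (2 ^ i) ≤
      ((Finset.univ : Finset V).offDiag.card : ℝ) * (1 - c) ^ (2 ^ i) := by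
  have h1 := (tendsto_add_atTop_iff_nat i).2 (hP.tendsto_flow hx (2 ^ i))
  refine le_of_tendsto' h1 fun N => ?_
  have e : (2 : ℝ≥0) ^ i / 2 ^ (N + i) = 1 / 2 ^ N := by
    have := two_pow_mul_div 1 i N
    rwa [mul_one] at this
  simp only [e]
  refine (flow_iterate_atLeastTwo_le_sum_noMeet (hP.stochastic _) _ _).trans ?_
  rw [← nsmul_eq_mul]
  refine Finset.sum_le_card_nsmul _ _ _ fun r _ => ?_
  rw [show 2 ^ (N + i) = 2 ^ N * 2 ^ i from pow_add _ _ _]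
  refine noMeet_mul_le (hP.stochastic _) hc1 (fun a b => ?_) _ _ _
  rw [stepPow_eq_of_add hP.transProb_zero hP.transProb_add]
  have e2 : ((2 ^ N : ℕ) : ℝ≥0) * (1 / 2 ^ N) = 1 := by
    push_cast
    exact mul_div_cancel₀ 1 (by positivity)
  rw [e2]
  exact hc a b

theorem ae_coalescenceTime_lt_top (hP : IsMarkovChain q P)
    (H : IsWalkSemigroup (transProb P) fun x => (π x).toReal) (hx : Function.Surjective x) :
    ∀ᵐ X ∂(Measure.pi fun j => P (x j)), coalescenceTime 1 X < ∞ := by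
  have hprob := hP.isProb
  obtain ⟨v, -⟩ := π.support_nonempty
  have : Nonempty V := ⟨v⟩
  obtain ⟨c, hc0, hc⟩ := exists_pos_le_hitStep (H.pos 1 one_pos)
  have hc1 : c ≤ 1 := (hc v v).trans (hitStep_le_one (hP.stochastic 1) v v)
  set μ := Measure.pi fun j => P (x j) with hμ
  have h1 : ∀ i : ℕ, μ.real {X | ¬ coalescenceTime 1 X < ∞} ≤
      ((Finset.univ : Finset V).offDiag.card : ℝ) * (1 - c) ^ (2 ^ i) := fun i => by
    refine le_trans (measureReal_mono fun X hX => ?_) (notCoalesced_le_geometric hP hx hc1 hc i)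
    have hX' : coalescenceTime 1 X = ∞ := not_lt_top_iff.1 hX
    change ((2 ^ i : ℝ≥0) : ℝ≥0∞) < coalescenceTime 1 X
    rw [hX']
    exact ENNReal.coe_lt_top
  have h2 : Tendsto (fun i : ℕ => ((Finset.univ : Finset V).offDiag.card : ℝ) *
      (1 - c) ^ (2 ^ i)) atTop (𝓝 0) := by
    have h3 := (tendsto_pow_atTop_nhds_zero_of_lt_one (r := 1 - c) (by linarith)
      (by linarith)).comp (tendsto_pow_atTop_atTop_of_one_lt (r := 2) one_lt_two)
    simpa using h3.const_mul (((Finset.univ : Finset V).offDiag.card : ℝ))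
  have h3 : μ.real {X | ¬ coalescenceTime 1 X < ∞} = 0 :=
    le_antisymm (ge_of_tendsto' h2 h1) measureReal_nonneg
  rw [ae_iff]
  exact (measureReal_eq_zero_iff).1 h3

end Times

/-! ### The mixing time -/

section MixingTime

variable {V : Type*} [Fintype V] [DecidableEq V] {P : V → Measure (PathSpace V)} {π : PMF V}

theorem tvDist_le_iff (x : V) (T : ℝ≥0) :
    tvDist P π x T ≤ 1 / 4 ↔ ∑ y, |transProb P T x y - (π y).toReal| ≤ 1 / 2 := by
  unfold tvDist transProb
  constructor <;> intro h <;> linarith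

/-- Some vertex has `π x ≤ 1/3`. From there the walk has not moved by time `T` with probability at
least `1 - 2 T`, so distance `1/4` forces `2 T ≥ 1 - 1/3 - 1/4`. -/
theorem one_fifth_le_mixingTime (H : IsWalkSemigroup (transProb P) fun x => (π x).toReal)
    (hn : 3 ≤ Fintype.card V) : (1 / 5 : ℝ) ≤ mixingTime P π := by
  obtain ⟨T₀, hT₀⟩ := H.exists_mixed (θ := 1 / 2) (by norm_num)
  have hne : {T : ℝ≥0 | ∀ x, tvDist P π x T ≤ 1 / 4}.Nonempty :=
    ⟨T₀, fun x => (tvDist_le_iff x T₀).2 (hT₀ x)⟩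
  have h5 : (1 / 5 : ℝ≥0) ≤ mixingTime P π := by
    refine le_csInf hne fun T hT => ?_
    obtain ⟨x, hx⟩ : ∃ x, (π x).toReal ≤ 1 / 3 := by
      by_contra! h
      have h1 := π.isProbVec.sum_eq_one
      have h2 : (3 : ℝ) ≤ Fintype.card V := by exact_mod_cast hn
      have h3 : ∑ _x : V, (1 / 3 : ℝ) < ∑ x, (π x).toReal := by
        refine Finset.sum_lt_sum_of_nonempty ?_ fun x _ => h x
        rw [Finset.univ_nonempty_iff, ← Fintype.card_pos_iff]
        omega
      rw [Finset.sum_const, Finset.card_univ, nsmul_eq_mul] at h3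
      linarith
    have h1 := hT x
    rw [tvDist] at h1
    have h2 := H.one_sub_le T x
    have h3 : ∑ y, |transProb P T x y - (π y).toReal| ≥
        2 * (transProb P T x x - (π x).toReal) := by
      have e : ∑ y, (transProb P T x y - (π y).toReal) = 0 := by
        rw [Finset.sum_sub_distrib, (H.stochastic T x).sum_eq_one, π.isProbVec.sum_eq_one, sub_self]
      rw [← Finset.add_sum_erase _ _ (Finset.mem_univ x)] at e ⊢
      have h4 := Finset.abs_sum_le_sum_abs
        (fun y => transProb P T x y - (π y).toReal) (Finset.univ.erase x)
      have h5 := neg_abs_le (∑ y ∈ Finset.univ.erase x, (transProb P T x y - (π y).toReal))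
      have h6 := le_abs_self (transProb P T x x - (π x).toReal)
      linarith
    change 1 / 2 * ∑ y, |transProb P T x y - (π y).toReal| ≤ 1 / 4 at h1
    have h7 : (1 / 5 : ℝ) ≤ T := by linarith
    exact_mod_cast h7
  exact_mod_cast h5

/-- Doubling the time makes it unnecessary to know that the infimum is attained. -/
theorem mixed_two_mul_mixingTime (H : IsWalkSemigroup (transProb P) fun x => (π x).toReal)
    (h0 : 0 < mixingTime P π) (x : V) :
    ∑ y, |transProb P (2 * mixingTime P π) x y - (π y).toReal| ≤ 1 / 2 := by
  obtain ⟨T₀, hT₀⟩ := H.exists_mixed (θ := 1 / 2) (by norm_num)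
  have hne : {T : ℝ≥0 | ∀ x, tvDist P π x T ≤ 1 / 4}.Nonempty :=
    ⟨T₀, fun x => (tvDist_le_iff x T₀).2 (hT₀ x)⟩
  have hlt : mixingTime P π < 2 * mixingTime P π := by
    rw [two_mul]; exact lt_add_of_pos_left _ h0
  obtain ⟨T, hT, hlt'⟩ := exists_lt_of_csInf_lt hne hlt
  exact (H.sum_abs_sub_antitone hlt'.le x).trans ((tvDist_le_iff x T).1 (hT x))

theorem mixed_mul_mixingTime (H : IsWalkSemigroup (transProb P) fun x => (π x).toReal)
    (h0 : 0 < mixingTime P π) (J : ℕ) (x : V) :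
    ∑ y, |transProb P (J * (2 * mixingTime P π)) x y - (π y).toReal| ≤ 2 * (1 / 2) ^ J :=
  H.sum_abs_sub_mul_le (by norm_num) (mixed_two_mul_mixingTime H h0) J x

end MixingTime
end

noncomputable section

/-! ### From pointwise bounds to the Wasserstein distance -/

theorem lintegral_exp_neg_div_Ioi {c : ℝ} (hc : 0 < c) (A : ℝ) :
    ∫⁻ x in Set.Ioi A, ENNReal.ofReal (Real.exp (-(x / c))) =
      ENNReal.ofReal (c * Real.exp (-(A / c))) := by
  have e : ∀ x : ℝ, -(x / c) = -c⁻¹ * x := fun x => by rw [div_eq_inv_mul, neg_mul]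
  have hc' : -c⁻¹ < 0 := neg_lt_zero.2 (inv_pos.2 hc)
  simp_rw [e]
  rw [← ofReal_integral_eq_lintegral_ofReal (integrableOn_exp_mul_Ioi hc' A)
    (ae_of_all _ fun x => (Real.exp_pos _).le), integral_exp_mul_Ioi hc' A]
  congr 1
  field_simp

/-- Finiteness permits the cancellation in `lintegral_kingmanTail_shift_le`. -/
theorem lintegral_kingmanTail_Ioi_ne_top (n : ℕ) :
    ∫⁻ x in Set.Ioi 0, ENNReal.ofReal (kingmanTail n x) ≠ ∞ := by
  refine ne_top_of_le_ne_top (b := ∫⁻ x in Set.Ioi (0 : ℝ),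
    6 * ENNReal.ofReal (Real.exp (-(x / 2)))) ?_ ?_
  · rw [lintegral_const_mul' _ _ (by norm_num), lintegral_exp_neg_div_Ioi two_pos]
    exact ENNReal.mul_ne_top (by norm_num) ENNReal.ofReal_ne_top
  · refine setLIntegral_mono' measurableSet_Ioi fun x hx => ?_
    rw [show (6 : ℝ≥0∞) = ENNReal.ofReal 6 by norm_num, ← ENNReal.ofReal_mul (by norm_num)]
    exact ENNReal.ofReal_le_ofReal (kingmanTail_le_exp n (le_of_lt hx))

/-- The cost of a time delay. -/
theorem lintegral_kingmanTail_shift_le (n : ℕ) {δ : ℝ} (hδ : 0 ≤ δ) :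
    ∫⁻ x in Set.Ioi 0, ENNReal.ofReal (kingmanTail n (x - δ) - kingmanTail n x) ≤
      ENNReal.ofReal δ := by
  set I := ∫⁻ x in Set.Ioi 0, ENNReal.ofReal (kingmanTail n x) with hI
  have hIt : I ≠ ∞ := lintegral_kingmanTail_Ioi_ne_top n
  have hm : Measurable fun x => ENNReal.ofReal (kingmanTail n x) :=
    (measurable_kingmanTail n).ennreal_ofReal
  have h1 : (∫⁻ x in Set.Ioi 0, ENNReal.ofReal (kingmanTail n (x - δ) - kingmanTail n x)) + I =
      ∫⁻ x in Set.Ioi 0, ENNReal.ofReal (kingmanTail n (x - δ)) := by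
    rw [hI, ← lintegral_add_right _ hm]
    refine lintegral_congr fun x => ?_
    rw [← ENNReal.ofReal_add (sub_nonneg.2 (kingmanTail_antitone n (by linarith)))
      (kingmanTail_nonneg n x), sub_add_cancel]
  have h2 : ∫⁻ x in Set.Ioi 0, ENNReal.ofReal (kingmanTail n (x - δ)) =
      ∫⁻ x in Set.Ioi (-δ), ENNReal.ofReal (kingmanTail n x) := by
    have h3 := (measurePreserving_sub_right (volume : Measure ℝ) δ).setLIntegral_comp_preimage
      (s := Set.Ioi (-δ)) measurableSet_Ioi hm
    rw [← h3]
    congr 2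
    ext x
    simp
  have h3 : ∫⁻ x in Set.Ioi (-δ), ENNReal.ofReal (kingmanTail n x) ≤ ENNReal.ofReal δ + I := by
    have : Set.Ioi (-δ) = Set.Ioc (-δ) 0 ∪ Set.Ioi 0 := (Set.Ioc_union_Ioi_eq_Ioi (by linarith)).symm
    rw [this]
    refine (lintegral_union_le _ _ _).trans (add_le_add ?_ le_rfl)
    calc ∫⁻ x in Set.Ioc (-δ) 0, ENNReal.ofReal (kingmanTail n x)
        ≤ ∫⁻ _x in Set.Ioc (-δ) 0, 1 := lintegral_mono fun x => by
          rw [← ENNReal.ofReal_one]; exact ENNReal.ofReal_le_ofReal (kingmanTail_le_one n x)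
      _ = ENNReal.ofReal δ := by simp
  rw [← h2, ← h1] at h3
  exact (ENNReal.add_le_add_iff_right hIt).1 h3

theorem exp_neg_le_two_div_sq {y : ℝ} (hy : 0 < y) : Real.exp (-y) ≤ 2 / y ^ 2 := by
  have h := Real.quadratic_le_exp_of_nonneg hy.le
  rw [Real.exp_neg, ← one_div, div_le_div_iff₀ (Real.exp_pos y) (by positivity)]
  nlinarith

/-- Integrating the pointwise comparison with the Kingman coalescent. -/
theorem lintegral_abs_sub_kingmanTail_le {F : ℝ → ℝ} {n : ℕ} {a C : ℝ} (ha : 0 < a)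
    (ha1 : a ≤ 1 / 64) (hC : 0 ≤ C) (hF0 : ∀ x, 0 ≤ F x) (hneg : ∀ x < 0, F x = 1)
    (hlow : ∀ x, 0 < x → kingmanTail n x - C * a ^ 2 * (1 + x) ≤ F x)
    (hup : ∀ x, 0 < x → F x ≤ kingmanTail n (x - 2 * a) + C * a ^ 2 * (1 + x))
    (htail : ∀ x, 8 ≤ x → F x ≤ Real.exp (-(x / 32))) :
    ∫⁻ x, ENNReal.ofReal |F x - kingmanTail n x| ≤
      ENNReal.ofReal ((2 * C + 500000) * a) := by
  -- This cut-off balances the two parts: the error `C a ^ 2 (1 + x)` integrates to at most `2 C a ^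
  -- 2 A ^ 2 = 2 C a` below `A`, and `exp (-(A / 32)) ≤ 2048 / A ^ 2 = 2048 a` beyond. The constant
  -- 500000 covers `2 + 7 * 32 * 2048`.
  set A := a ^ (-(1 / 2) : ℝ) with hA
  have hA0 : 0 < A := Real.rpow_pos_of_pos ha _
  have hA2 : a * A ^ 2 = 1 := by
    rw [hA, ← Real.rpow_natCast, ← Real.rpow_mul ha.le]
    norm_num
    rw [Real.rpow_neg_one, mul_inv_cancel₀ ha.ne']
  have hA8 : 8 ≤ A := by
    by_contra h
    push Not at h
    nlinarith
  set g1 : ℝ → ℝ≥0∞ := (Set.Ioi 0).indicator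
    (fun x => ENNReal.ofReal (kingmanTail n (x - 2 * a) - kingmanTail n x)) with hg1
  set g2 : ℝ → ℝ≥0∞ := (Set.Ioc 0 A).indicator
    (fun _ => ENNReal.ofReal (C * a ^ 2 * (1 + A))) with hg2
  set g3 : ℝ → ℝ≥0∞ := (Set.Ioi A).indicator
    (fun x => ENNReal.ofReal 7 * ENNReal.ofReal (Real.exp (-(x / 32)))) with hg3
  have hm2 : Measurable g2 := measurable_const.indicator measurableSet_Ioc
  have hm3 : Measurable g3 := Measurable.indicator (by fun_prop) measurableSet_Ioi
  have hm23 : Measurable fun x => g2 x + g3 x := hm2.add hm3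
  have hpt : ∀ᵐ x : ℝ, ENNReal.ofReal |F x - kingmanTail n x| ≤ g1 x + (g2 x + g3 x) := by
    have h0 : ∀ᵐ x : ℝ, x ≠ 0 := by simp [ae_iff]
    filter_upwards [h0] with x hx
    rcases lt_or_gt_of_ne hx with hx0 | hx0
    · rw [hneg x hx0, kingmanTail_of_neg n hx0]; simp
    rcases le_or_gt x A with hxA | hxA
    · have e1 : g1 x = ENNReal.ofReal (kingmanTail n (x - 2 * a) - kingmanTail n x) :=
        Set.indicator_of_mem hx0 _
      have e2 : g2 x = ENNReal.ofReal (C * a ^ 2 * (1 + A)) :=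
        Set.indicator_of_mem (show x ∈ Set.Ioc 0 A from ⟨hx0, hxA⟩) _
      have hs : 0 ≤ kingmanTail n (x - 2 * a) - kingmanTail n x :=
        sub_nonneg.2 (kingmanTail_antitone n (by linarith))
      have hc : C * a ^ 2 * (1 + x) ≤ C * a ^ 2 * (1 + A) := by gcongr
      refine le_trans ?_ (add_le_add le_rfl le_self_add)
      rw [e1, e2, ← ENNReal.ofReal_add hs (by positivity)]
      refine ENNReal.ofReal_le_ofReal (abs_le.2 ⟨?_, ?_⟩)
      · linarith [hlow x hx0]
      · linarith [hup x hx0]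
    · have e3 : g3 x = ENNReal.ofReal 7 * ENNReal.ofReal (Real.exp (-(x / 32))) :=
        Set.indicator_of_mem hxA _
      refine le_trans ?_ (le_add_self.trans (le_add_self (a := g2 x + g3 x) (b := g1 x)))
      rw [e3, ← ENNReal.ofReal_mul (by norm_num)]
      refine ENNReal.ofReal_le_ofReal ?_
      have h1 := htail x (hA8.trans hxA.le)
      have h2 := kingmanTail_le_exp n hx0.le
      have h3 : Real.exp (-(x / 2)) ≤ Real.exp (-(x / 32)) := Real.exp_le_exp.2 (by linarith)
      have h4 := kingmanTail_nonneg n x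
      have h5 := hF0 x
      have h6 := Real.exp_pos (-(x / 32))
      rw [abs_le]
      constructor <;> linarith
  refine (lintegral_mono_ae hpt).trans ?_
  rw [lintegral_add_right _ hm23, lintegral_add_right _ hm3, hg1, hg2, hg3,
    lintegral_indicator measurableSet_Ioi, lintegral_indicator measurableSet_Ioc,
    lintegral_indicator measurableSet_Ioi, lintegral_const_mul' _ _ ENNReal.ofReal_ne_top,
    lintegral_exp_neg_div_Ioi (by norm_num), setLIntegral_const, Real.volume_Ioc, sub_zero,
    ← ENNReal.ofReal_mul (by positivity), ← ENNReal.ofReal_mul (by positivity)]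
  refine (add_le_add (lintegral_kingmanTail_shift_le n (by positivity)) le_rfl).trans ?_
  rw [← ENNReal.ofReal_add (by positivity) (by positivity),
    ← ENNReal.ofReal_add (by positivity) (by positivity)]
  refine ENNReal.ofReal_le_ofReal ?_
  have h1 : Real.exp (-(A / 32)) ≤ 2048 * a := by
    refine (exp_neg_le_two_div_sq (by positivity)).trans (le_of_eq ?_)
    have : a = 1 / A ^ 2 := by rw [eq_div_iff (by positivity)]; exact hA2
    rw [this]
    field_simp
    norm_num
  have h2 : C * a ^ 2 * (1 + A) * A ≤ 2 * C * a := by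
    have h3 : (1 + A) * A ≤ 2 * A ^ 2 := by nlinarith
    calc C * a ^ 2 * (1 + A) * A = C * a ^ 2 * ((1 + A) * A) := by ring
      _ ≤ C * a ^ 2 * (2 * A ^ 2) := by gcongr
      _ = 2 * C * a * (a * A ^ 2) := by ring
      _ = 2 * C * a := by rw [hA2, mul_one]
  linarith
end

noncomputable section

/-! ### Choice of the parameters -/

theorem half_pow_le_inv {J : ℕ} {y : ℝ} (hy : 0 < y) (h : 2 * Real.log y ≤ J) :
    (1 / 2 : ℝ) ^ J ≤ y⁻¹ := by
  have h2 : (1 / 2 : ℝ) = Real.exp (-Real.log 2) := by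
    rw [Real.exp_neg, Real.exp_log two_pos]; norm_num
  have h3 : y⁻¹ = Real.exp (-Real.log y) := by rw [Real.exp_neg, Real.exp_log hy]
  rw [h2, h3, ← Real.exp_nat_mul]
  refine Real.exp_le_exp.2 ?_
  have h4 := Real.log_two_gt_d9
  have h5 : (J : ℝ) * (1 / 2) ≤ J * Real.log 2 :=
    mul_le_mul_of_nonneg_left (by linarith) (Nat.cast_nonneg _)
  linarith

theorem one_lt_log_of_three_le {n : ℕ} (hn : 3 ≤ n) : 1 < Real.log n := by
  rw [Real.lt_log_iff_exp_lt (by positivity)]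
  have : (3 : ℝ) ≤ n := by exact_mod_cast hn
  linarith [Real.exp_one_lt_d9]

theorem networkError_pow_six {n : ℕ} (hn : 3 ≤ n) {ε : ℝ} (hε0 : 0 < ε) (hε1 : ε < 1) :
    networkError n ε ^ 6 = ε * (1 + Real.log (1 / ε) / Real.log (Real.log n)) := by
  have h1 := Real.log_pos (one_lt_log_of_three_le hn)
  have h2 : 0 ≤ Real.log (1 / ε) := Real.log_nonneg (by rw [le_div_iff₀ hε0]; linarith)
  have h3 : 0 ≤ ε * (1 + Real.log (1 / ε) / Real.log (Real.log n)) := by positivity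
  rw [networkError, ← Real.rpow_natCast, ← Real.rpow_mul h3]
  norm_num

theorem networkError_pos {n : ℕ} (hn : 3 ≤ n) {ε : ℝ} (hε0 : 0 < ε) (hε1 : ε < 1) :
    0 < networkError n ε := by
  have h1 := Real.log_pos (one_lt_log_of_three_le hn)
  have h2 : 0 ≤ Real.log (1 / ε) := Real.log_nonneg (by rw [le_div_iff₀ hε0]; linarith)
  exact Real.rpow_pos_of_pos (by positivity) _

section Parameters

variable {V : Type*} [Fintype V] [DecidableEq V] {p : ℝ≥0 → V → V → ℝ} {π : V → ℝ}

/-- The number of walkers to which the full system is reduced. -/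
def walkerCount (n : ℕ) (a : ℝ) : ℕ := ⌈128 * Real.log n / a⌉₊

set_option maxHeartbeats 1000000 in
/-- Comparison of the non-coalescence probability with the Kingman coalescent, in terms of the
error `networkError`. -/
theorem IsWalkSemigroup.network_bounds (H : IsWalkSemigroup p π) {b ε : ℝ} {τ : ℝ≥0}
    (hb : ∀ x, π x ≤ b) (hb0 : 0 < b) (hτ : (1 / 5 : ℝ) ≤ τ)
    (hmix : ∀ (J : ℕ) x, ∑ y, |p (J * (2 * τ)) x y - π y| ≤ 2 * (1 / 2) ^ J)
    (hn : 3 ≤ Fintype.card V) (hε0 : 1 / (Fintype.card V : ℝ) < ε) (hε1 : ε < 1)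
    (hbτ : b * τ ≤ ε / (Real.log (Fintype.card V) ^ 4 * Real.log (Real.log (Fintype.card V))))
    {a : ℝ} (ha : a = networkError (Fintype.card V) ε) (ha1 : a ≤ 1 / 64)
    {t : ℝ≥0} (ht : 0 < t) {U m : ℝ}
    (hU : Tendsto (fun N : ℕ => (flow (p (t / 2 ^ N)))^[2 ^ N] atLeastTwo Finset.univ)
      atTop (𝓝 U)) (hm0 : 0 < m)
    (hm : Tendsto (fun N : ℕ => ((t / 2 ^ N : ℝ≥0) : ℝ) * statMeet (p (t / 2 ^ N)) π)
      atTop (𝓝 m)) :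
    kingmanTail (walkerCount (Fintype.card V) a - 1) (t / m) - 14000000000000 * a ^ 2 * (1 + t / m)
        ≤ U ∧
      U ≤ kingmanTail (walkerCount (Fintype.card V) a - 1) (t / m - 2 * a) +
        14000000000000 * a ^ 2 * (1 + t / m) := by
  set n := Fintype.card V with hndef
  set ℓ := Real.log n with hℓ
  set lam := Real.log ℓ with hlam
  set Λ := Real.log (1 / ε) with hΛ
  have hn0 : (0 : ℝ) < n := by positivity
  have hε : 0 < ε := lt_trans (by positivity) hε0
  have ha0 : 0 < a := ha ▸ networkError_pos hn hε hε1
  have hℓ1 : 1 < ℓ := one_lt_log_of_three_le hn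
  have hlam0 : 0 < lam := Real.log_pos hℓ1
  have hΛ0 : 0 ≤ Λ := Real.log_nonneg (by rw [le_div_iff₀ hε]; linarith)
  have ha6 : a ^ 6 = ε * (1 + Λ / lam) := ha ▸ networkError_pow_six hn hε hε1
  have hεa : ε ≤ a ^ 6 := by
    rw [ha6]
    exact le_mul_of_one_le_right hε.le (by linarith [div_nonneg hΛ0 hlam0.le])
  have ha6s : a ^ 6 ≤ (1 / 64) ^ 6 := pow_le_pow_left₀ ha0.le ha1 6
  have ha5s : a ^ 5 ≤ (1 / 64) ^ 5 := pow_le_pow_left₀ ha0.le ha1 5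
  have ha62 : a ^ 6 ≤ a ^ 2 := pow_le_pow_of_le_one ha0.le (by linarith) (by norm_num)
  have ha52 : a ^ 5 ≤ a ^ 2 := pow_le_pow_of_le_one ha0.le (by linarith) (by norm_num)
  have hℓ3 : 3 ≤ ℓ := by
    have h1 : (64 : ℝ) ^ 6 ≤ n := by
      have h2 : 1 / (n : ℝ) ≤ 1 / 64 ^ 6 := by
        refine (hε0.le.trans (hεa.trans ha6s)).trans (le_of_eq (by norm_num))
      exact (one_div_le_one_div hn0 (by positivity)).1 h2
    have h3 : Real.log (64 ^ 6) ≤ ℓ := Real.log_le_log (by positivity) h1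
    have h4 : Real.log ((64 : ℝ) ^ 6) = 36 * Real.log 2 := by
      rw [show (64 : ℝ) ^ 6 = 2 ^ 36 by norm_num, Real.log_pow]; norm_num
    linarith [Real.log_two_gt_d9]
  have hlam1 : 1 ≤ lam := by
    rw [hlam, Real.le_log_iff_exp_le (by linarith)]
    linarith [Real.exp_one_lt_d9]
  have hℓ0 : 0 < ℓ := by linarith
  set α := a ^ 6 / ℓ ^ 4 with hα
  have hα0 : 0 < α := by positivity
  have hℓ4 : (1 : ℝ) ≤ ℓ ^ 4 := one_le_pow₀ hℓ1.le
  have hαa : α ≤ a ^ 6 := div_le_self (by positivity) hℓ4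
  have hτ0 : 0 < τ := by
    have : (0 : ℝ) < τ := by linarith
    exact_mod_cast this
  have hbτα : b * τ ≤ α := by
    refine hbτ.trans ?_
    rw [hα]
    refine div_le_div₀ (by positivity) hεa (by positivity) ?_
    exact le_mul_of_one_le_right (by positivity) hlam1
  have hbα : b ≤ 5 * α := by
    have := mul_le_mul_of_nonneg_left hτ hb0.le
    linarith
  have hb4 : b ≤ 1 / 4 := by
    have : α ≤ (1 / 64) ^ 6 := hαa.trans ha6s
    norm_num at this
    linarith
  -- a lower bound for the mean meeting time
  have hbm : 1 ≤ 40 * b * m := by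
    have h1 := H.mul_le_of_tendsto hb hb0.le (fun N => show 0 < t / 2 ^ N by positivity)
      (tendsto_div_two_pow t) hm (T := Real.toNNReal (1 / (20 * b)))
      (Real.toNNReal_pos.2 (by positivity))
    rw [Real.coe_toNNReal _ (by positivity)] at h1
    -- Up to time `1 / (20 b)` two stationary walkers meet with probability at most `b + 1/4 ≤ 1/2`.
    have h2 : b * (1 + 5 * (1 / (20 * b))) = b + 1 / 4 := by field_simp; ring
    rw [h2] at h1
    have h3 : 1 / (20 * b) * (1 / 2) ≤ m := le_trans (by gcongr; linarith) h1
    have h4 : 1 / (20 * b) * (1 / 2) = 1 / (40 * b) := by field_simp; norm_num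
    rw [h4, div_le_iff₀ (by positivity)] at h3
    linarith
  have hdivm : ∀ T : ℝ, 0 ≤ T → T / m ≤ 40 * (b * T) := by
    intro T hT
    rw [div_le_iff₀ hm0]
    calc T = T * 1 := (mul_one T).symm
      _ ≤ T * (40 * b * m) := by gcongr
      _ = _ := by ring
  -- the delay
  set J := ⌈2 * Real.log (ℓ ^ 4 / ε)⌉₊ with hJ
  set T : ℝ≥0 := J * (2 * τ) with hT
  set θ : ℝ := 2 * (1 / 2) ^ J with hθ
  have hlogy : Real.log (ℓ ^ 4 / ε) = 4 * lam + Λ := by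
    rw [Real.log_div (by positivity) hε.ne', Real.log_pow, hΛ, one_div, Real.log_inv]
    push_cast
    ring
  have hJpos : 0 < J := Nat.ceil_pos.2 (by rw [hlogy]; linarith)
  have hT0 : 0 < T := by positivity
  have hθ0 : 0 ≤ θ := by positivity
  have hθα : θ ≤ 2 * α := by
    have h1 := half_pow_le_inv (J := J) (y := ℓ ^ 4 / ε) (by positivity) (Nat.le_ceil _)
    rw [inv_div] at h1
    have h2 : ε / ℓ ^ 4 ≤ α := div_le_div_of_nonneg_right hεa (by positivity)
    linarith
  have hTR : (T : ℝ) = J * (2 * τ) := by rw [hT]; push_cast; rfl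
  -- The number `J` of mixing periods is of order `ln ln n + ln (1/ε)`. The `ln ln n` in the
  -- assumption cancels the first part; the second is the reason for the term `ln (1/ε) / ln ln n`
  -- in `networkError`.
  have hbT : b * T ≤ 18 * α := by
    have h1 : (J : ℝ) ≤ 9 * lam + 2 * Λ := by
      have := (Nat.ceil_lt_add_one (show 0 ≤ 2 * Real.log (ℓ ^ 4 / ε) by
        rw [hlogy]; positivity)).le
      rw [hlogy] at this
      rw [hJ, hlogy]
      linarith
    have h3 : 0 ≤ ε / (ℓ ^ 4 * lam) := by positivity
    calc b * T = 2 * J * (b * τ) := by rw [hTR]; ring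
      _ ≤ 2 * (9 * lam + 2 * Λ) * (ε / (ℓ ^ 4 * lam)) := by gcongr
      _ = (18 * ε + 4 * (ε * (Λ / lam))) / ℓ ^ 4 := by field_simp; ring
      _ ≤ (18 * (ε * (1 + Λ / lam))) / ℓ ^ 4 := by
        refine div_le_div_of_nonneg_right ?_ (by positivity)
        have h4 : 0 ≤ ε * (Λ / lam) := by positivity
        have h5 : ε * (1 + Λ / lam) = ε + ε * (Λ / lam) := by ring
        linarith
      _ = 18 * α := by rw [← ha6, hα, mul_div_assoc]
  set k := walkerCount n a with hk
  have hℓa : 1 ≤ ℓ / a := by rw [le_div_iff₀ ha0]; linarith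
  have hk1 : 128 * (ℓ / a) ≤ k := by
    rw [← mul_div_assoc]; exact Nat.le_ceil _
  have hk2 : (k : ℝ) ≤ 129 * (ℓ / a) := by
    have := (Nat.ceil_lt_add_one (show 0 ≤ 128 * ℓ / a by positivity)).le
    rw [mul_div_assoc] at this
    have h2 : (k : ℝ) ≤ 128 * (ℓ / a) + 1 := by
      rw [hk, walkerCount, mul_div_assoc]; exact this
    linarith
  have hk2' : 2 ≤ k := by
    have : (2 : ℝ) ≤ k := by linarith
    exact_mod_cast this
  -- `2 T / m ≤ 80 * 18 α` and `4 θ ≤ 8 α` add up to `1448 α`.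
  set η : ℝ := 1500 * α with hη
  have hη1 : η ≤ 1 := by
    have : α ≤ (1 / 64) ^ 6 := hαa.trans ha6s
    norm_num at this
    linarith
  have hηlt : 2 * T / m + 4 * θ < η := by
    have h1 := hdivm T T.2
    rw [mul_div_assoc]
    linarith
  have htm : (0 : ℝ) ≤ t / m := by positivity
  -- This fixes the exponents: `(ℓ / a) ^ 4 * a ^ 6 / ℓ ^ 4 = a ^ 2`, hence the fourth power of the
  -- logarithm and the sixth root in the error.
  have hk4 : (k : ℝ) ^ 4 * α ≤ 129 ^ 4 * a ^ 2 := by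
    have h1 : (k : ℝ) ^ 4 ≤ (129 * (ℓ / a)) ^ 4 := pow_le_pow_left₀ (Nat.cast_nonneg _) hk2 4
    calc (k : ℝ) ^ 4 * α ≤ (129 * (ℓ / a)) ^ 4 * α := by gcongr
      _ = 129 ^ 4 * a ^ 2 := by rw [hα]; field_simp
  have herr : (k : ℝ) ^ 4 * (26 * η + 16 * (θ + b * (1 + 5 * T)) + 2 * η * (t / m)) ≤
      13900000000000 * a ^ 2 * (1 + t / m) := by
    have h1 : 26 * η + 16 * (θ + b * (1 + 5 * T)) + 2 * η * (t / m) ≤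
        50000 * α * (1 + t / m) := by
      have h2 : 0 ≤ α * (t / m) := by positivity
      have h3 : b * (1 + 5 * (T : ℝ)) ≤ 95 * α := by linarith
      have e1 : 2 * η * (t / m) = 3000 * (α * (t / m)) := by rw [hη]; ring
      have e2 : 50000 * α * (1 + t / m) = 50000 * α + 50000 * (α * (t / m)) := by ring
      rw [e1, e2, hη]
      linarith
    calc (k : ℝ) ^ 4 * (26 * η + 16 * (θ + b * (1 + 5 * T)) + 2 * η * (t / m))
        ≤ (k : ℝ) ^ 4 * (50000 * α * (1 + t / m)) := by gcongr
      _ = 50000 * ((k : ℝ) ^ 4 * α) * (1 + t / m) := by ring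
      _ ≤ 50000 * (129 ^ 4 * a ^ 2) * (1 + t / m) := by gcongr
      _ ≤ 13900000000000 * a ^ 2 * (1 + t / m) := by
        refine mul_le_mul_of_nonneg_right ?_ (by positivity)
        have := sq_nonneg a
        linarith
  obtain ⟨hlow, hup⟩ := H.kingman_bounds hb hb0.le ht hU hm0 hm hT0 hθ0 (hmix J) hηlt hη1 hk2'
  have ha2 : 0 ≤ a ^ 2 * (1 + t / m) := by positivity
  have ha2' : a ^ 2 ≤ a ^ 2 * (1 + t / m) := le_mul_of_one_le_right (by positivity) (by linarith)
  refine ⟨by linarith, ?_⟩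
  -- the early phase
  set J' := ⌈8 * ℓ⌉₊ with hJ'
  set T' : ℝ≥0 := J' * (2 * τ) with hT'
  have hJ'pos : 0 < J' := Nat.ceil_pos.2 (by positivity)
  have hT'0 : 0 < T' := by positivity
  have hT'R : (T' : ℝ) = J' * (2 * τ) := by rw [hT']; push_cast; rfl
  have hT'pos : (0 : ℝ) < T' := hT'0
  have hbT' : b * T' ≤ 18 * (ℓ * α) := by
    have h1 : (J' : ℝ) ≤ 9 * ℓ := by
      have := (Nat.ceil_lt_add_one (show 0 ≤ 8 * ℓ by positivity)).le
      linarith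
    calc b * T' = 2 * J' * (b * τ) := by rw [hT'R]; ring
      _ ≤ 2 * (9 * ℓ) * α := by gcongr
      _ = _ := by ring
  have hℓα : ℓ * α ≤ a ^ 6 := by
    rw [hα, mul_div_assoc', div_le_iff₀ (by positivity), mul_comm]
    have : ℓ ≤ ℓ ^ 4 := le_self_pow₀ hℓ1.le (by norm_num)
    gcongr
  have hθ' : 8 * (2 * (1 / 2 : ℝ) ^ J') ≤ (n : ℝ)⁻¹ := by
    have h1 := half_pow_le_inv (J := J') (y := (n : ℝ) ^ 4) (by positivity) (by
      rw [Real.log_pow]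
      have := Nat.le_ceil (8 * ℓ)
      push_cast
      linarith)
    have h3 : (3 : ℝ) ≤ n := by exact_mod_cast hn
    have h4 : (3 : ℝ) ^ 3 ≤ (n : ℝ) ^ 3 := pow_le_pow_left₀ (by norm_num) h3 3
    have h5 : 16 * ((n : ℝ) ^ 4)⁻¹ ≤ (n : ℝ)⁻¹ := by
      rw [← div_eq_mul_inv, div_le_iff₀ (by positivity)]
      have : (n : ℝ)⁻¹ * n ^ 4 = n ^ 3 := by field_simp
      rw [this]
      norm_num at h4
      linarith
    linarith
  have hkα : (k : ℝ) * (ℓ * α) ≤ 129 * a ^ 5 := by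
    have h1 : ℓ / a * (ℓ * α) ≤ a ^ 5 := by
      have e : ℓ / a * (ℓ * α) = a ^ 5 / ℓ ^ 2 := by rw [hα]; field_simp
      rw [e]
      exact div_le_self (by positivity) (one_le_pow₀ hℓ1.le)
    calc (k : ℝ) * (ℓ * α) ≤ 129 * (ℓ / a) * (ℓ * α) := by gcongr
      _ = 129 * (ℓ / a * (ℓ * α)) := by ring
      _ ≤ _ := by gcongr
  have hαℓα : α ≤ ℓ * α := le_mul_of_one_le_left hα0.le hℓ1.le
  have hkρ : k * (b * (1 + 5 * T')) ≤ 1 / 2 := by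
    have h1 : b * (1 + 5 * (T' : ℝ)) ≤ 95 * (ℓ * α) := by linarith
    have h2 : (k : ℝ) * (b * (1 + 5 * T')) ≤ k * (95 * (ℓ * α)) := by gcongr
    norm_num at ha5s
    linarith
  -- The early phase lasts about `a * m`. Its exponent `M (2 T') k / (64 m)` is at least `a k / 64 ≥
  -- 2 ln n`, which explains the 128 in `walkerCount`.
  set M := ⌈a * m / (2 * T')⌉₊ with hM
  have hM1 : a * m ≤ M * (2 * T') := by
    rw [← div_le_iff₀ (by positivity)]; exact Nat.le_ceil _
  have hM2 : M * (2 * T') ≤ a * m + 2 * T' := by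
    have h1 := (Nat.ceil_lt_add_one (show 0 ≤ a * m / (2 * T') by positivity)).le
    have h2 : (M : ℝ) * (2 * T') ≤ (a * m / (2 * T') + 1) * (2 * T') := by gcongr
    have h3 : (a * m / (2 * T') + 1) * (2 * (T' : ℝ)) = a * m + 2 * T' := by field_simp
    linarith
  have hδ : (2 * M * T' + T) / m < 2 * a := by
    have h1 : (2 * M * T' + T) / m ≤ (a * m + 2 * T' + T) / m :=
      div_le_div_of_nonneg_right (by linarith) hm0.le
    have h2 : (a * m + 2 * T' + T) / m = a + (2 * T' + T) / m := by
      rw [add_assoc, add_div, mul_div_cancel_right₀ _ hm0.ne']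
    have h3 := hdivm (2 * T' + T) (by positivity)
    have h4 : b * (2 * T' + T) ≤ 54 * a ^ 6 := by linarith
    have h5 : 2160 * a ^ 6 < a := by
      have h6 : a ^ 6 = a ^ 5 * a := by ring
      have h7 : a ^ 5 * a ≤ (1 / 64) ^ 5 * a := by gcongr
      norm_num at h7
      rw [h6]
      linarith
    linarith
  have hfin := hup T' (2 * (1 / 2) ^ J') (2 * a) M hT'0 (hmix J') hθ' hkρ hδ
  have hexp : (n : ℝ) * Real.exp (-(M * (k * T' / (32 * m)))) ≤ a ^ 2 := by
    have h1 : 2 * ℓ ≤ M * (k * T' / (32 * m)) := by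
      have e : M * (k * T' / (32 * m)) = M * (2 * T') * (k / (64 * m)) := by field_simp; ring
      have e2 : 2 * ℓ = a * m * (128 * (ℓ / a) / (64 * m)) := by field_simp; norm_num
      rw [e, e2]
      gcongr
    have h2 : Real.exp (-(M * (k * T' / (32 * m)))) ≤ Real.exp (-(2 * ℓ)) :=
      Real.exp_le_exp.2 (by linarith)
    have h3 : Real.exp (-(2 * ℓ)) = 1 / (n : ℝ) ^ 2 := by
      rw [Real.exp_neg, two_mul, Real.exp_add, Real.exp_log hn0, ← sq, one_div]
    calc (n : ℝ) * Real.exp (-(M * (k * T' / (32 * m)))) ≤ n * (1 / (n : ℝ) ^ 2) := by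
          rw [← h3]; gcongr
      _ = 1 / n := by field_simp
      _ ≤ a ^ 2 := hε0.le.trans (hεa.trans ha62)
  have hkθ : k * θ ≤ 258 * a ^ 2 := by
    calc (k : ℝ) * θ ≤ k * (2 * (ℓ * α)) := by gcongr; linarith
      _ = 2 * (k * (ℓ * α)) := by ring
      _ ≤ 2 * (129 * a ^ 5) := by gcongr
      _ ≤ _ := by linarith
  linarith

end Parameters
end

noncomputable section

/-! ### The random walk on a graph -/

section Final

variable {V : Type*} [Fintype V] [DecidableEq V] {q : V → V → ℝ} {P : V → Measure (PathSpace V)}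
  {π : PMF V} {k : ℕ} {x : Fin k → V}

/-- A half-life of `8 m` gives exponential tails beyond `8 m`. -/
theorem notCoalesced_mul_le_exp (hP : IsMarkovChain q P) (hx : Function.Surjective x) {m : ℝ≥0}
    (h8 : notCoalesced P x (8 * m) ≤ 1 / 2) {u : ℝ≥0} (hu : 8 ≤ u) :
    notCoalesced P x (u * m) ≤ Real.exp (-((u : ℝ) / 32)) := by
  obtain ⟨i, hi1, hi2⟩ := exists_nat_pow_near (x := u / 8) (y := 2)
    ((one_le_div (by norm_num)).2 hu) one_lt_two
  have h1 : 2 ^ i * (8 * m) ≤ u * m := by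
    rw [← mul_assoc]
    gcongr
    rwa [le_div_iff₀ (by norm_num)] at hi1
  have h2 : (u : ℝ) / 16 ≤ 2 ^ i := by
    have h : u < 2 ^ (i + 1) * 8 := by rwa [div_lt_iff₀ (by norm_num)] at hi2
    have h' : (u : ℝ) < 2 ^ (i + 1) * 8 := by exact_mod_cast h
    rw [pow_succ] at h'
    linarith
  have h3 : (1 / 2 : ℝ) ≤ Real.exp (-(1 / 2)) := by
    have := Real.add_one_le_exp (-(1 / 2) : ℝ)
    linarith
  calc notCoalesced P x (u * m) ≤ notCoalesced P x (2 ^ i * (8 * m)) := notCoalesced_antitone hP h1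
    _ ≤ notCoalesced P x (8 * m) ^ (2 ^ i) := notCoalesced_two_pow_le hP hx _ i
    _ ≤ Real.exp (-(1 / 2)) ^ (2 ^ i) :=
        pow_le_pow_left₀ (notCoalesced_nonneg _) (h8.trans h3) _
    _ = Real.exp (-((2 : ℝ) ^ i / 2)) := by
        rw [← Real.exp_nat_mul]
        congr 1
        push_cast
        ring
    _ ≤ Real.exp (-((u : ℝ) / 32)) := Real.exp_le_exp.2 (by linarith)

theorem measurable_coalescenceTime_toReal_div (m : ℝ) :
    Measurable fun X : Fin k → PathSpace V => (coalescenceTime 1 X).toReal / m :=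
  measurable_coalescenceTime.ennreal_toReal.div_const m

/-- The tail of the rescaled coalescence time at negative arguments. -/
theorem map_coalescenceTime_real_Ioi_of_neg (hP : IsMarkovChain q P) {m : ℝ} (hm : 0 ≤ m) {u : ℝ}
    (hu : u < 0) :
    ((Measure.pi fun j => P (x j)).map fun X => (coalescenceTime 1 X).toReal / m).real
      (Set.Ioi u) = 1 := by
  have hprob := hP.isProb
  rw [map_measureReal_apply (measurable_coalescenceTime_toReal_div m) measurableSet_Ioi]
  have : (fun X : Fin k → PathSpace V => (coalescenceTime 1 X).toReal / m) ⁻¹' Set.Ioi u =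
      Set.univ := by
    ext X
    simp only [Set.mem_preimage, Set.mem_Ioi, Set.mem_univ, iff_true]
    exact hu.trans_le (by positivity)
  rw [this, probReal_univ]

/-- The tail of the rescaled coalescence time at nonnegative arguments. -/
theorem map_coalescenceTime_real_Ioi
    (hfin : ∀ᵐ X ∂(Measure.pi fun j => P (x j)), coalescenceTime 1 X < ∞) {m : ℝ≥0}
    (hm : 0 < m) (u : ℝ≥0) :
    ((Measure.pi fun j => P (x j)).map fun X => (coalescenceTime 1 X).toReal / m).real
      (Set.Ioi (u : ℝ)) = notCoalesced P x (u * m) := by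
  rw [map_measureReal_apply (measurable_coalescenceTime_toReal_div _) measurableSet_Ioi,
    notCoalesced]
  refine measureReal_congr ?_
  filter_upwards [hfin] with X hX
  refine propext ?_
  change (u : ℝ) < (coalescenceTime 1 X).toReal / m ↔ ((u * m : ℝ≥0) : ℝ≥0∞) < coalescenceTime 1 X
  rw [lt_div_iff₀ (by exact_mod_cast hm), ← NNReal.coe_mul, ← ENNReal.coe_toReal,
    ENNReal.toReal_lt_toReal ENNReal.coe_ne_top hX.ne]

/-- The hypothesis excludes small graphs by itself: for `n = 1` there is no `ε` between `1 / n` and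
1, and for `n = 2` the right side is negative as `ln ln 2 < 0`. -/
theorem three_le_of_le_div_log {n : ℕ} {ε c : ℝ} (hε0 : 1 / (n : ℝ) < ε) (hε1 : ε < 1) (hn : n ≠ 0)
    (hc : 0 ≤ c) (h : c ≤ ε * n / (Real.log n ^ 4 * Real.log (Real.log n))) : 3 ≤ n := by
  by_contra hlt
  have hcase : n = 1 ∨ n = 2 := by omega
  rcases hcase with rfl | rfl
  · norm_num at hε0
    linarith
  · have h1 := Real.log_two_gt_d9
    have h2 := Real.log_two_lt_d9
    have h3 : Real.log (Real.log 2) < 0 := Real.log_neg (by linarith) (by linarith)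
    have h4 : (0 : ℝ) < ε := lt_trans (by norm_num) hε0
    have h5 : ε * (2 : ℕ) / (Real.log (2 : ℕ) ^ 4 * Real.log (Real.log (2 : ℕ))) < 0 := by
      refine div_neg_of_pos_of_neg (by positivity) (mul_neg_of_pos_of_neg ?_ ?_)
      · push_cast
        positivity
      · exact_mod_cast h3
    linarith

theorem SimpleGraph.Connected.degree_pos_of_card {G : SimpleGraph V} [DecidableRel G.Adj]
    (hG : G.Connected) (hn : 2 ≤ Fintype.card V) (x : V) : 0 < G.degree x := by
  have : Nontrivial V := Fintype.one_lt_card_iff_nontrivial.1 hn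
  exact hG.preconnected.degree_pos_of_nontrivial x

theorem SimpleGraph.Connected.maxDegree_lt_sum_degree {G : SimpleGraph V} [DecidableRel G.Adj]
    (hG : G.Connected) (hn : 2 ≤ Fintype.card V) : G.maxDegree < ∑ x, G.degree x := by
  have : Nontrivial V := Fintype.one_lt_card_iff_nontrivial.1 hn
  obtain ⟨v, hv⟩ := G.exists_maximal_degree_vertex
  obtain ⟨w, hw⟩ := exists_ne v
  rw [hv]
  exact Finset.single_lt_sum (f := fun x => G.degree x) hw (Finset.mem_univ v) (Finset.mem_univ w)
    (hG.degree_pos_of_card hn w) fun _ _ _ => Nat.zero_le _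

/-- Triangle inequality through the sum of the first `n` exponential variables. -/
theorem wasserstein_meanFieldLaw_le (μ : Measure ℝ) (n : ℕ) :
    wasserstein μ meanFieldLaw ≤
      (∫⁻ y : ℝ, ENNReal.ofReal |μ.real (Set.Ioi y) - kingmanTail n y|) +
        ENNReal.ofReal (2 / (n + 1)) := by
  have hprob : IsProbabilityMeasure meanFieldLaw :=
    Measure.isProbabilityMeasure_map measurable_tsum_seq.aemeasurable
  have hmeas : Measurable fun y : ℝ =>
      ENNReal.ofReal |meanFieldLaw.real (Set.Ioi y) - kingmanTail n y| := by
    have h1 : Antitone fun y : ℝ => meanFieldLaw.real (Set.Ioi y) :=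
      fun y z hyz => measureReal_mono (Set.Ioi_subset_Ioi hyz)
    have h2 := h1.measurable.sub (measurable_kingmanTail n)
    exact (measurable_norm.comp h2).ennreal_ofReal
  calc wasserstein μ meanFieldLaw
      ≤ ∫⁻ y : ℝ, (ENNReal.ofReal |μ.real (Set.Ioi y) - kingmanTail n y| +
          ENNReal.ofReal |meanFieldLaw.real (Set.Ioi y) - kingmanTail n y|) := by
        refine lintegral_mono fun y => ?_
        rw [← ENNReal.ofReal_add (abs_nonneg _) (abs_nonneg _),
          abs_sub_comm (meanFieldLaw.real _) (kingmanTail n y)]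
        exact ENNReal.ofReal_le_ofReal (abs_sub_le _ _ _)
    _ = _ := lintegral_add_right _ hmeas
    _ ≤ _ := by gcongr; exact lintegral_abs_meanFieldLaw_sub_kingmanTail_le n

/-- The rescaled coalescence time is close to the mean-field law. -/
theorem wasserstein_coalescenceTime_le (hP : IsMarkovChain q P)
    (H : IsWalkSemigroup (transProb P) fun y => (π y).toReal) (hx : Function.Surjective x)
    {b ε : ℝ} (hb : ∀ y, (π y).toReal ≤ b) (hb0 : 0 < b) (hn : 3 ≤ Fintype.card V)
    (hε0 : 1 / (Fintype.card V : ℝ) < ε) (hε1 : ε < 1)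
    (hbτ : b * mixingTime P π ≤
      ε / (Real.log (Fintype.card V) ^ 4 * Real.log (Real.log (Fintype.card V))))
    (hm0 : 0 < meanMeetingTime P π)
    (ha1 : networkError (Fintype.card V) ε ≤ 1 / 100000000) :
    wasserstein ((Measure.pi fun j => P (x j)).map fun X =>
        (coalescenceTime 1 X).toReal / (meanMeetingTime P π).toReal) meanFieldLaw ≤
      ENNReal.ofReal (28000000500001 * networkError (Fintype.card V) ε) := by
  set n := Fintype.card V with hn_def
  set a := networkError n ε with ha
  have hε : 0 < ε := lt_trans (by positivity) hε0
  have ha0 : 0 < a := networkError_pos hn hε hε1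
  have hmtop := meanMeetingTime_lt_top hP H
  have hfin := ae_coalescenceTime_lt_top hP H hx
  obtain ⟨m, hm⟩ : ∃ m : ℝ≥0, meanMeetingTime P π = m := ⟨_, (ENNReal.coe_toNNReal hmtop.ne).symm⟩
  have hmpos : 0 < m := by rw [hm] at hm0; exact_mod_cast hm0
  have hmposR : (0 : ℝ) < m := by exact_mod_cast hmpos
  have hmR : (meanMeetingTime P π).toReal = m := by rw [hm, ENNReal.coe_toReal]
  rw [hmR]
  set K := walkerCount n a with hK
  have hτ := one_fifth_le_mixingTime H hn
  have hτ0 : 0 < mixingTime P π := by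
    have : (0 : ℝ) < mixingTime P π := by linarith
    exact_mod_cast this
  set μ := (Measure.pi fun j => P (x j)).map fun X => (coalescenceTime 1 X).toReal / (m : ℝ)
    with hμ
  have htail : ∀ u : ℝ≥0, μ.real (Set.Ioi (u : ℝ)) = notCoalesced P x (u * m) :=
    map_coalescenceTime_real_Ioi hfin hmpos
  have hbounds : ∀ u : ℝ, 0 < u →
      kingmanTail (K - 1) u - 14000000000000 * a ^ 2 * (1 + u) ≤ μ.real (Set.Ioi u) ∧
      μ.real (Set.Ioi u) ≤ kingmanTail (K - 1) (u - 2 * a) + 14000000000000 * a ^ 2 * (1 + u) := by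
    intro u hu
    lift u to ℝ≥0 using hu.le
    have hu' : 0 < u := by exact_mod_cast hu
    have hum : 0 < u * m := mul_pos hu' hmpos
    have h := H.network_bounds hb hb0 hτ (mixed_mul_mixingTime H hτ0) hn hε0 hε1 hbτ ha
      (ha1.trans (by norm_num)) hum (hP.tendsto_flow hx (u * m)) hmposR
      (hmR ▸ tendsto_statMeet hP H hum)
    have e : ((u * m : ℝ≥0) : ℝ) / m = u := by
      push_cast
      field_simp
    rw [e] at h
    rw [htail]
    exact h
  -- The Kingman tail is at most `6 / 20` here. The bound `10 ^ (-8)` on `a` keeps the error `9 *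
  -- 14000000000000 * a ^ 2` small enough to stay below `1/2`.
  have h8 : notCoalesced P x (8 * m) ≤ 1 / 2 := by
    have h1 := (hbounds 8 (by norm_num)).2
    have h2 := htail 8
    rw [show ((8 : ℝ≥0) : ℝ) = 8 by norm_num] at h2
    rw [h2] at h1
    have h3 := kingmanTail_le_exp (K - 1) (u := 8 - 2 * a) (by linarith)
    have h4 : Real.exp (-((8 - 2 * a) / 2)) ≤ 1 / 20 := by
      have h5 : Real.exp (-((8 - 2 * a) / 2)) ≤ Real.exp (-3) := Real.exp_le_exp.2 (by linarith)
      have h6 : Real.exp (-3) * Real.exp 1 ^ 3 = 1 := by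
        rw [← Real.exp_nat_mul, ← Real.exp_add]
        norm_num
      have h7 : (2.718 : ℝ) ^ 3 ≤ Real.exp 1 ^ 3 := by
        have := Real.exp_one_gt_d9
        gcongr
        linarith
      have h8 : Real.exp (-3) * (2.718 : ℝ) ^ 3 ≤ 1 := h6 ▸ by gcongr
      norm_num at h8
      linarith
    have h5 : a ^ 2 ≤ (1 / 100000000) ^ 2 := by gcongr
    norm_num at h5
    nlinarith
  have hmain := lintegral_abs_sub_kingmanTail_le (n := K - 1) (C := 14000000000000)
    (F := fun u => μ.real (Set.Ioi u)) ha0 (ha1.trans (by norm_num)) (by norm_num)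
    (fun _ => measureReal_nonneg)
    (fun u hu => map_coalescenceTime_real_Ioi_of_neg hP hmposR.le hu)
    (fun u hu => (hbounds u hu).1) (fun u hu => (hbounds u hu).2) (fun u hu => by
      lift u to ℝ≥0 using by linarith
      simp only [htail]
      exact notCoalesced_mul_le_exp hP hx h8 (by exact_mod_cast hu))
  have hK1 : 128 * Real.log n / a ≤ K := Nat.le_ceil _
  have hlog := one_lt_log_of_three_le hn
  have hK0 : 2 / a ≤ K := le_trans (by gcongr; linarith) hK1
  have hKpos : (0 : ℝ) < K := lt_of_lt_of_le (by positivity) hK0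
  have hKpos' : 1 ≤ K := by exact_mod_cast hKpos
  refine (wasserstein_meanFieldLaw_le μ (K - 1)).trans ?_
  have e : ((K - 1 : ℕ) : ℝ) + 1 = K := by
    rw [Nat.cast_sub hKpos']
    push_cast
    ring
  rw [e]
  have h2 : 2 / (K : ℝ) ≤ a := by
    rw [div_le_iff₀ ha0] at hK0
    rw [div_le_iff₀ hKpos]
    linarith
  calc _ ≤ ENNReal.ofReal ((2 * 14000000000000 + 500000) * a) + ENNReal.ofReal a :=
        add_le_add hmain (ENNReal.ofReal_le_ofReal h2)
    _ = ENNReal.ofReal (28000000500001 * a) := by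
        rw [← ENNReal.ofReal_add (by positivity) ha0.le]
        congr 1
        ring

end Final

theorem mainTheorem3 :
    ∃ K ξ : ℝ, 0 < K ∧ 0 < ξ ∧
      ∀ (V : Type*) [Fintype V] (G : SimpleGraph V) [DecidableRel G.Adj], G.Connected →
      -- the random walk on `G`, its stationary distribution, and an enumeration of the vertices
      ∀ (P : V → Measure (PathSpace V)), IsMarkovChain (walkRate G) P →
      ∀ (π : PMF V), IsStationaryDist P π →
      ∀ (v : Fin (Fintype.card V) ≃ V) (ε : ℝ),
        1 / (Fintype.card V : ℝ) < ε → ε < 1 →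
        ((G.maxDegree : ℝ) / ((Fintype.card V : ℝ)⁻¹ * ∑ x, (G.degree x : ℝ))) *
            (mixingTime P π : ℝ) ≤
          ε * (Fintype.card V : ℝ) /
            (Real.log (Fintype.card V) ^ 4 * Real.log (Real.log (Fintype.card V))) →
        -- the quotient `C / m_G` makes sense
        0 < meanMeetingTime P π ∧ meanMeetingTime P π < ∞ ∧
        (∀ᵐ X ∂(Measure.pi fun j => P (v j)), coalescenceTime 1 X < ∞) ∧
        (networkError (Fintype.card V) ε ≤ ξ →
          wasserstein
              ((Measure.pi fun j => P (v j)).map fun X =>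
                (coalescenceTime 1 X).toReal / (meanMeetingTime P π).toReal)
              meanFieldLaw ≤
            ENNReal.ofReal (K * networkError (Fintype.card V) ε)) := by
  -- The first constant is `2 C + 500000 + 1` with `C = 14000000000000` from `network_bounds`; the
  -- last 1 pays for truncating the series.
  refine ⟨28000000500001, 1 / 100000000, by norm_num, by norm_num, ?_⟩
  intro V _ G _ hG P hP π hπ v ε hε0 hε1 hmixing
  classical
  have := hG.nonempty
  have hn : 3 ≤ Fintype.card V :=
    three_le_of_le_div_log hε0 hε1 Fintype.card_ne_zero (by positivity) hmixing
  have hdeg := hG.degree_pos_of_card (by omega : 2 ≤ Fintype.card V)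
  have H := hP.isWalkSemigroup hG hdeg hπ
  have hnR : (0 : ℝ) < Fintype.card V := by exact_mod_cast (by omega : 0 < Fintype.card V)
  have hlt : (G.maxDegree : ℝ) < ∑ x, (G.degree x : ℝ) := by
    exact_mod_cast hG.maxDegree_lt_sum_degree (by omega)
  have hmax : (0 : ℝ) < G.maxDegree := by
    have := (hdeg (Classical.arbitrary V)).trans_le (G.degree_le_maxDegree _)
    exact_mod_cast this
  have hsum : (0 : ℝ) < ∑ x, (G.degree x : ℝ) := hmax.trans hlt
  -- The stationary law is proportional to the degree, so this is the maximum of `π`.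
  set b : ℝ := G.maxDegree / ∑ x, (G.degree x : ℝ) with hb_def
  have hb0 : 0 < b := by positivity
  have hb1 : b < 1 := (div_lt_one hsum).2 hlt
  have hb : ∀ x, (π x).toReal ≤ b := fun x => by
    rw [hP.stationary_eq hG hdeg hπ x, hb_def]
    gcongr
    exact_mod_cast G.degree_le_maxDegree x
  have hbτ : b * mixingTime P π ≤
      ε / (Real.log (Fintype.card V) ^ 4 * Real.log (Real.log (Fintype.card V))) := by
    have e1 : (G.maxDegree : ℝ) / ((Fintype.card V : ℝ)⁻¹ * ∑ x, (G.degree x : ℝ)) *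
        mixingTime P π = Fintype.card V * (b * mixingTime P π) := by
      rw [hb_def]
      field_simp
    rw [e1, mul_comm ε, mul_div_assoc] at hmixing
    exact le_of_mul_le_mul_left hmixing hnR
  have hm0 : 0 < meanMeetingTime P π := by
    -- Positivity is claimed without smallness of the error, so only `b < 1` is at hand; this time
    -- makes `1 - b (1 + 5 T) = (1 - b) (1 - b / 2)` positive.
    have hT : (0 : ℝ) < (1 - b) / 10 := by linarith
    have h := H.mul_le_of_tendsto hb hb0.le (h := fun N => 1 / 2 ^ N) (fun N => by positivity)
      (tendsto_div_two_pow 1) (tendsto_statMeet hP H one_pos) (T := ⟨(1 - b) / 10, hT.le⟩)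
      (by exact_mod_cast hT)
    change (1 - b) / 10 * (1 - b * (1 + 5 * ((1 - b) / 10))) ≤ _ at h
    refine ENNReal.toReal_pos_iff.1 (lt_of_lt_of_le ?_ h) |>.1
    have : 0 < 1 - b * (1 + 5 * ((1 - b) / 10)) := by nlinarith
    positivity
  exact ⟨hm0, meanMeetingTime_lt_top hP H, ae_coalescenceTime_lt_top hP H v.surjective,
    wasserstein_coalescenceTime_le hP H v.surjective hb hb0 hn hε0 hε1 hbτ hm0⟩

end
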